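/- Let $q_3=e^{2\pi i/42}$. Let $\Gamma_3$ be the graph with vertices $1,2,3,4$, one edge between any two distinct vertices, and one loop at each of the vertices $2,3,4$ (none at $1$). For $q\in\mathbb C^\times$ let $\mathcal G_2(q)$ be the strict $\mathbb C$-linear pivotal category with objects $0,1,2,\dots$ (the tensor powers of a symmetrically self-dual object), generated by a cap $2\to0$, a cup $0\to2$ and a trivalent vertex $2\to1$, modulo the two zigzag identities and the following relations: the loop equals $q^{10}+q^8+q^2+1+q^{-2}+q^{-8}+q^{-10}$; the lollipop (vertex with two legs joined) is $0$; the vertex is invariant under one-click rotation; the bigon is $([7]_q-1)$ times the strand, where $[7]_q=q^6+q^4+q^2+1+q^{-2}+q^{-4}+q^{-6}$; the trigon is $-(q^4+1+q^{-4})$ times the vertex; the tetragon is $(q^2+q^{-2})$ times the sum of the two trees with two vertices and four leaves plus $(q^2+1+q^{-2})$ times the sum of the two planar pairings of four points; the pentagon is minus the sum of the five trees with three vertices and five leaves minus the sum of the five diagrams consisting of a strand and a vertex. Let $\overline{\mathcal G_2(q)}$ be its quotient by the (tensor ideal of) negligible morphisms, where $f:m\to n$ is negligible if $\operatorname{tr}(g\circ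 f)=0$ for all $g:n\to m$. For a finite unoriented graph $\Gamma$ with at most one edge between any two vertices and at most one loop at each vertex, let $\operatorname{GPA}(\Gamma)$ be the strict $\mathbb C$-linear monoidal category with objects $0,1,2,\dots$, where $\operatorname{Hom}(m\to n)$ has as basis the pairs $(p,q)$ of an $m$-path $p$ and an $n$-path $q$ in $\Gamma$ with $s(p)=s(q)$ and $t(p)=t(q)$; here $(p,q)$ followed by $(p',q')$ is $\delta_{q=p'}(p,q')$, and $(p,q)\otimes(p',q')=\delta_{t(p)=s(p')}(pp',qq')$. With $\lambda$ a Frobenius-Perron eigenvector (an eigenvector with positive entries) of the adjacency matrix of $\Gamma$, and with $e$ running over the $1$-paths of $\Gamma$ and $\bar e$ denoting the reversed path, its evaluation and coevaluation are $\sum_e\sqrt{\lambda_{t(e)}/\lambda_{s(e)}}\,(e\bar e,s(e))$ and $\sum_e\sqrt{\lambda_{t(e)}/\lambda_{s(e)}}\,(s(e),e\bar e)$. **Theorem.** There is a faithful ($\mathbb C$-linear, strict) monoidal functor $$\overline{F_3}:\overline{\mathcal G_2(q_3)}\to\operatorname{GPA}(\Gamma_3)$$ which is the identity on objects, sends the cap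 to the evaluation and the cup to the coevaluation, and is such that every coordinate of the image of the trivalent vertex in $\operatorname{Hom}_{\operatorname{GPA}(\Gamma_3)}(2\to1)$, with respect to the basis of pairs of parallel paths, is an algebraic number of degree $12$ or $24$ over $\mathbb Q$. -/

import Mathlib

open CategoryTheory

noncomputable section

/-! ## Strict linear monoidal categories whose objects are the tensor powers of one object -/

/-- Transport of an element of a family indexed by pairs of natural numbers. -/
def castHom {H : ℕ → ℕ → Type} {m m' n n' : ℕ} (hm : m = m') (hn : n = n') (f : H m n) :
    H m' n' :=
  hm ▸ hn ▸ f

/-- A strict `ℂ`-linear monoidal category with set of objects `ℕ`, the tensor product of objects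
being addition.  Composition is written in diagrammatic order: `comp f g` is "first `f`, then
`g`". -/
structure LinearPRO where
  Hom : ℕ → ℕ → Type
  [addCommGroup : ∀ m n, AddCommGroup (Hom m n)]
  [module : ∀ m n, Module ℂ (Hom m n)]
  id : ∀ n, Hom n n
  comp : ∀ {l m n}, Hom l m → Hom m n → Hom l n
  tensor : ∀ {m n m' n'}, Hom m n → Hom m' n' → Hom (m + m') (n + n')
  id_comp : ∀ {m n} (f : Hom m n), comp (id m) f = f
  comp_id : ∀ {m n} (f : Hom m n), comp f (id n) = f
  comp_assoc : ∀ {k l m n} (f : Hom k l) (g : Hom l m) (h : Hom m n),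
    comp (comp f g) h = comp f (comp g h)
  add_comp : ∀ {l m n} (f g : Hom l m) (h : Hom m n), comp (f + g) h = comp f h + comp g h
  comp_add : ∀ {l m n} (f : Hom l m) (g h : Hom m n), comp f (g + h) = comp f g + comp f h
  smul_comp : ∀ {l m n} (c : ℂ) (f : Hom l m) (g : Hom m n), comp (c • f) g = c • comp f g
  comp_smul : ∀ {l m n} (c : ℂ) (f : Hom l m) (g : Hom m n), comp f (c • g) = c • comp f g
  add_tensor : ∀ {m n m' n'} (f g : Hom m n) (h : Hom m' n'),
    tensor (f + g) h = tensor f h + tensor g h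
  tensor_add : ∀ {m n m' n'} (f : Hom m n) (g h : Hom m' n'),
    tensor f (g + h) = tensor f g + tensor f h
  smul_tensor : ∀ {m n m' n'} (c : ℂ) (f : Hom m n) (g : Hom m' n'),
    tensor (c • f) g = c • tensor f g
  tensor_smul : ∀ {m n m' n'} (c : ℂ) (f : Hom m n) (g : Hom m' n'),
    tensor f (c • g) = c • tensor f g
  id_tensor_id : ∀ m n, tensor (id m) (id n) = id (m + n)
  interchange : ∀ {l m n l' m' n'} (f : Hom l m) (g : Hom m n) (f' : Hom l' m') (g' : Hom m' n'),
    comp (tensor f f') (tensor g g') = tensor (comp f g) (comp f' g')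
  tensor_assoc : ∀ {m n m' n' m'' n''} (f : Hom m n) (g : Hom m' n') (h : Hom m'' n''),
    castHom (Nat.add_assoc m m' m'') (Nat.add_assoc n n' n'') (tensor (tensor f g) h)
      = tensor f (tensor g h)
  id_zero_tensor : ∀ {m n} (f : Hom m n),
    castHom (Nat.zero_add m) (Nat.zero_add n) (tensor (id 0) f) = f
  tensor_id_zero : ∀ {m n} (f : Hom m n), tensor f (id 0) = f

attribute [instance] LinearPRO.addCommGroup LinearPRO.module

infixl:65 " ⨟ " => LinearPRO.comp _
infixr:75 " ⊠ " => LinearPRO.tensor _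

namespace LinearPRO

/-! ### The associated monoidal category in the sense of Mathlib -/

/-- The objects of the category of `P`: a copy of `ℕ`. -/
structure Obj (P : LinearPRO) where
  n : ℕ

variable {P : LinearPRO}

instance instCategoryObj : Category P.Obj where
  Hom X Y := P.Hom X.n Y.n
  id X := P.id X.n
  comp f g := P.comp f g
  id_comp := P.id_comp
  comp_id := P.comp_id
  assoc := P.comp_assoc

instance instPreadditiveObj : Preadditive P.Obj where
  homGroup X Y := P.addCommGroup X.n Y.n
  add_comp _ _ _ := P.add_comp
  comp_add _ _ _ := P.comp_add

instance instLinearObj : Linear ℂ P.Obj where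
  homModule X Y := P.module X.n Y.n
  smul_comp _ _ _ := P.smul_comp
  comp_smul _ _ _ f c g := P.comp_smul c f g

theorem obj_eq {a b : ℕ} (h : a = b) : (⟨a⟩ : P.Obj) = ⟨b⟩ := congrArg Obj.mk h

theorem castHom_comp_eqToHom {a b a' b' : ℕ} (ha : a = a') (hb : b = b') (f : P.Hom a b) :
    (show (⟨a⟩ : P.Obj) ⟶ ⟨b⟩ from f) ≫ eqToHom (obj_eq hb)
      = eqToHom (obj_eq ha) ≫ (show (⟨a'⟩ : P.Obj) ⟶ ⟨b'⟩ from castHom ha hb f) := by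
  subst ha hb
  simp [castHom]

instance instMonoidalCategoryStructObj : MonoidalCategoryStruct P.Obj where
  tensorObj X Y := ⟨X.n + Y.n⟩
  tensorUnit := ⟨0⟩
  tensorHom f g := P.tensor f g
  whiskerLeft X _ _ g := P.tensor (P.id X.n) g
  whiskerRight f Y := P.tensor f (P.id Y.n)
  associator X Y Z := eqToIso (obj_eq (Nat.add_assoc X.n Y.n Z.n))
  leftUnitor X := eqToIso (obj_eq (Nat.zero_add X.n))
  rightUnitor X := eqToIso (obj_eq (Nat.add_zero X.n))

theorem associator_hom (X Y Z : P.Obj) : (MonoidalCategoryStruct.associator X Y Z).hom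
    = eqToHom (obj_eq (Nat.add_assoc X.n Y.n Z.n)) := rfl

theorem leftUnitor_hom (X : P.Obj) : (MonoidalCategoryStruct.leftUnitor X).hom
    = eqToHom (obj_eq (Nat.zero_add X.n)) := rfl

theorem rightUnitor_hom (X : P.Obj) : (MonoidalCategoryStruct.rightUnitor X).hom
    = eqToHom (obj_eq (Nat.add_zero X.n)) := rfl

theorem id_tensorHom_eqToHom (X : P.Obj) {Y Z : P.Obj} (h : Y = Z) :
    MonoidalCategoryStruct.tensorHom (𝟙 X) (eqToHom h)
      = eqToHom (congrArg (MonoidalCategoryStruct.tensorObj X) h) := by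
  subst h
  exact P.id_tensor_id _ _

theorem eqToHom_tensorHom_id {Y Z : P.Obj} (h : Y = Z) (X : P.Obj) :
    MonoidalCategoryStruct.tensorHom (eqToHom h) (𝟙 X)
      = eqToHom (congrArg (fun W => MonoidalCategoryStruct.tensorObj W X) h) := by
  subst h
  exact P.id_tensor_id _ _

instance instMonoidalCategoryObj : MonoidalCategory P.Obj :=
  MonoidalCategory.ofTensorHom
    (id_tensorHom_id := fun _ _ => P.id_tensor_id _ _)
    (id_tensorHom := fun _ {_ _} _ => rfl)
    (tensorHom_id := fun {_ _} _ _ => rfl)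
    (tensorHom_comp_tensorHom := fun f₁ f₂ g₁ g₂ => P.interchange f₁ g₁ f₂ g₂)
    (associator_naturality := fun {X₁ X₂ X₃ Y₁ Y₂ Y₃} f₁ f₂ f₃ => by
      refine (castHom_comp_eqToHom (Nat.add_assoc X₁.n X₂.n X₃.n)
        (Nat.add_assoc Y₁.n Y₂.n Y₃.n) (P.tensor (P.tensor f₁ f₂) f₃)).trans ?_
      rw [P.tensor_assoc]
      rfl)
    (leftUnitor_naturality := fun {X Y} f => by
      refine (castHom_comp_eqToHom (Nat.zero_add X.n) (Nat.zero_add Y.n)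
        (P.tensor (P.id 0) f)).trans ?_
      rw [P.id_zero_tensor]
      rfl)
    (rightUnitor_naturality := fun {X Y} f => by
      change P.comp (P.tensor f (P.id 0)) (P.id _) = P.comp (P.id _) f
      rw [P.tensor_id_zero, P.comp_id, P.id_comp])
    (pentagon := fun W X Y Z => by
      rw [associator_hom, associator_hom, associator_hom, associator_hom, associator_hom,
        id_tensorHom_eqToHom, eqToHom_tensorHom_id]
      exact (congrArg _ (eqToHom_trans _ _)).trans
        ((eqToHom_trans _ _).trans (eqToHom_trans _ _).symm))
    (triangle := fun X Y => by
      rw [associator_hom, leftUnitor_hom, rightUnitor_hom, id_tensorHom_eqToHom,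
        eqToHom_tensorHom_id]
      exact eqToHom_trans _ _)

end LinearPRO

/-! ### Strict monoidal functors -/

/-- A `ℂ`-linear strict monoidal functor which is the identity on objects (that is, which sends
the generating object to the generating object).  The monoidal functor in the sense of Mathlib is
`StrictMonoidalFunctor.toFunctor`, with its `Functor.Monoidal` and `Functor.Linear` instances. -/
structure StrictMonoidalFunctor (P Q : LinearPRO) where
  map : ∀ {m n}, P.Hom m n →ₗ[ℂ] Q.Hom m n
  map_id : ∀ n, map (P.id n) = Q.id n
  map_comp : ∀ {l m n} (f : P.Hom l m) (g : P.Hom m n), map (f ⨟ g) = map f ⨟ map g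
  map_tensor : ∀ {m n m' n'} (f : P.Hom m n) (g : P.Hom m' n'), map (f ⊠ g) = map f ⊠ map g

namespace StrictMonoidalFunctor

variable {P Q : LinearPRO} (F : StrictMonoidalFunctor P Q)

/-- The underlying functor. -/
def toFunctor : P.Obj ⥤ Q.Obj where
  obj X := ⟨X.n⟩
  map f := F.map f
  map_id _ := F.map_id _
  map_comp f g := F.map_comp f g

instance instAdditiveToFunctor : F.toFunctor.Additive where
  map_add := map_add F.map _ _

instance instLinearToFunctor : F.toFunctor.Linear ℂ where
  map_smul f c := map_smul F.map c f

theorem toFunctor_map_eqToHom {a b : ℕ} (h : a = b) :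
    F.toFunctor.map (eqToHom (LinearPRO.obj_eq (P := P) h))
      = eqToHom (LinearPRO.obj_eq (P := Q) h) := by
  subst h
  exact F.map_id a

/-- The underlying functor is a monoidal functor, with identities as structure morphisms. -/
def coreMonoidalToFunctor : F.toFunctor.CoreMonoidal where
  εIso := Iso.refl _
  μIso _ _ := Iso.refl _
  μIso_hom_natural_left {X Y} f X' := by
    change Q.comp (Q.tensor (F.map f) (Q.id _)) (Q.id _)
      = Q.comp (Q.id _) (F.map (P.tensor f (P.id _)))
    rw [Q.comp_id, Q.id_comp, F.map_tensor, F.map_id]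
  μIso_hom_natural_right {X Y} X' f := by
    change Q.comp (Q.tensor (Q.id _) (F.map f)) (Q.id _)
      = Q.comp (Q.id _) (F.map (P.tensor (P.id _) f))
    rw [Q.comp_id, Q.id_comp, F.map_tensor, F.map_id]
  associativity X Y Z := by
    have h := F.toFunctor_map_eqToHom (Nat.add_assoc X.n Y.n Z.n)
    change Q.comp (Q.tensor (Q.id (X.n + Y.n)) (Q.id Z.n)) (Q.comp (Q.id (X.n + Y.n + Z.n))
        (F.toFunctor.map (eqToHom (LinearPRO.obj_eq (P := P) (Nat.add_assoc X.n Y.n Z.n)))))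
      = Q.comp (eqToHom (LinearPRO.obj_eq (P := Q) (Nat.add_assoc X.n Y.n Z.n)))
        (Q.comp (Q.tensor (Q.id X.n) (Q.id (Y.n + Z.n))) (Q.id (X.n + (Y.n + Z.n))))
    rw [h, Q.id_tensor_id, Q.id_tensor_id, Q.id_comp, Q.comp_id]
    exact (Q.id_comp _).trans (Q.comp_id _).symm
  left_unitality X := by
    have h := F.toFunctor_map_eqToHom (Nat.zero_add X.n)
    change eqToHom (LinearPRO.obj_eq (P := Q) (Nat.zero_add X.n))
      = Q.comp (Q.tensor (Q.id 0) (Q.id X.n)) (Q.comp (Q.id (0 + X.n))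
        (F.toFunctor.map (eqToHom (LinearPRO.obj_eq (P := P) (Nat.zero_add X.n)))))
    rw [h, Q.id_tensor_id]
    exact ((Q.id_comp _).trans (Q.id_comp _)).symm
  right_unitality X := by
    have h := F.toFunctor_map_eqToHom (Nat.add_zero X.n)
    change eqToHom (LinearPRO.obj_eq (P := Q) (Nat.add_zero X.n))
      = Q.comp (Q.tensor (Q.id X.n) (Q.id 0)) (Q.comp (Q.id (X.n + 0))
        (F.toFunctor.map (eqToHom (LinearPRO.obj_eq (P := P) (Nat.add_zero X.n)))))
    rw [h, Q.id_tensor_id]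
    exact ((Q.id_comp _).trans (Q.id_comp _)).symm

instance instMonoidalToFunctor : F.toFunctor.Monoidal :=
  F.coreMonoidalToFunctor.toMonoidal

end StrictMonoidalFunctor

/-! ### Quotients by tensor ideals -/

namespace LinearPRO

variable (P : LinearPRO)

/-- Membership in the tensor ideal generated by a family `S` of sets of morphisms: the smallest
family of linear subspaces of the hom-spaces which contains `S` and is closed under composition
and tensor product with arbitrary morphisms, on both sides. -/
inductive InTensorIdeal (S : ∀ m n, Set (P.Hom m n)) : ∀ {m n : ℕ}, P.Hom m n → Prop
  | of {m n} {f : P.Hom m n} : f ∈ S m n → InTensorIdeal S f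
  | zero {m n} : InTensorIdeal S (0 : P.Hom m n)
  | add {m n} {f g : P.Hom m n} : InTensorIdeal S f → InTensorIdeal S g → InTensorIdeal S (f + g)
  | smul {m n} (c : ℂ) {f : P.Hom m n} : InTensorIdeal S f → InTensorIdeal S (c • f)
  | comp_left {l m n} (g : P.Hom l m) {f : P.Hom m n} : InTensorIdeal S f →
      InTensorIdeal S (g ⨟ f)
  | comp_right {l m n} {f : P.Hom l m} (g : P.Hom m n) : InTensorIdeal S f →
      InTensorIdeal S (f ⨟ g)
  | tensor_left {m n m' n'} (g : P.Hom m n) {f : P.Hom m' n'} : InTensorIdeal S f →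
      InTensorIdeal S (g ⊠ f)
  | tensor_right {m n m' n'} {f : P.Hom m n} (g : P.Hom m' n') : InTensorIdeal S f →
      InTensorIdeal S (f ⊠ g)

variable (S : ∀ m n, Set (P.Hom m n))

/-- The tensor ideal generated by `S`. -/
def tensorIdeal (m n : ℕ) : Submodule ℂ (P.Hom m n) where
  carrier := {f | P.InTensorIdeal S f}
  add_mem' := InTensorIdeal.add
  zero_mem' := InTensorIdeal.zero
  smul_mem' c _ := InTensorIdeal.smul c

variable {P}

theorem comp_sub_mem {l m n : ℕ} {f f' : P.Hom l m} {g g' : P.Hom m n}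
    (hf : f - f' ∈ P.tensorIdeal S l m) (hg : g - g' ∈ P.tensorIdeal S m n) :
    (f ⨟ g) - (f' ⨟ g') ∈ P.tensorIdeal S l n := by
  have e : (f ⨟ g) - (f' ⨟ g') = ((f - f') ⨟ g) + (f' ⨟ (g - g')) := by
    have h1 := P.add_comp (f - f') f' g
    have h2 := P.comp_add f' (g - g') g'
    rw [sub_add_cancel] at h1 h2
    rw [h1, h2]
    abel
  rw [e]
  exact add_mem (InTensorIdeal.comp_right g hf) (InTensorIdeal.comp_left f' hg)

theorem tensor_sub_mem {m n m' n' : ℕ} {f f' : P.Hom m n} {g g' : P.Hom m' n'}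
    (hf : f - f' ∈ P.tensorIdeal S m n) (hg : g - g' ∈ P.tensorIdeal S m' n') :
    (f ⊠ g) - (f' ⊠ g') ∈ P.tensorIdeal S (m + m') (n + n') := by
  have e : (f ⊠ g) - (f' ⊠ g') = ((f - f') ⊠ g) + (f' ⊠ (g - g')) := by
    have h1 := P.add_tensor (f - f') f' g
    have h2 := P.tensor_add f' (g - g') g'
    rw [sub_add_cancel] at h1 h2
    rw [h1, h2]
    abel
  rw [e]
  exact add_mem (InTensorIdeal.tensor_right g hf) (InTensorIdeal.tensor_left f' hg)

theorem mk_castHom {a b a' b' : ℕ} (ha : a = a') (hb : b = b') (f : P.Hom a b) :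
    castHom (H := fun m n => P.Hom m n ⧸ P.tensorIdeal S m n) ha hb
        ((P.tensorIdeal S a b).mkQ f)
      = (P.tensorIdeal S a' b').mkQ (castHom ha hb f) := by
  subst ha hb
  rfl

variable (P)

/-- The quotient of `P` by the tensor ideal generated by `S`. -/
def quotient : LinearPRO where
  Hom m n := P.Hom m n ⧸ P.tensorIdeal S m n
  id n := (P.tensorIdeal S n n).mkQ (P.id n)
  comp {l m n} := Quotient.map₂ (fun f g => f ⨟ g) (fun f f' hf g g' hg =>
    (Submodule.quotientRel_def _).2 (comp_sub_mem S
      ((Submodule.quotientRel_def _).1 hf) ((Submodule.quotientRel_def _).1 hg)))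
  tensor {m n m' n'} := Quotient.map₂ (fun f g => f ⊠ g) (fun f f' hf g g' hg =>
    (Submodule.quotientRel_def _).2 (tensor_sub_mem S
      ((Submodule.quotientRel_def _).1 hf) ((Submodule.quotientRel_def _).1 hg)))
  id_comp := by
    rintro m n ⟨f⟩
    exact congrArg (Submodule.mkQ _) (P.id_comp f)
  comp_id := by
    rintro m n ⟨f⟩
    exact congrArg (Submodule.mkQ _) (P.comp_id f)
  comp_assoc := by
    rintro k l m n ⟨f⟩ ⟨g⟩ ⟨h⟩
    exact congrArg (Submodule.mkQ _) (P.comp_assoc f g h)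
  add_comp := by
    rintro l m n ⟨f⟩ ⟨g⟩ ⟨h⟩
    exact congrArg (Submodule.mkQ _) (P.add_comp f g h)
  comp_add := by
    rintro l m n ⟨f⟩ ⟨g⟩ ⟨h⟩
    exact congrArg (Submodule.mkQ _) (P.comp_add f g h)
  smul_comp := by
    rintro l m n c ⟨f⟩ ⟨g⟩
    exact congrArg (Submodule.mkQ _) (P.smul_comp c f g)
  comp_smul := by
    rintro l m n c ⟨f⟩ ⟨g⟩
    exact congrArg (Submodule.mkQ _) (P.comp_smul c f g)
  add_tensor := by
    rintro m n m' n' ⟨f⟩ ⟨g⟩ ⟨h⟩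
    exact congrArg (Submodule.mkQ _) (P.add_tensor f g h)
  tensor_add := by
    rintro m n m' n' ⟨f⟩ ⟨g⟩ ⟨h⟩
    exact congrArg (Submodule.mkQ _) (P.tensor_add f g h)
  smul_tensor := by
    rintro m n m' n' c ⟨f⟩ ⟨g⟩
    exact congrArg (Submodule.mkQ _) (P.smul_tensor c f g)
  tensor_smul := by
    rintro m n m' n' c ⟨f⟩ ⟨g⟩
    exact congrArg (Submodule.mkQ _) (P.tensor_smul c f g)
  id_tensor_id m n := congrArg (Submodule.mkQ _) (P.id_tensor_id m n)
  interchange := by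
    rintro l m n l' m' n' ⟨f⟩ ⟨g⟩ ⟨f'⟩ ⟨g'⟩
    exact congrArg (Submodule.mkQ _) (P.interchange f g f' g')
  tensor_assoc := by
    rintro m n m' n' m'' n'' ⟨f⟩ ⟨g⟩ ⟨h⟩
    exact (mk_castHom S _ _ _).trans (congrArg (Submodule.mkQ _) (P.tensor_assoc f g h))
  id_zero_tensor := by
    rintro m n ⟨f⟩
    exact (mk_castHom S _ _ _).trans (congrArg (Submodule.mkQ _) (P.id_zero_tensor f))
  tensor_id_zero := by
    rintro m n ⟨f⟩
    exact congrArg (Submodule.mkQ _) (P.tensor_id_zero f)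

/-- The quotient functor. -/
def toQuotient : StrictMonoidalFunctor P (P.quotient S) where
  map {m n} := (P.tensorIdeal S m n).mkQ
  map_id _ := rfl
  map_comp _ _ := rfl
  map_tensor _ _ := rfl

/-! ### Traces and negligible morphisms -/

/-- A duality between the generating object and itself: morphisms `cap : 2 → 0` (evaluation) and
`cup : 0 → 2` (coevaluation) which satisfy the two zigzag identities. -/
structure SelfDuality where
  cap : P.Hom 2 0
  cup : P.Hom 0 2
  zigzag_left : ((P.id 1 ⊠ cup) ⨟ (cap ⊠ P.id 1) : P.Hom 1 1) = P.id 1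
  zigzag_right : ((cup ⊠ P.id 1) ⨟ (P.id 1 ⊠ cap) : P.Hom 1 1) = P.id 1

variable {P}

/-- The image of a self-duality under a strict monoidal functor. -/
def SelfDuality.image {Q : LinearPRO} (D : P.SelfDuality) (F : StrictMonoidalFunctor P Q) :
    Q.SelfDuality where
  cap := F.map D.cap
  cup := F.map D.cup
  zigzag_left := by
    have h := congrArg F.map D.zigzag_left
    rw [F.map_id] at h
    refine Eq.trans ?_ ((F.map_comp _ _).symm.trans h)
    rw [← F.map_id 1]
    exact (congrArg₂ Q.comp (F.map_tensor (P.id 1) D.cup) (F.map_tensor D.cap (P.id 1))).symm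
  zigzag_right := by
    have h := congrArg F.map D.zigzag_right
    rw [F.map_id] at h
    refine Eq.trans ?_ ((F.map_comp _ _).symm.trans h)
    rw [← F.map_id 1]
    exact (congrArg₂ Q.comp (F.map_tensor D.cup (P.id 1)) (F.map_tensor (P.id 1) D.cap)).symm

/-- Closing up the rightmost strand of a morphism. -/
def partialTrace (D : P.SelfDuality) {m n : ℕ} (f : P.Hom (m + 1) (n + 1)) : P.Hom m n :=
  (P.id m ⊠ D.cup) ⨟ (P.tensor (m := m + 1) (n := n + 1) f (P.id 1) ⨟ (P.id n ⊠ D.cap))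

/-- The categorical trace of an endomorphism, an endomorphism of the unit object: all strands are
closed up to the right, one after the other. -/
def trace (D : P.SelfDuality) : ∀ {n : ℕ}, P.Hom n n → P.Hom 0 0
  | 0, f => f
  | _ + 1, f => trace D (partialTrace D f)

/-- A morphism `f` is negligible if `tr (g ∘ f) = 0` for all `g` in the opposite direction. -/
def IsNegligible (D : P.SelfDuality) {m n : ℕ} (f : P.Hom m n) : Prop :=
  ∀ g : P.Hom n m, trace D (f ⨟ g) = 0

/-- The semisimple quotient, i.e. the quotient by the ideal of negligible morphisms.  (In the
categories of interest the negligible morphisms form a tensor ideal; here one divides by the tensor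
ideal which they generate, so that the definition makes sense without a proof of this.) -/
def semisimplification (D : P.SelfDuality) : LinearPRO :=
  P.quotient fun _ _ => {f | IsNegligible D f}

/-- The quotient functor to the semisimple quotient. -/
def toSemisimplification (D : P.SelfDuality) :
    StrictMonoidalFunctor P (semisimplification D) :=
  P.toQuotient fun _ _ => {f | IsNegligible D f}

end LinearPRO

/-! ## The trivalent category `G₂(q)` -/

namespace G2

/-- Formal expressions for linear combinations of planar diagrams with unoriented strands and
trivalent vertices: `Term m n` has `m` boundary points at the bottom and `n` at the top. -/
inductive Term : ℕ → ℕ → Type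
  | id (n : ℕ) : Term n n
  | cap : Term 2 0
  | cup : Term 0 2
  | vertex : Term 2 1
  | comp {l m n : ℕ} : Term l m → Term m n → Term l n
  | tensor {m n m' n' : ℕ} : Term m n → Term m' n' → Term (m + m') (n + n')
  | zero {m n : ℕ} : Term m n
  | add {m n : ℕ} : Term m n → Term m n → Term m n
  | smul {m n : ℕ} : ℂ → Term m n → Term m n

open Term in
/-- The congruence on expressions generated by the axioms of a strict `ℂ`-linear monoidal
category. -/
inductive TermRel : ∀ {m n : ℕ}, Term m n → Term m n → Prop
  | refl {m n} (f : Term m n) : TermRel f f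
  | symm {m n} {f g : Term m n} : TermRel f g → TermRel g f
  | trans {m n} {f g h : Term m n} : TermRel f g → TermRel g h → TermRel f h
  | comp_congr {l m n} {f f' : Term l m} {g g' : Term m n} : TermRel f f' → TermRel g g' →
      TermRel (comp f g) (comp f' g')
  | tensor_congr {m n m' n'} {f f' : Term m n} {g g' : Term m' n'} : TermRel f f' →
      TermRel g g' → TermRel (tensor f g) (tensor f' g')
  | add_congr {m n} {f f' g g' : Term m n} : TermRel f f' → TermRel g g' →
      TermRel (add f g) (add f' g')
  | smul_congr {m n} (c : ℂ) {f f' : Term m n} : TermRel f f' → TermRel (smul c f) (smul c f')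
  | add_assoc {m n} (f g h : Term m n) : TermRel (add (add f g) h) (add f (add g h))
  | add_comm {m n} (f g : Term m n) : TermRel (add f g) (add g f)
  | zero_add {m n} (f : Term m n) : TermRel (add zero f) f
  | neg_add {m n} (f : Term m n) : TermRel (add (smul (-1) f) f) zero
  | one_smul {m n} (f : Term m n) : TermRel (smul 1 f) f
  | mul_smul {m n} (c d : ℂ) (f : Term m n) : TermRel (smul (c * d) f) (smul c (smul d f))
  | smul_add {m n} (c : ℂ) (f g : Term m n) :
      TermRel (smul c (add f g)) (add (smul c f) (smul c g))
  | add_smul {m n} (c d : ℂ) (f : Term m n) :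
      TermRel (smul (c + d) f) (add (smul c f) (smul d f))
  | id_comp {m n} (f : Term m n) : TermRel (comp (id m) f) f
  | comp_id {m n} (f : Term m n) : TermRel (comp f (id n)) f
  | comp_assoc {k l m n} (f : Term k l) (g : Term l m) (h : Term m n) :
      TermRel (comp (comp f g) h) (comp f (comp g h))
  | add_comp {l m n} (f g : Term l m) (h : Term m n) :
      TermRel (comp (add f g) h) (add (comp f h) (comp g h))
  | comp_add {l m n} (f : Term l m) (g h : Term m n) :
      TermRel (comp f (add g h)) (add (comp f g) (comp f h))
  | smul_comp {l m n} (c : ℂ) (f : Term l m) (g : Term m n) :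
      TermRel (comp (smul c f) g) (smul c (comp f g))
  | comp_smul {l m n} (c : ℂ) (f : Term l m) (g : Term m n) :
      TermRel (comp f (smul c g)) (smul c (comp f g))
  | add_tensor {m n m' n'} (f g : Term m n) (h : Term m' n') :
      TermRel (tensor (add f g) h) (add (tensor f h) (tensor g h))
  | tensor_add {m n m' n'} (f : Term m n) (g h : Term m' n') :
      TermRel (tensor f (add g h)) (add (tensor f g) (tensor f h))
  | smul_tensor {m n m' n'} (c : ℂ) (f : Term m n) (g : Term m' n') :
      TermRel (tensor (smul c f) g) (smul c (tensor f g))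
  | tensor_smul {m n m' n'} (c : ℂ) (f : Term m n) (g : Term m' n') :
      TermRel (tensor f (smul c g)) (smul c (tensor f g))
  | id_tensor_id (m n : ℕ) : TermRel (tensor (id m) (id n)) (id (m + n))
  | interchange {l m n l' m' n'} (f : Term l m) (g : Term m n) (f' : Term l' m')
      (g' : Term m' n') :
      TermRel (comp (tensor f f') (tensor g g')) (tensor (comp f g) (comp f' g'))
  | tensor_assoc {m n m' n' m'' n''} (f : Term m n) (g : Term m' n') (h : Term m'' n'') :
      TermRel (castHom (Nat.add_assoc m m' m'') (Nat.add_assoc n n' n'')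
        (tensor (tensor f g) h)) (tensor f (tensor g h))
  | id_zero_tensor {m n} (f : Term m n) :
      TermRel (castHom (Nat.zero_add m) (Nat.zero_add n) (tensor (id 0) f)) f
  | tensor_id_zero {m n} (f : Term m n) : TermRel (tensor f (id 0)) f

/-- Congruence of expressions as a setoid. -/
def termSetoid (m n : ℕ) : Setoid (Term m n) where
  r := TermRel
  iseqv := ⟨TermRel.refl, TermRel.symm, TermRel.trans⟩

/-- The hom-spaces of the free strict `ℂ`-linear monoidal category on a cap, a cup and a trivalent
vertex. -/
def FreeHom (m n : ℕ) : Type := Quotient (termSetoid m n)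

/-- The class of an expression. -/
def FreeHom.mk {m n : ℕ} (f : Term m n) : FreeHom m n := Quotient.mk (termSetoid m n) f

theorem FreeHom.sound {m n : ℕ} {f g : Term m n} (h : TermRel f g) :
    FreeHom.mk f = FreeHom.mk g :=
  Quotient.sound h

theorem FreeHom.mk_castHom {a b a' b' : ℕ} (ha : a = a') (hb : b = b') (f : Term a b) :
    castHom ha hb (FreeHom.mk f) = FreeHom.mk (castHom ha hb f) := by
  subst ha hb
  rfl

instance FreeHom.instAdd (m n : ℕ) : Add (FreeHom m n) :=
  ⟨Quotient.map₂ Term.add fun _ _ h _ _ h' => TermRel.add_congr h h'⟩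

instance FreeHom.instZero (m n : ℕ) : Zero (FreeHom m n) := ⟨FreeHom.mk Term.zero⟩

instance FreeHom.instSMul (m n : ℕ) : SMul ℂ (FreeHom m n) :=
  ⟨fun c => Quotient.map (Term.smul c) fun _ _ h => TermRel.smul_congr c h⟩

instance FreeHom.instNeg (m n : ℕ) : Neg (FreeHom m n) := ⟨fun f => (-1 : ℂ) • f⟩

instance FreeHom.instAddCommGroup (m n : ℕ) : AddCommGroup (FreeHom m n) where
  add_assoc := by rintro ⟨f⟩ ⟨g⟩ ⟨h⟩; exact FreeHom.sound (TermRel.add_assoc f g h)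
  zero_add := by rintro ⟨f⟩; exact FreeHom.sound (TermRel.zero_add f)
  add_zero := by
    rintro ⟨f⟩
    exact FreeHom.sound ((TermRel.add_comm _ _).trans (TermRel.zero_add f))
  neg_add_cancel := by rintro ⟨f⟩; exact FreeHom.sound (TermRel.neg_add f)
  add_comm := by rintro ⟨f⟩ ⟨g⟩; exact FreeHom.sound (TermRel.add_comm f g)
  nsmul := nsmulRec
  zsmul := zsmulRec

instance FreeHom.instModule (m n : ℕ) : Module ℂ (FreeHom m n) :=
  Module.ofMinimalAxioms
    (smul_add := by rintro c ⟨f⟩ ⟨g⟩; exact FreeHom.sound (TermRel.smul_add c f g))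
    (add_smul := by rintro c d ⟨f⟩; exact FreeHom.sound (TermRel.add_smul c d f))
    (mul_smul := by rintro c d ⟨f⟩; exact FreeHom.sound (TermRel.mul_smul c d f))
    (one_smul := by rintro ⟨f⟩; exact FreeHom.sound (TermRel.one_smul f))

/-- The free strict `ℂ`-linear monoidal category generated by morphisms `cap : 2 → 0`,
`cup : 0 → 2` and `vertex : 2 → 1`. -/
def Free : LinearPRO where
  Hom := FreeHom
  id n := FreeHom.mk (Term.id n)
  comp := Quotient.map₂ Term.comp fun _ _ h _ _ h' => TermRel.comp_congr h h'
  tensor := Quotient.map₂ Term.tensor fun _ _ h _ _ h' => TermRel.tensor_congr h h'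
  id_comp := by rintro m n ⟨f⟩; exact FreeHom.sound (TermRel.id_comp f)
  comp_id := by rintro m n ⟨f⟩; exact FreeHom.sound (TermRel.comp_id f)
  comp_assoc := by
    rintro k l m n ⟨f⟩ ⟨g⟩ ⟨h⟩; exact FreeHom.sound (TermRel.comp_assoc f g h)
  add_comp := by rintro l m n ⟨f⟩ ⟨g⟩ ⟨h⟩; exact FreeHom.sound (TermRel.add_comp f g h)
  comp_add := by rintro l m n ⟨f⟩ ⟨g⟩ ⟨h⟩; exact FreeHom.sound (TermRel.comp_add f g h)
  smul_comp := by rintro l m n c ⟨f⟩ ⟨g⟩; exact FreeHom.sound (TermRel.smul_comp c f g)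
  comp_smul := by rintro l m n c ⟨f⟩ ⟨g⟩; exact FreeHom.sound (TermRel.comp_smul c f g)
  add_tensor := by
    rintro m n m' n' ⟨f⟩ ⟨g⟩ ⟨h⟩; exact FreeHom.sound (TermRel.add_tensor f g h)
  tensor_add := by
    rintro m n m' n' ⟨f⟩ ⟨g⟩ ⟨h⟩; exact FreeHom.sound (TermRel.tensor_add f g h)
  smul_tensor := by
    rintro m n m' n' c ⟨f⟩ ⟨g⟩; exact FreeHom.sound (TermRel.smul_tensor c f g)
  tensor_smul := by
    rintro m n m' n' c ⟨f⟩ ⟨g⟩; exact FreeHom.sound (TermRel.tensor_smul c f g)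
  id_tensor_id m n := FreeHom.sound (TermRel.id_tensor_id m n)
  interchange := by
    rintro l m n l' m' n' ⟨f⟩ ⟨g⟩ ⟨f'⟩ ⟨g'⟩
    exact FreeHom.sound (TermRel.interchange f g f' g')
  tensor_assoc := by
    rintro m n m' n' m'' n'' ⟨f⟩ ⟨g⟩ ⟨h⟩
    exact (FreeHom.mk_castHom _ _ _).trans (FreeHom.sound (TermRel.tensor_assoc f g h))
  id_zero_tensor := by
    rintro m n ⟨f⟩
    exact (FreeHom.mk_castHom _ _ _).trans (FreeHom.sound (TermRel.id_zero_tensor f))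
  tensor_id_zero := by rintro m n ⟨f⟩; exact FreeHom.sound (TermRel.tensor_id_zero f)

/-! ### Diagrams -/

/-- Identity diagrams: `n` vertical strands. -/
def idn (n : ℕ) : Free.Hom n n := Free.id n

/-- The cap. -/
def cap : Free.Hom 2 0 := FreeHom.mk Term.cap

/-- The cup. -/
def cup : Free.Hom 0 2 := FreeHom.mk Term.cup

/-- The trivalent vertex as a morphism `2 → 1`. -/
def vertex : Free.Hom 2 1 := FreeHom.mk Term.vertex

/-- The trivalent vertex as a morphism `1 → 2`, obtained by bending one leg. -/
def covertex : Free.Hom 1 2 :=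
  (idn 1 ⊠ cup : Free.Hom 1 3) ⨟ (vertex ⊠ idn 1 : Free.Hom 3 2)

/-- One-click rotation of a diagram with two boundary points at the bottom and one at the top. -/
def rotate21 (f : Free.Hom 2 1) : Free.Hom 2 1 :=
  (idn 2 ⊠ cup : Free.Hom 2 4) ⨟
    (idn 1 ⊠ f ⊠ idn 1 : Free.Hom 4 3) ⨟ (cap ⊠ idn 1 : Free.Hom 3 1)

/-- One-click rotation of a diagram with two boundary points at the bottom and three at the
top. -/
def rotate23 (f : Free.Hom 2 3) : Free.Hom 2 3 :=
  (idn 2 ⊠ cup : Free.Hom 2 4) ⨟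
    (idn 1 ⊠ f ⊠ idn 1 : Free.Hom 4 5) ⨟ (cap ⊠ idn 3 : Free.Hom 5 3)

/-- The loop. -/
def loop : Free.Hom 0 0 := cup ⨟ cap

/-- The lollipop: a vertex two of whose legs are joined. -/
def lollipop : Free.Hom 0 1 := cup ⨟ vertex

/-- The bigon with two external legs. -/
def bigon : Free.Hom 1 1 := covertex ⨟ vertex

/-- The tree with two vertices whose inner edge is vertical. -/
def treeI : Free.Hom 2 2 := vertex ⨟ covertex

/-- The tree with two vertices whose inner edge is horizontal. -/
def treeH : Free.Hom 2 2 :=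
  (covertex ⊠ idn 1 : Free.Hom 2 3) ⨟ (idn 1 ⊠ vertex : Free.Hom 3 2)

/-- The triangle with three external legs. -/
def trigon : Free.Hom 2 1 := treeH ⨟ vertex

/-- The square with four external legs. -/
def tetragon : Free.Hom 2 2 := treeH ⨟ treeH

/-- The pentagon with five external legs. -/
def pentagon : Free.Hom 2 3 :=
  treeH ⨟ (covertex ⊠ idn 1 : Free.Hom 2 3) ⨟
    (idn 1 ⊠ covertex ⊠ idn 1 : Free.Hom 3 4) ⨟
    (idn 2 ⊠ vertex : Free.Hom 4 3)

/-- A tree with three vertices and five leaves. -/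
def tree5 : Free.Hom 2 3 := treeI ⨟ (covertex ⊠ idn 1 : Free.Hom 2 3)

/-- A strand next to a vertex. -/
def strandVertex : Free.Hom 2 3 := idn 1 ⊠ covertex

/-- The quantum integer `[n]_q = q^(n-1) + q^(n-3) + ... + q^(1-n)`. -/
def qInt (q : ℂ) (n : ℕ) : ℂ := ∑ i ∈ Finset.range n, q ^ ((n : ℤ) - 1 - 2 * i)

/-- The defining relations of `G₂(q)`.  The zigzag identities say that the generating object is
self-dual; together with the rotation relation they make the category pivotal, that is, invariant
under planar isotopy. -/
inductive Skein (q : ℂ) : ∀ {m n : ℕ}, Free.Hom m n → Free.Hom m n → Prop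
  | zigzag_left : Skein q ((idn 1 ⊠ cup) ⨟ (cap ⊠ idn 1) : Free.Hom 1 1) (idn 1)
  | zigzag_right : Skein q ((cup ⊠ idn 1) ⨟ (idn 1 ⊠ cap) : Free.Hom 1 1) (idn 1)
  | loop : Skein q loop ((q ^ (10 : ℤ) + q ^ (8 : ℤ) + q ^ (2 : ℤ) + 1 + q ^ (-2 : ℤ)
      + q ^ (-8 : ℤ) + q ^ (-10 : ℤ)) • idn 0)
  | lollipop : Skein q lollipop 0
  | rotate : Skein q (rotate21 vertex) vertex
  | bigon : Skein q bigon ((qInt q 7 - 1) • idn 1)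
  | trigon : Skein q trigon (-(q ^ (4 : ℤ) + 1 + q ^ (-4 : ℤ)) • vertex)
  | tetragon : Skein q tetragon
      ((q ^ (2 : ℤ) + q ^ (-2 : ℤ)) • (treeI + treeH)
        + (q ^ (2 : ℤ) + 1 + q ^ (-2 : ℤ)) • (idn 2 + (cap ⨟ cup)))
  | pentagon : Skein q pentagon
      (-(∑ i ∈ Finset.range 5, rotate23^[i] tree5)
        - ∑ i ∈ Finset.range 5, rotate23^[i] strandVertex)

/-- The differences of the two sides of the defining relations. -/
def skeinRelators (q : ℂ) (m n : ℕ) : Set (Free.Hom m n) :=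
  {x | ∃ f g : Free.Hom m n, Skein q f g ∧ x = f - g}

end G2

/-- The trivalent category `G₂(q)`: the strict `ℂ`-linear pivotal category generated by a
self-dual object and a trivalent vertex subject to the defining relations. -/
def G2 (q : ℂ) : LinearPRO := G2.Free.quotient (G2.skeinRelators q)

namespace G2

/-- The morphism of `G₂(q)` given by a diagram. -/
def toG2 (q : ℂ) : StrictMonoidalFunctor Free (G2 q) := Free.toQuotient (skeinRelators q)

theorem toG2_eq {q : ℂ} {m n : ℕ} {f g : Free.Hom m n} (h : Skein q f g) :
    (toG2 q).map f = (toG2 q).map g :=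
  (Submodule.Quotient.eq _).2 (LinearPRO.InTensorIdeal.of ⟨f, g, h, rfl⟩)

/-- The self-duality of the generating object of `G₂(q)`. -/
def duality (q : ℂ) : (G2 q).SelfDuality where
  cap := (toG2 q).map cap
  cup := (toG2 q).map cup
  zigzag_left := toG2_eq Skein.zigzag_left
  zigzag_right := toG2_eq Skein.zigzag_right

end G2

/-- The semisimple quotient of `G₂(q)`. -/
def G2ss (q : ℂ) : LinearPRO := LinearPRO.semisimplification (G2.duality q)

namespace G2

/-- The self-duality of the generating object of the semisimple quotient of `G₂(q)`. -/
def dualityss (q : ℂ) : (G2ss q).SelfDuality :=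
  (duality q).image (LinearPRO.toSemisimplification (duality q))

/-- The trivalent vertex in the semisimple quotient of `G₂(q)`. -/
def vertexss (q : ℂ) : (G2ss q).Hom 2 1 :=
  (LinearPRO.toSemisimplification (duality q)).map ((toG2 q).map vertex)

end G2

/-! ## Graph planar algebras -/

/-- A graph: unoriented, with at most one edge between any two vertices, loops being allowed. -/
structure LoopGraph (V : Type) where
  Adj : V → V → Prop
  symm : ∀ v w, Adj v w → Adj w v

namespace LoopGraph

variable {V : Type} (Γ : LoopGraph V)

/-- A path of length `m`, given by its sequence of vertices. -/
def Path (m : ℕ) : Type := {p : Fin (m + 1) → V // ∀ i : Fin m, Γ.Adj (p i.castSucc) (p i.succ)}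

open Classical in
instance Path.instFintype [Fintype V] (m : ℕ) : Fintype (Γ.Path m) :=
  inferInstanceAs (Fintype {p : Fin (m + 1) → V // ∀ i : Fin m, Γ.Adj (p i.castSucc) (p i.succ)})

variable {Γ}

namespace Path

/-- The `i`-th vertex of a path. -/
def vert {m : ℕ} (p : Γ.Path m) (i : Fin (m + 1)) : V := p.1 i

/-- The source of a path. -/
def source {m : ℕ} (p : Γ.Path m) : V := p.vert 0

/-- The target of a path. -/
def target {m : ℕ} (p : Γ.Path m) : V := p.vert (Fin.last m)

/-- Two paths are parallel if they have the same source and the same target. -/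
def Parallel {m n : ℕ} (p : Γ.Path m) (q : Γ.Path n) : Prop :=
  p.source = q.source ∧ p.target = q.target

theorem Parallel.refl {m : ℕ} (p : Γ.Path m) : p.Parallel p := ⟨rfl, rfl⟩

@[ext]
theorem ext {m : ℕ} {p q : Γ.Path m} (h : ∀ i, p.vert i = q.vert i) : p = q :=
  Subtype.ext (funext h)

/-- The initial part of length `m` of a path of length `m + n`. -/
def take {m n : ℕ} (p : Γ.Path (m + n)) : Γ.Path m :=
  ⟨fun i => p.vert ⟨i, by omega⟩, fun i => p.2 ⟨i, by omega⟩⟩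

/-- The final part of length `n` of a path of length `m + n`. -/
def drop {m n : ℕ} (p : Γ.Path (m + n)) : Γ.Path n :=
  ⟨fun i => p.vert ⟨m + i, by omega⟩, fun i => p.2 ⟨m + i, by omega⟩⟩

/-- Concatenation of paths. -/
def append {m n : ℕ} (p : Γ.Path m) (q : Γ.Path n) (h : p.target = q.source) :
    Γ.Path (m + n) :=
  ⟨fun i => if hi : (i : ℕ) ≤ m then p.vert ⟨i, by omega⟩ else q.vert ⟨i - m, by omega⟩, by
    intro i
    have hi := i.2
    rcases lt_trichotomy (i : ℕ) m with hlt | heq | hgt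
    · have h1 : (i : ℕ) ≤ m := by omega
      have h2 : (i : ℕ) + 1 ≤ m := by omega
      simpa [h1, h2, vert] using p.2 ⟨i, hlt⟩
    · have h1 : (i : ℕ) ≤ m := by omega
      have h2 : ¬ ((i : ℕ) + 1 ≤ m) := by omega
      have e1 : p.vert ⟨i, by omega⟩ = q.vert ⟨0, by omega⟩ :=
        (congrArg p.vert (Fin.ext heq)).trans h
      have e2 : q.vert ⟨(i : ℕ) + 1 - m, by omega⟩ = q.vert ⟨1, by omega⟩ :=
        congrArg q.vert (Fin.ext (by simp; omega))
      have e3 := q.2 ⟨0, by omega⟩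
      simp only [Fin.val_castSucc, Fin.val_succ, h1, h2, dif_pos, dif_neg, not_false_eq_true]
      rw [e1, e2]
      exact e3
    · have h1 : ¬ ((i : ℕ) ≤ m) := by omega
      have h2 : ¬ ((i : ℕ) + 1 ≤ m) := by omega
      have e2 : q.vert ⟨(i : ℕ) + 1 - m, by omega⟩ = q.vert ⟨(i : ℕ) - m + 1, by omega⟩ :=
        congrArg q.vert (Fin.ext (by simp; omega))
      have e3 := q.2 ⟨i - m, by omega⟩
      simp only [Fin.val_castSucc, Fin.val_succ, h1, h2, dif_neg, not_false_eq_true]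
      rw [e2]
      exact e3⟩

theorem take_target {m n : ℕ} (p : Γ.Path (m + n)) :
    (take p : Γ.Path m).target = (drop p : Γ.Path n).source := rfl

theorem take_append {m n : ℕ} (p : Γ.Path m) (q : Γ.Path n) (h : p.target = q.source) :
    take (append p q h) = p := by
  ext i
  have hi : (i : ℕ) ≤ m := by omega
  simp [take, append, vert, hi]

theorem drop_append {m n : ℕ} (p : Γ.Path m) (q : Γ.Path n) (h : p.target = q.source) :
    drop (append p q h) = q := by
  ext i
  by_cases hi : (i : ℕ) = 0
  · have e : i = 0 := Fin.ext hi
    subst e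
    have h' : p.1 ⟨m, by omega⟩ = q.1 0 := h
    simp [drop, append, vert, h']
  · have h2 : i ≠ 0 := fun e => hi (congrArg Fin.val e)
    simp [drop, append, vert, h2]

theorem eq_of_take_drop {m n : ℕ} {p q : Γ.Path (m + n)}
    (h1 : (take p : Γ.Path m) = take q) (h2 : (drop p : Γ.Path n) = drop q) : p = q := by
  ext i
  by_cases hi : (i : ℕ) ≤ m
  · exact congrArg (fun r : Γ.Path m => r.vert ⟨i, by omega⟩) h1
  · have h3 := congrArg (fun r : Γ.Path n => r.vert ⟨i - m, by omega⟩) h2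
    have e : (⟨m + ((i : ℕ) - m), by omega⟩ : Fin (m + n + 1)) = i := Fin.ext (by simp; omega)
    have h4 : p.vert ⟨m + ((i : ℕ) - m), by omega⟩ = q.vert ⟨m + ((i : ℕ) - m), by omega⟩ := h3
    rwa [e] at h4

/-- Transport of a path along an equality of lengths. -/
def cast {m m' : ℕ} (h : m = m') (p : Γ.Path m) : Γ.Path m' := h ▸ p

theorem vert_cast {m m' : ℕ} (h : m = m') (p : Γ.Path m) (i : Fin (m' + 1)) :
    (cast h p).vert i = p.vert ⟨i, by omega⟩ := by
  subst h
  rfl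

end Path

variable (Γ)

/-- The hom-space `m → n` of the graph planar algebra: the vector space whose basis is the set of
pairs of parallel paths of lengths `m` and `n`.  A vector is given by the matrix of its
coordinates, which vanish at pairs of paths that are not parallel. -/
def GPAHom (m n : ℕ) : Submodule ℂ (Γ.Path m → Γ.Path n → ℂ) where
  carrier := {f | ∀ p q, ¬ p.Parallel q → f p q = 0}
  add_mem' := by
    intro f g hf hg p q h
    simp [hf p q h, hg p q h]
  zero_mem' := by
    intro p q _
    rfl
  smul_mem' := by
    intro c f hf p q h
    simp [hf p q h]

variable {Γ}

theorem GPAHom.castHom_apply {a b a' b' : ℕ} (ha : a = a') (hb : b = b') (f : Γ.GPAHom a b)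
    (p : Γ.Path a') (q : Γ.Path b') :
    (castHom (H := fun m n => Γ.GPAHom m n) ha hb f).1 p q
      = f.1 (p.cast ha.symm) (q.cast hb.symm) := by
  subst ha hb
  rfl

theorem GPAHom.ext {m n : ℕ} {f g : Γ.GPAHom m n} (h : ∀ p q, f.1 p q = g.1 p q) : f = g :=
  Subtype.ext (funext fun p => funext fun q => h p q)

variable [Fintype V] (Γ)

open Classical in
/-- The graph planar algebra of `Γ`.  On basis elements the composition (in diagrammatic order) is
`(p, q) (p', q') = δ_{q = p'} (p, q')`, and the tensor product is
`(p, q) ⊗ (p', q') = δ_{t(p) = s(p')} (p p', q q')`. -/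
def GPA : LinearPRO where
  Hom m n := Γ.GPAHom m n
  id n := ⟨fun p q => if p = q then 1 else 0, by
    intro p q h
    refine if_neg ?_
    rintro rfl
    exact h (Path.Parallel.refl p)⟩
  comp f g := ⟨fun p r => ∑ q, f.1 p q * g.1 q r, by
    intro p r h
    refine Finset.sum_eq_zero fun q _ => ?_
    by_cases hpq : p.Parallel q
    · rw [g.2 q r fun hqr => h ⟨hpq.1.trans hqr.1, hpq.2.trans hqr.2⟩, mul_zero]
    · rw [f.2 p q hpq, zero_mul]⟩
  tensor f g := ⟨fun p q => f.1 p.take q.take * g.1 p.drop q.drop, by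
    intro p q h
    change f.1 p.take q.take * g.1 p.drop q.drop = 0
    by_cases h1 : (Path.take p).Parallel (Path.take q)
    · by_cases h2 : (Path.drop p).Parallel (Path.drop q)
      · exact absurd ⟨h1.1, h2.2⟩ h
      · rw [g.2 _ _ h2, mul_zero]
    · rw [f.2 _ _ h1, zero_mul]⟩
  id_comp f := GPAHom.ext fun p q => by simp
  comp_id f := GPAHom.ext fun p q => by simp
  comp_assoc f g h := GPAHom.ext fun p q => by
    simp only [Finset.sum_mul, Finset.mul_sum, mul_assoc]
    exact Finset.sum_comm
  add_comp f g h := GPAHom.ext fun p q => by simp [add_mul, Finset.sum_add_distrib]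
  comp_add f g h := GPAHom.ext fun p q => by simp [mul_add, Finset.sum_add_distrib]
  smul_comp c f g := GPAHom.ext fun p q => by simp [mul_assoc, Finset.mul_sum]
  comp_smul c f g := GPAHom.ext fun p q => by simp [mul_left_comm, Finset.mul_sum]
  add_tensor f g h := GPAHom.ext fun p q => by simp [add_mul]
  tensor_add f g h := GPAHom.ext fun p q => by simp [mul_add]
  smul_tensor c f g := GPAHom.ext fun p q => by simp [mul_assoc]
  tensor_smul c f g := GPAHom.ext fun p q => by simp [mul_left_comm]
  id_tensor_id m n := GPAHom.ext fun p q => by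
    change (if (Path.take p : Γ.Path m) = Path.take q then (1 : ℂ) else 0)
      * (if (Path.drop p : Γ.Path n) = Path.drop q then (1 : ℂ) else 0) = if p = q then 1 else 0
    by_cases h : p = q
    · subst h
      simp
    · rw [if_neg h]
      by_cases h1 : (Path.take p : Γ.Path m) = Path.take q
      · by_cases h2 : (Path.drop p : Γ.Path n) = Path.drop q
        · exact absurd (Path.eq_of_take_drop h1 h2) h
        · rw [if_neg h2, mul_zero]
      · rw [if_neg h1, zero_mul]
  interchange {l m n l' m' n'} f g f' g' := GPAHom.ext fun p r => by
    change ∑ q : Γ.Path (m + m'), f.1 p.take q.take * f'.1 p.drop q.drop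
        * (g.1 q.take r.take * g'.1 q.drop r.drop)
      = (∑ a, f.1 p.take a * g.1 a r.take) * ∑ b, f'.1 p.drop b * g'.1 b r.drop
    rw [Finset.sum_mul_sum, ← Finset.sum_product']
    refine Finset.sum_of_injOn (fun q : Γ.Path (m + m') => (q.take, q.drop)) ?_ ?_ ?_ ?_
    · intro q _ q' _ h
      exact Path.eq_of_take_drop (congrArg Prod.fst h) (congrArg Prod.snd h)
    · intro q _
      simp
    · rintro ⟨a, b⟩ _ hab
      by_cases ha : (Path.take p).Parallel a
      · by_cases hb : (Path.drop p).Parallel b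
        · refine absurd ⟨a.append b (ha.2.symm.trans hb.1), by simp, ?_⟩ hab
          exact Prod.ext (Path.take_append _ _ _) (Path.drop_append _ _ _)
        · simp [f'.2 _ _ hb]
      · simp [f.2 _ _ ha]
    · intro q _
      exact mul_mul_mul_comm _ _ _ _
  tensor_assoc {m n m' n' m'' n''} f g h := GPAHom.ext fun p q => by
    rw [GPAHom.castHom_apply]
    change f.1 _ _ * g.1 _ _ * h.1 _ _ = f.1 _ _ * (g.1 _ _ * h.1 _ _)
    rw [mul_assoc]
    have key : ∀ {a b c : ℕ} (p : Γ.Path (a + (b + c))) (e : a + (b + c) = a + b + c),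
        (p.cast e).take.take = p.take ∧ (p.cast e).take.drop = p.drop.take
          ∧ (p.cast e).drop = p.drop.drop := by
      intro a b c p e
      refine ⟨Path.ext fun i => ?_, Path.ext fun i => ?_, Path.ext fun i => ?_⟩
      · exact Path.vert_cast e p _
      · exact Path.vert_cast e p _
      · refine (Path.vert_cast e p _).trans (congrArg p.vert (Fin.ext ?_))
        exact Nat.add_assoc a b i
    rw [(key p _).1, (key p _).2.1, (key p _).2.2, (key q _).1, (key q _).2.1, (key q _).2.2]
  id_zero_tensor {m n} f := GPAHom.ext fun p q => by
    rw [GPAHom.castHom_apply]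
    change (if (p.cast (Nat.zero_add m).symm).take = (q.cast (Nat.zero_add n).symm).take
      then (1 : ℂ) else 0) * f.1 _ _ = f.1 p q
    have key : ∀ {a : ℕ} (p : Γ.Path a) (e : a = 0 + a), (p.cast e).drop = p := by
      intro a p e
      refine Path.ext fun i => (Path.vert_cast e p _).trans (congrArg p.vert (Fin.ext ?_))
      exact Nat.zero_add i
    rw [key, key]
    by_cases h : p.source = q.source
    · rw [if_pos, one_mul]
      refine Path.ext fun i => ?_
      have hi : i = 0 := Fin.ext (by omega)
      subst hi
      change (p.cast _).vert ⟨0, _⟩ = (q.cast _).vert ⟨0, _⟩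
      rw [Path.vert_cast, Path.vert_cast]
      exact h
    · rw [f.2 p q fun h' => h h'.1, mul_zero]
  tensor_id_zero {m n} f := GPAHom.ext fun p q => by
    change f.1 p q * (if (Path.drop (m := m) (n := 0) p) = Path.drop (m := n) (n := 0) q
      then (1 : ℂ) else 0) = f.1 p q
    by_cases h : p.target = q.target
    · rw [if_pos, mul_one]
      refine Path.ext fun i => ?_
      have hi : i = 0 := Fin.ext (by omega)
      subst hi
      exact h
    · rw [f.2 p q fun h' => h h'.2, zero_mul]

open Classical in
/-- The adjacency matrix of `Γ`. -/
def adjMatrix : Matrix V V ℝ := Matrix.of fun v w => if Γ.Adj v w then 1 else 0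

/-- A Frobenius-Perron eigenvector of (the adjacency matrix of) `Γ`: an eigenvector with positive
entries. -/
def IsFrobeniusPerron (wt : V → ℝ) : Prop :=
  (∀ v, 0 < wt v) ∧ ∃ d : ℝ, Γ.adjMatrix.mulVec wt = d • wt

open Classical in
/-- The evaluation `∑_e √(λ_{t(e)} / λ_{s(e)}) (e ē, s(e))`. -/
def GPAev (wt : V → ℝ) : Γ.GPA.Hom 2 0 :=
  ⟨fun p q => if p.Parallel q then (Real.sqrt (wt (p.vert 1) / wt (p.vert 0)) : ℂ) else 0,
    fun _ _ h => if_neg h⟩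

open Classical in
/-- The coevaluation `∑_e √(λ_{t(e)} / λ_{s(e)}) (s(e), e ē)`. -/
def GPAcoev (wt : V → ℝ) : Γ.GPA.Hom 0 2 :=
  ⟨fun q p => if q.Parallel p then (Real.sqrt (wt (p.vert 1) / wt (p.vert 0)) : ℂ) else 0,
    fun _ _ h => if_neg h⟩

/-- The coordinate of a morphism of the graph planar algebra at a pair of paths. -/
def GPAcoord {m n : ℕ} (f : Γ.GPA.Hom m n) (p : Γ.Path m) (q : Γ.Path n) : ℂ := f.1 p q

end LoopGraph

/-- The module fusion graph at level three, with vertices `0, 1, 2, 3` (in place of `1, 2, 3, 4`):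
any two distinct vertices are joined by an edge, and there is a loop at every vertex but `0`. -/
def Γ₃ : LoopGraph (Fin 4) where
  Adj v w := v ≠ 0 ∨ w ≠ 0
  symm _ _ h := h.symm

/-- The root of unity `q₃ = exp (2 π i / 42)`. -/
def q₃ : ℂ := Complex.exp (2 * Real.pi * Complex.I / 42)

end

/-!
The functor is given by numbers attached to the triangles of `Γ₃`, which have to satisfy one
equation for each defining relation of `G₂(q)` and each closed walk on the graph bounding it.  The
proof has three parts: why a solution of these equations suffices, a solution, and the degrees of
the coordinates.

*Solutions give faithful functors.*  A `LoopGraph.CellSystem` consists of nonzero weights of the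
vertices and of numbers `u a b c`, invariant under cyclic permutations.  It defines a functor from
the free trivalent category to the graph planar algebra, and this functor respects the relations of
`G₂(q)` if the system is a solution (`CellSystem.IsSolution.map_eq`).  The equations are written
with respect to a rescaled basis, which removes the square roots of the weights; the automorphism
`LoopGraph.gauge` brings the cap and the cup back to the evaluation and the coevaluation.  If the
weights are positive and the cells are real and totally symmetric, the image is closed under
conjugate transposition.  Since closing up a strand is positive in the graph planar algebra, `f`
maps to zero as soon as the trace of `f f†` is zero, so negligible morphisms are killed.
Conversely, if `f` maps to zero then so does the trace of `f g` for all `g`, and `f` is negligible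
because every closed diagram is a multiple of the empty one (`G2.exists_smul_id`).  So the kernel of
the functor is exactly the ideal of negligible morphisms
(`LoopGraph.map_eq_zero_iff_isNegligible`), and the functor on the quotient is faithful
(`CellSystem.IsSolution.exists_faithful`).

*Closed diagrams are scalars.*  The relations remove faces with at most five edges.  Instead of
finding such a face by an Euler characteristic argument, diagrams without inputs are written as
combinations of growing diagrams (`G2.UpWord`), built from cups, from vertices that split a strand,
and from horizontal edges joining neighbouring strands.  What has to be shown is that a merging
vertex or a cap on top of a growing diagram can be removed.  For a merging vertex, the diagram below
it is read from the top to the bottom, while the vertex becomes a strip of horizontal edges, which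
absorbs the letters of the diagram until it bounds a face with at most five edges or becomes part of
a growing diagram (`G2.UpWord.opT_mem`); the induction is on the number of vertices (`G2.stable`).
The only growing diagram with no outputs is the empty one.

*The solution.*  Let `c = 2 cos (2 π / 21)`.  The loop parameter at `q₃` is `3 + 3 p`, where
`p ^ 2 + p = 1 / 3`, and the Frobenius-Perron eigenvectors are the multiples of `(3 p, 1, 1, 1)`.
The cells are symmetric in their three arguments and under cyclic permutations of the three vertices
with a loop; the transpositions of these vertices exchange the two roots `y` and `y'` of the
polynomial `t ^ 2 + c z t + p`, where `z` is the cell at `(0, 1, 1)`.  Hence, if the equations are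
proved from algebraic relations in which `y` and `y'` play the same role
(`LevelThree.Values`), it suffices to treat the closed walks up to rotation, reflection and all
permutations of the three vertices (`LevelThree.equation_of_covers`).

*Degrees.*  The coordinates of the trivalent vertex are the products of a cell by the square root of
a weight.  By Eisenstein's criterion at `7` for the minimal polynomial of `c + 1`, the field `ℚ(c)`
has degree `6`; it contains `p`.  The coordinates not equal to `y` or `y'` are square roots of
elements of this field, each of which generates the field and has a negative conjugate, so these
coordinates have degree `12`.  The roots `y` and `y'` generate a field which contains `c` and `z`
and whose degree over `ℚ(c)` is at most `4`, so that they have degree `12` or `24`.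
-/

/-! ### Morphisms acting on the strands of diagrams without inputs -/

namespace LinearPRO

variable {P : LinearPRO}

theorem castHom_heq {H : ℕ → ℕ → Type} {m m' n n' : ℕ} (hm : m = m') (hn : n = n') (f : H m n) :
    HEq (castHom hm hn f) f := by
  subst hm hn
  rfl

theorem comp_heq {l m n l' m' n' : ℕ} (hl : l = l') (hm : m = m') (hn : n = n')
    {f : P.Hom l m} {g : P.Hom m n} {f' : P.Hom l' m'} {g' : P.Hom m' n'}
    (hf : HEq f f') (hg : HEq g g') : HEq (f ⨟ g) (f' ⨟ g') := by
  subst hl hm hn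
  rw [eq_of_heq hf, eq_of_heq hg]

theorem tensor_heq {m n k l m' n' k' l' : ℕ} (hm : m = m') (hn : n = n') (hk : k = k')
    (hl : l = l') {f : P.Hom m n} {g : P.Hom k l} {f' : P.Hom m' n'} {g' : P.Hom k' l'}
    (hf : HEq f f') (hg : HEq g g') : HEq (f ⊠ g) (f' ⊠ g') := by
  subst hm hn hk hl
  rw [eq_of_heq hf, eq_of_heq hg]

theorem tensor_assoc_heq {m n m' n' m'' n'' : ℕ} (f : P.Hom m n) (g : P.Hom m' n')
    (h : P.Hom m'' n'') : HEq ((f ⊠ g) ⊠ h) (f ⊠ (g ⊠ h)) := by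
  rw [← P.tensor_assoc]
  exact (castHom_heq _ _ _).symm

theorem zero_comp {l m n : ℕ} (g : P.Hom m n) : ((0 : P.Hom l m) ⨟ g) = 0 := by
  simpa using P.smul_comp (0 : ℂ) (0 : P.Hom l m) g

theorem comp_zero {l m n : ℕ} (f : P.Hom l m) : (f ⨟ (0 : P.Hom m n)) = 0 := by
  simpa using P.comp_smul (0 : ℂ) f (0 : P.Hom m n)

theorem zero_tensor {m n m' n' : ℕ} (g : P.Hom m' n') : ((0 : P.Hom m n) ⊠ g) = 0 := by
  simpa using P.smul_tensor (0 : ℂ) (0 : P.Hom m n) g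

theorem tensor_zero {m n m' n' : ℕ} (f : P.Hom m n) : (f ⊠ (0 : P.Hom m' n')) = 0 := by
  simpa using P.tensor_smul (0 : ℂ) f (0 : P.Hom m' n')

theorem castHom_add {m m' n n' : ℕ} (hm : m = m') (hn : n = n') (f g : P.Hom m n) :
    castHom hm hn (f + g) = castHom hm hn f + castHom hm hn g := by
  subst hm hn
  rfl

theorem castHom_smul {m m' n n' : ℕ} (hm : m = m') (hn : n = n') (c : ℂ) (f : P.Hom m n) :
    castHom hm hn (c • f) = c • castHom hm hn f := by
  subst hm hn
  rfl

/-- A morphism with `a` strands to its left and `b` strands to its right. -/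
def whisk (a : ℕ) {k l : ℕ} (f : P.Hom k l) (b : ℕ) : P.Hom (a + k + b) (a + l + b) :=
  (P.id a ⊠ f) ⊠ P.id b

theorem whisk_heq (m d : ℕ) {k l : ℕ} (f : P.Hom k l) (b : ℕ) :
    HEq (whisk (m + d) f b) (P.id m ⊠ whisk d f b) := by
  have h1 : HEq (P.id (m + d) ⊠ f) (P.id m ⊠ (P.id d ⊠ f)) := by
    rw [← P.id_tensor_id]
    exact tensor_assoc_heq _ _ _
  exact (tensor_heq (by omega) (by omega) rfl rfl h1 HEq.rfl).trans (tensor_assoc_heq _ _ _)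

theorem whisk_id (a k b : ℕ) : whisk a (P.id k) b = P.id (a + k + b) := by
  rw [whisk, P.id_tensor_id, P.id_tensor_id]

theorem whisk_comp (a : ℕ) {k l m : ℕ} (f : P.Hom k l) (g : P.Hom l m) (b : ℕ) :
    whisk a (f ⨟ g) b = whisk a f b ⨟ whisk a g b := by
  simp only [whisk, P.interchange, P.id_comp]

variable (P) in
/-- Families of morphisms out of the unit object, one for each number of outputs.  Letting the
number of outputs vary makes the operators `act` composable without transports. -/
abbrev Elt : Type := ∀ n, P.Hom 0 n

theorem elt_heq (X : P.Elt) {m n : ℕ} (h : m = n) : HEq (X m) (X n) := by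
  subst h
  rfl

/-- Postcomposition with `f` placed to the right of `a` strands, any number of further strands
being allowed to the right of `f`.  The value vanishes where there are too few strands. -/
def act (a : ℕ) {k l : ℕ} (f : P.Hom k l) : Module.End ℂ P.Elt where
  toFun X n := if h : a + l ≤ n then
    castHom rfl (show a + l + (n - (a + l)) = n by omega)
      (X (a + k + (n - (a + l))) ⨟ whisk a f (n - (a + l))) else 0
  map_add' X Y := by
    funext n
    by_cases h : a + l ≤ n
    · simp only [Pi.add_apply, dif_pos h, P.add_comp, castHom_add]
    · simp only [Pi.add_apply, dif_neg h, add_zero]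
  map_smul' c X := by
    funext n
    by_cases h : a + l ≤ n
    · simp only [Pi.smul_apply, dif_pos h, P.smul_comp, RingHom.id_apply, castHom_smul]
    · simp only [Pi.smul_apply, dif_neg h, smul_zero]

theorem act_heq (a : ℕ) {k l : ℕ} (f : P.Hom k l) (X : P.Elt) (b n : ℕ) (h : n = a + l + b) :
    HEq (act a f X n) (X (a + k + b) ⨟ whisk a f b) := by
  obtain rfl : b = n - (a + l) := by omega
  have h' : a + l ≤ n := by omega
  change HEq (dite _ _ _) _
  rw [dif_pos h']
  exact castHom_heq _ _ _

theorem act_apply (a : ℕ) {k l : ℕ} (f : P.Hom k l) (X : P.Elt) (b : ℕ) :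
    act a f X (a + l + b) = X (a + k + b) ⨟ whisk a f b :=
  eq_of_heq (act_heq a f X b _ rfl)

theorem act_apply_of_lt (a : ℕ) {k l : ℕ} (f : P.Hom k l) (X : P.Elt) {n : ℕ} (h : n < a + l) :
    act a f X n = 0 :=
  dif_neg (by omega)

theorem act_ext {S T : Module.End ℂ P.Elt} (h : ∀ X n, S X n = T X n) : S = T :=
  LinearMap.ext fun X => funext fun n => h X n

variable (P) in
/-- Projection to the components with at least `m` outputs. -/
def proj (m : ℕ) : Module.End ℂ P.Elt where
  toFun X n := if m ≤ n then X n else 0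
  map_add' X Y := by
    funext n
    by_cases h : m ≤ n <;> simp [h]
  map_smul' c X := by
    funext n
    by_cases h : m ≤ n <;> simp [h]

theorem proj_apply {m n : ℕ} (h : m ≤ n) (X : P.Elt) : proj P m X n = X n := if_pos h

theorem proj_apply_of_lt {m n : ℕ} (h : n < m) (X : P.Elt) : proj P m X n = 0 :=
  if_neg (by omega)

theorem act_id (a k : ℕ) : act a (P.id k) = proj P (a + k) := by
  refine act_ext fun X n => ?_
  by_cases h : a + k ≤ n
  · obtain ⟨b, rfl⟩ := Nat.exists_eq_add_of_le h
    rw [act_apply, whisk_id, P.comp_id, proj_apply h]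
  · rw [act_apply_of_lt _ _ _ (by omega), proj_apply_of_lt (by omega)]

theorem proj_mul_act {m a k l : ℕ} (h : m ≤ a + l) (f : P.Hom k l) :
    proj P m * act a f = act a f := by
  refine act_ext fun X n => ?_
  change proj P m (act a f X) n = _
  by_cases hn : m ≤ n
  · rw [proj_apply hn]
  · rw [proj_apply_of_lt (by omega), act_apply_of_lt _ _ _ (by omega)]

theorem act_mul_proj {m a k l : ℕ} (h : m ≤ a + k) (f : P.Hom k l) :
    act a f * proj P m = act a f := by
  refine act_ext fun X n => ?_
  change act a f (proj P m X) n = _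
  by_cases hn : a + l ≤ n
  · obtain ⟨b, rfl⟩ := Nat.exists_eq_add_of_le hn
    rw [act_apply, act_apply, proj_apply (by omega)]
  · rw [act_apply_of_lt _ _ _ (by omega), act_apply_of_lt _ _ _ (by omega)]

theorem act_comp (a : ℕ) {k l m : ℕ} (f : P.Hom k l) (g : P.Hom l m) :
    act a (f ⨟ g) = act a g * act a f := by
  refine act_ext fun X n => ?_
  change _ = act a g (act a f X) n
  by_cases hn : a + m ≤ n
  · obtain ⟨b, rfl⟩ := Nat.exists_eq_add_of_le hn
    rw [act_apply, act_apply, act_apply, whisk_comp, P.comp_assoc]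
  · rw [act_apply_of_lt _ _ _ (by omega), act_apply_of_lt _ _ _ (by omega)]

theorem act_add (a : ℕ) {k l : ℕ} (f g : P.Hom k l) : act a (f + g) = act a f + act a g := by
  refine act_ext fun X n => ?_
  change _ = act a f X n + act a g X n
  by_cases hn : a + l ≤ n
  · obtain ⟨b, rfl⟩ := Nat.exists_eq_add_of_le hn
    simp only [act_apply, whisk, P.tensor_add, P.add_tensor, P.comp_add]
  · simp only [act_apply_of_lt _ _ _ (show n < a + l by omega), add_zero]

theorem act_smul (a : ℕ) {k l : ℕ} (c : ℂ) (f : P.Hom k l) : act a (c • f) = c • act a f := by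
  refine act_ext fun X n => ?_
  change _ = c • act a f X n
  by_cases hn : a + l ≤ n
  · obtain ⟨b, rfl⟩ := Nat.exists_eq_add_of_le hn
    simp only [act_apply, whisk, P.tensor_smul, P.smul_tensor, P.comp_smul]
  · simp only [act_apply_of_lt _ _ _ (show n < a + l by omega), smul_zero]

theorem act_zero (a : ℕ) {k l : ℕ} : act a (0 : P.Hom k l) = 0 := by
  simpa using act_smul a (0 : ℂ) (0 : P.Hom k l)

theorem act_id_tensor (a c : ℕ) {k l : ℕ} (g : P.Hom k l) :
    act a (P.id c ⊠ g) = act (a + c) g := by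
  refine act_ext fun X n => ?_
  by_cases hn : a + c + l ≤ n
  · obtain ⟨b, rfl⟩ := Nat.exists_eq_add_of_le hn
    rw [act_apply]
    refine eq_of_heq ((act_heq _ _ _ b _ (by omega)).trans ?_)
    refine comp_heq rfl (by omega) (by omega) (elt_heq X (by omega)) ?_
    refine tensor_heq (by omega) (by omega) rfl rfl ?_ HEq.rfl
    rw [← P.id_tensor_id]
    exact (tensor_assoc_heq _ _ _).symm
  · rw [act_apply_of_lt _ _ _ (by omega), act_apply_of_lt _ _ _ (by omega)]

theorem act_tensor_id (a c : ℕ) {k l : ℕ} (g : P.Hom k l) :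
    act a (g ⊠ P.id c) = act a g * proj P (a + k + c) := by
  refine act_ext fun X n => ?_
  change _ = act a g (proj P (a + k + c) X) n
  by_cases hn : a + l + c ≤ n
  · obtain ⟨b, rfl⟩ := Nat.exists_eq_add_of_le hn
    refine eq_of_heq ((act_heq _ _ _ b _ (by omega)).trans
      (HEq.trans ?_ (act_heq _ _ _ (c + b) _ (by omega)).symm))
    rw [proj_apply (by omega)]
    refine comp_heq rfl (by omega) (by omega) (elt_heq X (by omega)) ?_
    refine (tensor_heq (by omega) (by omega) rfl rfl (tensor_assoc_heq _ _ _).symm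
      HEq.rfl).trans ?_
    refine (tensor_assoc_heq _ _ _).trans ?_
    rw [P.id_tensor_id]
    rfl
  · rw [act_apply_of_lt _ _ _ (by omega)]
    by_cases hn' : a + l ≤ n
    · obtain ⟨b, rfl⟩ := Nat.exists_eq_add_of_le hn'
      rw [act_apply, proj_apply_of_lt (by omega), zero_comp]
    · rw [act_apply_of_lt _ _ _ (by omega)]

/-- Morphisms acting on disjoint sets of strands commute, up to a shift of the position of the one
to the right. -/
theorem act_far (a d : ℕ) {k l k' l' : ℕ} (f : P.Hom k l) (g : P.Hom k' l') :
    act (a + l + d) g * act a f = act a f * act (a + k + d) g := by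
  refine act_ext fun X n => ?_
  change act (a + l + d) g (act a f X) n = act a f (act (a + k + d) g X) n
  by_cases hn : a + l + d + l' ≤ n
  · obtain ⟨b, rfl⟩ := Nat.exists_eq_add_of_le hn
    rw [act_apply]
    refine eq_of_heq (HEq.trans ?_ (act_heq _ _ _ (d + l' + b) _ (by omega)).symm)
    have h1 : HEq (act a f X (a + l + d + k' + b) ⨟ whisk (a + l + d) g b)
        ((X (a + k + (d + k' + b)) ⨟ whisk a f (d + k' + b))
          ⨟ (P.id (a + l) ⊠ whisk d g b)) :=
      comp_heq rfl (by omega) (by omega) (act_heq _ _ _ _ _ (by omega)) (whisk_heq _ _ _ _)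
    have h2 : HEq (act (a + k + d) g X (a + k + (d + l' + b)) ⨟ whisk a f (d + l' + b))
        ((X (a + k + (d + k' + b)) ⨟ (P.id (a + k) ⊠ whisk d g b))
          ⨟ whisk a f (d + l' + b)) := by
      refine comp_heq rfl (by omega) (by omega) ?_ HEq.rfl
      refine (act_heq _ _ _ b _ (by omega)).trans ?_
      exact comp_heq rfl (by omega) (by omega) (elt_heq X (by omega)) (whisk_heq _ _ _ _)
    refine h1.trans (HEq.trans (heq_of_eq ?_) h2.symm)
    rw [P.comp_assoc, P.comp_assoc]
    congr 1
    unfold whisk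
    rw [P.interchange, P.interchange, P.id_comp, P.id_comp, P.comp_id, P.comp_id]
  · rw [act_apply_of_lt _ _ _ (by omega)]
    by_cases hn' : a + l ≤ n
    · obtain ⟨b, rfl⟩ := Nat.exists_eq_add_of_le hn'
      rw [act_apply, act_apply_of_lt _ _ _ (by omega), zero_comp]
    · rw [act_apply_of_lt _ _ _ (by omega)]

theorem act_mul_act_of_le {a e e' : ℕ} {k l k' l' : ℕ} (f : P.Hom k l) (g : P.Hom k' l')
    (h : a + l ≤ e) (he : e' + l = e + k) : act e g * act a f = act a f * act e' g := by
  obtain ⟨d, rfl⟩ := Nat.exists_eq_add_of_le h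
  obtain rfl : e' = a + k + d := by omega
  exact act_far a d f g

end LinearPRO

/-! ### Calculus of generators in `G₂(q)` -/

namespace G2

open LinearPRO

variable (q : ℂ)

/-- The operator by which a diagram acts on the strands to the right of the first `a`. -/
def op (a : ℕ) {k l : ℕ} (f : Free.Hom k l) : Module.End ℂ (G2 q).Elt := act a ((toG2 q).map f)

/-- Projection to the components with at least `m` outputs. -/
abbrev opP (m : ℕ) : Module.End ℂ (G2 q).Elt := proj (G2 q) m

/-- The cup, with `a` strands to its left. -/
abbrev opC (a : ℕ) : Module.End ℂ (G2 q).Elt := op q a cup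

/-- The cap, with `a` strands to its left. -/
abbrev opK (a : ℕ) : Module.End ℂ (G2 q).Elt := op q a cap

/-- The vertex merging two strands, with `a` strands to its left. -/
abbrev opM (a : ℕ) : Module.End ℂ (G2 q).Elt := op q a vertex

/-- The vertex splitting a strand, with `a` strands to its left. -/
abbrev opY (a : ℕ) : Module.End ℂ (G2 q).Elt := op q a covertex

/-- Two strands joined by a horizontal edge, with `a` strands to their left. -/
abbrev opH (a : ℕ) : Module.End ℂ (G2 q).Elt := op q a treeH

variable {q}

theorem op_comp (a : ℕ) {k l m : ℕ} (f : Free.Hom k l) (g : Free.Hom l m) :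
    op q a (f ⨟ g) = op q a g * op q a f :=
  act_comp (P := G2 q) a ((toG2 q).map f) ((toG2 q).map g)

theorem op_id_tensor (a c : ℕ) {k l : ℕ} (g : Free.Hom k l) :
    op q a (idn c ⊠ g) = op q (a + c) g :=
  act_id_tensor (P := G2 q) a c ((toG2 q).map g)

theorem op_tensor_id (a c : ℕ) {k l : ℕ} (g : Free.Hom k l) :
    op q a (g ⊠ idn c) = op q a g * opP q (a + k + c) :=
  act_tensor_id (P := G2 q) a c ((toG2 q).map g)

theorem op_idn (a k : ℕ) : op q a (idn k) = opP q (a + k) := act_id _ _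

theorem op_add (a : ℕ) {k l : ℕ} (f g : Free.Hom k l) : op q a (f + g) = op q a f + op q a g :=
  act_add (P := G2 q) a ((toG2 q).map f) ((toG2 q).map g)

theorem op_smul (a : ℕ) {k l : ℕ} (c : ℂ) (f : Free.Hom k l) : op q a (c • f) = c • op q a f :=
  act_smul (P := G2 q) a c ((toG2 q).map f)

theorem op_zero (a : ℕ) {k l : ℕ} : op q a (0 : Free.Hom k l) = 0 :=
  act_zero (P := G2 q) a

theorem op_congr (a : ℕ) {k l : ℕ} {f g : Free.Hom k l} (h : Skein q f g) :
    op q a f = op q a g :=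
  congrArg (act a) (toG2_eq h)

theorem proj_mul_op {m a k l : ℕ} (h : m ≤ a + l) (f : Free.Hom k l) :
    opP q m * op q a f = op q a f := proj_mul_act h _

theorem op_mul_proj {m a k l : ℕ} (h : m ≤ a + k) (f : Free.Hom k l) :
    op q a f * opP q m = op q a f := act_mul_proj h _

theorem op_far {a e e' : ℕ} {k l k' l' : ℕ} (f : Free.Hom k l) (g : Free.Hom k' l')
    (h : a + l ≤ e) (he : e' + l = e + k) : op q e g * op q a f = op q a f * op q e' g :=
  act_mul_act_of_le _ _ h he

theorem proj_mul_op_eq {m m' a k l : ℕ} (h : a + l ≤ m') (hm : m + l = m' + k)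
    (f : Free.Hom k l) : opP q m' * op q a f = op q a f * opP q m := by
  have h1 := op_far (q := q) (e' := m) f (idn 0) h hm
  rwa [op_idn, op_idn] at h1

theorem op_mul_op_mul_proj {m a b k l k' l' : ℕ} (h : a + l ≤ b + k') (hm : m + l = b + k' + k)
    (f : Free.Hom k l) (g : Free.Hom k' l') :
    op q b g * op q a f * opP q m = op q b g * op q a f := by
  rw [mul_assoc, ← proj_mul_op_eq h hm, ← mul_assoc, op_mul_proj le_rfl]

theorem opY_eq (a : ℕ) : opY q a = opM q a * opC q (a + 1) := by
  refine (op_comp a (idn 1 ⊠ cup : Free.Hom 1 3) (vertex ⊠ idn 1 : Free.Hom 3 2)).trans ?_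
  have h1 : op q a (idn 1 ⊠ cup : Free.Hom 1 3) = opC q (a + 1) := op_id_tensor a 1 cup
  have h2 : op q a (vertex ⊠ idn 1 : Free.Hom 3 2) = opM q a * opP q (a + 2 + 1) :=
    op_tensor_id a 1 vertex
  rw [h1, h2, mul_assoc, proj_mul_op (by omega)]

theorem opH_eq (a : ℕ) : opH q a = opM q (a + 1) * opY q a := by
  refine (op_comp a (covertex ⊠ idn 1 : Free.Hom 2 3) (idn 1 ⊠ vertex : Free.Hom 3 2)).trans ?_
  have h1 : op q a (covertex ⊠ idn 1 : Free.Hom 2 3) = opY q a * opP q (a + 1 + 1) :=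
    op_tensor_id a 1 covertex
  have h2 : op q a (idn 1 ⊠ vertex : Free.Hom 3 2) = opM q (a + 1) := op_id_tensor a 1 vertex
  rw [h1, h2, ← mul_assoc]
  exact op_mul_op_mul_proj (by omega) (by omega) _ _

theorem opK_opC (a : ℕ) : opK q a * opC q (a + 1) = opP q (a + 1) := by
  have h := op_congr a (Skein.zigzag_left (q := q))
  rw [op_comp, op_idn] at h
  rw [← h]
  have h1 : op q a (idn 1 ⊠ cup : Free.Hom 1 3) = opC q (a + 1) := op_id_tensor a 1 cup
  have h2 : op q a (cap ⊠ idn 1 : Free.Hom 3 1) = opK q a * opP q (a + 2 + 1) :=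
    op_tensor_id a 1 cap
  refine Eq.trans ?_ (congrArg₂ (· * ·) h2 h1).symm
  simp only [mul_assoc]
  rw [proj_mul_op (by omega)]

theorem opK_opC' (a : ℕ) : opK q (a + 1) * opC q a = opP q (a + 1) := by
  have h := op_congr a (Skein.zigzag_right (q := q))
  rw [op_comp, op_idn] at h
  rw [← h]
  have h1 : op q a (cup ⊠ idn 1 : Free.Hom 1 3) = opC q a * opP q (a + 1) :=
    op_tensor_id a 1 cup
  have h2 : op q a (idn 1 ⊠ cap : Free.Hom 3 1) = opK q (a + 1) :=
    op_id_tensor a 1 cap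
  refine Eq.trans ?_ (congrArg₂ (· * ·) h2 h1).symm
  simp only [← mul_assoc]
  exact (op_mul_op_mul_proj (by omega) (by omega) _ _).symm

theorem opM_eq (a : ℕ) : opM q a = opK q a * opM q (a + 1) * opC q (a + 2) := by
  have h := op_congr a (Skein.rotate (q := q))
  rw [rotate21, op_comp, op_comp] at h
  refine h.symm.trans ?_
  have h1 : op q a (idn 2 ⊠ cup : Free.Hom 2 4) = opC q (a + 2) := op_id_tensor a 2 cup
  have h2 : op q a (idn 1 ⊠ vertex ⊠ idn 1 : Free.Hom 4 3)
      = opM q (a + 1) * opP q (a + 1 + 2 + 1) :=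
    (op_id_tensor a 1 _).trans (op_tensor_id (a + 1) 1 vertex)
  have h3 : op q a (cap ⊠ idn 1 : Free.Hom 3 1) = opK q a * opP q (a + 2 + 1) :=
    op_tensor_id a 1 cap
  refine (congrArg₂ (· * ·) h3 (congrArg₂ (· * ·) h2 h1)).trans ?_
  simp only [mul_assoc]
  rw [proj_mul_op (k := 0) (by omega), ← mul_assoc (opP q _),
    proj_mul_op_eq (m := a + 4) (k := 2) (by omega) (by omega), mul_assoc,
    proj_mul_op (k := 0) (by omega)]

theorem opY_eq' (a : ℕ) : opY q a = opM q (a + 1) * opC q a := by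
  rw [opM_eq (a + 1), mul_assoc, op_far cup cup (e' := a + 1) (by omega) (by omega), ← mul_assoc,
    mul_assoc (opK q _), op_far cup vertex (e' := a) (by omega) (by omega), ← mul_assoc, opK_opC',
    proj_mul_op (by omega), opY_eq]

theorem opH_eq' (a : ℕ) : opH q a = opM q a * opY q (a + 1) := by
  rw [opH_eq, opY_eq, opY_eq', ← mul_assoc, ← mul_assoc,
    op_far vertex vertex (a := a) (e := a + 1) (e' := a + 2) (by omega) (by omega)]

theorem opK_opY_succ (a : ℕ) : opK q a * opY q (a + 1) = opM q a := by
  rw [opY_eq, ← mul_assoc, ← opM_eq]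

theorem opK_succ_opY (a : ℕ) : opK q (a + 1) * opY q a = opM q a := by
  rw [opY_eq, ← mul_assoc, op_far vertex cap (e' := a + 2) (by omega) (by omega), mul_assoc,
    opK_opC', op_mul_proj (by omega)]

theorem opM_opC (a : ℕ) : opM q a * opC q a = 0 := by
  rw [← op_comp, ← op_zero (q := q) (k := 0) (l := 1) a]
  exact op_congr a Skein.lollipop

theorem opY_opC (a : ℕ) : opY q (a + 1) * opC q a = opY q a * opC q a := by
  rw [opY_eq (a + 1), opY_eq' a, mul_assoc, mul_assoc,
    op_far cup cup (e' := a) (by omega) (by omega)]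

theorem opK_opM (a : ℕ) : opK q a * opM q (a + 1) = opK q a * opM q a := by
  rw [← opK_succ_opY (a + 1), ← opK_opY_succ a, ← mul_assoc, ← mul_assoc,
    op_far cap cap (a := a) (e := a) (e' := a + 2) (by omega) (by omega)]

theorem opM_opY (a : ℕ) : opM q a * opY q a = (qInt q 7 - 1) • opP q (a + 1) := by
  rw [← op_idn, ← op_smul, ← op_comp]
  exact op_congr a Skein.bigon

theorem opH_opC (a : ℕ) : opH q a * opC q a = (qInt q 7 - 1) • opC q a := by
  rw [opH_eq, mul_assoc, ← opY_opC, ← mul_assoc, opM_opY, smul_mul_assoc, proj_mul_op (by omega)]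

theorem opK_opH (a : ℕ) : opK q a * opH q a = (qInt q 7 - 1) • opK q a := by
  rw [opH_eq, ← mul_assoc, opK_opM, mul_assoc, opM_opY, mul_smul_comm, op_mul_proj (by omega)]

theorem opK_opY (a : ℕ) : opK q a * opY q a = 0 := by
  rw [opY_eq', ← mul_assoc, opK_opM, mul_assoc, opM_opC, mul_zero]

theorem opH_opC_succ (a : ℕ) : opH q a * opC q (a + 1) = opY q (a + 1) * opY q a := by
  rw [opH_eq, mul_assoc, ← op_far covertex cup (e := a + 2) (by omega) (by omega), ← mul_assoc,
    ← opY_eq]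

theorem opM_opH (a : ℕ) :
    opM q a * opH q a = -(q ^ (4 : ℤ) + 1 + q ^ (-4 : ℤ)) • opM q a := by
  rw [← op_smul, ← op_comp]
  exact op_congr a Skein.trigon

theorem opH_opY (a : ℕ) :
    opH q a * opY q a = -(q ^ (4 : ℤ) + 1 + q ^ (-4 : ℤ)) • opY q a := by
  rw [opH_eq', mul_assoc, ← opH_opC_succ, ← mul_assoc, opM_opH, smul_mul_assoc, ← opY_eq]

theorem opH_opY_succ (a : ℕ) : opH q a * opY q (a + 1) = opH q (a + 1) * opY q a := by
  rw [opH_eq, opH_eq' (a + 1), mul_assoc, mul_assoc,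
    op_far covertex covertex (a := a) (e := a + 1 + 1) (e' := a + 1) (by omega) (by omega)]

theorem opM_opH_succ (a : ℕ) : opM q a * opH q (a + 1) = opM q (a + 1) * opH q a := by
  rw [opH_eq, opH_eq', ← mul_assoc, ← mul_assoc,
    op_far vertex vertex (a := a) (e := a + 1) (e' := a + 2) (by omega) (by omega)]

theorem opK_opH_succ (a : ℕ) : opK q a * opH q (a + 1) = opM q a * opM q a := by
  rw [opH_eq, ← mul_assoc, ← op_far cap vertex (a := a) (e := a) (by omega) (by omega), mul_assoc,
    opK_opY_succ]

theorem opK_succ_opH (a : ℕ) : opK q (a + 1) * opH q a = opM q a * opM q (a + 1) := by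
  rw [opH_eq', ← mul_assoc, op_far vertex cap (e' := a + 2) (by omega) (by omega), mul_assoc,
    opK_succ_opY]

/-- The right hand side of the tetragon relation. -/
noncomputable def tetragonRHS (q : ℂ) : Free.Hom 2 2 :=
  (q ^ (2 : ℤ) + q ^ (-2 : ℤ)) • (treeI + treeH)
        + (q ^ (2 : ℤ) + 1 + q ^ (-2 : ℤ)) • (idn 2 + (cap ⨟ cup))

/-- The right hand side of the pentagon relation. -/
noncomputable def pentagonRHS : Free.Hom 2 3 :=
  -(∑ i ∈ Finset.range 5, rotate23^[i] tree5) - ∑ i ∈ Finset.range 5, rotate23^[i] strandVertex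

theorem opH_opH (a : ℕ) : opH q a * opH q a = op q a (tetragonRHS q) := by
  rw [← op_comp]
  exact op_congr a Skein.tetragon

theorem opH_opY_opH (a : ℕ) : opH q (a + 1) * opY q a * opH q a = op q a pentagonRHS := by
  refine Eq.trans ?_ (op_congr a Skein.pentagon)
  rw [pentagon, op_comp, op_comp, op_comp]
  have h1 : op q a (covertex ⊠ idn 1 : Free.Hom 2 3) = opY q a * opP q (a + 1 + 1) :=
    op_tensor_id a 1 covertex
  have h2 : op q a (idn 1 ⊠ covertex ⊠ idn 1 : Free.Hom 3 4)
      = opY q (a + 1) * opP q (a + 1 + 1 + 1) :=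
    (op_id_tensor a 1 _).trans (op_tensor_id (a + 1) 1 covertex)
  have h3 : op q a (idn 2 ⊠ vertex : Free.Hom 4 3) = opM q (a + 2) := op_id_tensor a 2 vertex
  refine Eq.trans ?_ (congrArg₂ (· * ·) h3 (congrArg₂ (· * ·) h2
    (congrArg₂ (· * ·) h1 (rfl : opH q a = _)))).symm
  rw [opH_eq (a + 1)]
  simp only [mul_assoc]
  rw [proj_mul_op (k := 2) (by omega), ← mul_assoc (opP q _),
    proj_mul_op_eq (m := a + 2) (by omega) (by omega), mul_assoc,
    proj_mul_op (k := 2) (by omega)]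

theorem opH_succ_opH_opH_succ (a : ℕ) :
    opH q (a + 1) * opH q a * opH q (a + 1) = opM q a * op q (a + 1) pentagonRHS := by
  rw [← opH_opY_opH, opH_eq' a, ← mul_assoc,
    op_far vertex treeH (e' := a + 2) (by omega) (by omega)]
  simp only [mul_assoc]

end G2

/-! ### Evaluation of closed diagrams in `G₂(q)` -/

namespace G2

open LinearPRO

/-- Morphisms which are linear combinations of diagrams with at most `d` vertices. -/
inductive Deg : ℕ → ∀ {k l : ℕ}, Free.Hom k l → Prop
  | id (n : ℕ) : Deg 0 (idn n)
  | cap : Deg 0 cap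
  | cup : Deg 0 cup
  | vertex : Deg 1 vertex
  | comp {d e k l m : ℕ} {f : Free.Hom k l} {g : Free.Hom l m} : Deg d f → Deg e g →
      Deg (d + e) (f ⨟ g)
  | tensor {d e k l k' l' : ℕ} {f : Free.Hom k l} {g : Free.Hom k' l'} : Deg d f → Deg e g →
      Deg (d + e) (f ⊠ g)
  | zero {k l : ℕ} : Deg 0 (0 : Free.Hom k l)
  | add {d k l : ℕ} {f g : Free.Hom k l} : Deg d f → Deg d g → Deg d (f + g)
  | smul {d k l : ℕ} (c : ℂ) {f : Free.Hom k l} : Deg d f → Deg d (c • f)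
  | mono {d e k l : ℕ} {f : Free.Hom k l} : d ≤ e → Deg d f → Deg e f

theorem exists_deg {k l : ℕ} (f : Free.Hom k l) : ∃ d, Deg d f := by
  obtain ⟨t, rfl⟩ : ∃ t, FreeHom.mk t = f := Quotient.exists_rep f
  induction t with
  | id n => exact ⟨0, Deg.id n⟩
  | cap => exact ⟨0, Deg.cap⟩
  | cup => exact ⟨0, Deg.cup⟩
  | vertex => exact ⟨1, Deg.vertex⟩
  | comp f g hf hg =>
    obtain ⟨d, hd⟩ := hf
    obtain ⟨e, he⟩ := hg
    exact ⟨d + e, Deg.comp hd he⟩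
  | tensor f g hf hg =>
    obtain ⟨d, hd⟩ := hf
    obtain ⟨e, he⟩ := hg
    exact ⟨d + e, Deg.tensor hd he⟩
  | zero => exact ⟨0, Deg.zero⟩
  | add f g hf hg =>
    obtain ⟨d, hd⟩ := hf
    obtain ⟨e, he⟩ := hg
    exact ⟨max d e, Deg.add (hd.mono (le_max_left _ _)) (he.mono (le_max_right _ _))⟩
  | smul c f hf =>
    obtain ⟨d, hd⟩ := hf
    exact ⟨d, Deg.smul c hd⟩

theorem Deg.neg {d k l : ℕ} {f : Free.Hom k l} (h : Deg d f) : Deg d (-f) := by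
  rw [← neg_one_smul ℂ f]
  exact h.smul _

theorem Deg.sum {d k l : ℕ} {ι : Type} (s : Finset ι) {f : ι → Free.Hom k l}
    (h : ∀ i, Deg d (f i)) : Deg d (∑ i ∈ s, f i) := by
  classical
  induction s using Finset.induction_on with
  | empty => exact (Deg.zero).mono (Nat.zero_le d)
  | insert i s hi ih => rw [Finset.sum_insert hi]; exact (h i).add ih

theorem deg_covertex : Deg 1 covertex :=
  Deg.comp (d := 0) (e := 1) (f := (idn 1 ⊠ cup : Free.Hom 1 3))
    (g := (vertex ⊠ idn 1 : Free.Hom 3 2))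
    (Deg.tensor (Deg.id 1) Deg.cup) (Deg.tensor Deg.vertex (Deg.id 1))

theorem deg_treeI : Deg 2 treeI := Deg.comp Deg.vertex deg_covertex

theorem deg_treeH : Deg 2 treeH :=
  Deg.comp (d := 1) (e := 1) (f := (covertex ⊠ idn 1 : Free.Hom 2 3))
    (g := (idn 1 ⊠ vertex : Free.Hom 3 2))
    (Deg.tensor deg_covertex (Deg.id 1)) (Deg.tensor (Deg.id 1) Deg.vertex)

theorem deg_tetragonRHS (q : ℂ) : Deg 2 (tetragonRHS q) :=
  ((deg_treeI.add deg_treeH).smul _).add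
    ((((Deg.id 2).add (Deg.comp Deg.cap Deg.cup)).smul _).mono (by omega))

theorem Deg.rotate23 {d : ℕ} {f : Free.Hom 2 3} (h : Deg d f) : Deg d (rotate23 f) := by
  have h1 : Deg d (f ⊠ idn 1 : Free.Hom 3 4) := Deg.tensor h (Deg.id 1)
  have h2 : Deg d (idn 1 ⊠ f ⊠ idn 1 : Free.Hom 4 5) :=
    (Deg.tensor (Deg.id 1) h1).mono (by omega)
  have h3 : Deg 0 (idn 2 ⊠ G2.cup : Free.Hom 2 4) := Deg.tensor (Deg.id 2) Deg.cup
  have h4 : Deg 0 (G2.cap ⊠ idn 3 : Free.Hom 5 3) := Deg.tensor Deg.cap (Deg.id 3)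
  exact ((h3.comp h2).comp h4).mono (by omega)

theorem Deg.iterate_rotate23 {d : ℕ} {f : Free.Hom 2 3} (h : Deg d f) (i : ℕ) :
    Deg d (G2.rotate23^[i] f) := by
  induction i with
  | zero => exact h
  | succ i ih => rw [Function.iterate_succ_apply']; exact ih.rotate23

theorem deg_pentagonRHS : Deg 3 pentagonRHS := by
  rw [pentagonRHS, sub_eq_add_neg]
  have h5 : Deg 3 tree5 := Deg.comp deg_treeI (Deg.tensor deg_covertex (Deg.id 1))
  have hs : Deg 1 strandVertex := Deg.tensor (Deg.id 1) deg_covertex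
  exact (Deg.sum _ h5.iterate_rotate23).neg.add
    ((Deg.sum _ hs.iterate_rotate23).neg.mono (by omega))

variable (q : ℂ)

/-- The empty diagram. -/
noncomputable def unit : (G2 q).Elt :=
  fun n => if h : 0 = n then castHom rfl h ((G2 q).id 0) else 0

/-- Diagrams without inputs that grow from the bottom to the top: they are built from the empty
diagram by cups, by splitting strands, and by joining neighbouring strands by a horizontal edge.
The indices are the numbers of vertices and of outputs. -/
inductive UpWord : ℕ → ℕ → (G2 q).Elt → Prop
  | unit : UpWord 0 0 (unit q)
  | cup {N n : ℕ} {X : (G2 q).Elt} (a : ℕ) (h : a ≤ n) : UpWord N n X →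
      UpWord N (n + 2) (opC q a X)
  | split {N n : ℕ} {X : (G2 q).Elt} (a : ℕ) (h : a + 1 ≤ n) : UpWord N n X →
      UpWord (N + 1) (n + 1) (opY q a X)
  | join {N n : ℕ} {X : (G2 q).Elt} (a : ℕ) (h : a + 2 ≤ n) : UpWord N n X →
      UpWord (N + 2) n (opH q a X)

/-- The span of the growing diagrams with at most `N` vertices and with `n` outputs. -/
def upSpan (N n : ℕ) : Submodule ℂ (G2 q).Elt :=
  Submodule.span ℂ {X | ∃ M ≤ N, UpWord q M n X}

variable {q}

theorem act_apply_eq_zero {P : LinearPRO} {a k l n m : ℕ} {f : P.Hom k l} {X : P.Elt}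
    (hX : ∀ j, j ≠ n → X j = 0) (h : m + k ≠ n + l) : act a f X m = 0 := by
  by_cases hn : a + l ≤ m
  · obtain ⟨b, rfl⟩ := Nat.exists_eq_add_of_le hn
    rw [act_apply, hX _ (by omega), zero_comp]
  · exact act_apply_of_lt _ _ _ (by omega)

theorem UpWord.apply_eq_zero {N n : ℕ} {X : (G2 q).Elt} (h : UpWord q N n X) :
    ∀ j, j ≠ n → X j = 0 := by
  induction h with
  | unit => exact fun j hj => dif_neg (Ne.symm hj)
  | cup a h _ ih => exact fun j hj => act_apply_eq_zero ih (by omega)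
  | split a h _ ih => exact fun j hj => act_apply_eq_zero ih (by omega)
  | join a h _ ih => exact fun j hj => act_apply_eq_zero ih (by omega)

theorem UpWord.eq_unit {N : ℕ} {X : (G2 q).Elt} {n : ℕ} (h : UpWord q N n X) (hn : n = 0) :
    X = G2.unit q := by
  induction h with
  | unit => rfl
  | cup a h _ ih => omega
  | split a h _ ih => omega
  | join a h _ ih => omega

theorem UpWord.mem {N n : ℕ} {X : (G2 q).Elt} (h : UpWord q N n X) : X ∈ upSpan q N n :=
  Submodule.subset_span ⟨N, le_rfl, h⟩

theorem upSpan_mono {N N' n : ℕ} (h : N ≤ N') : upSpan q N n ≤ upSpan q N' n :=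
  Submodule.span_mono fun _ ⟨M, hM, hX⟩ => ⟨M, hM.trans h, hX⟩

theorem map_mem_upSpan {M N n n' : ℕ} {T : Module.End ℂ (G2 q).Elt}
    (h : ∀ M' ≤ M, ∀ X, UpWord q M' n X → T X ∈ upSpan q N n') {X : (G2 q).Elt}
    (hX : X ∈ upSpan q M n) : T X ∈ upSpan q N n' := by
  have h' : upSpan q M n ≤ (upSpan q N n').comap T :=
    Submodule.span_le.2 fun X ⟨M', hM, hX⟩ => h M' hM X hX
  exact h' hX

theorem proj_eq_self {N n m : ℕ} {X : (G2 q).Elt} (hX : X ∈ upSpan q N n) (h : m ≤ n) :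
    opP q m X = X := by
  have h' : upSpan q N n ≤ LinearMap.eqLocus (opP q m) LinearMap.id := by
    refine Submodule.span_le.2 fun X ⟨M', hM, hX⟩ => funext fun j => ?_
    by_cases hj : m ≤ j
    · exact proj_apply hj X
    · exact (proj_apply_of_lt (by omega) X).trans (hX.apply_eq_zero j (by omega)).symm
  exact h' hX

theorem opC_mem {N n a : ℕ} {X : (G2 q).Elt} (hX : X ∈ upSpan q N n) (h : a ≤ n) :
    opC q a X ∈ upSpan q N (n + 2) :=
  map_mem_upSpan (fun _ hM _ hX => upSpan_mono hM (hX.cup a h).mem) hX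

theorem opY_mem {N n a : ℕ} {X : (G2 q).Elt} (hX : X ∈ upSpan q N n) (h : a + 1 ≤ n) :
    opY q a X ∈ upSpan q (N + 1) (n + 1) :=
  map_mem_upSpan (fun _ hM _ hX => upSpan_mono (by omega) (hX.split a h).mem) hX

theorem opH_mem {N n a : ℕ} {X : (G2 q).Elt} (hX : X ∈ upSpan q N n) (h : a + 2 ≤ n) :
    opH q a X ∈ upSpan q (N + 2) n :=
  map_mem_upSpan (fun _ hM _ hX => upSpan_mono (by omega) (hX.join a h).mem) hX

variable (q) in
/-- Diagrams with at most `N` vertices in total preserve the spans of growing diagrams. -/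
def Stable (N : ℕ) : Prop :=
  ∀ ⦃d k l : ℕ⦄ ⦃f : Free.Hom k l⦄, Deg d f → ∀ {M a n n' : ℕ} {X : (G2 q).Elt},
    X ∈ upSpan q M n → a + k ≤ n → n' + k = n + l → d + M ≤ N → op q a f X ∈ upSpan q (d + M) n'

/-- Only caps and merging vertices have to be dealt with: cups and splitting vertices are
letters of growing diagrams. -/
theorem stable_of_generators {N : ℕ}
    (hK : ∀ {M a n : ℕ} {X : (G2 q).Elt}, X ∈ upSpan q M (n + 2) → a ≤ n → M ≤ N →
      opK q a X ∈ upSpan q M n)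
    (hM : ∀ {M a n : ℕ} {X : (G2 q).Elt}, X ∈ upSpan q M (n + 1) → a + 1 ≤ n → M + 1 ≤ N →
      opM q a X ∈ upSpan q (M + 1) n) : Stable q N := by
  intro d k l f hf
  induction hf with
  | id m =>
    intro M a n n' X hX h h' hN
    obtain rfl : n' = n := by omega
    rwa [op_idn, proj_eq_self hX h, Nat.zero_add]
  | cap =>
    intro M a n n' X hX h h' hN
    obtain rfl : n = n' + 2 := by omega
    rw [Nat.zero_add]
    exact hK hX (by omega) (by omega)
  | cup =>
    intro M a n n' X hX h h' hN
    obtain rfl : n' = n + 2 := by omega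
    rw [Nat.zero_add]
    exact opC_mem hX (by omega)
  | vertex =>
    intro M a n n' X hX h h' hN
    obtain rfl : n = n' + 1 := by omega
    rw [Nat.add_comm]
    exact hM hX (by omega) (by omega)
  | @comp d e k l m f g _ _ hf hg =>
    intro M a n n' X hX h h' hN
    rw [op_comp, Nat.add_comm d, Nat.add_assoc]
    exact hg (hf hX h (n' := n + l - k) (by omega) (by omega)) (by omega) (by omega) (by omega)
  | @tensor d e k l k' l' f g _ _ hf hg =>
    intro M a n n' X hX h h' hN
    have h1 : f ⊠ g = (f ⊠ idn k') ⨟ (idn l ⊠ g) := by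
      rw [Free.interchange, idn, idn, Free.comp_id, Free.id_comp]
    rw [h1, op_comp, op_tensor_id, op_id_tensor, Nat.add_comm d, Nat.add_assoc]
    change op q (a + l) g (op q a f (opP q _ X)) ∈ _
    rw [proj_eq_self hX (by omega)]
    exact hg (hf hX (n' := n + l - k) (by omega) (by omega) (by omega)) (by omega) (by omega)
      (by omega)
  | zero =>
    intro M a n n' X hX h h' hN
    rw [op_zero]
    exact zero_mem _
  | add _ _ hf hg =>
    intro M a n n' X hX h h' hN
    rw [op_add]
    exact add_mem (hf hX h h' hN) (hg hX h h' hN)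
  | smul c _ hf =>
    intro M a n n' X hX h h' hN
    rw [op_smul]
    exact Submodule.smul_mem _ c (hf hX h h' hN)
  | mono hde _ hf =>
    intro M a n n' X hX h h' hN
    exact upSpan_mono (by omega) (hf hX h h' (by omega))

/-! #### Merging two neighbouring strands of a growing diagram -/

variable (q) in
/-- The product of horizontal edges `H_a H_{a+1} ⋯ H_{a+r-1}`. -/
noncomputable def opR (a : ℕ) : ℕ → Module.End ℂ (G2 q).Elt
  | 0 => 1
  | r + 1 => opR a r * opH q (a + r)

variable (q) in
/-- The product `M_a H_{a+1} ⋯ H_{a+r}`: a strip that enters below the strands `a, …, a + r + 1`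
and leaves with one strand less. -/
noncomputable def opT (a r : ℕ) : Module.End ℂ (G2 q).Elt := opM q a * opR q (a + 1) r

theorem opT_zero (a : ℕ) : opT q a 0 = opM q a := mul_one _

theorem opT_succ (a r : ℕ) : opT q a (r + 1) = opT q a r * opH q (a + r + 1) := by
  rw [opT, opR, ← mul_assoc, opT, Nat.add_right_comm]

theorem opT_succ' (a r : ℕ) : opT q a (r + 1) = opT q (a + 1) r * opH q a := by
  induction r with
  | zero => rw [opT_succ, opT_zero, opT_zero, Nat.add_zero, opM_opH_succ]
  | succ r ih =>
    rw [opT_succ, ih, opT_succ, mul_assoc, mul_assoc,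
      op_far treeH treeH (a := a) (e := a + 1 + r + 1) (e' := a + 1 + r + 1) (by omega) (by omega),
      show a + (r + 1) + 1 = a + 1 + r + 1 by omega]

theorem opR_mul_op {k l j e e' : ℕ} (f : Free.Hom k l) (r : ℕ) (h : j + l ≤ e)
    (he : e' + l = e + k) : opR q e r * op q j f = op q j f * opR q e' r := by
  induction r with
  | zero => rw [opR, opR, one_mul, mul_one]
  | succ r ih =>
    rw [opR, opR, mul_assoc, op_far f treeH (e' := e' + r) (by omega) (by omega), ← mul_assoc, ih,
      mul_assoc]

theorem opT_mul_op_left {k l j e e' : ℕ} (f : Free.Hom k l) (r : ℕ) (h : j + l ≤ e)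
    (he : e' + l = e + k) : opT q e r * op q j f = op q j f * opT q e' r := by
  rw [opT, opT, mul_assoc, opR_mul_op f r (e' := e' + 1) (by omega) (by omega), ← mul_assoc,
    op_far f vertex h he, mul_assoc]

theorem opT_mul_op_right {k l j a : ℕ} (f : Free.Hom k l) (r : ℕ) (h : a + r + 1 ≤ j) :
    opT q a r * op q (j + 1) f = op q j f * opT q a r := by
  induction r with
  | zero => rw [opT_zero, op_far vertex f (e' := j + 1) (by omega) (by omega)]
  | succ r ih =>
    rw [opT_succ, mul_assoc, ← op_far treeH f (e := j + 1) (by omega) (by omega), ← mul_assoc,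
      ih (by omega), mul_assoc]

theorem opR_mem {N n a r : ℕ} {X : (G2 q).Elt} (hX : X ∈ upSpan q N n) (h : a + r + 1 ≤ n) :
    opR q a r X ∈ upSpan q (N + 2 * r) n := by
  induction r generalizing N X with
  | zero => exact hX
  | succ r ih =>
    have h1 := ih (opH_mem hX (a := a + r) (by omega)) (by omega)
    exact upSpan_mono (by omega) h1

theorem opT_mem {N : ℕ} (hS : Stable q N) {M n a r : ℕ} {X : (G2 q).Elt}
    (hX : X ∈ upSpan q M (n + 1)) (h : a + r + 1 ≤ n) (hN : M + 2 * r + 1 ≤ N) :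
    opT q a r X ∈ upSpan q (M + 2 * r + 1) n := by
  have h1 := hS Deg.vertex (opR_mem hX (a := a + 1) (r := r) (by omega)) (a := a) (n' := n)
    (by omega) (by omega) (by omega)
  exact upSpan_mono (by omega) h1

/-- A strip applied to a growing diagram whose last letter `Z j` lies within the strip bounds a
face with at most five edges, which can be removed. -/
theorem opT_reduce {N : ℕ} (hS : Stable q N) (e s i : ℕ) (Z : ℕ → Module.End ℂ (G2 q).Elt)
    (hZ : ∀ a j, a + 2 ≤ j → opH q a * Z j = Z j * opH q a)
    (hM : ∀ {M n a : ℕ} {X : (G2 q).Elt}, X ∈ upSpan q M n → a + i ≤ n → M + e ≤ N →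
      opM q a (Z a X) ∈ upSpan q (M + e + 1) (n + s - 1))
    (hH : ∀ {M n a : ℕ} {X : (G2 q).Elt}, X ∈ upSpan q M n → a + i ≤ n → M + e ≤ N →
      opH q a (Z a X) ∈ upSpan q (M + e) (n + s))
    (hHH : ∀ {M n a : ℕ} {X : (G2 q).Elt}, X ∈ upSpan q M n → a + 1 + i ≤ n → a + 3 ≤ n + s →
      M + e + 2 ≤ N → opH q (a + 1) (opH q a (Z (a + 1) X)) ∈ upSpan q (M + e + 2) (n + s))
    (r : ℕ) {M n a j : ℕ} {X : (G2 q).Elt} (hX : X ∈ upSpan q M n) (hj : a ≤ j) (hj' : j ≤ a + r)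
    (hi : j + i ≤ n) (hr : a + r + 2 ≤ n + s) (hN : M + e + 2 * r ≤ N) :
    opT q a r (Z j X) ∈ upSpan q (M + e + 2 * r + 1) (n + s - 1) := by
  induction r using Nat.strong_induction_on generalizing M a X with
  | _ r ih =>
  rcases r with _ | r
  · obtain rfl : a = j := by omega
    rw [opT_zero]
    exact hM hX hi (by omega)
  obtain rfl | hja : a = j ∨ a + 1 ≤ j := by omega
  · rw [opT_succ']
    refine upSpan_mono ?_ (opT_mem hS (n := n + s - 1) (M := M + e) (X := opH q a (Z a X)) ?_ ?_ ?_)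
    · omega
    · rw [show n + s - 1 + 1 = n + s by omega]
      exact hH hX hi (by omega)
    · omega
    · omega
  obtain rfl | hja : a + 1 = j ∨ a + 2 ≤ j := by omega
  · rcases r with _ | r
    · rw [opT_succ, opT_zero]
      refine upSpan_mono ?_ (hS Deg.vertex (a := a) (n := n + s) (hH hX hi ?_) ?_ ?_ ?_) <;> omega
    · rw [opT_succ', opT_succ']
      refine upSpan_mono ?_ (opT_mem hS (n := n + s - 1) (M := M + e + 2)
        (X := opH q (a + 1) (opH q a (Z (a + 1) X))) ?_ ?_ ?_)
      · omega
      · rw [show n + s - 1 + 1 = n + s by omega]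
        exact hHH hX hi (by omega) (by omega)
      · omega
      · omega
  · rw [opT_succ']
    change opT q (a + 1) r ((opH q a * Z j) X) ∈ _
    rw [hZ a j hja]
    have h1 := ih r (by omega) (opH_mem hX (a := a) (by omega)) (a := a + 1) (by omega) (by omega)
      (by omega) (by omega)
    exact upSpan_mono (by omega) h1

theorem opT_opC_reduce {N : ℕ} (hS : Stable q N) (r : ℕ) {M n a j : ℕ} {X : (G2 q).Elt}
    (hX : X ∈ upSpan q M n) (hj : a ≤ j) (hj' : j ≤ a + r) (hi : j ≤ n) (hr : a + r ≤ n)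
    (hN : M + 2 * r ≤ N) : opT q a r (opC q j X) ∈ upSpan q (M + 2 * r + 1) (n + 1) := by
  refine opT_reduce hS 0 2 0 (opC q) ?_ ?_ ?_ ?_ r hX hj hj' hi (by omega) hN
  · intro a j h
    exact (op_far treeH cup h rfl).symm
  · intro M n a X hX h hN
    change (opM q a * opC q a) X ∈ _
    rw [opM_opC]
    exact zero_mem _
  · intro M n a X hX h hN
    change (opH q a * opC q a) X ∈ _
    rw [opH_opC]
    exact Submodule.smul_mem _ _ (opC_mem hX h)
  · intro M n a X hX h h' hN
    change opH q (a + 1) ((opH q a * opC q (a + 1)) X) ∈ _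
    rw [opH_opC_succ]
    change (opH q (a + 1) * opY q (a + 1)) (opY q a X) ∈ _
    rw [opH_opY]
    exact Submodule.smul_mem _ _ (opY_mem (opY_mem hX (by omega)) (by omega))

theorem opT_opY_reduce {N : ℕ} (hS : Stable q N) (r : ℕ) {M n a j : ℕ} {X : (G2 q).Elt}
    (hX : X ∈ upSpan q M n) (hj : a ≤ j) (hj' : j ≤ a + r) (hi : j + 1 ≤ n) (hr : a + r + 1 ≤ n)
    (hN : M + 1 + 2 * r ≤ N) : opT q a r (opY q j X) ∈ upSpan q (M + 1 + 2 * r + 1) n := by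
  refine opT_reduce hS 1 1 1 (opY q) ?_ ?_ ?_ ?_ r hX hj hj' hi (by omega) hN
  · intro a j h
    exact (op_far treeH covertex h rfl).symm
  · intro M n a X hX h hN
    change (opM q a * opY q a) X ∈ _
    rw [opM_opY]
    change (_ : ℂ) • opP q (a + 1) X ∈ _
    rw [proj_eq_self hX h]
    exact Submodule.smul_mem _ _ (upSpan_mono (by omega) hX)
  · intro M n a X hX h hN
    change (opH q a * opY q a) X ∈ _
    rw [opH_opY]
    exact Submodule.smul_mem _ _ (opY_mem hX h)
  · intro M n a X hX h h' hN
    change opH q (a + 1) ((opH q a * opY q (a + 1)) X) ∈ _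
    rw [opH_opY_succ]
    change (opH q (a + 1) * opH q (a + 1)) (opY q a X) ∈ _
    rw [opH_opH]
    refine upSpan_mono ?_ (hS (deg_tetragonRHS q) (opY_mem hX (a := a) ?_) ?_ ?_ ?_) <;> omega

theorem opT_opH_reduce {N : ℕ} (hS : Stable q N) (r : ℕ) {M n a j : ℕ} {X : (G2 q).Elt}
    (hX : X ∈ upSpan q M n) (hj : a ≤ j) (hj' : j ≤ a + r) (hi : j + 2 ≤ n) (hr : a + r + 2 ≤ n)
    (hN : M + 2 + 2 * r ≤ N) : opT q a r (opH q j X) ∈ upSpan q (M + 2 + 2 * r + 1) (n - 1) := by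
  refine opT_reduce hS 2 0 2 (opH q) ?_ ?_ ?_ ?_ r hX hj hj' hi (by omega) hN
  · intro a j h
    exact (op_far treeH treeH h rfl).symm
  · intro M n a X hX h hN
    change (opM q a * opH q a) X ∈ _
    rw [opM_opH]
    refine Submodule.smul_mem _ _ (upSpan_mono ?_ (hS Deg.vertex hX ?_ ?_ ?_)) <;> omega
  · intro M n a X hX h hN
    change (opH q a * opH q a) X ∈ _
    rw [opH_opH]
    refine upSpan_mono ?_ (hS (deg_tetragonRHS q) hX ?_ ?_ ?_) <;> omega
  · intro M n a X hX h h' hN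
    change (opH q (a + 1) * opH q a * opH q (a + 1)) X ∈ _
    rw [opH_succ_opH_opH_succ]
    refine upSpan_mono ?_ (hS Deg.vertex (n := n + 1) (hS deg_pentagonRHS hX ?_ ?_ ?_) ?_ ?_ ?_)
      <;> omega

/-- A strip on top of a vertex splitting the strand at its right end is a product of horizontal
edges, in the opposite order: `M_a H_{a+1} ⋯ H_{a+r} Y_{a+r+1} = H_{a+r} ⋯ H_a`. -/
theorem opT_opY_mem {M n a r : ℕ} {X : (G2 q).Elt} (hX : X ∈ upSpan q M n) (h : a + r + 2 ≤ n) :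
    opT q a r (opY q (a + r + 1) X) ∈ upSpan q (M + 2 * r + 2) n := by
  induction r with
  | zero =>
    change (opT q a 0 * opY q (a + 1)) X ∈ _
    rw [opT_zero, ← opH_eq']
    exact opH_mem hX (by omega)
  | succ r ih =>
    rw [opT_succ]
    change opT q a r ((opH q (a + r + 1) * opY q (a + r + 1 + 1)) X) ∈ _
    rw [opH_opY_succ]
    change (opT q a r * opH q (a + r + 1 + 1)) (opY q (a + r + 1) X) ∈ _
    rw [opT_mul_op_right treeH r le_rfl]
    exact opH_mem (ih (by omega)) (by omega)

/-- Strips map growing diagrams to combinations of growing diagrams.  The letters of the diagram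
are pushed through the strip from the top to the bottom: they pass beside it, extend it, complete
it to a growing diagram, or lie within it and bound a removable face. -/
theorem UpWord.opT_mem {N : ℕ} (hS : Stable q N) {M n : ℕ} {X : (G2 q).Elt}
    (hX : UpWord q M n X) : ∀ {a r : ℕ}, a + r + 2 ≤ n → M + 2 * r ≤ N →
      opT q a r X ∈ upSpan q (M + 2 * r + 1) (n - 1) := by
  induction hX with
  | unit => intro a r h; omega
  | @cup M n X j hj hX ih =>
    intro a r h hN
    rcases lt_trichotomy (j + 1) a with h1 | rfl | h1
    · obtain ⟨e, rfl⟩ : ∃ e, a = e + 2 := ⟨a - 2, by omega⟩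
      change (opT q (e + 2) r * opC q j) X ∈ _
      rw [opT_mul_op_left G2.cup r (e' := e) (by omega) (by omega)]
      have h2 := opC_mem (ih (a := e) (r := r) (by omega) hN) (a := j) (by omega)
      rwa [show n - 1 + 2 = n + 2 - 1 by omega] at h2
    · change (opT q (j + 1) r * opC q j) X ∈ _
      rw [opT, mul_assoc, opR_mul_op G2.cup r (e' := j) (by omega) (by omega), ← mul_assoc,
        ← opY_eq']
      exact opY_mem (opR_mem hX.mem (by omega)) (by omega)
    · obtain h2 | rfl | h2 : j ≤ a + r ∨ j = a + r + 1 ∨ a + r + 2 ≤ j := by omega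
      · exact opT_opC_reduce hS r hX.mem (by omega) h2 hj (by omega) hN
      · rcases r with _ | r
        · change (opT q a 0 * opC q (a + 1)) X ∈ _
          rw [opT_zero, ← opY_eq]
          exact opY_mem hX.mem (by omega)
        · rw [opT_succ]
          change opT q a r ((opH q (a + r + 1) * opC q (a + r + 1 + 1)) X) ∈ _
          rw [opH_opC_succ]
          change (opT q a r * opY q (a + r + 1 + 1)) (opY q (a + r + 1) X) ∈ _
          rw [opT_mul_op_right covertex r le_rfl]
          exact upSpan_mono (by omega)
            (opY_mem (opT_opY_mem hX.mem (by omega)) (a := a + r + 1) (by omega))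
      · obtain ⟨e, rfl⟩ : ∃ e, j = e + 1 := ⟨j - 1, by omega⟩
        change (opT q a r * opC q (e + 1)) X ∈ _
        rw [opT_mul_op_right G2.cup r (by omega)]
        have h2 := opC_mem (ih (a := a) (r := r) (by omega) hN) (a := e) (by omega)
        rwa [show n - 1 + 2 = n + 2 - 1 by omega] at h2
  | @split M n X j hj hX ih =>
    intro a r h hN
    rcases lt_trichotomy (j + 1) a with h1 | rfl | h1
    · obtain ⟨e, rfl⟩ : ∃ e, a = e + 1 := ⟨a - 1, by omega⟩
      change (opT q (e + 1) r * opY q j) X ∈ _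
      rw [opT_mul_op_left covertex r (e' := e) (by omega) (by omega)]
      have h2 := opY_mem (ih (a := e) (r := r) (by omega) (by omega)) (a := j) (by omega)
      rw [show n - 1 + 1 = n + 1 - 1 by omega] at h2
      exact upSpan_mono (by omega) h2
    · change (opT q (j + 1) r * opY q j) X ∈ _
      rw [opT, mul_assoc, opR_mul_op covertex r (e' := j + 1) (by omega) (by omega), ← mul_assoc,
        ← opH_eq]
      exact upSpan_mono (by omega) (opH_mem (opR_mem hX.mem (by omega)) (by omega))
    · obtain h2 | rfl | h2 : j ≤ a + r ∨ j = a + r + 1 ∨ a + r + 2 ≤ j := by omega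
      · exact opT_opY_reduce hS r hX.mem (by omega) h2 hj (by omega) hN
      · exact upSpan_mono (by omega) (opT_opY_mem hX.mem (by omega))
      · obtain ⟨e, rfl⟩ : ∃ e, j = e + 1 := ⟨j - 1, by omega⟩
        change (opT q a r * opY q (e + 1)) X ∈ _
        rw [opT_mul_op_right covertex r (by omega)]
        have h2 := opY_mem (ih (a := a) (r := r) (by omega) (by omega)) (a := e) (by omega)
        rw [show n - 1 + 1 = n + 1 - 1 by omega] at h2
        exact upSpan_mono (by omega) h2
  | @join M n X j hj hX ih =>
    intro a r h hN
    rcases lt_trichotomy (j + 1) a with h1 | rfl | h1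
    · change (opT q a r * opH q j) X ∈ _
      rw [opT_mul_op_left treeH r (e' := a) (by omega) (by omega)]
      exact upSpan_mono (by omega)
        (opH_mem (ih (a := a) (r := r) (by omega) (by omega)) (a := j) (by omega))
    · change (opT q (j + 1) r * opH q j) X ∈ _
      rw [← opT_succ']
      exact upSpan_mono (by omega) (ih (by omega) (by omega))
    · obtain h2 | rfl | h2 : j ≤ a + r ∨ j = a + r + 1 ∨ a + r + 2 ≤ j := by omega
      · exact opT_opH_reduce hS r hX.mem (by omega) h2 hj (by omega) (by omega)
      · change (opT q a r * opH q (a + r + 1)) X ∈ _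
        rw [← opT_succ]
        exact upSpan_mono (by omega) (ih (by omega) (by omega))
      · obtain ⟨e, rfl⟩ : ∃ e, j = e + 1 := ⟨j - 1, by omega⟩
        change (opT q a r * opH q (e + 1)) X ∈ _
        rw [opT_mul_op_right treeH r (by omega)]
        exact upSpan_mono (by omega)
          (opH_mem (ih (a := a) (r := r) (by omega) (by omega)) (a := e) (by omega))

theorem opK_opC_self (a : ℕ) : ∃ c : ℂ, opK q a * opC q a = c • opP q a := by
  have h := (op_comp a cup cap).symm.trans (op_congr a (Skein.loop (q := q)))
  rw [op_smul, op_idn, Nat.add_zero] at h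
  exact ⟨_, h⟩

/-- Caps map growing diagrams to combinations of growing diagrams. -/
theorem UpWord.opK_mem {N : ℕ}
    (hV : ∀ {M a n : ℕ} {X : (G2 q).Elt}, X ∈ upSpan q M (n + 1) → a + 1 ≤ n → M + 1 ≤ N →
      opM q a X ∈ upSpan q (M + 1) n) {M n : ℕ} {X : (G2 q).Elt} (hX : UpWord q M n X) :
    ∀ {a : ℕ}, a + 2 ≤ n → M ≤ N → opK q a X ∈ upSpan q M (n - 2) := by
  induction hX with
  | unit => intro a h; omega
  | @cup M n X j hj hX ih =>
    intro a h hN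
    obtain h1 | rfl | rfl | rfl | h1 : j + 2 ≤ a ∨ a = j + 1 ∨ a = j ∨ j = a + 1 ∨ a + 2 ≤ j := by
      omega
    · obtain ⟨e, rfl⟩ : ∃ e, a = e + 2 := ⟨a - 2, by omega⟩
      change (opK q (e + 2) * opC q j) X ∈ _
      rw [op_far G2.cup G2.cap (e' := e) (by omega) (by omega)]
      have h2 := opC_mem (ih (a := e) (by omega) hN) (a := j) (by omega)
      rwa [show n - 2 + 2 = n + 2 - 2 by omega] at h2
    · change (opK q (j + 1) * opC q j) X ∈ _
      rw [opK_opC', proj_eq_self hX.mem (by omega)]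
      exact hX.mem
    · obtain ⟨c, hc⟩ := opK_opC_self (q := q) a
      change (opK q a * opC q a) X ∈ _
      rw [hc]
      change c • opP q a X ∈ _
      rw [proj_eq_self hX.mem (by omega)]
      exact Submodule.smul_mem _ c hX.mem
    · change (opK q a * opC q (a + 1)) X ∈ _
      rw [opK_opC, proj_eq_self hX.mem (by omega)]
      exact hX.mem
    · obtain ⟨e, rfl⟩ : ∃ e, j = e + 2 := ⟨j - 2, by omega⟩
      change (opK q a * opC q (e + 2)) X ∈ _
      rw [← op_far G2.cap G2.cup (e := e) (by omega) (by omega)]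
      have h2 := opC_mem (ih (a := a) (by omega) hN) (a := e) (by omega)
      rwa [show n - 2 + 2 = n + 2 - 2 by omega] at h2
  | @split M n X j hj hX ih =>
    intro a h hN
    obtain h1 | rfl | rfl | rfl | h1 : j + 2 ≤ a ∨ a = j + 1 ∨ a = j ∨ j = a + 1 ∨ a + 2 ≤ j := by
      omega
    · obtain ⟨e, rfl⟩ : ∃ e, a = e + 1 := ⟨a - 1, by omega⟩
      change (opK q (e + 1) * opY q j) X ∈ _
      rw [op_far covertex G2.cap (e' := e) (by omega) (by omega)]
      have h2 := opY_mem (ih (a := e) (by omega) (by omega)) (a := j) (by omega)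
      rwa [show n - 2 + 1 = n + 1 - 2 by omega] at h2
    · change (opK q (j + 1) * opY q j) X ∈ _
      rw [opK_succ_opY]
      refine hV ?_ (by omega) hN
      rw [show n + 1 - 2 + 1 = n by omega]
      exact hX.mem
    · change (opK q a * opY q a) X ∈ _
      rw [opK_opY]
      exact zero_mem _
    · change (opK q a * opY q (a + 1)) X ∈ _
      rw [opK_opY_succ]
      refine hV ?_ (by omega) hN
      rw [show n + 1 - 2 + 1 = n by omega]
      exact hX.mem
    · obtain ⟨e, rfl⟩ : ∃ e, j = e + 2 := ⟨j - 2, by omega⟩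
      change (opK q a * opY q (e + 2)) X ∈ _
      rw [← op_far G2.cap covertex (e := e) (by omega) (by omega)]
      have h2 := opY_mem (ih (a := a) (by omega) (by omega)) (a := e) (by omega)
      rwa [show n - 2 + 1 = n + 1 - 2 by omega] at h2
  | @join M n X j hj hX ih =>
    intro a h hN
    obtain h1 | rfl | rfl | rfl | h1 : j + 2 ≤ a ∨ a = j + 1 ∨ a = j ∨ j = a + 1 ∨ a + 2 ≤ j := by
      omega
    · change (opK q a * opH q j) X ∈ _
      rw [op_far treeH G2.cap (e' := a) (by omega) (by omega)]
      exact opH_mem (ih (a := a) (by omega) (by omega)) (a := j) (by omega)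
    · change (opK q (j + 1) * opH q j) X ∈ _
      rw [opK_succ_opH]
      obtain ⟨m, rfl⟩ : ∃ m, n = m + 2 := ⟨n - 2, by omega⟩
      exact hV (hV hX.mem (by omega) (by omega)) (by omega) (by omega)
    · change (opK q a * opH q a) X ∈ _
      rw [opK_opH]
      exact Submodule.smul_mem _ _ (upSpan_mono (by omega) (ih h (by omega)))
    · change (opK q a * opH q (a + 1)) X ∈ _
      rw [opK_opH_succ]
      obtain ⟨m, rfl⟩ : ∃ m, n = m + 2 := ⟨n - 2, by omega⟩
      exact hV (hV hX.mem (by omega) (by omega)) (by omega) (by omega)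
    · obtain ⟨e, rfl⟩ : ∃ e, j = e + 2 := ⟨j - 2, by omega⟩
      change (opK q a * opH q (e + 2)) X ∈ _
      rw [← op_far G2.cap treeH (e := e) (by omega) (by omega)]
      exact opH_mem (ih (a := a) (by omega) (by omega)) (a := e) (by omega)

/-- A merging vertex is a strip of length zero, so that strips in diagrams with fewer than `N`
vertices, which serve to remove the merging vertices, provide the induction. -/
theorem stable (N : ℕ) : Stable q N := by
  induction N using Nat.strong_induction_on with
  | _ N ih =>
  have hV : ∀ {M a n : ℕ} {X : (G2 q).Elt}, X ∈ upSpan q M (n + 1) → a + 1 ≤ n → M + 1 ≤ N →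
      opM q a X ∈ upSpan q (M + 1) n := by
    intro M a n X hX h hN
    refine map_mem_upSpan (fun M' hM' X hX => ?_) hX
    have h1 := hX.opT_mem (ih (N - 1) (by omega)) (a := a) (r := 0) (by omega) (by omega)
    rw [opT_zero] at h1
    exact upSpan_mono (by omega) h1
  refine stable_of_generators ?_ hV
  intro M a n X hX h hN
  refine map_mem_upSpan (fun M' hM' X hX => ?_) hX
  exact upSpan_mono hM' (hX.opK_mem hV (a := a) (by omega) (by omega))

/-- Every closed diagram in `G₂(q)` is a multiple of the empty diagram. -/
theorem exists_smul_id (x : (G2 q).Hom 0 0) : ∃ c : ℂ, x = c • (G2 q).id 0 := by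
  obtain ⟨f, rfl⟩ : ∃ f, (toG2 q).map f = x := Submodule.mkQ_surjective _ x
  obtain ⟨d, hd⟩ := exists_deg f
  have h1 : op q 0 f (unit q) ∈ upSpan q d 0 :=
    (stable d : Stable q d) hd (M := 0) (n := 0) UpWord.unit.mem le_rfl rfl le_rfl
  have h2 : upSpan q d 0 ≤ Submodule.span ℂ {unit q} :=
    Submodule.span_le.2 fun X ⟨M, _, hX⟩ => hX.eq_unit rfl ▸ Submodule.mem_span_singleton_self _
  obtain ⟨c, hc⟩ := Submodule.mem_span_singleton.1 (h2 h1)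
  refine ⟨c, ?_⟩
  have h3 := act_apply 0 ((toG2 q).map f) (unit q) 0
  have h4 : unit q 0 = (G2 q).id 0 := rfl
  have h5 : whisk 0 ((toG2 q).map f) 0 = (toG2 q).map f :=
    ((G2 q).tensor_id_zero _).trans ((G2 q).id_zero_tensor ((toG2 q).map f))
  have h6 : op q 0 f (unit q) 0 = (toG2 q).map f := by
    refine h3.trans ?_
    rw [h5]
    exact (G2 q).id_comp _
  rw [← h6, ← hc]
  exact congrArg (c • ·) h4

end G2

/-! ### Functors out of presented categories -/

namespace LinearPRO

variable {P Q : LinearPRO}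

theorem map_eq_zero_of_inTensorIdeal (F : StrictMonoidalFunctor P Q)
    {S : ∀ m n, Set (P.Hom m n)} (hS : ∀ m n, ∀ f ∈ S m n, F.map f = 0) {m n : ℕ}
    {f : P.Hom m n} (hf : P.InTensorIdeal S f) : F.map f = 0 := by
  induction hf with
  | of h => exact hS _ _ _ h
  | zero => exact map_zero _
  | add _ _ hf hg => rw [map_add, hf, hg, add_zero]
  | smul c _ hf => rw [map_smul, hf, smul_zero]
  | comp_left g _ hf => rw [F.map_comp, hf, comp_zero]
  | comp_right g _ hf => rw [F.map_comp, hf, zero_comp]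
  | tensor_left g _ hf => rw [F.map_tensor, hf, tensor_zero]
  | tensor_right g _ hf => rw [F.map_tensor, hf, zero_tensor]

/-- The functor out of a quotient induced by a functor that kills the generators of the ideal. -/
noncomputable def liftQuotient (F : StrictMonoidalFunctor P Q) (S : ∀ m n, Set (P.Hom m n))
    (hS : ∀ m n, ∀ f ∈ S m n, F.map f = 0) : StrictMonoidalFunctor (P.quotient S) Q where
  map {m n} := (P.tensorIdeal S m n).liftQ F.map
    fun _ hf => map_eq_zero_of_inTensorIdeal F hS hf
  map_id n := F.map_id n
  map_comp := by
    rintro l m n ⟨f⟩ ⟨g⟩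
    exact F.map_comp f g
  map_tensor := by
    rintro m n m' n' ⟨f⟩ ⟨g⟩
    exact F.map_tensor f g

/-- A strict monoidal functor commutes with partial traces. -/
theorem map_partialTrace (F : StrictMonoidalFunctor P Q) (D : P.SelfDuality) {m n : ℕ}
    (f : P.Hom (m + 1) (n + 1)) :
    F.map (partialTrace D f) = partialTrace (D.image F) (F.map f) := by
  have h1 : F.map (P.id m ⊠ D.cup) = Q.id m ⊠ F.map D.cup := by rw [F.map_tensor, F.map_id]
  have h2 : F.map (P.id n ⊠ D.cap) = Q.id n ⊠ F.map D.cap := by rw [F.map_tensor, F.map_id]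
  have h3 : F.map (P.tensor (m := m + 1) (n := n + 1) f (P.id 1))
      = Q.tensor (m := m + 1) (n := n + 1) (F.map f) (Q.id 1) := by rw [F.map_tensor, F.map_id]
  refine (F.map_comp (l := m) (m := m + 2) (n := n) (P.id m ⊠ D.cup) _).trans ?_
  refine congrArg₂ Q.comp h1 ?_
  exact (F.map_comp (l := m + 2) (m := n + 2) (n := n)
    (P.tensor (m := m + 1) (n := n + 1) f (P.id 1)) _).trans
    (congrArg₂ Q.comp h3 h2)

theorem map_trace (F : StrictMonoidalFunctor P Q) (D : P.SelfDuality) {n : ℕ} (f : P.Hom n n) :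
    F.map (trace D f) = trace (D.image F) (F.map f) := by
  induction n with
  | zero => rfl
  | succ n ih => exact (ih _).trans (congrArg _ (map_partialTrace F D f))

end LinearPRO

namespace G2

open LinearPRO

variable {Q : LinearPRO} (c : Q.Hom 2 0) (u : Q.Hom 0 2) (v : Q.Hom 2 1)

/-- The interpretation of an expression in a category with chosen images of the generators. -/
def termHom : ∀ {m n : ℕ}, Term m n → Q.Hom m n
  | _, _, .id n => Q.id n
  | _, _, .cap => c
  | _, _, .cup => u
  | _, _, .vertex => v
  | _, _, .comp f g => Q.comp (termHom f) (termHom g)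
  | _, _, .tensor f g => Q.tensor (termHom f) (termHom g)
  | _, _, .zero => 0
  | _, _, .add f g => termHom f + termHom g
  | _, _, .smul a f => a • termHom f

theorem termHom_castHom {m n m' n' : ℕ} (hm : m = m') (hn : n = n') (f : Term m n) :
    termHom c u v (castHom hm hn f) = castHom hm hn (termHom c u v f) := by
  subst hm hn
  rfl

/-- The relations between expressions in the free category are instances of the axioms of strict
monoidal linear categories, so that they hold in every such category. -/
theorem termHom_eq {m n : ℕ} {f g : Term m n} (h : TermRel f g) :
    termHom c u v f = termHom c u v g := by
  induction h with
  | refl => rfl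
  | symm _ ih => exact ih.symm
  | trans _ _ ih ih' => exact ih.trans ih'
  | comp_congr _ _ ih ih' => simp only [termHom, ih, ih']
  | tensor_congr _ _ ih ih' => simp only [termHom, ih, ih']
  | add_congr _ _ ih ih' => simp only [termHom, ih, ih']
  | smul_congr c _ ih => simp only [termHom, ih]
  | add_assoc => exact add_assoc _ _ _
  | add_comm => exact add_comm _ _
  | zero_add => exact zero_add _
  | neg_add f => simp [termHom]
  | one_smul => exact one_smul _ _
  | mul_smul => exact mul_smul _ _ _
  | smul_add => exact smul_add _ _ _
  | add_smul => exact add_smul _ _ _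
  | id_comp => exact Q.id_comp _
  | comp_id => exact Q.comp_id _
  | comp_assoc => exact Q.comp_assoc _ _ _
  | add_comp => exact Q.add_comp _ _ _
  | comp_add => exact Q.comp_add _ _ _
  | smul_comp => exact Q.smul_comp _ _ _
  | comp_smul => exact Q.comp_smul _ _ _
  | add_tensor => exact Q.add_tensor _ _ _
  | tensor_add => exact Q.tensor_add _ _ _
  | smul_tensor => exact Q.smul_tensor _ _ _
  | tensor_smul => exact Q.tensor_smul _ _ _
  | id_tensor_id => exact Q.id_tensor_id _ _
  | interchange => exact Q.interchange _ _ _ _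
  | tensor_assoc => rw [termHom_castHom]; exact Q.tensor_assoc _ _ _
  | id_zero_tensor => rw [termHom_castHom]; exact Q.id_zero_tensor _
  | tensor_id_zero => exact Q.tensor_id_zero _

/-- The functor out of the free category given by the images of the generators. -/
def freeLift : StrictMonoidalFunctor Free Q where
  map {m n} :=
    { toFun := Quotient.lift (termHom c u v) fun _ _ h => termHom_eq c u v h
      map_add' := by rintro ⟨f⟩ ⟨g⟩; rfl
      map_smul' := by rintro a ⟨f⟩; rfl }
  map_id _ := rfl
  map_comp := by rintro l m n ⟨f⟩ ⟨g⟩; rfl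
  map_tensor := by rintro m n m' n' ⟨f⟩ ⟨g⟩; rfl

end G2

/-! ### Morphisms of the graph planar algebra as operators -/

namespace LoopGraph

variable {V : Type} {Γ : LoopGraph V}

namespace Path

/-- The list of vertices of a path. -/
def toList {m : ℕ} (p : Γ.Path m) : List V := List.ofFn p.1

theorem toList_injective {m : ℕ} : Function.Injective (toList (Γ := Γ) (m := m)) :=
  fun _ _ h => Subtype.ext (List.ofFn_injective h)

theorem toList_take {m n : ℕ} (p : Γ.Path (m + n)) :
    (take p : Γ.Path m).toList = p.toList.take (m + 1) := by
  refine List.ext_getElem (by simp [toList]) fun i h1 h2 => ?_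
  simp [toList, take, vert, -List.ofFn_succ]

theorem toList_drop {m n : ℕ} (p : Γ.Path (m + n)) :
    (drop p : Γ.Path n).toList = p.toList.drop m := by
  refine List.ext_getElem (by simp [toList]; omega) fun i h1 h2 => ?_
  simp [toList, drop, vert, -List.ofFn_succ]

theorem toList_append {m n : ℕ} (p : Γ.Path m) (q : Γ.Path n) (h : p.target = q.source) :
    (append p q h).toList = p.toList ++ q.toList.tail := by
  refine List.ext_getElem (by simp [toList]) fun i h1 h2 => ?_
  by_cases hi : i < m + 1
  · have hi' : i ≤ m := by omega
    rw [List.getElem_append_left (by simpa [toList] using hi)]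
    simp [toList, append, vert, hi', -List.ofFn_succ]
  · have hi' : ¬ i ≤ m := by omega
    rw [List.getElem_append_right (by simpa [toList] using hi)]
    simp [toList, append, vert, hi', show i - (m + 1) + 1 = i - m by omega, -List.ofFn_succ]

theorem exists_toList_zero (a : V) : ∃ p : Γ.Path 0, p.toList = [a] :=
  ⟨⟨fun _ => a, fun i => i.elim0⟩, by simp [toList]⟩

theorem exists_toList_one {a b : V} : (∃ p : Γ.Path 1, p.toList = [a, b]) ↔ Γ.Adj a b := by
  constructor
  · rintro ⟨p, h⟩
    have h' : p.1 0 = a ∧ p.1 1 = b := by simpa [toList] using h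
    rw [← h'.1, ← h'.2]
    exact p.2 0
  · intro h
    refine ⟨⟨![a, b], fun i => ?_⟩, by simp [toList]⟩
    fin_cases i
    exact h

theorem exists_toList_two {a b c : V} :
    (∃ p : Γ.Path 2, p.toList = [a, b, c]) ↔ Γ.Adj a b ∧ Γ.Adj b c := by
  constructor
  · rintro ⟨p, h⟩
    have h' : p.1 0 = a ∧ p.1 1 = b ∧ p.1 2 = c := by simpa [toList] using h
    rw [← h'.1, ← h'.2.1, ← h'.2.2]
    exact ⟨p.2 0, p.2 1⟩
  · intro h
    refine ⟨⟨![a, b, c], fun i => ?_⟩, by simp [toList]⟩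
    fin_cases i
    exacts [h.1, h.2]

theorem exists_toList_three {a b c d : V} :
    (∃ p : Γ.Path 3, p.toList = [a, b, c, d]) ↔ Γ.Adj a b ∧ Γ.Adj b c ∧ Γ.Adj c d := by
  constructor
  · rintro ⟨p, h⟩
    have h' : p.1 0 = a ∧ p.1 1 = b ∧ p.1 2 = c ∧ p.1 3 = d := by simpa [toList] using h
    rw [← h'.1, ← h'.2.1, ← h'.2.2.1, ← h'.2.2.2]
    exact ⟨p.2 0, p.2 1, p.2 2⟩
  · intro h
    refine ⟨⟨![a, b, c, d], fun i => ?_⟩, by simp [toList]⟩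
    fin_cases i
    exacts [h.1, h.2.1, h.2.2]

theorem toList_zero (p : Γ.Path 0) : p.toList = [p.1 0] := by simp [toList]

theorem toList_one (p : Γ.Path 1) : p.toList = [p.1 0, p.1 1] := by simp [toList]

theorem toList_two (p : Γ.Path 2) : p.toList = [p.1 0, p.1 1, p.1 2] := by simp [toList]

end Path

variable [Fintype V]

open Classical in
/-- The operator on functions on lists of vertices given by a morphism `f` of the graph planar
algebra: `(lev f ψ) l = ∑ q, f (l, q) ψ(q)` if `l` is the list of vertices of a path, and `0`
otherwise. -/
noncomputable def lev {m n : ℕ} (f : Γ.GPA.Hom m n) (ψ : List V → ℂ) (l : List V) : ℂ :=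
  ∑ p : Γ.Path m, if p.toList = l then ∑ q, f.1 p q * ψ q.toList else 0

theorem lev_toList {m n : ℕ} (f : Γ.GPA.Hom m n) (ψ : List V → ℂ) (p : Γ.Path m) :
    lev f ψ p.toList = ∑ q, f.1 p q * ψ q.toList := by
  rw [lev, Finset.sum_eq_single p]
  · rw [if_pos rfl]
  · intro p' _ h
    exact if_neg fun e => h (Path.toList_injective e)
  · intro h
    exact absurd (Finset.mem_univ _) h

theorem lev_of_not {m n : ℕ} (f : Γ.GPA.Hom m n) (ψ : List V → ℂ) {l : List V}
    (h : ¬ ∃ p : Γ.Path m, p.toList = l) : lev f ψ l = 0 :=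
  Finset.sum_eq_zero fun p _ => if_neg fun e => h ⟨p, e⟩

theorem lev_ext {m n : ℕ} {f g : Γ.GPA.Hom m n}
    (h : ∀ (ψ : List V → ℂ) (p : Γ.Path m), lev f ψ p.toList = lev g ψ p.toList) : f = g := by
  classical
  refine GPAHom.ext fun p q => ?_
  have h1 := h (fun l => if q.toList = l then 1 else 0) p
  rw [lev_toList, lev_toList] at h1
  simpa [Path.toList_injective.eq_iff] using h1

theorem lev_add {m n : ℕ} (f g : Γ.GPA.Hom m n) (ψ : List V → ℂ) (l : List V) :
    lev (f + g) ψ l = lev f ψ l + lev g ψ l := by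
  rw [lev, lev, lev, ← Finset.sum_add_distrib]
  refine Finset.sum_congr rfl fun p _ => ?_
  split_ifs
  · rw [← Finset.sum_add_distrib]
    exact Finset.sum_congr rfl fun q _ => add_mul _ _ _
  · exact (add_zero _).symm

theorem lev_smul {m n : ℕ} (c : ℂ) (f : Γ.GPA.Hom m n) (ψ : List V → ℂ) (l : List V) :
    lev (c • f) ψ l = c * lev f ψ l := by
  rw [lev, lev, Finset.mul_sum]
  refine Finset.sum_congr rfl fun p _ => ?_
  split_ifs
  · rw [Finset.mul_sum]
    exact Finset.sum_congr rfl fun q _ => mul_assoc _ _ _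
  · exact (mul_zero _).symm

theorem lev_zero {m n : ℕ} (ψ : List V → ℂ) (l : List V) :
    lev (0 : Γ.GPA.Hom m n) ψ l = 0 := by
  have h := lev_smul (0 : ℂ) (0 : Γ.GPA.Hom m n) ψ l
  rwa [zero_smul, zero_mul] at h

theorem lev_comp {k m n : ℕ} (f : Γ.GPA.Hom k m) (g : Γ.GPA.Hom m n) (ψ : List V → ℂ)
    (l : List V) : lev (f ⨟ g) ψ l = lev f (lev g ψ) l := by
  by_cases h : ∃ p : Γ.Path k, p.toList = l
  · obtain ⟨p, rfl⟩ := h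
    rw [lev_toList, lev_toList]
    simp only [lev_toList, Finset.mul_sum]
    rw [Finset.sum_comm]
    refine Finset.sum_congr rfl fun q _ => ?_
    change (∑ r, f.1 p r * g.1 r q) * _ = _
    rw [Finset.sum_mul]
    exact Finset.sum_congr rfl fun r _ => mul_assoc _ _ _
  · rw [lev_of_not _ _ h, lev_of_not _ _ h]

theorem lev_id_of {n : ℕ} {l : List V} (h : ∃ p : Γ.Path n, p.toList = l) (ψ : List V → ℂ) :
    lev (Γ.GPA.id n) ψ l = ψ l := by
  classical
  obtain ⟨p, rfl⟩ := h
  rw [lev_toList]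
  change ∑ q, (if p = q then (1 : ℂ) else 0) * _ = _
  simp

theorem lev_tensor {m n m' n' : ℕ} (f : Γ.GPA.Hom m n) (g : Γ.GPA.Hom m' n') (ψ : List V → ℂ)
    {l : List V} (hl : l.length = m + m' + 1) :
    lev (f ⊠ g) ψ l
      = lev f (fun l₁ => lev g (fun l₂ => ψ (l₁ ++ l₂.tail)) (l.drop m)) (l.take (m + 1)) := by
  by_cases h : ∃ p : Γ.Path (m + m'), p.toList = l
  · obtain ⟨p, rfl⟩ := h
    rw [← Path.toList_take, ← Path.toList_drop, lev_toList, lev_toList]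
    simp only [lev_toList, Finset.mul_sum]
    rw [← Finset.sum_product']
    refine Finset.sum_of_injOn (fun q : Γ.Path (n + n') => (q.take, q.drop)) ?_ ?_ ?_ ?_
    · intro q _ q' _ h
      exact Path.eq_of_take_drop (congrArg Prod.fst h) (congrArg Prod.snd h)
    · intro q _
      simp
    · rintro ⟨a, b⟩ _ hab
      by_cases ha : (Path.take p).Parallel a
      · by_cases hb : (Path.drop p).Parallel b
        · refine absurd ⟨a.append b (ha.2.symm.trans hb.1), by simp, ?_⟩ hab
          exact Prod.ext (Path.take_append _ _ _) (Path.drop_append _ _ _)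
        · simp [g.2 _ _ hb]
      · simp [f.2 _ _ ha]
    · intro q _
      change f.1 p.take q.take * g.1 p.drop q.drop * _ = _
      rw [mul_assoc]
      have e : q = Path.append (Path.take q) (Path.drop q) (Path.take_target q) :=
        Path.eq_of_take_drop (Path.take_append _ _ _).symm (Path.drop_append _ _ _).symm
      congr 3
      conv_lhs => rw [e]
      exact Path.toList_append _ _ _
  · rw [lev_of_not _ _ h]
    by_cases h1 : ∃ p : Γ.Path m, p.toList = l.take (m + 1)
    · obtain ⟨p, hp⟩ := h1
      have h2 : ¬ ∃ q : Γ.Path m', q.toList = l.drop m := by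
        rintro ⟨q, hq⟩
        have hpq : p.target = q.source := by
          have h3 : p.toList[m]'(by simp [Path.toList]) = p.target := by
            simp [Path.toList, Path.target, Path.vert, Fin.last, -List.ofFn_succ]
          have h4 : q.toList[0]'(by simp [Path.toList]) = q.source := by
            simp [Path.toList, Path.source, Path.vert]
          rw [← h3, ← h4]
          simp [hp, hq]
        refine h ⟨p.append q hpq, ?_⟩
        rw [Path.toList_append, hp, hq, List.tail_drop, List.take_append_drop]
      rw [← hp, lev_toList]
      exact (Finset.sum_eq_zero fun q _ => by rw [lev_of_not _ _ h2, mul_zero]).symm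
    · rw [lev_of_not _ _ h1]

end LoopGraph

/-! ### Evaluation of diagrams in the graph planar algebra -/

namespace LoopGraph

variable {V : Type} {Γ : LoopGraph V}

variable (Γ) in
open Classical in
/-- The entries of the adjacency matrix, as complex numbers. -/
noncomputable def adjC (a b : V) : ℂ := if Γ.Adj a b then 1 else 0

theorem adjC_of {a b : V} (h : Γ.Adj a b) : Γ.adjC a b = 1 := if_pos h

variable [Fintype V]

theorem lev_id_zero (ψ : List V → ℂ) (a : V) : lev (Γ.GPA.id 0) ψ [a] = ψ [a] :=
  lev_id_of (Path.exists_toList_zero a) ψ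

theorem lev_id_one (ψ : List V → ℂ) (a b : V) :
    lev (Γ.GPA.id 1) ψ [a, b] = Γ.adjC a b * ψ [a, b] := by
  by_cases h : Γ.Adj a b
  · rw [lev_id_of (Path.exists_toList_one.2 h), adjC_of h, one_mul]
  · rw [lev_of_not _ _ fun h' => h (Path.exists_toList_one.1 h'), adjC, if_neg h, zero_mul]

theorem lev_id_two (ψ : List V → ℂ) (a b c : V) :
    lev (Γ.GPA.id 2) ψ [a, b, c] = Γ.adjC a b * Γ.adjC b c * ψ [a, b, c] := by
  by_cases h : Γ.Adj a b ∧ Γ.Adj b c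
  · rw [lev_id_of (Path.exists_toList_two.2 h), adjC_of h.1, adjC_of h.2, one_mul, one_mul]
  · rw [lev_of_not _ _ fun h' => h (Path.exists_toList_two.1 h'), adjC, adjC, ite_zero_mul_ite_zero,
      if_neg h, zero_mul]

theorem lev_id_three (ψ : List V → ℂ) (a b c d : V) :
    lev (Γ.GPA.id 3) ψ [a, b, c, d]
      = Γ.adjC a b * Γ.adjC b c * Γ.adjC c d * ψ [a, b, c, d] := by
  by_cases h : Γ.Adj a b ∧ Γ.Adj b c ∧ Γ.Adj c d
  · rw [lev_id_of (Path.exists_toList_three.2 h), adjC_of h.1, adjC_of h.2.1, adjC_of h.2.2,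
      one_mul, one_mul, one_mul]
  · rw [lev_of_not _ _ fun h' => h (Path.exists_toList_three.1 h'), adjC, adjC, adjC,
      ite_zero_mul_ite_zero, ite_zero_mul_ite_zero, if_neg fun h' => h ⟨h'.1.1, h'.1.2, h'.2⟩,
      zero_mul]

theorem lev_id_tensor {m n : ℕ} (f : Γ.GPA.Hom m n) (ψ : List V → ℂ) (a b : V) {l : List V}
    (hl : l.length = m) :
    lev (Γ.GPA.tensor (m := 1) (n := 1) (Γ.GPA.id 1) f) ψ (a :: b :: l)
      = Γ.adjC a b * lev f (fun l' => ψ (a :: b :: l'.tail)) (b :: l) := by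
  rw [lev_tensor _ _ _ (by simp; omega)]
  exact lev_id_one _ a b

theorem lev_id_two_tensor {m n : ℕ} (f : Γ.GPA.Hom m n) (ψ : List V → ℂ) (a b c : V)
    {l : List V} (hl : l.length = m) :
    lev (Γ.GPA.tensor (m := 2) (n := 2) (Γ.GPA.id 2) f) ψ (a :: b :: c :: l)
      = Γ.adjC a b * Γ.adjC b c * lev f (fun l' => ψ (a :: b :: c :: l'.tail)) (c :: l) := by
  rw [lev_tensor _ _ _ (by simp; omega)]
  exact lev_id_two _ a b c

theorem lev_tensor_id {m n : ℕ} (f : Γ.GPA.Hom m n) (ψ : List V → ℂ) (b c : V) {l : List V}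
    (hl : l.length = m) :
    lev (Γ.GPA.tensor (m' := 1) (n' := 1) f (Γ.GPA.id 1)) ψ (l ++ [b, c])
      = Γ.adjC b c * lev f (fun l' => ψ (l' ++ [c])) (l ++ [b]) := by
  subst hl
  rw [lev_tensor _ _ _ (by simp)]
  have h1 : (l ++ [b, c]).drop l.length = [b, c] := by simp
  have h2 : (l ++ [b, c]).take (l.length + 1) = l ++ [b] := List.take_length_add_append 1
  rw [h1, h2]
  simp only [lev_id_one]
  rw [← lev_smul, lev, lev]
  refine Finset.sum_congr rfl fun p _ => ?_
  split_ifs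
  · refine Finset.sum_congr rfl fun q _ => ?_
    change _ = Γ.adjC b c * f.1 p q * _
    simp only [List.tail_cons]
    ring
  · rfl

open Classical in
/-- The evaluation, up to rescaling of the basis: `∑_e w_{s(e)}⁻¹ (e ē, s(e))`. -/
noncomputable def ratCap (w : V → ℂ) : Γ.GPA.Hom 2 0 :=
  ⟨fun p q => if p.Parallel q then (w (p.vert 0))⁻¹ else 0, fun _ _ h => if_neg h⟩

open Classical in
/-- The coevaluation, up to rescaling of the basis: `∑_e w_{t(e)} (s(e), e ē)`. -/
noncomputable def ratCup (w : V → ℂ) : Γ.GPA.Hom 0 2 :=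
  ⟨fun p q => if p.Parallel q then w (q.vert 1) else 0, fun _ _ h => if_neg h⟩

open Classical in
/-- The morphism `2 → 1` whose coordinate at a triangle with vertices `a, b, c` is `u a b c`. -/
noncomputable def ratVertex (u : V → V → V → ℂ) : Γ.GPA.Hom 2 1 :=
  ⟨fun p q => if p.Parallel q then u (p.vert 0) (p.vert 1) (p.vert 2) else 0,
    fun _ _ h => if_neg h⟩

variable (w : V → ℂ)

open Classical in
theorem lev_ratCap (ψ : List V → ℂ) (a b c : V) :
    lev (Γ := Γ) (ratCap w) ψ [a, b, c]
      = if a = c then Γ.adjC a b * (w a)⁻¹ * ψ [a] else 0 := by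
  by_cases h : ∃ p : Γ.Path 2, p.toList = [a, b, c]
  · obtain ⟨p, hp⟩ := h
    have hadj := Path.exists_toList_two.1 ⟨p, hp⟩
    have hp' := hp
    rw [Path.toList_two] at hp'
    simp only [List.cons.injEq, and_true] at hp'
    obtain ⟨rfl, rfl, rfl⟩ := hp'
    rw [← hp, lev_toList, adjC_of hadj.1]
    split_ifs with h
    · obtain ⟨q, hq⟩ := Path.exists_toList_zero (Γ := Γ) (p.1 0)
      have hq0 : q.1 0 = p.1 0 := by simpa [Path.toList] using hq
      rw [Finset.sum_eq_single q]
      · rw [hq]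
        have : p.Parallel q := ⟨hq0.symm, h.symm.trans hq0.symm⟩
        simp [ratCap, this, Path.vert]
      · intro q' _ hne
        have : ¬ p.Parallel q' := fun h' => hne (Path.ext fun i => by
          have hi : i = 0 := Fin.ext (by omega)
          subst hi
          exact h'.1.symm.trans hq0.symm)
        simp [ratCap, this]
      · simp
    · refine Finset.sum_eq_zero fun q _ => ?_
      have : ¬ p.Parallel q := fun h' => h (h'.1.trans h'.2.symm)
      simp [ratCap, this]
  · rw [lev_of_not _ _ h]
    split_ifs with hac
    · subst hac
      have : ¬ Γ.Adj a b := fun h' => h (Path.exists_toList_two.2 ⟨h', Γ.symm _ _ h'⟩)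
      simp [adjC, this]
    · rfl

theorem lev_ratCup (ψ : List V → ℂ) (a : V) :
    lev (Γ := Γ) (ratCup w) ψ [a] = ∑ b, Γ.adjC a b * w b * ψ [a, b, a] := by
  classical
  obtain ⟨p, hp⟩ := Path.exists_toList_zero (Γ := Γ) a
  have hp0 : p.1 0 = a := by simpa [Path.toList] using hp
  have key : ∀ q : Γ.Path 2, p.Parallel q ↔ a = q.1 0 ∧ a = q.1 2 := by
    intro q
    rw [← hp0]
    rfl
  refine (congrArg (lev (ratCup w) ψ) hp).symm.trans ((lev_toList _ _ _).trans ?_)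
  simp only [ratCup, ite_mul, zero_mul]
  refine Finset.sum_bij_ne_zero (fun q _ _ => q.1 1) (fun _ _ _ => Finset.mem_univ _) ?_ ?_ ?_
  · intro q _ hq q' _ hq' h
    have h1 := (key q).1 (by by_contra h'; exact hq (if_neg h'))
    have h2 := (key q').1 (by by_contra h'; exact hq' (if_neg h'))
    refine Path.toList_injective ?_
    rw [Path.toList_two, Path.toList_two, ← h1.1, ← h1.2, ← h2.1, ← h2.2, h]
  · intro b _ hb
    have hab : Γ.Adj a b := by
      by_contra h'
      exact hb (by rw [adjC, if_neg h', zero_mul, zero_mul])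
    obtain ⟨q, hq⟩ := Path.exists_toList_two.2 ⟨hab, Γ.symm _ _ hab⟩
    have hq' := hq
    rw [Path.toList_two] at hq'
    simp only [List.cons.injEq, and_true] at hq'
    refine ⟨q, Finset.mem_univ _, ?_, hq'.2.1⟩
    rw [if_pos ((key q).2 ⟨hq'.1.symm, hq'.2.2.symm⟩), hq, Path.vert, hq'.2.1]
    rwa [adjC_of hab, one_mul] at hb
  · intro q _ hq
    have h1 := (key q).1 (by by_contra h'; exact hq (if_neg h'))
    have hadj : Γ.Adj a (q.1 1) := by
      rw [h1.1]
      exact q.2 0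
    rw [if_pos ((key q).2 h1), adjC_of hadj, one_mul, Path.toList_two, ← h1.1, ← h1.2]
    rfl

theorem lev_ratVertex {u : V → V → V → ℂ}
    (hu : ∀ a b c, u a b c ≠ 0 → Γ.Adj a b ∧ Γ.Adj b c ∧ Γ.Adj a c)
    (ψ : List V → ℂ) (a b c : V) :
    lev (Γ := Γ) (ratVertex u) ψ [a, b, c] = u a b c * ψ [a, c] := by
  by_cases h : u a b c = 0
  · rw [h, zero_mul]
    by_cases h' : ∃ p : Γ.Path 2, p.toList = [a, b, c]
    · obtain ⟨p, hp⟩ := h'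
      have hp' := hp
      rw [Path.toList_two] at hp'
      simp only [List.cons.injEq, and_true] at hp'
      obtain ⟨rfl, rfl, rfl⟩ := hp'
      rw [← hp, lev_toList]
      refine Finset.sum_eq_zero fun q _ => ?_
      simp [ratVertex, Path.vert, h]
    · rw [lev_of_not _ _ h']
  · obtain ⟨h1, h2, h3⟩ := hu _ _ _ h
    obtain ⟨p, hp⟩ := Path.exists_toList_two.2 ⟨h1, h2⟩
    obtain ⟨q, hq⟩ := Path.exists_toList_one.2 h3
    have hp' := hp
    rw [Path.toList_two] at hp'
    simp only [List.cons.injEq, and_true] at hp'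
    obtain ⟨rfl, rfl, rfl⟩ := hp'
    have hq' := hq
    rw [Path.toList_one] at hq'
    simp only [List.cons.injEq, and_true] at hq'
    rw [← hp, lev_toList, Finset.sum_eq_single q]
    · rw [hq]
      have : p.Parallel q := ⟨hq'.1.symm, hq'.2.symm⟩
      simp [ratVertex, this, Path.vert]
    · intro q' _ hne
      have : ¬ p.Parallel q' := fun h' => hne (Path.toList_injective (by
        rw [hq, Path.toList_one, ← show p.1 0 = q'.1 0 from h'.1,
          ← show p.1 2 = q'.1 1 from h'.2]))
      simp [ratVertex, this]
    · simp

end LoopGraph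

/-! ### Cell systems -/

namespace LoopGraph

variable {V : Type} {Γ : LoopGraph V}

/-- Data from which a strict monoidal functor from the free trivalent category to the graph planar
algebra of `Γ` is built: nonzero weights `w a` of the vertices, and numbers `u a b c`, invariant
under cyclic permutations, attached to the closed walks of length three. -/
structure CellSystem (Γ : LoopGraph V) where
  w : V → ℂ
  u : V → V → V → ℂ
  w_ne_zero : ∀ a, w a ≠ 0
  cyclic : ∀ a b c, u a b c = u b c a
  supp : ∀ a b c, u a b c ≠ 0 → Γ.Adj a b

namespace CellSystem

variable (S : CellSystem Γ)

theorem adj {a b c : V} (h : S.u a b c ≠ 0) : Γ.Adj a b ∧ Γ.Adj b c ∧ Γ.Adj a c :=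
  ⟨S.supp _ _ _ h, S.supp _ _ _ (by rwa [← S.cyclic]),
    Γ.symm _ _ (S.supp _ _ _ (by rwa [← S.cyclic, ← S.cyclic]))⟩

variable [Fintype V]

/-- The interpretation of diagrams given by a cell system. -/
noncomputable def functor : StrictMonoidalFunctor G2.Free Γ.GPA :=
  G2.freeLift (ratCap S.w) (ratCup S.w) (ratVertex S.u)

/-- The operator on functions on lists of vertices given by a diagram. -/
noncomputable def ev {m n : ℕ} (f : G2.Free.Hom m n) : (List V → ℂ) → List V → ℂ :=
  lev (S.functor.map f)

theorem ev_ext {m n : ℕ} {f g : G2.Free.Hom m n}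
    (h : ∀ (ψ : List V → ℂ) (p : Γ.Path m), S.ev f ψ p.toList = S.ev g ψ p.toList) :
    S.functor.map f = S.functor.map g :=
  lev_ext h

theorem ev_comp {k m n : ℕ} (f : G2.Free.Hom k m) (g : G2.Free.Hom m n) (ψ : List V → ℂ)
    (l : List V) : S.ev (f ⨟ g) ψ l = S.ev f (S.ev g ψ) l := by
  rw [ev, S.functor.map_comp, lev_comp]
  rfl

theorem ev_id_tensor {m n : ℕ} (f : G2.Free.Hom m n) (ψ : List V → ℂ) (a b : V) {l : List V}
    (hl : l.length = m) :
    S.ev (G2.Free.tensor (m := 1) (n := 1) (G2.idn 1) f) ψ (a :: b :: l)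
      = Γ.adjC a b * S.ev f (fun l' => ψ (a :: b :: l'.tail)) (b :: l) := by
  rw [ev, S.functor.map_tensor]
  exact lev_id_tensor _ ψ a b hl

theorem ev_tensor_id {m n : ℕ} (f : G2.Free.Hom m n) (ψ : List V → ℂ) (b c : V) {l : List V}
    (hl : l.length = m) :
    S.ev (G2.Free.tensor (m' := 1) (n' := 1) f (G2.idn 1)) ψ (l ++ [b, c])
      = Γ.adjC b c * S.ev f (fun l' => ψ (l' ++ [c])) (l ++ [b]) := by
  rw [ev, S.functor.map_tensor]
  exact lev_tensor_id _ ψ b c hl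

theorem ev_add {m n : ℕ} (f g : G2.Free.Hom m n) (ψ : List V → ℂ) (l : List V) :
    S.ev (f + g) ψ l = S.ev f ψ l + S.ev g ψ l := by
  rw [ev, map_add, lev_add]
  rfl

theorem ev_smul {m n : ℕ} (c : ℂ) (f : G2.Free.Hom m n) (ψ : List V → ℂ) (l : List V) :
    S.ev (c • f) ψ l = c * S.ev f ψ l := by
  rw [ev, map_smul, lev_smul]
  rfl

open Classical in
theorem ev_cap (ψ : List V → ℂ) (a b c : V) :
    S.ev G2.cap ψ [a, b, c] = if a = c then Γ.adjC a b * (S.w a)⁻¹ * ψ [a] else 0 :=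
  lev_ratCap S.w ψ a b c

theorem ev_cup (ψ : List V → ℂ) (a : V) :
    S.ev G2.cup ψ [a] = ∑ b, Γ.adjC a b * S.w b * ψ [a, b, a] :=
  lev_ratCup S.w ψ a

theorem ev_vertex (ψ : List V → ℂ) (a b c : V) :
    S.ev G2.vertex ψ [a, b, c] = S.u a b c * ψ [a, c] :=
  lev_ratVertex (fun _ _ _ h => S.adj h) ψ a b c

theorem ev_id_zero (ψ : List V → ℂ) (a : V) : S.ev (G2.idn 0) ψ [a] = ψ [a] :=
  lev_id_zero ψ a

theorem ev_id_one (ψ : List V → ℂ) (a b : V) :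
    S.ev (G2.idn 1) ψ [a, b] = Γ.adjC a b * ψ [a, b] :=
  lev_id_one ψ a b

theorem ev_id_two (ψ : List V → ℂ) (a b c : V) :
    S.ev (G2.idn 2) ψ [a, b, c] = Γ.adjC a b * Γ.adjC b c * ψ [a, b, c] :=
  lev_id_two ψ a b c

theorem ev_id_two_tensor {m n : ℕ} (f : G2.Free.Hom m n) (ψ : List V → ℂ) (a b c : V)
    {l : List V} (hl : l.length = m) :
    S.ev (G2.Free.tensor (m := 2) (n := 2) (G2.idn 2) f) ψ (a :: b :: c :: l)
      = Γ.adjC a b * Γ.adjC b c * S.ev f (fun l' => ψ (a :: b :: c :: l'.tail)) (c :: l) := by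
  rw [ev, S.functor.map_tensor]
  exact lev_id_two_tensor _ ψ a b c hl

theorem ev_id_two_cup (ψ : List V → ℂ) (a b c : V) :
    S.ev (G2.idn 2 ⊠ G2.cup : G2.Free.Hom 2 4) ψ [a, b, c]
      = Γ.adjC a b * Γ.adjC b c * ∑ d, Γ.adjC c d * S.w d * ψ [a, b, c, d, c] := by
  refine (S.ev_id_two_tensor (m := 0) (n := 2) G2.cup ψ a b c (l := []) rfl).trans ?_
  rw [ev_cup]
  rfl

theorem ev_id_vertex (ψ : List V → ℂ) (a b c d : V) :
    S.ev (G2.idn 1 ⊠ G2.vertex : G2.Free.Hom 3 2) ψ [a, b, c, d]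
      = Γ.adjC a b * (S.u b c d * ψ [a, b, d]) := by
  refine (S.ev_id_tensor (m := 2) (n := 1) G2.vertex ψ a b (l := [c, d]) rfl).trans ?_
  rw [ev_vertex]
  rfl

theorem ev_vertex_id (ψ : List V → ℂ) (a b c d : V) :
    S.ev (G2.vertex ⊠ G2.idn 1 : G2.Free.Hom 3 2) ψ [a, b, c, d]
      = Γ.adjC c d * (S.u a b c * ψ [a, c, d]) := by
  refine (S.ev_tensor_id (m := 2) (n := 1) G2.vertex ψ c d (l := [a, b]) rfl).trans ?_
  refine congrArg (_ * ·) (ev_vertex _ _ a b c)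

theorem ev_covertex (ψ : List V → ℂ) (a c : V) :
    S.ev G2.covertex ψ [a, c] = ∑ x, S.w x * S.u a c x * ψ [a, x, c] := by
  refine (S.ev_comp (k := 1) (m := 3) (n := 2) _ _ ψ [a, c]).trans ?_
  refine (S.ev_id_tensor (m := 0) (n := 2) G2.cup _ a c (l := []) rfl).trans ?_
  rw [ev_cup, Finset.mul_sum]
  refine Finset.sum_congr rfl fun x _ => ?_
  refine (congrArg (fun t => Γ.adjC a c * (Γ.adjC c x * S.w x * t))
    (S.ev_vertex_id ψ a c x c)).trans ?_
  by_cases h : S.u a c x = 0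
  · simp [h]
  · obtain ⟨h1, h2, h3⟩ := S.adj h
    rw [adjC_of h1, adjC_of h2, adjC_of (Γ.symm _ _ h2)]
    ring

theorem ev_covertex_id (ψ : List V → ℂ) (a b c : V) :
    S.ev (G2.covertex ⊠ G2.idn 1 : G2.Free.Hom 2 3) ψ [a, b, c]
      = Γ.adjC b c * ∑ x, S.w x * S.u a b x * ψ [a, x, b, c] := by
  refine (S.ev_tensor_id (m := 1) (n := 2) G2.covertex ψ b c (l := [a]) rfl).trans ?_
  refine congrArg (_ * ·) (ev_covertex _ _ a b)

theorem ev_id_covertex (ψ : List V → ℂ) (a b c : V) :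
    S.ev (G2.idn 1 ⊠ G2.covertex : G2.Free.Hom 2 3) ψ [a, b, c]
      = Γ.adjC a b * ∑ x, S.w x * S.u b c x * ψ [a, b, x, c] := by
  refine (S.ev_id_tensor (m := 1) (n := 2) G2.covertex ψ a b (l := [c]) rfl).trans ?_
  rw [ev_covertex]
  rfl

theorem ev_treeH (ψ : List V → ℂ) (a b c : V) :
    S.ev G2.treeH ψ [a, b, c] = ∑ x, S.w x * S.u a b x * S.u x b c * ψ [a, x, c] := by
  refine (S.ev_comp (k := 2) (m := 3) (n := 2) _ _ ψ [a, b, c]).trans ?_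
  rw [ev_covertex_id, Finset.mul_sum]
  refine Finset.sum_congr rfl fun x _ => ?_
  rw [ev_id_vertex]
  by_cases h : S.u a b x = 0
  · simp [h]
  by_cases h' : S.u x b c = 0
  · simp [h']
  rw [adjC_of (S.adj h).2.2, adjC_of (S.adj h').2.1]
  ring

theorem ev_treeI (ψ : List V → ℂ) (a b c : V) :
    S.ev G2.treeI ψ [a, b, c] = ∑ x, S.w x * S.u a b c * S.u a c x * ψ [a, x, c] := by
  refine (S.ev_comp (k := 2) (m := 1) (n := 2) _ _ ψ [a, b, c]).trans ?_
  rw [ev_vertex, ev_covertex, Finset.mul_sum]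
  exact Finset.sum_congr rfl fun x _ => by ring

open Classical in
theorem ev_cap_id (ψ : List V → ℂ) (a b c d : V) :
    S.ev (G2.cap ⊠ G2.idn 1 : G2.Free.Hom 3 1) ψ [a, b, c, d]
      = if a = c then Γ.adjC a b * Γ.adjC c d * (S.w a)⁻¹ * ψ [a, d] else 0 := by
  refine (S.ev_tensor_id (m := 2) (n := 0) G2.cap ψ c d (l := [a, b]) rfl).trans ?_
  refine (congrArg (_ * ·) (ev_cap _ _ a b c)).trans ?_
  split_ifs
  · simp only [List.cons_append, List.nil_append]
    ring
  · exact mul_zero _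

open Classical in
theorem ev_id_cap (ψ : List V → ℂ) (a b c d : V) :
    S.ev (G2.idn 1 ⊠ G2.cap : G2.Free.Hom 3 1) ψ [a, b, c, d]
      = if b = d then Γ.adjC a b * Γ.adjC b c * (S.w b)⁻¹ * ψ [a, b] else 0 := by
  refine (S.ev_id_tensor (m := 2) (n := 0) G2.cap ψ a b (l := [c, d]) rfl).trans ?_
  rw [ev_cap]
  split_ifs
  · simp only [List.tail_cons]
    ring
  · exact mul_zero _

theorem ev_cup_id (ψ : List V → ℂ) (a b : V) :
    S.ev (G2.cup ⊠ G2.idn 1 : G2.Free.Hom 1 3) ψ [a, b]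
      = Γ.adjC a b * ∑ x, Γ.adjC a x * S.w x * ψ [a, x, a, b] := by
  refine (S.ev_tensor_id (m := 0) (n := 2) G2.cup ψ a b (l := []) rfl).trans ?_
  exact congrArg (_ * ·) (ev_cup _ _ a)

theorem ev_id_cup (ψ : List V → ℂ) (a b : V) :
    S.ev (G2.idn 1 ⊠ G2.cup : G2.Free.Hom 1 3) ψ [a, b]
      = Γ.adjC a b * ∑ x, Γ.adjC b x * S.w x * ψ [a, b, x, b] := by
  refine (S.ev_id_tensor (m := 0) (n := 2) G2.cup ψ a b (l := []) rfl).trans ?_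
  rw [ev_cup]
  rfl

open Classical in
theorem ev_cap_id_three (ψ : List V → ℂ) (a b c d e f : V) :
    S.ev (G2.cap ⊠ G2.idn 3 : G2.Free.Hom 5 3) ψ [a, b, c, d, e, f]
      = if a = c then Γ.adjC a b * (S.w a)⁻¹ * (Γ.adjC c d * Γ.adjC d e * Γ.adjC e f)
        * ψ [a, d, e, f] else 0 := by
  rw [ev, S.functor.map_tensor]
  refine (lev_tensor (m := 2) (n := 0) (m' := 3) (n' := 3) _ _ ψ rfl).trans ?_
  refine (S.ev_cap _ a b c).trans ?_
  split_ifs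
  · refine (congrArg (_ * ·) (lev_id_three _ c d e f)).trans ?_
    simp only [List.cons_append, List.nil_append, List.tail_cons]
    ring
  · rfl

end CellSystem
end LoopGraph

/-! ### The relations of `G₂(q)` for a cell system -/

namespace LoopGraph

namespace CellSystem

variable {V : Type} {Γ : LoopGraph V}

theorem adjC_comm (a b : V) : Γ.adjC a b = Γ.adjC b a := by
  by_cases h : Γ.Adj a b
  · rw [adjC_of h, adjC_of (Γ.symm _ _ h)]
  · rw [adjC, adjC, if_neg h, if_neg fun h' => h (Γ.symm _ _ h')]

theorem adjC_mul_self (a b : V) : Γ.adjC a b * Γ.adjC a b = Γ.adjC a b := by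
  rw [adjC]
  split_ifs <;> simp

theorem adjC_eq_zero_or_one (a b : V) : Γ.adjC a b = 0 ∨ Γ.adjC a b = 1 := by
  rw [adjC]
  split_ifs <;> simp

variable [Fintype V] (S : CellSystem Γ)

theorem map_zigzag_left :
    S.functor.map ((G2.idn 1 ⊠ G2.cup) ⨟ (G2.cap ⊠ G2.idn 1) : G2.Free.Hom 1 1)
      = S.functor.map (G2.idn 1) := by
  classical
  refine S.ev_ext fun ψ p => ?_
  rw [Path.toList_one]
  generalize p.1 0 = a, p.1 1 = b
  rw [ev_id_one]
  refine (S.ev_comp (k := 1) (m := 3) (n := 1) _ _ ψ [a, b]).trans ?_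
  rw [ev_id_cup]
  simp only [ev_cap_id, mul_ite, mul_zero, Finset.sum_ite_eq, Finset.mem_univ, if_true]
  rw [adjC_comm b a]
  have h1 := S.w_ne_zero a
  have h2 := adjC_mul_self (Γ := Γ) a b
  field_simp
  linear_combination (Γ.adjC a b ^ 2 + Γ.adjC a b + 1) * h2 * ψ [a, b]

theorem map_zigzag_right :
    S.functor.map ((G2.cup ⊠ G2.idn 1) ⨟ (G2.idn 1 ⊠ G2.cap) : G2.Free.Hom 1 1)
      = S.functor.map (G2.idn 1) := by
  classical
  refine S.ev_ext fun ψ p => ?_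
  rw [Path.toList_one]
  generalize p.1 0 = a, p.1 1 = b
  rw [ev_id_one]
  refine (S.ev_comp (k := 1) (m := 3) (n := 1) _ _ ψ [a, b]).trans ?_
  rw [ev_cup_id]
  simp only [ev_id_cap, mul_ite, mul_zero, Finset.sum_ite_eq', Finset.mem_univ, if_true]
  rw [adjC_comm b a]
  have h1 := S.w_ne_zero b
  have h2 := adjC_mul_self (Γ := Γ) a b
  field_simp
  linear_combination (Γ.adjC a b ^ 2 + Γ.adjC a b + 1) * h2 * ψ [a, b]

theorem ev_loop (ψ : List V → ℂ) (a : V) :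
    S.ev G2.loop ψ [a] = (∑ x, Γ.adjC a x * S.w x) * (S.w a)⁻¹ * ψ [a] := by
  refine (S.ev_comp (k := 0) (m := 2) (n := 0) _ _ ψ [a]).trans ?_
  rw [ev_cup, Finset.sum_mul, Finset.sum_mul]
  refine Finset.sum_congr rfl fun x _ => ?_
  rw [ev_cap, if_pos rfl]
  linear_combination S.w x * (S.w a)⁻¹ * ψ [a] * adjC_mul_self (Γ := Γ) a x

theorem ev_lollipop (ψ : List V → ℂ) (a : V) :
    S.ev G2.lollipop ψ [a] = (∑ x, S.w x * S.u a a x) * ψ [a, a] := by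
  refine (S.ev_comp (k := 0) (m := 2) (n := 1) _ _ ψ [a]).trans ?_
  rw [ev_cup, Finset.sum_mul]
  refine Finset.sum_congr rfl fun x _ => ?_
  rw [ev_vertex, ← S.cyclic a a x]
  by_cases h : S.u a a x = 0
  · simp [h]
  · rw [adjC_of (S.adj h).2.1]
    ring

theorem ev_bigon (ψ : List V → ℂ) (a b : V) :
    S.ev G2.bigon ψ [a, b] = (∑ x, S.w x * (S.u a b x * S.u a x b)) * ψ [a, b] := by
  refine (S.ev_comp (k := 1) (m := 2) (n := 1) _ _ ψ [a, b]).trans ?_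
  rw [ev_covertex, Finset.sum_mul]
  exact Finset.sum_congr rfl fun x _ => by rw [ev_vertex]; ring

theorem ev_trigon (ψ : List V → ℂ) (a b c : V) :
    S.ev G2.trigon ψ [a, b, c]
      = (∑ x, S.w x * (S.u a b x * S.u b c x * S.u c a x)) * ψ [a, c] := by
  refine (S.ev_comp (k := 2) (m := 2) (n := 1) _ _ ψ [a, b, c]).trans ?_
  rw [ev_treeH, Finset.sum_mul]
  refine Finset.sum_congr rfl fun x _ => ?_
  rw [ev_vertex, S.cyclic x b c, S.cyclic a x c, S.cyclic x c a]
  ring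

theorem ev_tetragon (ψ : List V → ℂ) (a b c : V) :
    S.ev G2.tetragon ψ [a, b, c]
      = ∑ y, S.w y * (∑ x, S.w x * (S.u a b x * S.u b c x * S.u c y x * S.u y a x))
        * ψ [a, y, c] := by
  refine (S.ev_comp (k := 2) (m := 2) (n := 2) _ _ ψ [a, b, c]).trans ?_
  rw [ev_treeH]
  simp only [ev_treeH, Finset.mul_sum, Finset.sum_mul]
  rw [Finset.sum_comm]
  refine Finset.sum_congr rfl fun y _ => Finset.sum_congr rfl fun x _ => ?_
  rw [S.cyclic x b c, ← S.cyclic y a x, S.cyclic y x c, S.cyclic x c y]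
  ring

/-- The diagram `f` with two points at the bottom and three at the top has value
`φ a b c d e`, where `a, b, c, d, e` are the labels of the five regions in cyclic order. -/
def HasValue (f : G2.Free.Hom 2 3) (φ : V → V → V → V → V → ℂ) : Prop :=
  ∀ (ψ : List V → ℂ) (a b c : V), S.ev f ψ [a, b, c]
    = ∑ x, ∑ y, Γ.adjC a b * Γ.adjC b c * Γ.adjC c y * Γ.adjC y x * Γ.adjC x a
      * (S.w x * S.w y * φ a b c y x) * ψ [a, x, y, c]

theorem hasValue_strandVertex [DecidableEq V] :
    S.HasValue G2.strandVertex fun _ b c d e => if b = e then (S.w b)⁻¹ * S.u b c d else 0 := by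
  intro ψ a b c
  refine (S.ev_id_covertex ψ a b c).trans ?_
  simp only [mul_ite, ite_mul, mul_zero, zero_mul]
  rw [Finset.sum_comm]
  simp only [Finset.sum_ite_eq, Finset.mem_univ, if_true]
  rw [Finset.mul_sum]
  refine Finset.sum_congr rfl fun y _ => ?_
  by_cases h : S.u b c y = 0
  · simp [h]
  · obtain ⟨h1, h2, h3⟩ := S.adj h
    have hw := S.w_ne_zero b
    rw [adjC_of h1, adjC_of h2, adjC_of (Γ.symm _ _ h3), adjC_comm b a]
    field_simp
    linear_combination -S.w y * ψ [a, b, y, c] * adjC_mul_self (Γ := Γ) a b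

theorem hasValue_tree5 :
    S.HasValue G2.tree5 fun a b c d e => S.u a b c * S.u a c d * S.u a d e := by
  intro ψ a b c
  refine (S.ev_comp (k := 2) (m := 2) (n := 3) _ _ ψ [a, b, c]).trans ?_
  rw [ev_treeI]
  simp only [ev_covertex_id, Finset.mul_sum]
  rw [Finset.sum_comm]
  refine Finset.sum_congr rfl fun x _ => Finset.sum_congr rfl fun y _ => ?_
  by_cases h : S.u a b c = 0
  · simp [h]
  by_cases h' : S.u a c y = 0
  · simp [h']
  by_cases h'' : S.u a y x = 0
  · simp [h'']
  rw [adjC_of (S.adj h).1, adjC_of (S.adj h).2.1, adjC_of (S.adj h').2.1, adjC_of (S.adj h'').2.1,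
    adjC_of (Γ.symm _ _ (S.adj h'').2.2), adjC_of (Γ.symm _ _ (S.adj h').2.1)]
  ring

theorem hasValue_pentagon :
    S.HasValue G2.pentagon fun a b c d e =>
      ∑ x, S.w x * (S.u a b x * S.u b c x * S.u c d x * S.u d e x * S.u e a x) := by
  intro ψ a b c
  refine (S.ev_comp (k := 2) (m := 4) (n := 3) _ _ ψ [a, b, c]).trans ?_
  refine (S.ev_comp (k := 2) (m := 3) (n := 4) _ _ _ [a, b, c]).trans ?_
  refine (S.ev_comp (k := 2) (m := 2) (n := 3) _ _ _ [a, b, c]).trans ?_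
  rw [ev_treeH]
  have h1 : ∀ (ψ : List V → ℂ) (a b c d : V),
      S.ev (G2.idn 1 ⊠ G2.covertex ⊠ G2.idn 1 : G2.Free.Hom 3 4) ψ [a, b, c, d]
        = Γ.adjC a b * Γ.adjC c d * ∑ x, S.w x * S.u b c x * ψ [a, b, x, c, d] := by
    intro ψ a b c d
    refine (S.ev_id_tensor (m := 2) (n := 3) _ ψ a b (l := [c, d]) rfl).trans ?_
    rw [mul_assoc]
    exact congrArg (_ * ·) (S.ev_covertex_id _ b c d)
  have h2 : ∀ (ψ : List V → ℂ) (a b c d e : V),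
      S.ev (G2.idn 2 ⊠ G2.vertex : G2.Free.Hom 4 3) ψ [a, b, c, d, e]
        = Γ.adjC a b * Γ.adjC b c * (S.u c d e * ψ [a, b, c, e]) := by
    intro ψ a b c d e
    refine (S.ev_id_two_tensor (m := 2) (n := 1) _ ψ a b c (l := [d, e]) rfl).trans ?_
    rw [ev_vertex]
    rfl
  simp only [ev_covertex_id, h1, h2, Finset.mul_sum, Finset.sum_mul]
  rw [Finset.sum_comm]
  refine Finset.sum_congr rfl fun y _ => ?_
  rw [Finset.sum_comm]
  refine Finset.sum_congr rfl fun z _ => Finset.sum_congr rfl fun x _ => ?_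
  rw [S.cyclic x b c, S.cyclic a x y, S.cyclic x y a, S.cyclic y x z, S.cyclic x z y,
    S.cyclic z x c, S.cyclic x c z]
  by_cases e1 : S.u a b x = 0
  · simp [e1]
  by_cases e2 : S.u b c x = 0
  · simp [e2]
  by_cases e3 : S.u y a x = 0
  · simp [e3]
  by_cases e4 : S.u z y x = 0
  · simp [e4]
  by_cases e5 : S.u c z x = 0
  · simp [e5]
  rw [adjC_of (S.adj e1).1, adjC_of (S.adj e2).1, adjC_of (S.adj e5).1, adjC_of (S.adj e4).1,
    adjC_of (S.adj e3).1, adjC_comm x c, adjC_of (S.adj e2).2.1, adjC_comm a y,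
    adjC_of (S.adj e3).1, adjC_comm y z, adjC_of (S.adj e4).1]
  ring

variable {S} in
/-- Rotating a diagram by one click rotates the labels of the regions. -/
theorem HasValue.rotate {f : G2.Free.Hom 2 3} {φ : V → V → V → V → V → ℂ}
    (h : S.HasValue f φ) : S.HasValue (G2.rotate23 f) fun a b c d e => φ b c d e a := by
  classical
  intro ψ a b c
  refine (S.ev_comp (k := 2) (m := 5) (n := 3) _ _ ψ [a, b, c]).trans ?_
  refine (S.ev_comp (k := 2) (m := 4) (n := 5) _ _ _ [a, b, c]).trans ?_
  rw [ev_id_two_cup]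
  have h1 : ∀ (ψ : List V → ℂ) (a b c d e : V),
      S.ev (G2.idn 1 ⊠ f ⊠ G2.idn 1 : G2.Free.Hom 4 5) ψ [a, b, c, d, e]
        = Γ.adjC a b * (Γ.adjC d e * ∑ x, ∑ y,
          Γ.adjC b c * Γ.adjC c d * Γ.adjC d y * Γ.adjC y x * Γ.adjC x b
            * (S.w x * S.w y * φ b c d y x) * ψ [a, b, x, y, d, e]) := by
    intro ψ a b c d e
    refine (S.ev_id_tensor (m := 3) (n := 4) _ ψ a b (l := [c, d, e]) rfl).trans ?_
    refine congrArg (_ * ·) ((S.ev_tensor_id (m := 2) (n := 3) f _ d e (l := [b, c]) rfl).trans ?_)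
    exact congrArg (_ * ·) (h _ b c d)
  simp only [h1, ev_cap_id_three, mul_ite, mul_zero, Finset.sum_ite_irrel, Finset.sum_const_zero,
    Finset.mul_sum]
  simp only [Finset.sum_ite_eq, Finset.mem_univ, if_true]
  rw [Finset.sum_comm]
  refine Finset.sum_congr rfl fun y _ => Finset.sum_congr rfl fun d _ => ?_
  rw [adjC_comm d c, adjC_comm a y]
  rcases adjC_eq_zero_or_one (Γ := Γ) a b with e | e
  · simp [e]
  rcases adjC_eq_zero_or_one (Γ := Γ) b c with e' | e'
  · simp [e']
  rcases adjC_eq_zero_or_one (Γ := Γ) c d with e₁ | e₁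
  · simp [e₁]
  rcases adjC_eq_zero_or_one (Γ := Γ) d y with e₂ | e₂
  · simp [e₂]
  rcases adjC_eq_zero_or_one (Γ := Γ) y a with e₃ | e₃
  · simp [e₃]
  rw [e, e', e₁, e₂, e₃, adjC_comm y d, e₂]
  have hw := S.w_ne_zero a
  field_simp

variable {S} in
theorem HasValue.add {f g : G2.Free.Hom 2 3} {φ χ : V → V → V → V → V → ℂ}
    (hf : S.HasValue f φ) (hg : S.HasValue g χ) :
    S.HasValue (f + g) fun a b c d e => φ a b c d e + χ a b c d e := by
  intro ψ a b c
  rw [ev_add, hf, hg, ← Finset.sum_add_distrib]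
  refine Finset.sum_congr rfl fun x _ => ?_
  rw [← Finset.sum_add_distrib]
  exact Finset.sum_congr rfl fun y _ => by ring

variable {S} in
theorem HasValue.smul {f : G2.Free.Hom 2 3} {φ : V → V → V → V → V → ℂ} (k : ℂ)
    (hf : S.HasValue f φ) : S.HasValue (k • f) fun a b c d e => k * φ a b c d e := by
  intro ψ a b c
  rw [ev_smul, hf, Finset.mul_sum]
  refine Finset.sum_congr rfl fun x _ => ?_
  rw [Finset.mul_sum]
  exact Finset.sum_congr rfl fun y _ => by ring

variable {S} in
/-- The sum over the five rotations of a diagram. -/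
theorem HasValue.sum_rotate {f : G2.Free.Hom 2 3} {φ : V → V → V → V → V → ℂ}
    (h : S.HasValue f φ) :
    S.HasValue (∑ i ∈ Finset.range 5, G2.rotate23^[i] f) fun a b c d e =>
      φ a b c d e + φ b c d e a + φ c d e a b + φ d e a b c + φ e a b c d := by
  simp only [Finset.sum_range_succ, Finset.sum_range_zero, zero_add, Function.iterate_succ_apply',
    Function.iterate_zero_apply]
  have h1 := HasValue.rotate h
  have h2 := HasValue.rotate h1
  have h3 := HasValue.rotate h2
  exact (((h.add h1).add h2).add h3).add (HasValue.rotate h3)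

variable {S} in
/-- Diagrams with two points at the bottom and three at the top have the same image if their values
agree on closed walks. -/
theorem HasValue.map_eq {f g : G2.Free.Hom 2 3} {φ χ : V → V → V → V → V → ℂ}
    (hf : S.HasValue f φ) (hg : S.HasValue g χ)
    (h : ∀ a b c d e, Γ.Adj a b → Γ.Adj b c → Γ.Adj c d → Γ.Adj d e → Γ.Adj e a →
      φ a b c d e = χ a b c d e) : S.functor.map f = S.functor.map g := by
  refine S.ev_ext fun ψ p => ?_
  rw [Path.toList_two, hf, hg]
  generalize p.1 0 = a, p.1 1 = b, p.1 2 = c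
  refine Finset.sum_congr rfl fun x _ => Finset.sum_congr rfl fun y _ => ?_
  by_cases h' : Γ.Adj a b ∧ Γ.Adj b c ∧ Γ.Adj c y ∧ Γ.Adj y x ∧ Γ.Adj x a
  · rw [h _ _ _ _ _ h'.1 h'.2.1 h'.2.2.1 h'.2.2.2.1 h'.2.2.2.2]
  · have e : Γ.adjC a b * Γ.adjC b c * Γ.adjC c y * Γ.adjC y x * Γ.adjC x a = 0 := by
      by_contra h0
      refine h' ⟨?_, ?_, ?_, ?_, ?_⟩ <;>
      · by_contra h1
        exact h0 (by simp [adjC, h1])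
    rw [e, zero_mul, zero_mul, zero_mul, zero_mul]

/-- The trivalent vertex is invariant under rotation because the cells are invariant under cyclic
permutations. -/
theorem map_rotate21 : S.functor.map (G2.rotate21 G2.vertex) = S.functor.map G2.vertex := by
  classical
  refine S.ev_ext fun ψ p => ?_
  rw [Path.toList_two]
  generalize p.1 0 = a, p.1 1 = b, p.1 2 = c
  refine (S.ev_comp (k := 2) (m := 3) (n := 1) _ _ ψ [a, b, c]).trans ?_
  refine (S.ev_comp (k := 2) (m := 4) (n := 3) _ _ _ [a, b, c]).trans ?_
  rw [ev_id_two_cup, ev_vertex]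
  have h1 : ∀ (ψ : List V → ℂ) (a b c d e : V),
      S.ev (G2.idn 1 ⊠ G2.vertex ⊠ G2.idn 1 : G2.Free.Hom 4 3) ψ [a, b, c, d, e]
        = Γ.adjC a b * Γ.adjC d e * (S.u b c d * ψ [a, b, d, e]) := by
    intro ψ a b c d e
    refine (S.ev_id_tensor (m := 3) (n := 2) _ ψ a b (l := [c, d, e]) rfl).trans ?_
    rw [mul_assoc]
    exact congrArg (_ * ·) (S.ev_vertex_id _ b c d e)
  simp only [h1, ev_cap_id, mul_ite, mul_zero, Finset.sum_ite_eq, Finset.mem_univ, if_true]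
  rw [S.cyclic a b c]
  by_cases h : S.u b c a = 0
  · simp [h]
  obtain ⟨h1, h2, h3⟩ := S.adj h
  rw [adjC_of h1, adjC_of h2, adjC_of (Γ.symm _ _ h3), adjC_of (Γ.symm _ _ h2)]
  have hw := S.w_ne_zero a
  field_simp

/-- The equations on a cell system which express that the defining relations of the trivalent
category `G₂` hold, with coefficients `d` (loop), `B` (bigon), `τ` (trigon), `α` and `β`
(tetragon). -/
structure IsSolution [DecidableEq V] (d B τ α β : ℂ) : Prop where
  loop : ∀ a, ∑ x, Γ.adjC a x * S.w x = d * S.w a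
  lollipop : ∀ a, Γ.Adj a a → ∑ x, S.w x * S.u a a x = 0
  bigon : ∀ a b, Γ.Adj a b → ∑ x, S.w x * (S.u a b x * S.u a x b) = B
  trigon : ∀ a b c, Γ.Adj a b → Γ.Adj b c → Γ.Adj c a →
    ∑ x, S.w x * (S.u a b x * S.u b c x * S.u c a x) = -τ * S.u a b c
  tetragon : ∀ a b c d, Γ.Adj a b → Γ.Adj b c → Γ.Adj c d → Γ.Adj d a →
    ∑ x, S.w x * (S.u a b x * S.u b c x * S.u c d x * S.u d a x)
      = α * (S.u a b c * S.u a c d + S.u a b d * S.u d b c)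
        + β * ((if b = d then (S.w b)⁻¹ else 0) + if a = c then (S.w a)⁻¹ else 0)
  pentagon : ∀ a b c d e, Γ.Adj a b → Γ.Adj b c → Γ.Adj c d → Γ.Adj d e → Γ.Adj e a →
    ∑ x, S.w x * (S.u a b x * S.u b c x * S.u c d x * S.u d e x * S.u e a x)
      = -(S.u a b c * S.u a c d * S.u a d e + S.u b c d * S.u b d e * S.u b e a
          + S.u c d e * S.u c e a * S.u c a b + S.u d e a * S.u d a b * S.u d b c
          + S.u e a b * S.u e b c * S.u e c d)
        - ((if b = e then (S.w b)⁻¹ * S.u b c d else 0)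
          + (if c = a then (S.w c)⁻¹ * S.u c d e else 0)
          + (if d = b then (S.w d)⁻¹ * S.u d e a else 0)
          + (if e = c then (S.w e)⁻¹ * S.u e a b else 0)
          + if a = d then (S.w a)⁻¹ * S.u a b c else 0)

variable {S} in
/-- The functor given by a solution of the cell equations respects the relations of `G₂(q)`. -/
theorem IsSolution.map_eq [DecidableEq V] {d B τ α β : ℂ} (h : S.IsSolution d B τ α β) {q : ℂ}
    (hd : q ^ (10 : ℤ) + q ^ (8 : ℤ) + q ^ (2 : ℤ) + 1 + q ^ (-2 : ℤ)
      + q ^ (-8 : ℤ) + q ^ (-10 : ℤ) = d) (hB : G2.qInt q 7 - 1 = B)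
    (hτ : q ^ (4 : ℤ) + 1 + q ^ (-4 : ℤ) = τ) (hα : q ^ (2 : ℤ) + q ^ (-2 : ℤ) = α)
    (hβ : q ^ (2 : ℤ) + 1 + q ^ (-2 : ℤ) = β) {m n : ℕ} {f g : G2.Free.Hom m n}
    (hfg : G2.Skein q f g) : S.functor.map f = S.functor.map g := by
  cases hfg with
  | zigzag_left => exact S.map_zigzag_left
  | zigzag_right => exact S.map_zigzag_right
  | loop =>
    refine S.ev_ext fun ψ p => ?_
    rw [Path.toList_zero, ev_smul, ev_id_zero, ev_loop, h.loop, hd,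
      mul_inv_cancel_right₀ (S.w_ne_zero _)]
  | lollipop =>
    refine S.ev_ext fun ψ p => ?_
    have h0 : S.ev (0 : G2.Free.Hom 0 1) ψ p.toList = 0 := by
      rw [ev, map_zero, lev_zero]
    rw [h0, Path.toList_zero, ev_lollipop]
    by_cases ha : Γ.Adj (p.1 0) (p.1 0)
    · rw [h.lollipop _ ha, zero_mul]
    · rw [Finset.sum_eq_zero, zero_mul]
      intro x _
      by_contra hx
      exact ha (S.adj (right_ne_zero_of_mul hx)).1
  | rotate => exact S.map_rotate21
  | bigon =>
    refine S.ev_ext fun ψ p => ?_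
    have h1 : Γ.Adj (p.1 0) (p.1 1) := p.2 0
    rw [Path.toList_one, ev_smul, ev_id_one, ev_bigon, h.bigon _ _ h1, hB, adjC_of h1, one_mul]
  | trigon =>
    refine S.ev_ext fun ψ p => ?_
    rw [Path.toList_two, ev_smul, ev_vertex, ev_trigon, hτ]
    have h1 : Γ.Adj (p.1 0) (p.1 1) := p.2 0
    have h2 : Γ.Adj (p.1 1) (p.1 2) := p.2 1
    by_cases h3 : Γ.Adj (p.1 2) (p.1 0)
    · rw [h.trigon _ _ _ h1 h2 h3]
      ring
    · have h4 : S.u (p.1 0) (p.1 1) (p.1 2) = 0 := by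
        by_contra h4
        exact h3 (Γ.symm _ _ (S.adj h4).2.2)
      rw [h4, Finset.sum_eq_zero]
      · ring
      · intro x _
        by_contra hx
        exact h3 (S.adj (right_ne_zero_of_mul (right_ne_zero_of_mul hx))).1
  | tetragon =>
    refine S.ev_ext fun ψ p => ?_
    have h1 : Γ.Adj (p.1 0) (p.1 1) := p.2 0
    have h2 : Γ.Adj (p.1 1) (p.1 2) := p.2 1
    rw [Path.toList_two, ev_add, ev_smul, ev_smul, ev_add, ev_add, ev_id_two, ev_tetragon, ev_treeI,
      ev_treeH, hα, hβ]
    revert h1 h2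
    generalize p.1 0 = a, p.1 1 = b, p.1 2 = c
    intro h1 h2
    have e1 : S.ev (G2.cap ⨟ G2.cup) ψ [a, b, c]
        = ∑ y, S.w y * (if a = c then Γ.adjC a y * (S.w a)⁻¹ else 0) * ψ [a, y, c] := by
      refine (S.ev_comp (k := 2) (m := 0) (n := 2) _ _ ψ [a, b, c]).trans ?_
      rw [ev_cap]
      split_ifs with hac
      · subst hac
        rw [ev_cup, Finset.mul_sum, adjC_of h1]
        exact Finset.sum_congr rfl fun y _ => by ring
      · simp
    have e2 : ψ [a, b, c]
        = ∑ y, S.w y * (if b = y then (S.w b)⁻¹ else 0) * ψ [a, y, c] := by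
      simp [S.w_ne_zero b]
    rw [e1, adjC_of h1, adjC_of h2, one_mul, one_mul, e2, ← Finset.sum_add_distrib,
      ← Finset.sum_add_distrib, Finset.mul_sum, Finset.mul_sum, ← Finset.sum_add_distrib]
    refine Finset.sum_congr rfl fun y _ => ?_
    by_cases h3 : Γ.Adj c y ∧ Γ.Adj y a
    · rw [h.tetragon a b c y h1 h2 h3.1 h3.2, adjC_of (Γ.symm _ _ h3.2), one_mul]
      ring
    · have e3 : (∑ x, S.w x * (S.u a b x * S.u b c x * S.u c y x * S.u y a x)) = 0 := by
        refine Finset.sum_eq_zero fun x _ => ?_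
        by_contra hx
        have hx' := right_ne_zero_of_mul hx
        exact h3 ⟨(S.adj (right_ne_zero_of_mul (left_ne_zero_of_mul hx'))).1,
          (S.adj (right_ne_zero_of_mul hx')).1⟩
      have e4 : S.u a b c * S.u a c y = 0 := by
        by_contra hx
        have hx' := S.adj (right_ne_zero_of_mul hx)
        exact h3 ⟨hx'.2.1, Γ.symm _ _ hx'.2.2⟩
      have e5 : S.u a b y * S.u y b c = 0 := by
        by_contra hx
        exact h3 ⟨Γ.symm _ _ (S.adj (right_ne_zero_of_mul hx)).2.2,
          Γ.symm _ _ (S.adj (left_ne_zero_of_mul hx)).2.2⟩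
      have e6 : (if b = y then (S.w b)⁻¹ else 0) = 0 :=
        if_neg (by rintro rfl; exact h3 ⟨Γ.symm _ _ h2, Γ.symm _ _ h1⟩)
      have e7 : (if a = c then Γ.adjC a y * (S.w a)⁻¹ else 0) = 0 := by
        split_ifs with hac
        · subst hac
          have : ¬ Γ.Adj a y := fun hay => h3 ⟨hay, Γ.symm _ _ hay⟩
          rw [adjC, if_neg this, zero_mul]
        · rfl
      rw [e3, e6, e7]
      linear_combination -α * S.w y * ψ [a, y, c] * (e4 + e5)
  | pentagon =>
    refine HasValue.map_eq S.hasValue_pentagon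
      ((S.hasValue_tree5.sum_rotate.smul (-1)).add
        (S.hasValue_strandVertex.sum_rotate.smul (-1))) ?_ |>.trans ?_
    · intro a b c d e h1 h2 h3 h4 h5
      rw [h.pentagon a b c d e h1 h2 h3 h4 h5]
      ring
    · rw [neg_one_smul, neg_one_smul, sub_eq_add_neg]

end CellSystem
end LoopGraph

/-! ### Rescaling the basis of the graph planar algebra -/

/-- The composition of two strict monoidal functors. -/
def StrictMonoidalFunctor.comp {P Q R : LinearPRO} (F : StrictMonoidalFunctor P Q)
    (G : StrictMonoidalFunctor Q R) : StrictMonoidalFunctor P R where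
  map := G.map ∘ₗ F.map
  map_id n := (congrArg _ (F.map_id n)).trans (G.map_id n)
  map_comp f g := (congrArg _ (F.map_comp f g)).trans (G.map_comp _ _)
  map_tensor f g := (congrArg _ (F.map_tensor f g)).trans (G.map_tensor _ _)

namespace LoopGraph

variable {V : Type} {Γ : LoopGraph V}

/-- The product of the values of a function at the vertices of a path other than its source. -/
def Path.weight (s : V → ℂ) {m : ℕ} (p : Γ.Path m) : ℂ := ∏ i : Fin m, s (p.vert i.succ)

theorem Path.weight_ne_zero {s : V → ℂ} (hs : ∀ a, s a ≠ 0) {m : ℕ} (p : Γ.Path m) :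
    p.weight s ≠ 0 :=
  Finset.prod_ne_zero_iff.2 fun _ _ => hs _

theorem Path.weight_add (s : V → ℂ) {m n : ℕ} (p : Γ.Path (m + n)) :
    p.weight s = (Path.take p : Γ.Path m).weight s * (Path.drop p : Γ.Path n).weight s := by
  rw [weight, Fin.prod_univ_add]
  rfl

variable [Fintype V]

/-- The automorphism of the graph planar algebra which rescales the basis vector `(p, q)` by the
quotient of the weights of `p` and `q`. -/
noncomputable def gauge (s : V → ℂ) (hs : ∀ a, s a ≠ 0) :
    StrictMonoidalFunctor Γ.GPA Γ.GPA where
  map {m n} :=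
    { toFun := fun f => ⟨fun p q => f.1 p q * (p.weight s / q.weight s), fun p q h =>
        mul_eq_zero_of_left (f.2 p q h) _⟩
      map_add' := fun f g => GPAHom.ext fun p q => add_mul _ _ _
      map_smul' := fun c f => GPAHom.ext fun p q => mul_assoc _ _ _ }
  map_id n := GPAHom.ext fun p q => by
    classical
    change (if p = q then (1 : ℂ) else 0) * _ = if p = q then 1 else 0
    split_ifs with h
    · subst h
      rw [div_self (Path.weight_ne_zero hs p), one_mul]
    · exact zero_mul _
  map_comp f g := GPAHom.ext fun p r => by
    change (∑ q, f.1 p q * g.1 q r) * (p.weight s / r.weight s)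
      = ∑ q, f.1 p q * (p.weight s / q.weight s) * (g.1 q r * (q.weight s / r.weight s))
    rw [Finset.sum_mul]
    refine Finset.sum_congr rfl fun q _ => ?_
    have hq := Path.weight_ne_zero hs q
    field_simp
  map_tensor f g := GPAHom.ext fun p q => by
    change f.1 p.take q.take * g.1 p.drop q.drop * (p.weight s / q.weight s)
      = f.1 p.take q.take * (p.take.weight s / q.take.weight s)
        * (g.1 p.drop q.drop * (p.drop.weight s / q.drop.weight s))
    rw [Path.weight_add s p, Path.weight_add s q, mul_div_mul_comm]
    ring

/-! ### Positivity of the trace -/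

open scoped ComplexOrder ComplexConjugate

open Classical in
/-- The diagonal entry of a partial trace at `p` is the sum of the diagonal entries at the
extensions of `p` by an edge, weighted by the entries of the cup and the cap.  Here `q` runs over
the extensions of `p` by two edges, to which the cup contributes nothing unless they end at the
target of `p`. -/
theorem partialTrace_apply_self (D : Γ.GPA.SelfDuality) {m : ℕ} (g : Γ.GPA.Hom (m + 1) (m + 1))
    (p : Γ.Path m) : (LinearPRO.partialTrace D g).1 p p
      = ∑ q : Γ.Path (m + 2), if (Path.take q : Γ.Path m) = p then
          D.cup.1 (Path.drop (m := m) (n := 0) p) (Path.drop q : Γ.Path 2)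
            * D.cap.1 (Path.drop q : Γ.Path 2) (Path.drop (m := m) (n := 0) p)
            * g.1 (Path.take (m := m + 1) (n := 1) q) (Path.take (m := m + 1) (n := 1) q)
        else 0 := by
  change ∑ q : Γ.Path (m + 2), (if p = (Path.take q : Γ.Path m) then (1 : ℂ) else 0)
      * D.cup.1 (Path.drop (m := m) (n := 0) p) (Path.drop q : Γ.Path 2)
      * ∑ r : Γ.Path (m + 2), (g.1 (Path.take (m := m + 1) (n := 1) q)
          (Path.take (m := m + 1) (n := 1) r)
        * if (Path.drop (m := m + 1) (n := 1) q) = Path.drop (m := m + 1) (n := 1) r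
            then (1 : ℂ) else 0)
      * ((if (Path.take r : Γ.Path m) = p then (1 : ℂ) else 0)
        * D.cap.1 (Path.drop r : Γ.Path 2) (Path.drop (m := m) (n := 0) p)) = _
  refine Finset.sum_congr rfl fun q _ => ?_
  by_cases hq : (Path.take q : Γ.Path m) = p
  · rw [if_pos hq, if_pos hq.symm, Finset.sum_eq_single q]
    · rw [if_pos hq, if_pos rfl]
      ring
    · intro r _ hr
      by_cases h1 : (Path.drop (m := m + 1) (n := 1) q) = Path.drop (m := m + 1) (n := 1) r
      · have h2 : (Path.take r : Γ.Path m) ≠ p := fun h2 => hr <| Path.ext fun i => by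
          by_cases hi : (i : ℕ) ≤ m
          · exact congrArg (fun t : Γ.Path m => t.vert ⟨i, by omega⟩) (h2.trans hq.symm)
          · have h3 := congrArg (fun t : Γ.Path 1 => t.vert ⟨i - (m + 1), by omega⟩) h1
            have e : (⟨m + 1 + ((i : ℕ) - (m + 1)), by omega⟩ : Fin (m + 1 + 1 + 1)) = i :=
              Fin.ext (by simp; omega)
            change q.vert ⟨m + 1 + ((i : ℕ) - (m + 1)), by omega⟩
              = r.vert ⟨m + 1 + ((i : ℕ) - (m + 1)), by omega⟩ at h3
            rw [e] at h3
            exact h3.symm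
        rw [if_neg h2]
        ring
      · rw [if_neg h1]
        ring
    · simp
  · rw [if_neg hq, if_neg fun h => hq h.symm, zero_mul, zero_mul]

/-- Positivity of the trace: if the diagonal entries of `g` are nonnegative and the trace of `g`
vanishes, then so do the diagonal entries. -/
theorem apply_self_eq_zero_of_trace_eq_zero (D : Γ.GPA.SelfDuality)
    (hD : ∀ (p : Γ.Path 0) (q : Γ.Path 2), 0 ≤ D.cup.1 p q * D.cap.1 q p
      ∧ (p.Parallel q → D.cup.1 p q * D.cap.1 q p ≠ 0)) :
    ∀ {n : ℕ} (g : Γ.GPA.Hom n n), (∀ p, 0 ≤ g.1 p p) → LinearPRO.trace D g = 0 →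
      ∀ p, g.1 p p = 0
  | 0, g, _, h => fun p => by
    change g = 0 at h
    rw [h]
    rfl
  | n + 1, g, hg, h => fun p => by
    classical
    have hnn : ∀ (p : Γ.Path n) (q : Γ.Path (n + 2)), 0 ≤ if (Path.take q : Γ.Path n) = p then
          D.cup.1 (Path.drop (m := n) (n := 0) p) (Path.drop q : Γ.Path 2)
            * D.cap.1 (Path.drop q : Γ.Path 2) (Path.drop (m := n) (n := 0) p)
            * g.1 (Path.take (m := n + 1) (n := 1) q) (Path.take (m := n + 1) (n := 1) q)
        else 0 := by
      intro p q
      split_ifs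
      · exact mul_nonneg (hD _ _).1 (hg _)
      · exact le_rfl
    have h1 := apply_self_eq_zero_of_trace_eq_zero D hD (LinearPRO.partialTrace D g)
      (fun p => by
        rw [partialTrace_apply_self]
        exact Finset.sum_nonneg fun q _ => hnn p q) h
    have h2 := h1 (Path.take p : Γ.Path n)
    rw [partialTrace_apply_self] at h2
    -- the path `p` followed by its last edge in the opposite direction
    let e : Γ.Path 1 := ⟨![p.vert (Fin.last (n + 1)), p.vert ⟨n, by omega⟩], fun i => by
      fin_cases i
      exact Γ.symm _ _ (p.2 (Fin.last n))⟩
    let q : Γ.Path (n + 2) := Path.append (m := n + 1) (n := 1) p e rfl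
    have hq : (Path.take (m := n + 1) (n := 1) q) = p := Path.take_append _ _ _
    have hq' : (Path.drop (m := n + 1) (n := 1) q) = e := Path.drop_append _ _ _
    have hq2 : (Path.take q : Γ.Path n) = (Path.take p : Γ.Path n) :=
      congrArg (fun t : Γ.Path (n + 1) => (Path.take t : Γ.Path n)) hq
    have h3 := (Finset.sum_eq_zero_iff_of_nonneg (fun q _ => hnn _ q)).1 h2 q
      (Finset.mem_univ _)
    rw [if_pos hq2, hq] at h3
    refine (mul_eq_zero.1 h3).resolve_left ((hD _ _).2 ⟨?_, ?_⟩)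
    · exact (congrArg (fun t : Γ.Path n => t.vert (Fin.last n)) hq2).symm
    · exact (congrArg (fun t : Γ.Path 1 => t.vert 1) hq').symm

/-- If the images of the generators are compatible with conjugate transposition then the image of
a functor from the free trivalent category is closed under conjugate transposition. -/
theorem exists_map_eq_conjTranspose (F : StrictMonoidalFunctor G2.Free Γ.GPA)
    (hcap : ∀ p q, (F.map G2.cup).1 q p = conj ((F.map G2.cap).1 p q))
    (hvertex : ∀ p q, (F.map G2.covertex).1 q p = conj ((F.map G2.vertex).1 p q)) {m n : ℕ}
    (f : G2.Free.Hom m n) :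
    ∃ g : G2.Free.Hom n m, ∀ p q, (F.map g).1 q p = conj ((F.map f).1 p q) := by
  classical
  refine Quot.inductionOn f fun t => ?_
  clear f
  induction t with
  | id n =>
    refine ⟨G2.Free.id n, fun p q => ?_⟩
    change (F.map (G2.Free.id n)).1 q p = conj ((F.map (G2.Free.id n)).1 p q)
    rw [F.map_id]
    change (if q = p then (1 : ℂ) else 0) = conj (if p = q then (1 : ℂ) else 0)
    by_cases h : p = q
    · simp [h]
    · simp [h, Ne.symm h]
  | cap => exact ⟨G2.cup, hcap⟩
  | cup =>
    refine ⟨G2.cap, fun p q => ?_⟩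
    rw [← Complex.conj_conj ((F.map G2.cap).1 q p), ← hcap]
    rfl
  | vertex => exact ⟨G2.covertex, hvertex⟩
  | @comp l m n f g ihf ihg =>
    obtain ⟨f', hf⟩ := ihf
    obtain ⟨g', hg⟩ := ihg
    refine ⟨g' ⨟ f', fun p q => ?_⟩
    rw [F.map_comp]
    refine Eq.trans ?_ (congrArg (fun t : Γ.GPA.Hom l n => conj (t.1 p q))
      (F.map_comp (G2.FreeHom.mk f) (G2.FreeHom.mk g))).symm
    change ∑ r, (F.map g').1 q r * (F.map f').1 r p = conj (∑ r, _ * _)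
    rw [map_sum]
    refine Finset.sum_congr rfl fun r _ => ?_
    rw [hf, hg, map_mul, mul_comm]
    rfl
  | @tensor m n m' n' f g ihf ihg =>
    obtain ⟨f', hf⟩ := ihf
    obtain ⟨g', hg⟩ := ihg
    refine ⟨f' ⊠ g', fun p q => ?_⟩
    rw [F.map_tensor]
    refine Eq.trans ?_ (congrArg (fun t : Γ.GPA.Hom (m + m') (n + n') => conj (t.1 p q))
      (F.map_tensor (G2.FreeHom.mk f) (G2.FreeHom.mk g))).symm
    change (F.map f').1 q.take p.take * (F.map g').1 q.drop p.drop = conj (_ * _)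
    rw [hf, hg, map_mul]
    rfl
  | zero =>
    refine ⟨0, fun p q => ?_⟩
    refine Eq.trans ?_ (congrArg (fun t : Γ.GPA.Hom _ _ => conj (t.1 p q)) (map_zero F.map)).symm
    rw [map_zero]
    exact (map_zero _).symm
  | add f g ihf ihg =>
    obtain ⟨f', hf⟩ := ihf
    obtain ⟨g', hg⟩ := ihg
    refine ⟨f' + g', fun p q => ?_⟩
    refine Eq.trans ?_ (congrArg (fun t : Γ.GPA.Hom _ _ => conj (t.1 p q))
      (map_add F.map (G2.FreeHom.mk f) (G2.FreeHom.mk g))).symm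
    rw [map_add]
    change (F.map f').1 q p + (F.map g').1 q p = conj (_ + _)
    rw [hf, hg, map_add]
    rfl
  | smul c f ihf =>
    obtain ⟨f', hf⟩ := ihf
    refine ⟨conj c • f', fun p q => ?_⟩
    refine Eq.trans ?_ (congrArg (fun t : Γ.GPA.Hom _ _ => conj (t.1 p q))
      (map_smul F.map c (G2.FreeHom.mk f))).symm
    rw [map_smul]
    change conj c * (F.map f').1 q p = conj (c * _)
    rw [hf, map_mul]
    rfl

end LoopGraph

namespace LoopGraph

variable {V : Type} {Γ : LoopGraph V} [Fintype V]

open LinearPRO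

theorem trace_zero {P : LinearPRO} (D : P.SelfDuality) :
    ∀ n : ℕ, trace D (0 : P.Hom n n) = 0
  | 0 => rfl
  | n + 1 => by
    change trace D (partialTrace D 0) = 0
    rw [partialTrace, zero_tensor, zero_comp, comp_zero, trace_zero D n]

/-- A functor from `G₂(q)` to a graph planar algebra whose image is closed under conjugate
transposition, and for which closing up a strand is positive, kills exactly the negligible
morphisms: if `f` is negligible then the trace of `f f†` vanishes, so that `f` maps to zero; if `f`
maps to zero then so does the trace of `f g` for all `g`, and this trace is a multiple of the empty
diagram. -/
theorem map_eq_zero_iff_isNegligible {q : ℂ} [Nonempty V]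
    (F : StrictMonoidalFunctor (G2 q) Γ.GPA)
    (hcap : ∀ p r, (F.map (G2.duality q).cup).1 r p
      = (starRingEnd ℂ) ((F.map (G2.duality q).cap).1 p r))
    (hpos : ∀ p r, p.Parallel r → (F.map (G2.duality q).cup).1 p r ≠ 0)
    (hvertex : ∀ p r, (F.map ((G2.toG2 q).map G2.covertex)).1 r p
      = (starRingEnd ℂ) ((F.map ((G2.toG2 q).map G2.vertex)).1 p r)) {m n : ℕ}
    (f : (G2 q).Hom m n) : F.map f = 0 ↔ IsNegligible (G2.duality q) f := by
  open scoped ComplexOrder in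
  constructor
  · intro h g
    obtain ⟨c, hc⟩ := G2.exists_smul_id (trace (G2.duality q) (f ⨟ g))
    have h1 : F.map (trace (G2.duality q) (f ⨟ g)) = 0 := by
      have h2 : F.map (f ⨟ g) = 0 := by rw [F.map_comp, h, zero_comp]
      rw [map_trace, h2, trace_zero]
    rw [hc, map_smul, F.map_id] at h1
    obtain ⟨a⟩ := ‹Nonempty V›
    obtain ⟨p, -⟩ := Path.exists_toList_zero (Γ := Γ) a
    have h2 := congrArg (fun t : Γ.GPA.Hom 0 0 => t.1 p p) h1
    have h3 : c * (Γ.GPA.id 0).1 p p = 0 := h2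
    have h4 : (Γ.GPA.id 0).1 p p = 1 := if_pos rfl
    rw [h4, mul_one] at h3
    rw [hc, h3, zero_smul]
  · intro h
    obtain ⟨f₀, rfl⟩ := Submodule.mkQ_surjective _ f
    obtain ⟨g₀, hg⟩ := exists_map_eq_conjTranspose ((G2.toG2 q).comp F) hcap hvertex f₀
    have h1 := h ((G2.toG2 q).map g₀)
    have h2 : trace ((G2.duality q).image F)
        (F.map ((G2.toG2 q).map f₀ ⨟ (G2.toG2 q).map g₀)) = 0 := by
      rw [← map_trace]
      exact (congrArg _ h1).trans (map_zero F.map)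
    have key : ∀ p, (F.map ((G2.toG2 q).map f₀ ⨟ (G2.toG2 q).map g₀)).1 p p
        = ∑ r, (F.map ((G2.toG2 q).map f₀)).1 p r
          * (starRingEnd ℂ) ((F.map ((G2.toG2 q).map f₀)).1 p r) := by
      intro p
      rw [F.map_comp]
      exact Finset.sum_congr rfl fun r _ => congrArg (_ * ·) (hg p r)
    have hnn : ∀ z : ℂ, 0 ≤ z * (starRingEnd ℂ) z := fun z => by
      rw [Complex.mul_conj]
      exact_mod_cast Complex.normSq_nonneg z
    have h3 := apply_self_eq_zero_of_trace_eq_zero ((G2.duality q).image F) (fun p r => by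
        have e : ((G2.duality q).image F).cup.1 p r
            = (starRingEnd ℂ) (((G2.duality q).image F).cap.1 r p) := hcap r p
        refine ⟨?_, fun hpr => ?_⟩
        · rw [e, mul_comm]
          exact hnn _
        · have h5 : ((G2.duality q).image F).cup.1 p r ≠ 0 := hpos p r hpr
          refine mul_ne_zero h5 fun h6 => h5 ?_
          rw [e, h6, map_zero]) _
      (fun p => by
        rw [key]
        exact Finset.sum_nonneg fun r _ => hnn _) h2
    refine GPAHom.ext fun p r => ?_
    have h4 := h3 p
    rw [key] at h4
    have h5 := (Finset.sum_eq_zero_iff_of_nonneg fun r _ => hnn _).1 h4 r (Finset.mem_univ _)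
    rw [Complex.mul_conj] at h5
    exact Complex.normSq_eq_zero.1 (by exact_mod_cast h5)

end LoopGraph

/-! ### Faithful functors from solutions of the cell equations -/

namespace LoopGraph

variable {V : Type} {Γ : LoopGraph V} [Fintype V]

namespace CellSystem

open LinearPRO

/-- A solution of the cell equations with positive weights and real, totally symmetric cells gives
a faithful functor on the semisimple quotient of `G₂(q)`. -/
theorem IsSolution.exists_faithful [DecidableEq V] [Nonempty V] {S : CellSystem Γ}
    {d B τ α β : ℂ} (h : S.IsSolution d B τ α β) {q : ℂ}
    (hd : q ^ (10 : ℤ) + q ^ (8 : ℤ) + q ^ (2 : ℤ) + 1 + q ^ (-2 : ℤ)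
      + q ^ (-8 : ℤ) + q ^ (-10 : ℤ) = d) (hB : G2.qInt q 7 - 1 = B)
    (hτ : q ^ (4 : ℤ) + 1 + q ^ (-4 : ℤ) = τ) (hα : q ^ (2 : ℤ) + q ^ (-2 : ℤ) = α)
    (hβ : q ^ (2 : ℤ) + 1 + q ^ (-2 : ℤ) = β) {w : V → ℝ} {u : V → V → V → ℝ}
    (hw : ∀ a, 0 < w a) (hSw : ∀ a, S.w a = w a) (hSu : ∀ a b c, S.u a b c = u a b c)
    (hu : ∀ a b c, u a b c = u a c b) :
    ∃ F : StrictMonoidalFunctor (G2ss q) Γ.GPA, F.toFunctor.Faithful ∧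
      F.map (G2.dualityss q).cap = Γ.GPAev w ∧
      F.map (G2.dualityss q).cup = Γ.GPAcoev w ∧
      ∀ (p : Γ.Path 2) (e : Γ.Path 1), p.Parallel e →
        Γ.GPAcoord (F.map (G2.vertexss q)) p e
          = ((Real.sqrt (w (p.vert 1)) * u (p.vert 0) (p.vert 1) (p.vert 2) : ℝ) : ℂ) := by
  classical
  set s : V → ℂ := fun a => (Real.sqrt (w a) : ℂ) with hs_def
  have hs : ∀ a, s a ≠ 0 := fun a =>
    Complex.ofReal_ne_zero.2 (Real.sqrt_ne_zero'.2 (hw a))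
  have hss : ∀ a, s a * s a = S.w a := fun a => by
    rw [hSw, hs_def, ← Complex.ofReal_mul, Real.mul_self_sqrt (hw a).le]
  have hsq : ∀ a b, ((Real.sqrt (w b / w a) : ℝ) : ℂ) = s b / s a := fun a b => by
    rw [Real.sqrt_div (hw b).le, Complex.ofReal_div]
  have hweight : ∀ p : Γ.Path 2, p.weight s = s (p.vert 1) * s (p.vert 2) := fun p =>
    Fin.prod_univ_two _
  have hweight1 : ∀ p : Γ.Path 1, p.weight s = s (p.vert 1) := fun p => Fin.prod_univ_one _
  have hweight0 : ∀ p : Γ.Path 0, p.weight s = 1 := fun p => rfl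
  let F₀ : StrictMonoidalFunctor G2.Free Γ.GPA := S.functor.comp (gauge s hs)
  have hF₀ : ∀ m n, ∀ f ∈ G2.skeinRelators q m n, F₀.map f = 0 := by
    rintro m n _ ⟨f, g, hfg, rfl⟩
    rw [map_sub, sub_eq_zero]
    exact congrArg (gauge s hs).map (h.map_eq hd hB hτ hα hβ hfg)
  let F₁ : StrictMonoidalFunctor (G2 q) Γ.GPA := liftQuotient F₀ _ hF₀
  have hcap : F₁.map (G2.duality q).cap = Γ.GPAev w := by
    refine GPAHom.ext fun p r => ?_
    change (if p.Parallel r then (S.w (p.vert 0))⁻¹ else 0) * (p.weight s / r.weight s)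
      = if p.Parallel r then _ else 0
    split_ifs with hpr
    · have h2 : p.vert 2 = p.vert 0 := hpr.2.trans hpr.1.symm
      rw [hweight, hweight0, h2, hsq, ← hss]
      have := hs (p.vert 0)
      field_simp
    · exact zero_mul _
  have hcup : F₁.map (G2.duality q).cup = Γ.GPAcoev w := by
    refine GPAHom.ext fun r p => ?_
    change (if r.Parallel p then S.w (p.vert 1) else 0) * (r.weight s / p.weight s)
      = if r.Parallel p then _ else 0
    split_ifs with hpr
    · have h2 : p.vert 2 = p.vert 0 := hpr.2.symm.trans hpr.1
      rw [hweight, hweight0, h2, hsq, ← hss]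
      have := hs (p.vert 0)
      have := hs (p.vert 1)
      field_simp
    · exact zero_mul _
  have hvertex : ∀ (p : Γ.Path 2) (e : Γ.Path 1), p.Parallel e →
      (F₁.map ((G2.toG2 q).map G2.vertex)).1 p e
        = ((Real.sqrt (w (p.vert 1)) * u (p.vert 0) (p.vert 1) (p.vert 2) : ℝ) : ℂ) := by
    intro p e hpe
    change (if p.Parallel e then S.u (p.vert 0) (p.vert 1) (p.vert 2) else 0)
      * (p.weight s / e.weight s) = _
    have h2 : p.vert 2 = e.vert 1 := hpe.2
    have := hs (e.vert 1)
    rw [if_pos hpe, hweight, hweight1, h2, hSu, Complex.ofReal_mul]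
    change _ = s _ * _
    field_simp
  have hcovertex : ∀ (p : Γ.Path 2) (e : Γ.Path 1), p.Parallel e →
      (F₁.map ((G2.toG2 q).map G2.covertex)).1 e p
        = ((Real.sqrt (w (p.vert 1)) * u (p.vert 0) (p.vert 1) (p.vert 2) : ℝ) : ℂ) := by
    intro p e hpe
    have h0 : e.vert 0 = p.vert 0 := hpe.1.symm
    have h2 : e.vert 1 = p.vert 2 := hpe.2.symm
    have h1 : (S.functor.map G2.covertex).1 e p
        = S.w (p.vert 1) * S.u (p.vert 0) (p.vert 2) (p.vert 1) := by
      classical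
      have h3 := S.ev_covertex (fun l => if p.toList = l then 1 else 0) (e.vert 0) (e.vert 1)
      have h4 : e.toList = [e.vert 0, e.vert 1] := Path.toList_one e
      rw [← h4, ev, lev_toList] at h3
      simp only [Path.toList_injective.eq_iff, mul_ite, mul_one, mul_zero, Finset.sum_ite_eq,
        Finset.mem_univ, if_true] at h3
      have h5 : ∀ x, p.toList = [e.vert 0, x, e.vert 1] ↔ p.vert 1 = x := fun x => by
        rw [Path.toList_two, h0, h2]
        simp [Path.vert]
      simp only [h5, Finset.sum_ite_eq, Finset.mem_univ, if_true] at h3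
      rw [h3, h0, h2]
    change (S.functor.map G2.covertex).1 e p * (e.weight s / p.weight s) = _
    have := hs (p.vert 1)
    have := hs (p.vert 2)
    rw [h1, hweight, hweight1, h2, hSu, ← hu, Complex.ofReal_mul, ← hss]
    change _ = s _ * _
    field_simp
  have hker : ∀ {m n : ℕ} (f : (G2 q).Hom m n),
      F₁.map f = 0 ↔ IsNegligible (G2.duality q) f := by
    refine map_eq_zero_iff_isNegligible F₁ ?_ ?_ ?_
    · intro p r
      rw [hcap, hcup]
      change (if r.Parallel p then _ else 0) = (starRingEnd ℂ) (if p.Parallel r then _ else 0)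
      by_cases hpr : p.Parallel r
      · rw [if_pos hpr, if_pos ⟨hpr.1.symm, hpr.2.symm⟩, Complex.conj_ofReal]
      · rw [if_neg hpr, if_neg fun h' => hpr ⟨h'.1.symm, h'.2.symm⟩, map_zero]
    · intro p r hpr
      rw [hcup]
      change (if p.Parallel r then _ else 0) ≠ 0
      rw [if_pos hpr, hsq]
      exact div_ne_zero (hs _) (hs _)
    · intro p e
      by_cases hpe : p.Parallel e
      · rw [hvertex p e hpe, hcovertex p e hpe, Complex.conj_ofReal]
      · refine ((F₁.map _).2 _ _ fun h' => hpe ⟨h'.1.symm, h'.2.symm⟩).trans ?_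
        refine Eq.symm ((congrArg (starRingEnd ℂ) ((F₁.map _).2 _ _ hpe)).trans (map_zero _))
  let F₂ : StrictMonoidalFunctor (G2ss q) Γ.GPA :=
    liftQuotient F₁ (fun _ _ => {f | IsNegligible (G2.duality q) f}) fun _ _ f hf =>
      (hker f).2 hf
  refine ⟨F₂, ⟨fun {X Y} f g hfg => ?_⟩, hcap, hcup, hvertex⟩
  obtain ⟨f, rfl⟩ := Submodule.mkQ_surjective _ f
  obtain ⟨g, rfl⟩ := Submodule.mkQ_surjective _ g
  have h1 : F₁.map f = F₁.map g := hfg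
  rw [← sub_eq_zero, ← map_sub, hker] at h1
  exact (Submodule.Quotient.eq _).2 (InTensorIdeal.of h1)

end CellSystem

/-- The evaluation does not depend on the normalization of the weights. -/
theorem GPAev_eq {w w' : V → ℝ} {k : ℝ} (hk : k ≠ 0) (h : ∀ a, w' a = k * w a) :
    Γ.GPAev w' = Γ.GPAev w := by
  classical
  refine GPAHom.ext fun p q => ?_
  change (if p.Parallel q then _ else 0) = if p.Parallel q then _ else 0
  rw [h, h, mul_div_mul_left _ _ hk]

theorem GPAcoev_eq {w w' : V → ℝ} {k : ℝ} (hk : k ≠ 0) (h : ∀ a, w' a = k * w a) :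
    Γ.GPAcoev w' = Γ.GPAcoev w := by
  classical
  refine GPAHom.ext fun p q => ?_
  change (if p.Parallel q then _ else 0) = if p.Parallel q then _ else 0
  rw [h, h, mul_div_mul_left _ _ hk]

end LoopGraph

/-! ### The cell equations on the graph at level three -/

namespace LevelThree

/-- The cyclic permutation of the three vertices `1, 2, 3` which carry a loop. -/
def next : Fin 4 → Fin 4 := ![0, 2, 3, 1]

/-- The type of a triple of vertices, up to cyclic permutations of the vertices `1, 2, 3` and up to
permutations of the three entries.  The triples with two entries equal to `0`, which are not closed
walks, have type `0`. -/
def kind (a b c : Fin 4) : Fin 7 :=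
  if a = 0 ∧ b = 0 ∨ b = 0 ∧ c = 0 ∨ a = 0 ∧ c = 0 then 0
  else if a = 0 ∨ b = 0 ∨ c = 0 then (if a = b ∨ b = c ∨ a = c then 1 else 2)
  else if a = b ∧ b = c then 3
  else if a = b then (if c = next a then 4 else 5)
  else if b = c then (if a = next b then 4 else 5)
  else if a = c then (if b = next a then 4 else 5)
  else 6

/-- Numbers satisfying the relations needed for the cells at level three.  Here `3 * p` is the
weight of the vertex `0`, the other weights being `1`, and `c` is to be `2 cos (2 π / 21)`. -/
structure Values where
  (p c z Z X U y y' : ℝ)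
  hp : p ^ 2 = (1 - 3 * p) / 3
  hc : c ^ 3 = 1 - c + 2 * c ^ 2 + 3 * p * (c ^ 2 - c - 1)
  hz2 : z ^ 2 = (1 + p) * (c ^ 2 - c - 1)
  hZ2 : Z ^ 2 = z ^ 2 + 1
  hX : X = (c - 3 * p) * z
  hU : U = (-3 + 7 * c - 3 * c ^ 2 + 3 * p * (2 * c - c ^ 2)) * Z
  hv : y' = -c * z - y
  hyv : y * y' = p

namespace Values

/-- Exchanging the two roots `y` and `y'`. -/
def swap (P : Values) : Values :=
  { P with
    y := P.y'
    y' := P.y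
    hv := by rw [P.hv]; ring
    hyv := by rw [mul_comm]; exact P.hyv }

variable (P : Values)

/-- The value of the cell at a triple of a given type. -/
def val : Fin 7 → ℝ := ![0, P.z, P.Z, P.X, P.y, P.y', P.U]

/-- The cells. -/
def cell (a b c : Fin 4) : ℝ := P.val (kind a b c)

/-- The weights of the vertices. -/
def weight : Fin 4 → ℝ := ![3 * P.p, 1, 1, 1]

/-- The inverses of the weights of the vertices. -/
def invWeight : Fin 4 → ℝ := ![1 + P.p, 1, 1, 1]

theorem y_sq : P.y ^ 2 = -P.c * P.z * P.y - P.p := by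
  linear_combination P.y * P.hv - P.hyv

theorem X_sq : P.X ^ 2 = P.c - 1 + P.p := by
  linear_combination (-3 * P.p * P.z + P.c * P.z + P.X) * P.hX + (9 * P.p ^ 2 - 6 * P.p * P.c +
  P.c ^ 2) * P.hz2 + (-3 * P.p ^ 2 + P.p * P.c - 2 * P.p + P.c + 1) * P.hc + (3 * P.c - 6) * P.hp

theorem X_mul_z : P.X * P.z = 1 - 2 * P.c + P.c ^ 2 + P.p * (1 - 2 * P.c + P.c ^ 2) := by
  linear_combination P.z * P.hX + (-3 * P.p + P.c) * P.hz2 + (P.p + 1) * P.hc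

theorem U_sq : P.U ^ 2 = P.c - 1 - 2 * P.p := by
  linear_combination (-3 * P.p * P.c ^ 2 * P.Z + 6 * P.p * P.c * P.Z - 3 * P.c ^ 2 * P.Z + 7 * P.c
  * P.Z - 3 * P.Z + P.U) * P.hU + (9 * P.p ^ 2 * P.c ^ 4 - 36 * P.p ^ 2 * P.c ^ 3 + 36 * P.p ^ 2 *
  P.c ^ 2 + 18 * P.p * P.c ^ 4 - 78 * P.p * P.c ^ 3 + 102 * P.p * P.c ^ 2 - 36 * P.p * P.c + 9 *
  P.c ^ 4 - 42 * P.c ^ 3 + 67 * P.c ^ 2 - 42 * P.c + 9) * P.hZ2 + (9 * P.p ^ 2 * P.c ^ 4 - 36 *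
  P.p ^ 2 * P.c ^ 3 + 36 * P.p ^ 2 * P.c ^ 2 + 18 * P.p * P.c ^ 4 - 78 * P.p * P.c ^ 3 + 102 * P.p
  * P.c ^ 2 - 36 * P.p * P.c + 9 * P.c ^ 4 - 42 * P.c ^ 3 + 67 * P.c ^ 2 - 42 * P.c + 9) * P.hz2 +
  (243 * P.p ^ 6 + 81 * P.p ^ 5 * P.c + 648 * P.p ^ 5 + 27 * P.p ^ 4 * P.c ^ 2 + 189 * P.p ^ 4 *
  P.c + 351 * P.p ^ 4 + 9 * P.p ^ 3 * P.c ^ 3 + 54 * P.p ^ 3 * P.c ^ 2 + 63 * P.p ^ 3 * P.c - 234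
  * P.p ^ 3 + 27 * P.p ^ 2 * P.c ^ 3 - 6 * P.p ^ 2 * P.c ^ 2 - 84 * P.p ^ 2 * P.c - 129 * P.p ^ 2
  + 27 * P.p * P.c ^ 3 - 66 * P.p * P.c ^ 2 - 5 * P.p * P.c + 52 * P.p + 9 * P.c ^ 3 - 33 * P.c ^
  2 + 34 * P.c + 1) * P.hc + (729 * P.p ^ 5 * P.c ^ 2 - 729 * P.p ^ 5 * P.c - 729 * P.p ^ 5 + 1458
  * P.p ^ 4 * P.c ^ 2 - 1701 * P.p ^ 4 * P.c - 972 * P.p ^ 4 + 405 * P.p ^ 3 * P.c ^ 2 - 729 * P.p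
  ^ 3 * P.c + 324 * P.p ^ 3 - 432 * P.p ^ 2 * P.c ^ 2 + 513 * P.p ^ 2 * P.c + 405 * P.p ^ 2 - 63 *
  P.p * P.c ^ 2 + 180 * P.p * P.c - 144 * P.p + 42 * P.c ^ 2 - 69 * P.c - 6) * P.hp

theorem U_mul_Z : P.U * P.Z = 1 - 3 * P.c + P.c ^ 2 + P.p * (1 - 2 * P.c + P.c ^ 2) := by
  linear_combination P.Z * P.hU + (-3 * P.p * P.c ^ 2 + 6 * P.p * P.c - 3 * P.c ^ 2 + 7 * P.c - 3)
  * P.hZ2 + (-3 * P.p * P.c ^ 2 + 6 * P.p * P.c - 3 * P.c ^ 2 + 7 * P.c - 3) * P.hz2 + (-9 * P.p ^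
  3 - 3 * P.p ^ 2 * P.c - 15 * P.p ^ 2 - 6 * P.p * P.c - 2 * P.p - 3 * P.c + 4) * P.hc + (-27 *
  P.p ^ 2 * P.c ^ 2 + 27 * P.p ^ 2 * P.c + 27 * P.p ^ 2 - 27 * P.p * P.c ^ 2 + 36 * P.p * P.c + 9
  * P.p + 3 * P.c - 9) * P.hp

end Values

variable (P : Values)

/-- The equation for the closed walk given by a list of vertices: if the list has length `1`, the
equation for the lollipop, if it has length `2`, `3`, `4` or `5`, those for the bigon, the trigon,
the tetragon and the pentagon. -/
def Equation : List (Fin 4) → Prop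
  | [a] => ∑ x, P.weight x * P.cell a a x = 0
  | [a, b] => ∑ x, P.weight x * (P.cell a b x * P.cell a x b)
      = P.c ^ 3 - 3 * P.c + (P.c ^ 2 - 2) + P.c
  | [a, b, c] => ∑ x, P.weight x * (P.cell a b x * P.cell b c x * P.cell c a x)
      = -(P.c ^ 2 - 1) * P.cell a b c
  | [a, b, c, d] =>
    ∑ x, P.weight x * (P.cell a b x * P.cell b c x * P.cell c d x * P.cell d a x)
      = P.c * (P.cell a b c * P.cell a c d + P.cell a b d * P.cell d b c)
        + (P.c + 1) * ((if b = d then P.invWeight b else 0) + if a = c then P.invWeight a else 0)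
  | [a, b, c, d, e] =>
    ∑ x, P.weight x
        * (P.cell a b x * P.cell b c x * P.cell c d x * P.cell d e x * P.cell e a x)
      = -(P.cell a b c * P.cell a c d * P.cell a d e + P.cell b c d * P.cell b d e * P.cell b e a
          + P.cell c d e * P.cell c e a * P.cell c a b + P.cell d e a * P.cell d a b * P.cell d b c
          + P.cell e a b * P.cell e b c * P.cell e c d)
        - ((if b = e then P.invWeight b * P.cell b c d else 0)
          + (if c = a then P.invWeight c * P.cell c d e else 0)
          + (if d = b then P.invWeight d * P.cell d e a else 0)
          + (if e = c then P.invWeight e * P.cell e a b else 0)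
          + if a = d then P.invWeight a * P.cell a b c else 0)
  | _ => True

/-- Representatives, up to symmetry, of the closed walks of length at most `4`. -/
def shortWalks : List (List (Fin 4)) :=
  [[1], [0, 1], [1, 1], [1, 2], [0, 1, 1], [0, 1, 2], [1, 1, 1], [1, 1, 2], [1, 2, 3], [0, 1, 0,
  1], [0, 1, 0, 2], [0, 1, 1, 1], [0, 1, 1, 2], [0, 1, 2, 1], [0, 1, 2, 3], [1, 1, 1, 1], [1, 1,
  1, 2], [1, 1, 2, 2], [1, 1, 2, 3], [1, 2, 1, 2], [1, 2, 1, 3]]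

/-- The equation for each representative is a polynomial combination of the relations in `Values`,
given explicitly. -/
theorem equation_short : ∀ l ∈ shortWalks, Equation P l := by
  intro l hl
  simp only [shortWalks, List.mem_cons, List.not_mem_nil, or_false] at hl
  rcases hl with rfl | rfl | rfl | rfl | rfl | rfl | rfl | rfl | rfl | rfl | rfl | rfl | rfl | rfl
    | rfl | rfl | rfl | rfl | rfl | rfl | rfl
  all_goals simp only [Equation, Fin.sum_univ_four,
    Values.cell, kind, next, Values.val, Values.weight, Values.invWeight, Fin.isValue,
    Fin.reduceEq, and_self, and_true, true_and, and_false, false_and, or_self, or_true, true_or,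
    or_false, false_or, if_true, if_false, Matrix.cons_val]
  · linear_combination P.hv + P.hX
  · linear_combination 2 * P.hZ2 + 3 * P.hz2 + (-1) * P.hc
  · linear_combination P.X_sq + (-P.c * P.z + P.y') * P.hv + (-1) * P.hyv + P.y_sq + (3 * P.p +
    P.c ^ 2) * P.hz2 + (3 * P.p ^ 2 + P.p * P.c + 4 * P.p + P.c) * P.hc + (9 * P.p * P.c ^ 2 - 9 *
    P.p * P.c - 9 * P.p + 9 * P.c ^ 2 - 12 * P.c - 3) * P.hp
  · linear_combination P.U_sq + 3 * P.p * P.hZ2 + (-P.c * P.z + P.y') * P.hv + (-1) * P.hyv +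
    P.y_sq + (3 * P.p + P.c ^ 2) * P.hz2 + (3 * P.p ^ 2 + P.p * P.c + 4 * P.p + P.c) * P.hc + (9 *
    P.p * P.c ^ 2 - 9 * P.p * P.c - 9 * P.p + 9 * P.c ^ 2 - 12 * P.c - 3) * P.hp
  · linear_combination P.z * P.X_mul_z + (P.y + P.y') * P.hZ2 + (P.z ^ 2 + 1) * P.hv + (-P.c *
    P.z) * P.hz2 + (-P.p * P.z - P.z) * P.hc + (-3 * P.c ^ 2 * P.z + 3 * P.c * P.z + 3 * P.z) *
    P.hp
  · linear_combination P.Z * P.U_mul_Z + P.z * P.Z * P.hv + (-P.c * P.Z) * P.hz2 + (-P.p * P.Z -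
    P.Z) * P.hc + (-3 * P.c ^ 2 * P.Z + 3 * P.c * P.Z + 3 * P.Z) * P.hp
  · linear_combination P.X * P.X_sq + (-P.p + P.c ^ 2 * P.z ^ 2 - P.c * P.z * P.y' + P.y' ^ 2) *
    P.hv + (P.c * P.z - P.y') * P.hyv + (P.p + P.c ^ 2 + P.c - 2) * P.hX + (-P.c * P.z + P.y) *
    P.y_sq + (3 * P.p * P.z - P.c ^ 3 * P.z) * P.hz2 + (-9 * P.p ^ 3 * P.z - 3 * P.p ^ 2 * P.c *
    P.z - 15 * P.p ^ 2 * P.z - P.p * P.c ^ 2 * P.z - 4 * P.p * P.c * P.z - 6 * P.p * P.z - P.c ^ 2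
    * P.z - P.c * P.z + P.z) * P.hc + (-27 * P.p ^ 2 * P.c ^ 2 * P.z + 27 * P.p ^ 2 * P.c * P.z +
    27 * P.p ^ 2 * P.z - 27 * P.p * P.c ^ 2 * P.z + 36 * P.p * P.c * P.z + 9 * P.p * P.z - 9 * P.c
    ^ 2 * P.z + 12 * P.c * P.z - 3 * P.z) * P.hp
  · linear_combination P.y' * P.hyv + P.y' * P.U_sq + 3 * P.p * P.z * P.hZ2 + (-P.p + P.c - 1) *
    P.hv + P.y ^ 2 * P.hX + (-3 * P.p * P.z + P.c * P.z) * P.y_sq + (3 * P.p * P.c * P.y + 3 * P.p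
    * P.z - P.c ^ 2 * P.y) * P.hz2 + (-P.p * P.c * P.y - P.p * P.y - P.c * P.y - P.y) * P.hc + (3
    * P.c ^ 2 * P.z - 3 * P.c ^ 2 * P.y - 3 * P.c * P.z + 3 * P.c * P.y + 3 * P.y) * P.hp
  · linear_combination 3 * P.U * P.hyv + 3 * P.p * P.Z * P.hZ2 + (3 * P.p + P.c ^ 2 - 1) * P.hU +
    3 * P.p * P.Z * P.hz2 + (-9 * P.p ^ 2 * P.Z - 3 * P.p * P.c * P.Z - 9 * P.p * P.Z - 3 * P.c *
    P.Z + P.Z) * P.hc + (-27 * P.p * P.c ^ 2 * P.Z + 27 * P.p * P.c * P.Z + 27 * P.p * P.Z - 15 *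
    P.c ^ 2 * P.Z + 33 * P.c * P.Z - 12 * P.Z) * P.hp
  · linear_combination (2 * P.z ^ 2 + 2 * P.Z ^ 2 + 2) * P.hZ2 + (3 * P.p * P.c ^ 2 - 3 * P.p *
    P.c - 3 * P.p + 3 * P.c ^ 2 - 4 * P.c + 3 * P.z ^ 2 + 1) * P.hz2 + (9 * P.p ^ 3 + 3 * P.p ^ 2
    * P.c + 18 * P.p ^ 2 + 6 * P.p * P.c + 8 * P.p + 3 * P.c - 1) * P.hc + (27 * P.p ^ 2 * P.c ^ 2
    - 27 * P.p ^ 2 * P.c - 27 * P.p ^ 2 + 36 * P.p * P.c ^ 2 - 45 * P.p * P.c - 18 * P.p + 9 * P.c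
    ^ 2 - 15 * P.c + 6) * P.hp
  · linear_combination (-P.c + 3 * P.z ^ 2 + P.Z ^ 2 + 1) * P.hZ2 + (3 * P.p * P.c ^ 2 - 3 * P.p *
    P.c - 3 * P.p + 3 * P.c ^ 2 - 4 * P.c + 3 * P.z ^ 2 + 1) * P.hz2 + (9 * P.p ^ 3 + 3 * P.p ^ 2
    * P.c + 18 * P.p ^ 2 + 6 * P.p * P.c + 8 * P.p + 3 * P.c - 1) * P.hc + (27 * P.p ^ 2 * P.c ^ 2
    - 27 * P.p ^ 2 * P.c - 27 * P.p ^ 2 + 36 * P.p * P.c ^ 2 - 45 * P.p * P.c - 18 * P.p + 9 * P.c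
    ^ 2 - 15 * P.c + 6) * P.hp
  · linear_combination P.z ^ 2 * P.X_sq + (-P.c) * P.X_mul_z + (P.y ^ 2 + P.y' ^ 2) * P.hZ2 +
    (-P.c * P.z ^ 3 - P.c * P.z + P.z ^ 2 * P.y' + P.y') * P.hv + (-P.z ^ 2 - 1) * P.hyv + (P.z ^
    2 + 1) * P.y_sq + (P.p * P.c ^ 4 - P.p * P.c ^ 3 - P.p * P.c ^ 2 - P.p + P.c ^ 4 - P.c ^ 3 +
    P.c ^ 2 * P.z ^ 2 - 1) * P.hz2 + (27 * P.p ^ 5 + 9 * P.p ^ 4 * P.c + 72 * P.p ^ 4 + 3 * P.p ^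
    3 * P.c ^ 2 + 21 * P.p ^ 3 * P.c + 57 * P.p ^ 3 + P.p ^ 2 * P.c ^ 3 + 6 * P.p ^ 2 * P.c ^ 2 +
    13 * P.p ^ 2 * P.c + 8 * P.p ^ 2 + 2 * P.p * P.c ^ 3 + 3 * P.p * P.c ^ 2 - 5 * P.p + P.c ^ 3 -
    P.c - 1) * P.hc + (81 * P.p ^ 4 * P.c ^ 2 - 81 * P.p ^ 4 * P.c - 81 * P.p ^ 4 + 162 * P.p ^ 3
    * P.c ^ 2 - 189 * P.p ^ 3 * P.c - 108 * P.p ^ 3 + 99 * P.p ^ 2 * P.c ^ 2 - 135 * P.p ^ 2 * P.c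
    - 18 * P.p ^ 2 + 18 * P.p * P.c ^ 2 - 27 * P.p * P.c + 15 * P.p + 3 * P.c + 3) * P.hp
  · linear_combination P.z * P.Z * P.hyv + P.Z * P.y * P.X_mul_z + P.Z * P.y' * P.U_mul_Z + (P.p *
    P.c ^ 2 * P.Z - 2 * P.p * P.c * P.Z + P.p * P.Z + P.c ^ 2 * P.Z - 3 * P.c * P.Z + P.Z) * P.hv
    + (-P.p * P.z * P.Z - P.z * P.Z) * P.hc + (-3 * P.c ^ 2 * P.z * P.Z + 3 * P.c * P.z * P.Z + 3
    * P.z * P.Z) * P.hp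
  · linear_combination P.Z ^ 2 * P.U_sq + (-2 * P.p + P.y' ^ 2 - 1) * P.hZ2 + (-P.c * P.z ^ 3 -
    P.c * P.z + P.z ^ 2 * P.y' + P.y') * P.hv + (-P.z ^ 2 - 1) * P.hyv + P.z ^ 2 * P.y_sq + (P.p *
    P.c ^ 4 - P.p * P.c ^ 3 - P.p * P.c ^ 2 - 4 * P.p + P.c ^ 4 - P.c ^ 3 + P.c ^ 2 * P.z ^ 2 - 1)
    * P.hz2 + (27 * P.p ^ 5 + 9 * P.p ^ 4 * P.c + 72 * P.p ^ 4 + 3 * P.p ^ 3 * P.c ^ 2 + 21 * P.p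
    ^ 3 * P.c + 57 * P.p ^ 3 + P.p ^ 2 * P.c ^ 3 + 6 * P.p ^ 2 * P.c ^ 2 + 13 * P.p ^ 2 * P.c + 8
    * P.p ^ 2 + 2 * P.p * P.c ^ 3 + 3 * P.p * P.c ^ 2 - 4 * P.p + P.c ^ 3 - P.c) * P.hc + (81 *
    P.p ^ 4 * P.c ^ 2 - 81 * P.p ^ 4 * P.c - 81 * P.p ^ 4 + 162 * P.p ^ 3 * P.c ^ 2 - 189 * P.p ^
    3 * P.c - 108 * P.p ^ 3 + 99 * P.p ^ 2 * P.c ^ 2 - 135 * P.p ^ 2 * P.c - 18 * P.p ^ 2 + 18 *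
    P.p * P.c ^ 2 - 27 * P.p * P.c + 15 * P.p + 3 * P.c + 3) * P.hp
  · linear_combination P.Z ^ 2 * P.hyv + (-P.c + P.z * P.y + P.z * P.y') * P.U_mul_Z + (P.p - P.c)
    * P.hZ2 + (P.p * P.c ^ 2 * P.z - 2 * P.p * P.c * P.z + P.p * P.z + P.c ^ 2 * P.z - 3 * P.c *
    P.z + P.z) * P.hv + (-P.p * P.c ^ 3 + 2 * P.p * P.c ^ 2 - P.p * P.c + P.p - P.c ^ 3 + 3 * P.c
    ^ 2 - 2 * P.c) * P.hz2 + (-9 * P.p ^ 4 - 3 * P.p ^ 3 * P.c - 18 * P.p ^ 3 - P.p ^ 2 * P.c ^ 2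
    - 5 * P.p ^ 2 * P.c - 5 * P.p ^ 2 - 2 * P.p * P.c ^ 2 + 4 * P.p - P.c ^ 2 + 2 * P.c) * P.hc +
    (-27 * P.p ^ 3 * P.c ^ 2 + 27 * P.p ^ 3 * P.c + 27 * P.p ^ 3 - 36 * P.p ^ 2 * P.c ^ 2 + 45 *
    P.p ^ 2 * P.c + 18 * P.p ^ 2 - 3 * P.p * P.c ^ 2 + 9 * P.p * P.c - 12 * P.p + 3 * P.c ^ 2 - 6
    * P.c) * P.hp
  · linear_combination (P.p - P.c + P.X ^ 2 - 1) * P.X_sq + (2 * P.p * P.c * P.z - P.p * P.y' -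
    P.c ^ 3 * P.z ^ 3 + P.c ^ 2 * P.z ^ 2 * P.y' - P.c * P.z * P.y' ^ 2 + P.y' ^ 3) * P.hv + (P.p
    - P.c ^ 2 * P.z ^ 2 + P.c * P.z * P.y' - P.y' ^ 2) * P.hyv + (-P.p + P.c ^ 2 * P.z ^ 2 - P.c *
    P.z * P.y + P.y ^ 2) * P.y_sq + (3 * P.p ^ 2 * P.c ^ 2 - 3 * P.p ^ 2 * P.c - 3 * P.p ^ 2 + P.p
    * P.c ^ 6 - P.p * P.c ^ 5 - P.p * P.c ^ 4 - P.p * P.c ^ 2 - 3 * P.p * P.c + 3 * P.p * P.z ^ 2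
    - 3 * P.p + P.c ^ 6 - P.c ^ 5 + P.c ^ 4 * P.z ^ 2 - P.c ^ 4) * P.hz2 + (243 * P.p ^ 7 + 81 *
    P.p ^ 6 * P.c + 810 * P.p ^ 6 + 27 * P.p ^ 5 * P.c ^ 2 + 243 * P.p ^ 5 * P.c + 918 * P.p ^ 5 +
    9 * P.p ^ 4 * P.c ^ 3 + 72 * P.p ^ 4 * P.c ^ 2 + 234 * P.p ^ 4 * P.c + 342 * P.p ^ 4 + 3 * P.p
    ^ 3 * P.c ^ 4 + 21 * P.p ^ 3 * P.c ^ 3 + 57 * P.p ^ 3 * P.c ^ 2 + 57 * P.p ^ 3 * P.c - 54 *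
    P.p ^ 3 + P.p ^ 2 * P.c ^ 5 + 6 * P.p ^ 2 * P.c ^ 4 + 13 * P.p ^ 2 * P.c ^ 3 + 5 * P.p ^ 2 *
    P.c ^ 2 - 24 * P.p ^ 2 * P.c - 45 * P.p ^ 2 + 2 * P.p * P.c ^ 5 + 3 * P.p * P.c ^ 4 - P.p *
    P.c ^ 3 - 8 * P.p * P.c ^ 2 - 8 * P.p * P.c + P.p + P.c ^ 5 - 2 * P.c ^ 3 - P.c ^ 2 + P.c + 1)
    * P.hc + (729 * P.p ^ 6 * P.c ^ 2 - 729 * P.p ^ 6 * P.c - 729 * P.p ^ 6 + 1944 * P.p ^ 5 * P.c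
    ^ 2 - 2187 * P.p ^ 5 * P.c - 1458 * P.p ^ 5 + 1782 * P.p ^ 4 * P.c ^ 2 - 2268 * P.p ^ 4 * P.c
    - 729 * P.p ^ 4 + 594 * P.p ^ 3 * P.c ^ 2 - 864 * P.p ^ 3 * P.c + 135 * P.p ^ 3 + 18 * P.p ^ 2
    * P.c ^ 2 - 9 * P.p ^ 2 * P.c + 126 * P.p ^ 2 - 9 * P.p * P.c ^ 2 + 45 * P.p * P.c + 3 * P.p +
    3 * P.c ^ 2 + 6 * P.c) * P.hp
  · linear_combination (3 * P.p - P.c + P.y * P.y' + 1) * P.hyv + P.y ^ 2 * P.X_sq + P.y' ^ 2 *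
    P.U_sq + 3 * P.p * P.z ^ 2 * P.hZ2 + (2 * P.p * P.c * P.z - 2 * P.p * P.y' - P.c ^ 2 * P.z +
    P.c * P.z + P.c * P.y' - P.y') * P.hv + (-P.c * P.y) * P.hX + (P.p - 1) * P.y_sq + (3 * P.p ^
    2 * P.c ^ 2 - 3 * P.p ^ 2 * P.c - 3 * P.p ^ 2 + P.p * P.c ^ 2 - 3 * P.p * P.c + 3 * P.p * P.z
    ^ 2 + P.c ^ 3 - P.c ^ 2) * P.hz2 + (9 * P.p ^ 4 + 3 * P.p ^ 3 * P.c + 21 * P.p ^ 3 + 7 * P.p ^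
    2 * P.c + 13 * P.p ^ 2 + P.p * P.c ^ 2 + 4 * P.p * P.c + P.c ^ 2 - 1) * P.hc + (27 * P.p ^ 3 *
    P.c ^ 2 - 27 * P.p ^ 3 * P.c - 27 * P.p ^ 3 + 45 * P.p ^ 2 * P.c ^ 2 - 54 * P.p ^ 2 * P.c - 27
    * P.p ^ 2 + 18 * P.p * P.c ^ 2 - 27 * P.p * P.c + 3 * P.p + 6) * P.hp
  · linear_combination (-2 * P.c + P.X * P.y + P.X * P.y' + P.U ^ 2) * P.hyv + P.p * P.U_sq + 3 *
    P.p * P.z ^ 2 * P.hZ2 + P.p * P.X * P.hv + (-P.p * P.c) * P.X_mul_z + (3 * P.p ^ 2 * P.c ^ 2 -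
    3 * P.p ^ 2 * P.c - 3 * P.p ^ 2 + 3 * P.p * P.c ^ 2 - 3 * P.p * P.c + 3 * P.p * P.z ^ 2) *
    P.hz2 + (9 * P.p ^ 4 + 3 * P.p ^ 3 * P.c + 18 * P.p ^ 3 + 6 * P.p ^ 2 * P.c + 8 * P.p ^ 2 + 3
    * P.p * P.c - P.p) * P.hc + (27 * P.p ^ 3 * P.c ^ 2 - 27 * P.p ^ 3 * P.c - 27 * P.p ^ 3 + 36 *
    P.p ^ 2 * P.c ^ 2 - 45 * P.p ^ 2 * P.c - 18 * P.p ^ 2 + 9 * P.p * P.c ^ 2 - 15 * P.p * P.c + 6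
    * P.p) * P.hp
  · linear_combination (P.X * P.U + P.U * P.y + P.U * P.y') * P.hyv + 3 * P.p * P.z * P.Z * P.hZ2
    + (P.p * P.U - P.c * P.U) * P.hv + P.p * P.U * P.hX + (-3 * P.p ^ 2 * P.z + P.c ^ 2 * P.z) *
    P.hU + 3 * P.p * P.z * P.Z * P.hz2 + (-9 * P.p ^ 2 * P.z * P.Z - 3 * P.p * P.c * P.z * P.Z - 9
    * P.p * P.z * P.Z - 3 * P.c * P.z * P.Z + P.z * P.Z) * P.hc + (-18 * P.p * P.c ^ 2 * P.z * P.Z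
    + 9 * P.p * P.c * P.z * P.Z + 27 * P.p * P.z * P.Z - 6 * P.c ^ 2 * P.z * P.Z + 12 * P.c * P.z
    * P.Z - 3 * P.z * P.Z) * P.hp
  · linear_combination (-2 * P.p + P.c + P.U ^ 2 - 1) * P.U_sq + (3 * P.p * P.z ^ 2 + 3 * P.p *
    P.Z ^ 2 + 3 * P.p) * P.hZ2 + (2 * P.p * P.c * P.z - P.p * P.y' - P.c ^ 3 * P.z ^ 3 + P.c ^ 2 *
    P.z ^ 2 * P.y' + P.c ^ 2 * P.z - P.c * P.z * P.y' ^ 2 - P.c * P.y' + P.y' ^ 3) * P.hv + (P.p -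
    P.c ^ 2 * P.z ^ 2 + P.c * P.z * P.y' + P.c - P.y' ^ 2) * P.hyv + (-P.p + P.c ^ 2 * P.z ^ 2 -
    P.c * P.z * P.y - P.c + P.y ^ 2) * P.y_sq + (3 * P.p ^ 2 * P.c ^ 2 - 3 * P.p ^ 2 * P.c - 3 *
    P.p ^ 2 + P.p * P.c ^ 6 - P.p * P.c ^ 5 - P.p * P.c ^ 4 - P.p * P.c ^ 2 - 3 * P.p * P.c + 3 *
    P.p * P.z ^ 2 + 3 * P.p + P.c ^ 6 - P.c ^ 5 + P.c ^ 4 * P.z ^ 2 - P.c ^ 4 - P.c ^ 3) * P.hz2 +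
    (243 * P.p ^ 7 + 81 * P.p ^ 6 * P.c + 810 * P.p ^ 6 + 27 * P.p ^ 5 * P.c ^ 2 + 243 * P.p ^ 5 *
    P.c + 918 * P.p ^ 5 + 9 * P.p ^ 4 * P.c ^ 3 + 72 * P.p ^ 4 * P.c ^ 2 + 234 * P.p ^ 4 * P.c +
    342 * P.p ^ 4 + 3 * P.p ^ 3 * P.c ^ 4 + 21 * P.p ^ 3 * P.c ^ 3 + 57 * P.p ^ 3 * P.c ^ 2 + 57 *
    P.p ^ 3 * P.c - 63 * P.p ^ 3 + P.p ^ 2 * P.c ^ 5 + 6 * P.p ^ 2 * P.c ^ 4 + 13 * P.p ^ 2 * P.c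
    ^ 3 + 5 * P.p ^ 2 * P.c ^ 2 - 27 * P.p ^ 2 * P.c - 60 * P.p ^ 2 + 2 * P.p * P.c ^ 5 + 3 * P.p
    * P.c ^ 4 - P.p * P.c ^ 3 - 9 * P.p * P.c ^ 2 - 12 * P.p * P.c - 5 * P.p + P.c ^ 5 - 2 * P.c ^
    3 - 2 * P.c ^ 2 + 1) * P.hc + (729 * P.p ^ 6 * P.c ^ 2 - 729 * P.p ^ 6 * P.c - 729 * P.p ^ 6 +
    1944 * P.p ^ 5 * P.c ^ 2 - 2187 * P.p ^ 5 * P.c - 1458 * P.p ^ 5 + 1782 * P.p ^ 4 * P.c ^ 2 -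
    2268 * P.p ^ 4 * P.c - 729 * P.p ^ 4 + 594 * P.p ^ 3 * P.c ^ 2 - 864 * P.p ^ 3 * P.c + 135 *
    P.p ^ 3 - 9 * P.p ^ 2 * P.c ^ 2 + 18 * P.p ^ 2 * P.c + 153 * P.p ^ 2 - 36 * P.p * P.c ^ 2 + 81
    * P.p * P.c + 12 * P.p - 3 * P.c ^ 2 + 15 * P.c) * P.hp
  · linear_combination (3 * P.p - 2 * P.c + P.y * P.y' + 1) * P.hyv + (-P.c + P.y ^ 2 + P.y' ^ 2)
    * P.U_sq + (3 * P.p * P.z ^ 2 + 3 * P.p * P.Z ^ 2 + 3 * P.p) * P.hZ2 + (2 * P.p * P.c * P.z -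
    2 * P.p * P.y' - P.c ^ 2 * P.z + P.c * P.z + P.c * P.y' - P.y') * P.hv + (-2 * P.p + P.c - 1)
    * P.y_sq + (3 * P.p ^ 2 * P.c ^ 2 - 3 * P.p ^ 2 * P.c - 3 * P.p ^ 2 + P.p * P.c ^ 2 - 3 * P.p
    * P.c + 3 * P.p * P.z ^ 2 + 3 * P.p + P.c ^ 3 - P.c ^ 2) * P.hz2 + (9 * P.p ^ 4 + 3 * P.p ^ 3
    * P.c + 21 * P.p ^ 3 + 7 * P.p ^ 2 * P.c + 13 * P.p ^ 2 + P.p * P.c ^ 2 + 4 * P.p * P.c + P.c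
    ^ 2 - 1) * P.hc + (27 * P.p ^ 3 * P.c ^ 2 - 27 * P.p ^ 3 * P.c - 27 * P.p ^ 3 + 45 * P.p ^ 2 *
    P.c ^ 2 - 54 * P.p ^ 2 * P.c - 27 * P.p ^ 2 + 18 * P.p * P.c ^ 2 - 27 * P.p * P.c + 3 * P.p +
    3 * P.c ^ 2 - 3 * P.c + 6) * P.hp

/-- Representatives, up to symmetry, of the closed walks of length `5`. -/
def pentagonWalks : List (List (Fin 4)) :=
  [[0, 1, 0, 1, 1], [0, 1, 0, 1, 2], [0, 1, 0, 2, 2], [0, 1, 0, 2, 3], [0, 1, 1, 1, 1], [0, 1, 1,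
  1, 2], [0, 1, 1, 2, 1], [0, 1, 1, 2, 2], [0, 1, 1, 2, 3], [0, 1, 2, 1, 2], [0, 1, 2, 1, 3], [0,
  1, 2, 2, 1], [0, 1, 2, 2, 3], [0, 1, 2, 3, 1], [1, 1, 1, 1, 1], [1, 1, 1, 1, 2], [1, 1, 1, 2,
  2], [1, 1, 1, 2, 3], [1, 1, 2, 1, 2], [1, 1, 2, 1, 3], [1, 1, 2, 2, 3], [1, 1, 2, 3, 2], [1, 2,
  1, 2, 3]]

theorem equation_pentagon : ∀ l ∈ pentagonWalks, Equation P l := by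
  intro l hl
  simp only [pentagonWalks, List.mem_cons, List.not_mem_nil, or_false] at hl
  rcases hl with rfl | rfl | rfl | rfl | rfl | rfl | rfl | rfl | rfl | rfl | rfl | rfl | rfl | rfl
    | rfl | rfl | rfl | rfl | rfl | rfl | rfl | rfl | rfl
  all_goals simp only [Equation, Fin.sum_univ_four,
    Values.cell, kind, next, Values.val, Values.weight, Values.invWeight, Fin.isValue,
    Fin.reduceEq, and_self, and_true, true_and, and_false, false_and, or_self, or_true, true_or,
    or_false, false_or, if_true, if_false, Matrix.cons_val]
  · linear_combination (P.z ^ 3 + P.z) * P.X_mul_z + (P.z ^ 2 * P.y + P.z ^ 2 * P.y' + P.Z ^ 2 *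
    P.y + P.Z ^ 2 * P.y' + P.y + P.y') * P.hZ2 + (P.z ^ 4 + 2 * P.z ^ 2 + 1) * P.hv + (-P.p * P.c
    ^ 3 * P.z + 2 * P.p * P.c ^ 2 * P.z - P.p * P.c * P.z + P.p * P.z - P.c ^ 3 * P.z + 2 * P.c ^
    2 * P.z - P.c * P.z ^ 3 - 3 * P.c * P.z + 3 * P.z) * P.hz2 + (-9 * P.p ^ 4 * P.z - 3 * P.p ^ 3
    * P.c * P.z - 18 * P.p ^ 3 * P.z - P.p ^ 2 * P.c ^ 2 * P.z - 5 * P.p ^ 2 * P.c * P.z - 8 * P.p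
    ^ 2 * P.z - 2 * P.p * P.c ^ 2 * P.z - P.p * P.c * P.z - P.c ^ 2 * P.z + P.c * P.z - P.z) *
    P.hc + (-27 * P.p ^ 3 * P.c ^ 2 * P.z + 27 * P.p ^ 3 * P.c * P.z + 27 * P.p ^ 3 * P.z - 36 *
    P.p ^ 2 * P.c ^ 2 * P.z + 45 * P.p ^ 2 * P.c * P.z + 18 * P.p ^ 2 * P.z - 12 * P.p * P.c ^ 2 *
    P.z + 18 * P.p * P.c * P.z - 3 * P.p * P.z - 3 * P.c ^ 2 * P.z + 3 * P.c * P.z) * P.hp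
  · linear_combination P.Z ^ 3 * P.U_mul_Z + (P.p * P.c ^ 2 * P.Z - 2 * P.p * P.c * P.Z + P.p *
    P.Z + P.c ^ 2 * P.Z - 3 * P.c * P.Z + P.z * P.Z * P.y' + 2 * P.Z) * P.hZ2 + (P.z ^ 3 * P.Z +
    P.z * P.Z) * P.hv + (-P.p * P.c ^ 3 * P.Z + 2 * P.p * P.c ^ 2 * P.Z - P.p * P.c * P.Z + P.p *
    P.Z - P.c ^ 3 * P.Z + 2 * P.c ^ 2 * P.Z - P.c * P.z ^ 2 * P.Z - 3 * P.c * P.Z + 3 * P.Z) *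
    P.hz2 + (-9 * P.p ^ 4 * P.Z - 3 * P.p ^ 3 * P.c * P.Z - 18 * P.p ^ 3 * P.Z - P.p ^ 2 * P.c ^ 2
    * P.Z - 5 * P.p ^ 2 * P.c * P.Z - 8 * P.p ^ 2 * P.Z - 2 * P.p * P.c ^ 2 * P.Z - P.p * P.c *
    P.Z - P.c ^ 2 * P.Z + P.c * P.Z - P.Z) * P.hc + (-27 * P.p ^ 3 * P.c ^ 2 * P.Z + 27 * P.p ^ 3
    * P.c * P.Z + 27 * P.p ^ 3 * P.Z - 36 * P.p ^ 2 * P.c ^ 2 * P.Z + 45 * P.p ^ 2 * P.c * P.Z +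
    18 * P.p ^ 2 * P.Z - 12 * P.p * P.c ^ 2 * P.Z + 18 * P.p * P.c * P.Z - 3 * P.p * P.Z - 3 * P.c
    ^ 2 * P.Z + 3 * P.c * P.Z) * P.hp
  · linear_combination P.z * P.Z ^ 2 * P.X_mul_z + (P.p * P.c ^ 2 * P.z - 2 * P.p * P.c * P.z +
    P.p * P.z + P.c ^ 2 * P.z - 2 * P.c * P.z + P.z ^ 2 * P.y + P.z ^ 2 * P.y' + 3 * P.z + P.Z ^ 2
    * P.y + P.y + P.y') * P.hZ2 + (P.z ^ 4 + 2 * P.z ^ 2 + 1) * P.hv + (-P.p * P.c ^ 3 * P.z + 2 *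
    P.p * P.c ^ 2 * P.z - P.p * P.c * P.z + P.p * P.z - P.c ^ 3 * P.z + 2 * P.c ^ 2 * P.z - P.c *
    P.z ^ 3 - 3 * P.c * P.z + 3 * P.z) * P.hz2 + (-9 * P.p ^ 4 * P.z - 3 * P.p ^ 3 * P.c * P.z -
    18 * P.p ^ 3 * P.z - P.p ^ 2 * P.c ^ 2 * P.z - 5 * P.p ^ 2 * P.c * P.z - 8 * P.p ^ 2 * P.z - 2
    * P.p * P.c ^ 2 * P.z - P.p * P.c * P.z - P.c ^ 2 * P.z + P.c * P.z - P.z) * P.hc + (-27 * P.p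
    ^ 3 * P.c ^ 2 * P.z + 27 * P.p ^ 3 * P.c * P.z + 27 * P.p ^ 3 * P.z - 36 * P.p ^ 2 * P.c ^ 2 *
    P.z + 45 * P.p ^ 2 * P.c * P.z + 18 * P.p ^ 2 * P.z - 12 * P.p * P.c ^ 2 * P.z + 18 * P.p *
    P.c * P.z - 3 * P.p * P.z - 3 * P.c ^ 2 * P.z + 3 * P.c * P.z) * P.hp
  · linear_combination (P.z ^ 2 * P.Z + P.Z) * P.U_mul_Z + (P.z * P.Z * P.y + P.z * P.Z * P.y' + 2
    * P.Z) * P.hZ2 + (P.z ^ 3 * P.Z + P.z * P.Z) * P.hv + (-P.p * P.c ^ 3 * P.Z + 2 * P.p * P.c ^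
    2 * P.Z - P.p * P.c * P.Z + P.p * P.Z - P.c ^ 3 * P.Z + 2 * P.c ^ 2 * P.Z - P.c * P.z ^ 2 *
    P.Z - 3 * P.c * P.Z + 3 * P.Z) * P.hz2 + (-9 * P.p ^ 4 * P.Z - 3 * P.p ^ 3 * P.c * P.Z - 18 *
    P.p ^ 3 * P.Z - P.p ^ 2 * P.c ^ 2 * P.Z - 5 * P.p ^ 2 * P.c * P.Z - 8 * P.p ^ 2 * P.Z - 2 *
    P.p * P.c ^ 2 * P.Z - P.p * P.c * P.Z - P.c ^ 2 * P.Z + P.c * P.Z - P.Z) * P.hc + (-27 * P.p ^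
    3 * P.c ^ 2 * P.Z + 27 * P.p ^ 3 * P.c * P.Z + 27 * P.p ^ 3 * P.Z - 36 * P.p ^ 2 * P.c ^ 2 *
    P.Z + 45 * P.p ^ 2 * P.c * P.Z + 18 * P.p ^ 2 * P.Z - 12 * P.p * P.c ^ 2 * P.Z + 18 * P.p *
    P.c * P.Z - 3 * P.p * P.Z - 3 * P.c ^ 2 * P.Z + 3 * P.c * P.Z) * P.hp
  · linear_combination (P.z ^ 2 * P.X + 2 * P.z) * P.X_sq + (P.p * P.z + P.c * P.z + P.z) *
    P.X_mul_z + (P.y ^ 3 + P.y' ^ 3) * P.hZ2 + (-P.p * P.z ^ 2 - P.p + P.c ^ 2 * P.z ^ 4 + P.c ^ 2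
    * P.z ^ 2 - P.c * P.z ^ 3 * P.y' - P.c * P.z * P.y' + P.z ^ 2 * P.y' ^ 2 + P.y' ^ 2) * P.hv +
    (P.c * P.z ^ 3 + P.c * P.z - P.z ^ 2 * P.y' - P.y') * P.hyv + P.hX + (-P.c * P.z ^ 3 - P.c *
    P.z + P.z ^ 2 * P.y + P.y) * P.y_sq + (-P.p * P.c ^ 5 * P.z + P.p * P.c ^ 4 * P.z + P.p * P.c
    ^ 3 * P.z + 3 * P.p * P.c * P.z - P.c ^ 5 * P.z + P.c ^ 4 * P.z - P.c ^ 3 * P.z ^ 3 + P.z) *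
    P.hz2 + (-81 * P.p ^ 6 * P.z - 27 * P.p ^ 5 * P.c * P.z - 243 * P.p ^ 5 * P.z - 9 * P.p ^ 4 *
    P.c ^ 2 * P.z - 72 * P.p ^ 4 * P.c * P.z - 234 * P.p ^ 4 * P.z - 3 * P.p ^ 3 * P.c ^ 3 * P.z -
    21 * P.p ^ 3 * P.c ^ 2 * P.z - 57 * P.p ^ 3 * P.c * P.z - 63 * P.p ^ 3 * P.z - P.p ^ 2 * P.c ^
    4 * P.z - 6 * P.p ^ 2 * P.c ^ 3 * P.z - 13 * P.p ^ 2 * P.c ^ 2 * P.z - 8 * P.p ^ 2 * P.c * P.z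
    + 14 * P.p ^ 2 * P.z - 2 * P.p * P.c ^ 4 * P.z - 3 * P.p * P.c ^ 3 * P.z + 4 * P.p * P.c * P.z
    + 5 * P.p * P.z - P.c ^ 4 * P.z + P.c ^ 2 * P.z) * P.hc + (-243 * P.p ^ 5 * P.c ^ 2 * P.z +
    243 * P.p ^ 5 * P.c * P.z + 243 * P.p ^ 5 * P.z - 567 * P.p ^ 4 * P.c ^ 2 * P.z + 648 * P.p ^
    4 * P.c * P.z + 405 * P.p ^ 4 * P.z - 432 * P.p ^ 3 * P.c ^ 2 * P.z + 567 * P.p ^ 3 * P.c *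
    P.z + 135 * P.p ^ 3 * P.z - 117 * P.p ^ 2 * P.c ^ 2 * P.z + 171 * P.p ^ 2 * P.c * P.z - 45 *
    P.p ^ 2 * P.z - 12 * P.p * P.c ^ 2 * P.z + 6 * P.p * P.c * P.z - 15 * P.p * P.z - 3 * P.c ^ 2
    * P.z - 3 * P.c * P.z) * P.hp
  · linear_combination (-P.p * P.c ^ 2 * P.Z + 2 * P.p * P.c * P.Z - P.p * P.Z - P.c ^ 2 * P.Z + 3
    * P.c * P.Z + P.z * P.Z * P.y - P.Z) * P.hyv + P.z * P.Z * P.y * P.X_sq + P.Z * P.X_mul_z +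
    P.Z * P.y' ^ 2 * P.U_mul_Z + (-P.p * P.c ^ 3 * P.z * P.Z + 2 * P.p * P.c ^ 2 * P.z * P.Z + P.p
    * P.c ^ 2 * P.Z * P.y' - P.p * P.c * P.z * P.Z - 2 * P.p * P.c * P.Z * P.y' + P.p * P.Z * P.y'
    - P.c ^ 3 * P.z * P.Z + 3 * P.c ^ 2 * P.z * P.Z + P.c ^ 2 * P.Z * P.y' - P.c * P.z * P.Z - 3 *
    P.c * P.Z * P.y' + P.Z * P.y') * P.hv + P.Z * P.y * P.hX + P.Z * P.y_sq + (P.p * P.c ^ 4 * P.Z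
    - 2 * P.p * P.c ^ 3 * P.Z + P.p * P.c ^ 2 * P.Z + P.c ^ 4 * P.Z - 3 * P.c ^ 3 * P.Z + P.c ^ 2
    * P.Z + P.Z) * P.hz2 + (27 * P.p ^ 5 * P.Z + 9 * P.p ^ 4 * P.c * P.Z + 63 * P.p ^ 4 * P.Z + 3
    * P.p ^ 3 * P.c ^ 2 * P.Z + 18 * P.p ^ 3 * P.c * P.Z + 30 * P.p ^ 3 * P.Z + P.p ^ 2 * P.c ^ 3
    * P.Z + 5 * P.p ^ 2 * P.c ^ 2 * P.Z + 5 * P.p ^ 2 * P.c * P.Z - 17 * P.p ^ 2 * P.Z + 2 * P.p *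
    P.c ^ 3 * P.Z - 6 * P.p * P.c * P.Z + P.p * P.z * P.Z * P.y - 10 * P.p * P.Z + P.c ^ 3 * P.Z -
    2 * P.c ^ 2 * P.Z - 2 * P.c * P.Z + P.z * P.Z * P.y + P.Z) * P.hc + (81 * P.p ^ 4 * P.c ^ 2 *
    P.Z - 81 * P.p ^ 4 * P.c * P.Z - 81 * P.p ^ 4 * P.Z + 135 * P.p ^ 3 * P.c ^ 2 * P.Z - 162 *
    P.p ^ 3 * P.c * P.Z - 81 * P.p ^ 3 * P.Z + 36 * P.p ^ 2 * P.c ^ 2 * P.Z - 63 * P.p ^ 2 * P.c *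
    P.Z + 27 * P.p ^ 2 * P.Z - 27 * P.p * P.c ^ 2 * P.Z + 33 * P.p * P.c * P.Z + 27 * P.p * P.Z +
    3 * P.c ^ 2 * P.z * P.Z * P.y - 9 * P.c ^ 2 * P.Z - 3 * P.c * P.z * P.Z * P.y + 18 * P.c * P.Z
    - 3 * P.z * P.Z * P.y - 6 * P.Z) * P.hp
  · linear_combination P.Z ^ 2 * P.y' * P.hyv + P.Z ^ 2 * P.y' * P.U_sq + (P.z * P.y ^ 2 + P.y) *
    P.X_mul_z + (-P.p * P.y' + P.c * P.y' + P.z + P.y - P.y') * P.hZ2 + (-P.p * P.z ^ 2 - P.p +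
    P.c * P.z ^ 2 + P.c - P.z ^ 2 - 1) * P.hv + (P.p * P.c ^ 2 * P.z - 2 * P.p * P.c * P.z + P.p *
    P.z + P.c ^ 2 * P.z - 2 * P.c * P.z + 2 * P.z) * P.y_sq + (-P.p * P.c ^ 3 * P.y + 2 * P.p *
    P.c ^ 2 * P.y + P.p * P.c * P.z - P.p * P.c * P.y + P.p * P.y - P.c ^ 3 * P.y - P.c ^ 2 * P.z
    + 2 * P.c ^ 2 * P.y + P.c * P.z - 3 * P.c * P.y + P.z + 3 * P.y) * P.hz2 + (-9 * P.p ^ 4 * P.y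
    - 3 * P.p ^ 3 * P.c * P.y - 18 * P.p ^ 3 * P.y - P.p ^ 2 * P.c ^ 2 * P.y - 5 * P.p ^ 2 * P.c *
    P.y - 2 * P.p ^ 2 * P.z - 8 * P.p ^ 2 * P.y - 2 * P.p * P.c ^ 2 * P.y - P.p * P.c * P.z - P.p
    * P.c * P.y - 2 * P.p * P.z - P.c ^ 2 * P.y - P.c * P.z + P.c * P.y - P.y) * P.hc + (-27 * P.p
    ^ 3 * P.c ^ 2 * P.y + 27 * P.p ^ 3 * P.c * P.y + 27 * P.p ^ 3 * P.y - 36 * P.p ^ 2 * P.c ^ 2 *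
    P.y + 45 * P.p ^ 2 * P.c * P.y + 18 * P.p ^ 2 * P.y - 6 * P.p * P.c ^ 2 * P.z - 12 * P.p * P.c
    ^ 2 * P.y + 6 * P.p * P.c * P.z + 18 * P.p * P.c * P.y + 6 * P.p * P.z - 3 * P.p * P.y - 3 *
    P.c ^ 2 * P.z - 3 * P.c ^ 2 * P.y + 6 * P.c * P.z + 3 * P.c * P.y - 3 * P.z) * P.hp
  · linear_combination (2 * P.z * P.Z * P.X + P.Z ^ 2 * P.U + 2 * P.Z) * P.hyv + 2 * P.p * P.Z *
    P.X_mul_z + P.p * P.Z * P.U_mul_Z + P.z * P.Z * P.hv + (-P.c * P.Z + P.Z) * P.hz2 + (-P.p *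
    P.Z - P.Z) * P.hc + (-3 * P.c * P.Z + 6 * P.Z) * P.hp
  · linear_combination (-P.p * P.c ^ 2 * P.z + 2 * P.p * P.c * P.z - P.p * P.z - P.c ^ 2 * P.z + 3
    * P.c * P.z - P.z + P.Z ^ 2 * P.y) * P.hyv + P.Z * P.U * P.y * P.X_mul_z + (P.p * P.c ^ 2 *
    P.y - 2 * P.p * P.c * P.y + P.p * P.y + P.c ^ 2 * P.y - 2 * P.c * P.y + P.z * P.y' ^ 2 + P.z +
    2 * P.y + P.y') * P.U_mul_Z + (P.p * P.y + P.z + P.y) * P.hZ2 + (-P.p * P.c ^ 3 * P.z ^ 2 + 2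
    * P.p * P.c ^ 2 * P.z ^ 2 + P.p * P.c ^ 2 * P.z * P.y' + P.p * P.c ^ 2 - P.p * P.c * P.z ^ 2 -
    2 * P.p * P.c * P.z * P.y' - 2 * P.p * P.c + P.p * P.z * P.y' + P.p - P.c ^ 3 * P.z ^ 2 + 3 *
    P.c ^ 2 * P.z ^ 2 + P.c ^ 2 * P.z * P.y' + P.c ^ 2 - P.c * P.z ^ 2 - 3 * P.c * P.z * P.y' - 3
    * P.c + P.z * P.y' + 1) * P.hv + (P.p * P.c ^ 4 * P.z - 2 * P.p * P.c ^ 3 * P.z + P.p * P.c ^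
    3 * P.y + P.p * P.c ^ 2 * P.z - 2 * P.p * P.c ^ 2 * P.y + P.p * P.c * P.y + P.p * P.y + P.c ^
    4 * P.z - 3 * P.c ^ 3 * P.z + P.c ^ 3 * P.y + P.c ^ 2 * P.z - 3 * P.c ^ 2 * P.y + P.c * P.y +
    P.z + P.y) * P.hz2 + (27 * P.p ^ 5 * P.z + 9 * P.p ^ 4 * P.c * P.z + 63 * P.p ^ 4 * P.z + 9 *
    P.p ^ 4 * P.y + 3 * P.p ^ 3 * P.c ^ 2 * P.z + 18 * P.p ^ 3 * P.c * P.z + 3 * P.p ^ 3 * P.c *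
    P.y + 30 * P.p ^ 3 * P.z + 21 * P.p ^ 3 * P.y + P.p ^ 2 * P.c ^ 3 * P.z + 5 * P.p ^ 2 * P.c ^
    2 * P.z + P.p ^ 2 * P.c ^ 2 * P.y + 5 * P.p ^ 2 * P.c * P.z + 6 * P.p ^ 2 * P.c * P.y - 17 *
    P.p ^ 2 * P.z + 9 * P.p ^ 2 * P.y + 2 * P.p * P.c ^ 3 * P.z + 2 * P.p * P.c ^ 2 * P.y - 6 *
    P.p * P.c * P.z + 2 * P.p * P.c * P.y - 11 * P.p * P.z - 8 * P.p * P.y + P.c ^ 3 * P.z - 2 *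
    P.c ^ 2 * P.z + P.c ^ 2 * P.y - 2 * P.c * P.z - P.c * P.y - 5 * P.y) * P.hc + (81 * P.p ^ 4 *
    P.c ^ 2 * P.z - 81 * P.p ^ 4 * P.c * P.z - 81 * P.p ^ 4 * P.z + 135 * P.p ^ 3 * P.c ^ 2 * P.z
    + 27 * P.p ^ 3 * P.c ^ 2 * P.y - 162 * P.p ^ 3 * P.c * P.z - 27 * P.p ^ 3 * P.c * P.y - 81 *
    P.p ^ 3 * P.z - 27 * P.p ^ 3 * P.y + 36 * P.p ^ 2 * P.c ^ 2 * P.z + 45 * P.p ^ 2 * P.c ^ 2 *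
    P.y - 63 * P.p ^ 2 * P.c * P.z - 54 * P.p ^ 2 * P.c * P.y + 27 * P.p ^ 2 * P.z - 27 * P.p ^ 2
    * P.y - 27 * P.p * P.c ^ 2 * P.z + 9 * P.p * P.c ^ 2 * P.y + 33 * P.p * P.c * P.z - 18 * P.p *
    P.c * P.y + 27 * P.p * P.z + 12 * P.p * P.y - 12 * P.c ^ 2 * P.z - 9 * P.c ^ 2 * P.y + 21 *
    P.c * P.z + 9 * P.c * P.y - 3 * P.z + 12 * P.y) * P.hp
  · linear_combination P.Z ^ 2 * P.U * P.U_sq + (-2 * P.p * P.Z + P.c * P.Z - P.Z) * P.U_mul_Z +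
    P.Z * P.hZ2 + (-P.p * P.z * P.Z + P.c ^ 2 * P.z ^ 3 * P.Z - P.c * P.z ^ 2 * P.Z * P.y' - P.c *
    P.z * P.Z + P.z * P.Z * P.y' ^ 2 + P.z * P.Z + P.Z * P.y') * P.hv + (P.c * P.z ^ 2 * P.Z - P.z
    * P.Z * P.y' - P.Z) * P.hyv + (-P.c * P.z ^ 2 * P.Z + P.z * P.Z * P.y + P.Z) * P.y_sq + (-P.p
    * P.c ^ 5 * P.Z + P.p * P.c ^ 4 * P.Z + P.p * P.c ^ 3 * P.Z + 3 * P.p * P.c * P.Z - P.c ^ 5 *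
    P.Z + P.c ^ 4 * P.Z - P.c ^ 3 * P.z ^ 2 * P.Z + P.c ^ 3 * P.Z + P.c ^ 2 * P.Z - P.c * P.Z +
    P.Z) * P.hz2 + (-81 * P.p ^ 6 * P.Z - 27 * P.p ^ 5 * P.c * P.Z - 243 * P.p ^ 5 * P.Z - 9 * P.p
    ^ 4 * P.c ^ 2 * P.Z - 72 * P.p ^ 4 * P.c * P.Z - 234 * P.p ^ 4 * P.Z - 3 * P.p ^ 3 * P.c ^ 3 *
    P.Z - 21 * P.p ^ 3 * P.c ^ 2 * P.Z - 57 * P.p ^ 3 * P.c * P.Z - 54 * P.p ^ 3 * P.Z - P.p ^ 2 *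
    P.c ^ 4 * P.Z - 6 * P.p ^ 2 * P.c ^ 3 * P.Z - 13 * P.p ^ 2 * P.c ^ 2 * P.Z - 5 * P.p ^ 2 * P.c
    * P.Z + 32 * P.p ^ 2 * P.Z - 2 * P.p * P.c ^ 4 * P.Z - 3 * P.p * P.c ^ 3 * P.Z + P.p * P.c ^ 2
    * P.Z + 9 * P.p * P.c * P.Z + 14 * P.p * P.Z - P.c ^ 4 * P.Z + 2 * P.c ^ 2 * P.Z + 2 * P.c *
    P.Z) * P.hc + (-243 * P.p ^ 5 * P.c ^ 2 * P.Z + 243 * P.p ^ 5 * P.c * P.Z + 243 * P.p ^ 5 *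
    P.Z - 567 * P.p ^ 4 * P.c ^ 2 * P.Z + 648 * P.p ^ 4 * P.c * P.Z + 405 * P.p ^ 4 * P.Z - 432 *
    P.p ^ 3 * P.c ^ 2 * P.Z + 567 * P.p ^ 3 * P.c * P.Z + 135 * P.p ^ 3 * P.Z - 90 * P.p ^ 2 * P.c
    ^ 2 * P.Z + 144 * P.p ^ 2 * P.c * P.Z - 72 * P.p ^ 2 * P.Z + 24 * P.p * P.c ^ 2 * P.Z - 39 *
    P.p * P.c * P.Z - 33 * P.p * P.Z + 9 * P.c ^ 2 * P.Z - 18 * P.c * P.Z - 3 * P.Z) * P.hp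
  · linear_combination (-P.p * P.c ^ 2 * P.Z + 2 * P.p * P.c * P.Z - P.p * P.Z - P.c ^ 2 * P.Z + 3
    * P.c * P.Z + P.z * P.Z * P.y) * P.hyv + (P.z * P.Z * P.y + P.Z) * P.U_sq + (P.Z * P.y' ^ 2 +
    P.Z) * P.U_mul_Z + P.Z * P.hZ2 + (-P.p * P.c ^ 3 * P.z * P.Z + 2 * P.p * P.c ^ 2 * P.z * P.Z +
    P.p * P.c ^ 2 * P.Z * P.y' - P.p * P.c * P.z * P.Z - 2 * P.p * P.c * P.Z * P.y' + P.p * P.Z *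
    P.y' - P.c ^ 3 * P.z * P.Z + 3 * P.c ^ 2 * P.z * P.Z + P.c ^ 2 * P.Z * P.y' - P.c * P.z * P.Z
    - 3 * P.c * P.Z * P.y' + P.Z * P.y') * P.hv + (P.p * P.c ^ 4 * P.Z - 2 * P.p * P.c ^ 3 * P.Z +
    P.p * P.c ^ 2 * P.Z + P.c ^ 4 * P.Z - 3 * P.c ^ 3 * P.Z + P.c ^ 2 * P.Z + P.Z) * P.hz2 + (27 *
    P.p ^ 5 * P.Z + 9 * P.p ^ 4 * P.c * P.Z + 63 * P.p ^ 4 * P.Z + 3 * P.p ^ 3 * P.c ^ 2 * P.Z +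
    18 * P.p ^ 3 * P.c * P.Z + 30 * P.p ^ 3 * P.Z + P.p ^ 2 * P.c ^ 3 * P.Z + 5 * P.p ^ 2 * P.c ^
    2 * P.Z + 5 * P.p ^ 2 * P.c * P.Z - 17 * P.p ^ 2 * P.Z + 2 * P.p * P.c ^ 3 * P.Z - 6 * P.p *
    P.c * P.Z + P.p * P.z * P.Z * P.y - 10 * P.p * P.Z + P.c ^ 3 * P.Z - 2 * P.c ^ 2 * P.Z - 2 *
    P.c * P.Z + P.z * P.Z * P.y + P.Z) * P.hc + (81 * P.p ^ 4 * P.c ^ 2 * P.Z - 81 * P.p ^ 4 * P.c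
    * P.Z - 81 * P.p ^ 4 * P.Z + 135 * P.p ^ 3 * P.c ^ 2 * P.Z - 162 * P.p ^ 3 * P.c * P.Z - 81 *
    P.p ^ 3 * P.Z + 36 * P.p ^ 2 * P.c ^ 2 * P.Z - 63 * P.p ^ 2 * P.c * P.Z + 27 * P.p ^ 2 * P.Z -
    27 * P.p * P.c ^ 2 * P.Z + 33 * P.p * P.c * P.Z + 27 * P.p * P.Z + 3 * P.c ^ 2 * P.z * P.Z *
    P.y - 9 * P.c ^ 2 * P.Z - 3 * P.c * P.z * P.Z * P.y + 18 * P.c * P.Z - 3 * P.z * P.Z * P.y - 6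
    * P.Z) * P.hp
  · linear_combination (-P.p * P.c ^ 2 * P.z + 2 * P.p * P.c * P.z - P.p * P.z - P.c ^ 2 * P.z + 2
    * P.c * P.z + P.z ^ 2 * P.y + P.z - P.X) * P.hyv + P.Z ^ 2 * P.y * P.U_sq + (-2 * P.p * P.y +
    P.c * P.y + P.z + P.X * P.y' ^ 2 - P.y + 2 * P.y') * P.hZ2 + (-P.c * P.y' + P.z * P.y' ^ 2) *
    P.X_mul_z + (-P.p * P.c ^ 3 * P.z ^ 2 - P.p * P.c ^ 3 + 2 * P.p * P.c ^ 2 * P.z ^ 2 + P.p *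
    P.c ^ 2 * P.z * P.y' + 2 * P.p * P.c ^ 2 - P.p * P.c * P.z ^ 2 - 2 * P.p * P.c * P.z * P.y' -
    P.p * P.c + P.p * P.z * P.y' - P.c ^ 3 * P.z ^ 2 - P.c ^ 3 + 2 * P.c ^ 2 * P.z ^ 2 + P.c ^ 2 *
    P.z * P.y' + 2 * P.c ^ 2 - P.c * P.z ^ 2 - 2 * P.c * P.z * P.y' - P.c + 2 * P.z ^ 2 + P.z *
    P.y' + P.X * P.y' + 3) * P.hv + (-P.p) * P.hX + (P.p * P.c ^ 4 * P.z - 2 * P.p * P.c ^ 3 * P.z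
    + P.p * P.c ^ 3 * P.y + P.p * P.c ^ 2 * P.z - 2 * P.p * P.c ^ 2 * P.y + P.p * P.c * P.y - P.p
    * P.y + P.c ^ 4 * P.z - 2 * P.c ^ 3 * P.z + P.c ^ 3 * P.y + P.c ^ 2 * P.z - 2 * P.c ^ 2 * P.y
    - 2 * P.c * P.z + 2 * P.c * P.y + P.z - 3 * P.y) * P.hz2 + (27 * P.p ^ 5 * P.z + 9 * P.p ^ 4 *
    P.c * P.z + 63 * P.p ^ 4 * P.z + 9 * P.p ^ 4 * P.y + 3 * P.p ^ 3 * P.c ^ 2 * P.z + 18 * P.p ^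
    3 * P.c * P.z + 3 * P.p ^ 3 * P.c * P.y + 39 * P.p ^ 3 * P.z + 18 * P.p ^ 3 * P.y + P.p ^ 2 *
    P.c ^ 3 * P.z + 5 * P.p ^ 2 * P.c ^ 2 * P.z + P.p ^ 2 * P.c ^ 2 * P.y + 8 * P.p ^ 2 * P.c *
    P.z + 5 * P.p ^ 2 * P.c * P.y + P.p ^ 2 * P.z + 8 * P.p ^ 2 * P.y + 2 * P.p * P.c ^ 3 * P.z +
    P.p * P.c ^ 2 * P.z + 2 * P.p * P.c ^ 2 * P.y - P.p * P.c * P.z + P.p * P.c * P.y - 3 * P.p *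
    P.z + P.c ^ 3 * P.z - P.c ^ 2 * P.z + P.c ^ 2 * P.y - P.c * P.y - P.z + P.y) * P.hc + (81 *
    P.p ^ 4 * P.c ^ 2 * P.z - 81 * P.p ^ 4 * P.c * P.z - 81 * P.p ^ 4 * P.z + 135 * P.p ^ 3 * P.c
    ^ 2 * P.z + 27 * P.p ^ 3 * P.c ^ 2 * P.y - 162 * P.p ^ 3 * P.c * P.z - 27 * P.p ^ 3 * P.c *
    P.y - 81 * P.p ^ 3 * P.z - 27 * P.p ^ 3 * P.y + 63 * P.p ^ 2 * P.c ^ 2 * P.z + 36 * P.p ^ 2 *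
    P.c ^ 2 * P.y - 90 * P.p ^ 2 * P.c * P.z - 45 * P.p ^ 2 * P.c * P.y - 18 * P.p ^ 2 * P.y + 9 *
    P.p * P.c ^ 2 * P.z + 12 * P.p * P.c ^ 2 * P.y - 12 * P.p * P.c * P.z - 18 * P.p * P.c * P.y +
    9 * P.p * P.z + 3 * P.p * P.y + 3 * P.c ^ 2 * P.y + 3 * P.c * P.z - 3 * P.c * P.y + 3 * P.z) *
    P.hp
  · linear_combination (2 * P.z * P.Z * P.U + P.Z ^ 2 * P.X) * P.hyv + (2 * P.p * P.z + P.y +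
    P.y') * P.U_mul_Z + (P.p * P.X + P.z + P.y + P.y') * P.hZ2 + P.p * P.z * P.X_mul_z + (P.p *
    P.c ^ 2 - 2 * P.p * P.c + P.p + P.c ^ 2 - 3 * P.c + P.z ^ 2 + 2) * P.hv + P.p * P.hX + (-P.c *
    P.z + P.z) * P.hz2 + (-2 * P.p * P.z - 2 * P.z) * P.hc + (-3 * P.c ^ 2 * P.z + 6 * P.z) * P.hp
  · linear_combination (P.z ^ 2 * P.U + 2 * P.Z ^ 2 * P.U) * P.hyv + (2 * P.p * P.Z + 2 * P.Z) *
    P.U_mul_Z + P.Z * P.hZ2 + P.z * P.U * P.hv + (P.p * P.z ^ 2 - P.c * P.z ^ 2 + 1) * P.hU + (-3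
    * P.p ^ 2 * P.c ^ 2 * P.Z + 6 * P.p ^ 2 * P.c * P.Z + 3 * P.p * P.c ^ 3 * P.Z - 9 * P.p * P.c
    ^ 2 * P.Z + 7 * P.p * P.c * P.Z - 3 * P.p * P.Z + 3 * P.c ^ 3 * P.Z - 7 * P.c ^ 2 * P.Z + 3 *
    P.c * P.Z + P.Z) * P.hz2 + (18 * P.p ^ 4 * P.Z + 6 * P.p ^ 3 * P.c * P.Z + 39 * P.p ^ 3 * P.Z
    + 3 * P.p ^ 2 * P.c ^ 2 * P.Z + 9 * P.p ^ 2 * P.c * P.Z + 16 * P.p ^ 2 * P.Z + 6 * P.p * P.c ^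
    2 * P.Z - P.p * P.c * P.Z - 9 * P.p * P.Z + 3 * P.c ^ 2 * P.Z - 4 * P.c * P.Z - 4 * P.Z) *
    P.hc + (54 * P.p ^ 3 * P.c ^ 2 * P.Z - 54 * P.p ^ 3 * P.c * P.Z - 54 * P.p ^ 3 * P.Z + 81 *
    P.p ^ 2 * P.c ^ 2 * P.Z - 99 * P.p ^ 2 * P.c * P.Z - 45 * P.p ^ 2 * P.Z + 18 * P.p * P.c ^ 2 *
    P.Z - 33 * P.p * P.c * P.Z + 18 * P.p * P.Z - 9 * P.c ^ 2 * P.Z + 9 * P.c * P.Z + 15 * P.Z) *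
    P.hp
  · linear_combination (P.p * P.X + P.c * P.X + P.X ^ 3 + 4 * P.X) * P.X_sq + (P.p ^ 2 - 3 * P.p *
    P.c ^ 2 * P.z ^ 2 + 2 * P.p * P.c * P.z * P.y' - P.p * P.y' ^ 2 + P.c ^ 4 * P.z ^ 4 - P.c ^ 3
    * P.z ^ 3 * P.y' + P.c ^ 2 * P.z ^ 2 * P.y' ^ 2 - P.c * P.z * P.y' ^ 3 + P.y' ^ 4) * P.hv +
    (-2 * P.p * P.c * P.z + P.p * P.y' + P.c ^ 3 * P.z ^ 3 - P.c ^ 2 * P.z ^ 2 * P.y' + P.c * P.z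
    * P.y' ^ 2 - P.y' ^ 3) * P.hyv + (P.p ^ 2 + 2 * P.p * P.c + 3 * P.p + P.c ^ 2 + 3 * P.c + 1) *
    P.hX + (2 * P.p * P.c * P.z - P.p * P.y - P.c ^ 3 * P.z ^ 3 + P.c ^ 2 * P.z ^ 2 * P.y - P.c *
    P.z * P.y ^ 2 + P.y ^ 3) * P.y_sq + (3 * P.p ^ 2 * P.c ^ 2 * P.z - 3 * P.p ^ 2 * P.c * P.z - 3
    * P.p ^ 2 * P.z - P.p * P.c ^ 7 * P.z + P.p * P.c ^ 6 * P.z + P.p * P.c ^ 5 * P.z + 5 * P.p *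
    P.c ^ 3 * P.z + 3 * P.p * P.c ^ 2 * P.z - 3 * P.p * P.c * P.z + 3 * P.p * P.z ^ 3 - 3 * P.p *
    P.z - P.c ^ 7 * P.z + P.c ^ 6 * P.z - P.c ^ 5 * P.z ^ 3 + P.c ^ 5 * P.z) * P.hz2 + (-729 * P.p
    ^ 8 * P.z - 243 * P.p ^ 7 * P.c * P.z - 2673 * P.p ^ 7 * P.z - 81 * P.p ^ 6 * P.c ^ 2 * P.z -
    810 * P.p ^ 6 * P.c * P.z - 3483 * P.p ^ 6 * P.z - 27 * P.p ^ 5 * P.c ^ 3 * P.z - 243 * P.p ^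
    5 * P.c ^ 2 * P.z - 918 * P.p ^ 5 * P.c * P.z - 1701 * P.p ^ 5 * P.z - 9 * P.p ^ 4 * P.c ^ 4 *
    P.z - 72 * P.p ^ 4 * P.c ^ 3 * P.z - 234 * P.p ^ 4 * P.c ^ 2 * P.z - 333 * P.p ^ 4 * P.c * P.z
    + 63 * P.p ^ 4 * P.z - 3 * P.p ^ 3 * P.c ^ 5 * P.z - 21 * P.p ^ 3 * P.c ^ 4 * P.z - 57 * P.p ^
    3 * P.c ^ 3 * P.z - 54 * P.p ^ 3 * P.c ^ 2 * P.z + 78 * P.p ^ 3 * P.c * P.z + 261 * P.p ^ 3 *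
    P.z - P.p ^ 2 * P.c ^ 6 * P.z - 6 * P.p ^ 2 * P.c ^ 5 * P.z - 13 * P.p ^ 2 * P.c ^ 4 * P.z - 5
    * P.p ^ 2 * P.c ^ 3 * P.z + 31 * P.p ^ 2 * P.c ^ 2 * P.z + 64 * P.p ^ 2 * P.c * P.z + 24 * P.p
    ^ 2 * P.z - 2 * P.p * P.c ^ 6 * P.z - 3 * P.p * P.c ^ 5 * P.z + P.p * P.c ^ 4 * P.z + 8 * P.p
    * P.c ^ 3 * P.z + 12 * P.p * P.c ^ 2 * P.z + 3 * P.p * P.c * P.z - 12 * P.p * P.z - P.c ^ 6 *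
    P.z + 2 * P.c ^ 4 * P.z + P.c ^ 3 * P.z - P.c ^ 2 * P.z - P.c * P.z + P.z) * P.hc + (-2187 *
    P.p ^ 7 * P.c ^ 2 * P.z + 2187 * P.p ^ 7 * P.c * P.z + 2187 * P.p ^ 7 * P.z - 6561 * P.p ^ 6 *
    P.c ^ 2 * P.z + 7290 * P.p ^ 6 * P.c * P.z + 5103 * P.p ^ 6 * P.z - 7047 * P.p ^ 5 * P.c ^ 2 *
    P.z + 8748 * P.p ^ 5 * P.c * P.z + 3402 * P.p ^ 5 * P.z - 2997 * P.p ^ 4 * P.c ^ 2 * P.z +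
    4212 * P.p ^ 4 * P.c * P.z - 81 * P.p ^ 4 * P.z - 189 * P.p ^ 3 * P.c ^ 2 * P.z + 297 * P.p ^
    3 * P.c * P.z - 675 * P.p ^ 3 * P.z + 126 * P.p ^ 2 * P.c ^ 2 * P.z - 306 * P.p ^ 2 * P.c *
    P.z - 72 * P.p ^ 2 * P.z - 15 * P.p * P.c ^ 2 * P.z - 36 * P.p * P.c * P.z + 36 * P.p * P.z -
    15 * P.c ^ 2 * P.z + 3 * P.c * P.z - 3 * P.z) * P.hp
  · linear_combination (-2 * P.p * P.c * P.z + P.p * P.y + 2 * P.p * P.y' + P.c ^ 2 * P.z - P.c *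
    P.z - P.c * P.y' + P.y ^ 2 * P.y' + P.y') * P.hyv + (P.X * P.y ^ 2 + 2 * P.y) * P.X_sq + P.y'
    ^ 3 * P.U_sq + 3 * P.p * P.z ^ 3 * P.hZ2 + (2 * P.p ^ 2 - 2 * P.p * P.c ^ 2 * P.z ^ 2 + 2 *
    P.p * P.c * P.z * P.y' - P.p * P.c - 2 * P.p * P.y' ^ 2 + P.p + P.c ^ 3 * P.z ^ 2 - P.c ^ 2 *
    P.z ^ 2 - P.c ^ 2 * P.z * P.y' + P.c * P.z * P.y' + P.c * P.y' ^ 2 - P.y' ^ 2) * P.hv + (P.p *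
    P.y ^ 2 + P.c * P.y ^ 2 + P.y ^ 2 + 1) * P.hX + (-3 * P.p ^ 2 * P.z - 2 * P.p * P.c * P.z - 3
    * P.p * P.z + P.c ^ 2 * P.z + P.y) * P.y_sq + (3 * P.p ^ 2 * P.c ^ 2 * P.z - 3 * P.p ^ 2 * P.c
    * P.z + 3 * P.p ^ 2 * P.c * P.y - 3 * P.p ^ 2 * P.z + 2 * P.p * P.c ^ 3 * P.z + 3 * P.p * P.c
    ^ 2 * P.z + 4 * P.p * P.c ^ 2 * P.y - 3 * P.p * P.c * P.z + 3 * P.p * P.c * P.y + 3 * P.p *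
    P.z ^ 3 - P.c ^ 4 * P.z + P.c ^ 3 * P.z - 2 * P.c ^ 3 * P.y + P.c ^ 2 * P.y) * P.hz2 + (3 *
    P.p ^ 3 * P.z - 3 * P.p ^ 3 * P.y - P.p ^ 2 * P.c ^ 2 * P.z + 2 * P.p ^ 2 * P.c * P.z - 2 *
    P.p ^ 2 * P.c * P.y + 6 * P.p ^ 2 * P.z - 5 * P.p ^ 2 * P.y - P.p * P.c ^ 3 * P.z - P.p * P.c
    ^ 2 * P.z - 2 * P.p * P.c ^ 2 * P.y + 3 * P.p * P.c * P.z - 3 * P.p * P.c * P.y + 3 * P.p *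
    P.z - P.p * P.y - P.c ^ 3 * P.z - 2 * P.c ^ 2 * P.y + P.c * P.z - P.c * P.y + P.y) * P.hc + (9
    * P.p ^ 2 * P.c ^ 2 * P.z - 9 * P.p ^ 2 * P.c ^ 2 * P.y - 9 * P.p ^ 2 * P.c * P.z + 9 * P.p ^
    2 * P.c * P.y - 9 * P.p ^ 2 * P.z + 9 * P.p ^ 2 * P.y + 9 * P.p * P.c ^ 2 * P.z - 9 * P.p *
    P.c ^ 2 * P.y - 12 * P.p * P.c * P.z + 12 * P.p * P.c * P.y + 3 * P.p * P.y + 3 * P.c ^ 2 *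
    P.z - 6 * P.c * P.z - 3 * P.y) * P.hp
  · linear_combination (P.p * P.X + P.X ^ 2 * P.y + P.X * P.y * P.y' + 2 * P.X + P.U ^ 2 * P.y' +
    3 * P.y) * P.hyv + P.p * P.y * P.X_sq + P.p * P.y' * P.U_sq + 3 * P.p * P.z ^ 3 * P.hZ2 + (-2
    * P.p ^ 2 + P.p * P.c - P.p + 1) * P.hv + (P.p ^ 2 + 2 * P.p) * P.hX + (3 * P.p ^ 2 * P.c ^ 2
    * P.z - 3 * P.p ^ 2 * P.c * P.z - 3 * P.p ^ 2 * P.z + 3 * P.p * P.c ^ 2 * P.z - 3 * P.p * P.c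
    * P.z + 3 * P.p * P.z ^ 3) * P.hz2 + (9 * P.p ^ 4 * P.z + 3 * P.p ^ 3 * P.c * P.z + 18 * P.p ^
    3 * P.z + 6 * P.p ^ 2 * P.c * P.z + 9 * P.p ^ 2 * P.z + 3 * P.p * P.c * P.z) * P.hc + (27 *
    P.p ^ 3 * P.c ^ 2 * P.z - 27 * P.p ^ 3 * P.c * P.z - 27 * P.p ^ 3 * P.z + 36 * P.p ^ 2 * P.c ^
    2 * P.z - 45 * P.p ^ 2 * P.c * P.z - 18 * P.p ^ 2 * P.z + 12 * P.p * P.c ^ 2 * P.z - 18 * P.p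
    * P.c * P.z + 3 * P.c * P.z + 3 * P.y) * P.hp
  · linear_combination (-P.p * P.U + P.X ^ 2 * P.U + P.U * P.y ^ 2 + P.U * P.y' ^ 2) * P.hyv + P.p
    * P.U * P.X_sq + 3 * P.p * P.z ^ 2 * P.Z * P.hZ2 + (-P.p * P.c * P.z * P.U + P.p * P.U * P.y'
    - P.c * P.z * P.U + P.X * P.U + P.U * P.y') * P.hv + (-P.c * P.U) * P.X_mul_z + (-P.p * P.c ^
    3 + P.p * P.c ^ 2 * P.z ^ 2 + 2 * P.p * P.c ^ 2 + P.p * P.c * P.z * P.y + P.p * P.y ^ 2 - P.p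
    - P.c ^ 3 + P.c ^ 2 * P.z ^ 2 + 2 * P.c ^ 2 + P.c * P.z * P.y - P.c + P.y ^ 2 + 1) * P.hU +
    (-3 * P.p ^ 2 * P.c ^ 2 * P.Z + 6 * P.p ^ 2 * P.c * P.Z - 6 * P.p * P.c ^ 2 * P.Z + 13 * P.p *
    P.c * P.Z - 3 * P.p * P.Z - 3 * P.c ^ 2 * P.Z + 7 * P.c * P.Z - 3 * P.Z) * P.y_sq + (-3 * P.p
    ^ 2 * P.c ^ 4 * P.Z + 6 * P.p ^ 2 * P.c ^ 3 * P.Z + 3 * P.p ^ 2 * P.c ^ 2 * P.Z - 3 * P.p ^ 2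
    * P.c * P.Z - 3 * P.p ^ 2 * P.Z - 6 * P.p * P.c ^ 4 * P.Z + 13 * P.p * P.c ^ 3 * P.Z - 3 * P.p
    * P.c * P.Z + 3 * P.p * P.z ^ 2 * P.Z - 3 * P.c ^ 4 * P.Z + 7 * P.c ^ 3 * P.Z - 3 * P.c ^ 2 *
    P.Z) * P.hz2 + (-81 * P.p ^ 6 * P.Z - 27 * P.p ^ 5 * P.c * P.Z - 270 * P.p ^ 5 * P.Z - 9 * P.p
    ^ 4 * P.c ^ 2 * P.Z - 81 * P.p ^ 4 * P.c * P.Z - 252 * P.p ^ 4 * P.Z - 3 * P.p ^ 3 * P.c ^ 3 *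
    P.Z - 24 * P.p ^ 3 * P.c ^ 2 * P.Z - 60 * P.p ^ 3 * P.c * P.Z - 3 * P.p ^ 3 * P.Z - 9 * P.p ^
    2 * P.c ^ 3 * P.Z - 14 * P.p ^ 2 * P.c ^ 2 * P.Z + 13 * P.p ^ 2 * P.c * P.Z + 66 * P.p ^ 2 *
    P.Z - 9 * P.p * P.c ^ 3 * P.Z + 8 * P.p * P.c ^ 2 * P.Z + 16 * P.p * P.c * P.Z + 6 * P.p * P.Z
    - 3 * P.c ^ 3 * P.Z + 7 * P.c ^ 2 * P.Z - 3 * P.c * P.Z) * P.hc + (-243 * P.p ^ 5 * P.c ^ 2 *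
    P.Z + 243 * P.p ^ 5 * P.c * P.Z + 243 * P.p ^ 5 * P.Z - 648 * P.p ^ 4 * P.c ^ 2 * P.Z + 729 *
    P.p ^ 4 * P.c * P.Z + 486 * P.p ^ 4 * P.Z - 432 * P.p ^ 3 * P.c ^ 2 * P.Z + 594 * P.p ^ 3 *
    P.c * P.Z + 81 * P.p ^ 3 * P.Z + 27 * P.p ^ 2 * P.c ^ 2 * P.Z + 9 * P.p ^ 2 * P.c * P.Z - 162
    * P.p ^ 2 * P.Z + 60 * P.p * P.c ^ 2 * P.Z - 105 * P.p * P.c * P.Z - 9 * P.p * P.Z + 9 * P.c ^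
    2 * P.Z - 21 * P.c * P.Z + 9 * P.Z) * P.hp
  · linear_combination (P.p * P.c * P.z - P.p * P.y' + P.y' ^ 3 + 2 * P.y') * P.hyv + (-2 * P.p *
    P.y' + P.c * P.y' + P.U ^ 2 * P.y' - P.y') * P.U_sq + (3 * P.p * P.z ^ 3 + 3 * P.p * P.z * P.Z
    ^ 2 + 3 * P.p * P.z) * P.hZ2 + (3 * P.p ^ 2 + P.p * P.c ^ 2 * P.z ^ 2 - P.p * P.c * P.z * P.y'
    - 4 * P.p * P.c + P.p * P.y' ^ 2 + 6 * P.p + P.c ^ 2 - 2 * P.c + 1) * P.hv + (P.y ^ 4 + P.y ^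
    2) * P.hX + (3 * P.p ^ 2 * P.z - 3 * P.p * P.c ^ 2 * P.z ^ 3 + 3 * P.p * P.c * P.z ^ 2 * P.y -
    P.p * P.c * P.z - 3 * P.p * P.z * P.y ^ 2 - 3 * P.p * P.z + P.c ^ 3 * P.z ^ 3 - P.c ^ 2 * P.z
    ^ 2 * P.y + P.c * P.z * P.y ^ 2 - P.c * P.z + 2 * P.y) * P.y_sq + (3 * P.p ^ 2 * P.c ^ 5 * P.y
    - 3 * P.p ^ 2 * P.c ^ 4 * P.y - 3 * P.p ^ 2 * P.c ^ 3 * P.y + 6 * P.p ^ 2 * P.c ^ 2 * P.z - 3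
    * P.p ^ 2 * P.c * P.z - 6 * P.p ^ 2 * P.c * P.y - 3 * P.p ^ 2 * P.z - P.p * P.c ^ 6 * P.y + 4
    * P.p * P.c ^ 5 * P.y - 2 * P.p * P.c ^ 4 * P.y + 3 * P.p * P.c ^ 3 * P.z ^ 2 * P.y - 2 * P.p
    * P.c ^ 3 * P.z - 3 * P.p * P.c ^ 3 * P.y + 3 * P.p * P.c ^ 2 * P.z + P.p * P.c ^ 2 * P.y - 3
    * P.p * P.c * P.z + 3 * P.p * P.c * P.y + 3 * P.p * P.z ^ 3 + 3 * P.p * P.z - P.c ^ 6 * P.y +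
    P.c ^ 5 * P.y - P.c ^ 4 * P.z ^ 2 * P.y + P.c ^ 4 * P.y + P.c ^ 2 * P.y) * P.hz2 + (-81 * P.p
    ^ 6 * P.y - 27 * P.p ^ 5 * P.c * P.y - 216 * P.p ^ 5 * P.y - 9 * P.p ^ 4 * P.c ^ 2 * P.y - 63
    * P.p ^ 4 * P.c * P.y - 171 * P.p ^ 4 * P.y - 3 * P.p ^ 3 * P.c ^ 3 * P.y - 18 * P.p ^ 3 * P.c
    ^ 2 * P.y - 39 * P.p ^ 3 * P.c * P.y - 21 * P.p ^ 3 * P.y - P.p ^ 2 * P.c ^ 5 * P.y - 4 * P.p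
    ^ 2 * P.c ^ 3 * P.y - 2 * P.p ^ 2 * P.c ^ 2 * P.z - 8 * P.p ^ 2 * P.c ^ 2 * P.y + P.p ^ 2 *
    P.c * P.z + 3 * P.p ^ 2 * P.c * P.y + 21 * P.p ^ 2 * P.y - 2 * P.p * P.c ^ 5 * P.y + P.p * P.c
    ^ 3 * P.y - 2 * P.p * P.c ^ 2 * P.z + 2 * P.p * P.c ^ 2 * P.y + P.p * P.c * P.z + 6 * P.p *
    P.c * P.y + 6 * P.p * P.y - P.c ^ 5 * P.y + 2 * P.c ^ 3 * P.y + P.c ^ 2 * P.y - P.z) * P.hc +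
    (-243 * P.p ^ 5 * P.c ^ 2 * P.y + 243 * P.p ^ 5 * P.c * P.y + 243 * P.p ^ 5 * P.y - 486 * P.p
    ^ 4 * P.c ^ 2 * P.y + 567 * P.p ^ 4 * P.c * P.y + 324 * P.p ^ 4 * P.y - 297 * P.p ^ 3 * P.c ^
    2 * P.y + 405 * P.p ^ 3 * P.c * P.y + 54 * P.p ^ 3 * P.y - 45 * P.p ^ 2 * P.c ^ 2 * P.y + 72 *
    P.p ^ 2 * P.c * P.y - 54 * P.p ^ 2 * P.y - 3 * P.p * P.c ^ 2 * P.z + 9 * P.p * P.c ^ 2 * P.y +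
    3 * P.p * P.c * P.z - 21 * P.p * P.c * P.y - 12 * P.p * P.y + 3 * P.c ^ 2 * P.y - 6 * P.c *
    P.y + 3 * P.z - 6 * P.y) * P.hp
  · linear_combination (P.p * P.X + P.X * P.y * P.y' + P.X + P.U ^ 2 * P.y + P.U ^ 2 * P.y' + P.y
    + P.y') * P.hyv + (P.p * P.y + P.p * P.y' + P.y + P.y') * P.U_sq + (3 * P.p * P.z ^ 3 + 3 *
    P.p * P.z * P.Z ^ 2 + 3 * P.p * P.z) * P.hZ2 + (-2 * P.p ^ 2 + P.p * P.c - 2 * P.p + P.c) *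
    P.hv + (P.p ^ 2 + P.p) * P.hX + (3 * P.p ^ 2 * P.c ^ 2 * P.z - 3 * P.p ^ 2 * P.c * P.z - 3 *
    P.p ^ 2 * P.z + 3 * P.p * P.c ^ 2 * P.z - 3 * P.p * P.c * P.z + 3 * P.p * P.z ^ 3 + 3 * P.p *
    P.z) * P.hz2 + (9 * P.p ^ 4 * P.z + 3 * P.p ^ 3 * P.c * P.z + 18 * P.p ^ 3 * P.z + 6 * P.p ^ 2
    * P.c * P.z + 9 * P.p ^ 2 * P.z + 3 * P.p * P.c * P.z) * P.hc + (27 * P.p ^ 3 * P.c ^ 2 * P.z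
    - 27 * P.p ^ 3 * P.c * P.z - 27 * P.p ^ 3 * P.z + 36 * P.p ^ 2 * P.c ^ 2 * P.z - 45 * P.p ^ 2
    * P.c * P.z - 18 * P.p ^ 2 * P.z + 12 * P.p * P.c ^ 2 * P.z - 18 * P.p * P.c * P.z + 3 * P.c ^
    2 * P.z) * P.hp
  · linear_combination (P.p * P.U + P.X * P.U * P.y + P.X * P.U * P.y' + P.U * P.y * P.y' + 2 *
    P.U) * P.hyv + 3 * P.p * P.z ^ 2 * P.Z * P.hZ2 + (P.p * P.X * P.U - P.c * P.z * P.U + P.U *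
    P.y') * P.hv + (-P.p * P.c * P.U) * P.X_mul_z + (-P.p ^ 2 * P.c ^ 3 + 2 * P.p ^ 2 * P.c ^ 2 -
    P.p ^ 2 * P.c + P.p ^ 2 - P.p * P.c ^ 3 + 2 * P.p * P.c ^ 2 - P.p * P.c + 2 * P.p + P.c ^ 2 *
    P.z ^ 2 + P.c * P.z * P.y + P.y ^ 2) * P.hU + (-3 * P.p * P.c ^ 2 * P.Z + 6 * P.p * P.c * P.Z
    - 3 * P.c ^ 2 * P.Z + 7 * P.c * P.Z - 3 * P.Z) * P.y_sq + (3 * P.p ^ 2 * P.c ^ 2 * P.Z - 3 *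
    P.p ^ 2 * P.c * P.Z - 3 * P.p ^ 2 * P.Z - 3 * P.p * P.c ^ 4 * P.Z + 6 * P.p * P.c ^ 3 * P.Z +
    3 * P.p * P.c ^ 2 * P.Z - 3 * P.p * P.c * P.Z + 3 * P.p * P.z ^ 2 * P.Z - 3 * P.c ^ 4 * P.Z +
    7 * P.c ^ 3 * P.Z - 3 * P.c ^ 2 * P.Z) * P.hz2 + (-54 * P.p ^ 5 * P.Z - 18 * P.p ^ 4 * P.c *
    P.Z - 135 * P.p ^ 4 * P.Z - 6 * P.p ^ 3 * P.c ^ 2 * P.Z - 39 * P.p ^ 3 * P.c * P.Z - 75 * P.p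
    ^ 3 * P.Z - 3 * P.p ^ 2 * P.c ^ 3 * P.Z - 9 * P.p ^ 2 * P.c ^ 2 * P.Z - 16 * P.p ^ 2 * P.c *
    P.Z + 33 * P.p ^ 2 * P.Z - 6 * P.p * P.c ^ 3 * P.Z + P.p * P.c ^ 2 * P.Z + 9 * P.p * P.c * P.Z
    + 24 * P.p * P.Z - 3 * P.c ^ 3 * P.Z + 4 * P.c ^ 2 * P.Z + 4 * P.c * P.Z - 3 * P.Z) * P.hc +
    (-162 * P.p ^ 4 * P.c ^ 2 * P.Z + 162 * P.p ^ 4 * P.c * P.Z + 162 * P.p ^ 4 * P.Z - 297 * P.p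
    ^ 3 * P.c ^ 2 * P.Z + 351 * P.p ^ 3 * P.c * P.Z + 189 * P.p ^ 3 * P.Z - 99 * P.p ^ 2 * P.c ^ 2
    * P.Z + 162 * P.p ^ 2 * P.c * P.Z - 45 * P.p ^ 2 * P.Z + 45 * P.p * P.c ^ 2 * P.Z - 48 * P.p *
    P.c * P.Z - 63 * P.p * P.Z + 9 * P.c ^ 2 * P.Z - 21 * P.c * P.Z + 9 * P.Z) * P.hp
  · linear_combination (-2 * P.p * P.c * P.z + P.p * P.y + 2 * P.p * P.y' + P.c ^ 2 * P.z - P.c *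
    P.z - P.c * P.y' + P.y ^ 2 * P.y' + 2 * P.y + P.y') * P.hyv + (P.X * P.y ^ 2 + 2 * P.y + P.y'
    ^ 3 + P.y') * P.U_sq + (3 * P.p * P.z ^ 3 + 3 * P.p * P.z * P.Z ^ 2 + 3 * P.p * P.z) * P.hZ2 +
    (2 * P.p ^ 2 - 2 * P.p * P.c ^ 2 * P.z ^ 2 + 2 * P.p * P.c * P.z * P.y' - P.p * P.c - 2 * P.p
    * P.y' ^ 2 - P.p + P.c ^ 3 * P.z ^ 2 - P.c ^ 2 * P.z ^ 2 - P.c ^ 2 * P.z * P.y' + P.c * P.z *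
    P.y' + P.c * P.y' ^ 2 + P.c - P.y' ^ 2 - 1) * P.hv + (-2 * P.p * P.y ^ 2 + P.c * P.y ^ 2 - P.y
    ^ 2) * P.hX + (6 * P.p ^ 2 * P.z - 5 * P.p * P.c * P.z + 3 * P.p * P.z + P.c ^ 2 * P.z - P.c *
    P.z) * P.y_sq + (3 * P.p ^ 2 * P.c ^ 2 * P.z - 3 * P.p ^ 2 * P.c * P.z - 6 * P.p ^ 2 * P.c *
    P.y - 3 * P.p ^ 2 * P.z + 2 * P.p * P.c ^ 3 * P.z + 3 * P.p * P.c ^ 2 * P.z + 7 * P.p * P.c ^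
    2 * P.y - 3 * P.p * P.c * P.z - 3 * P.p * P.c * P.y + 3 * P.p * P.z ^ 3 + 3 * P.p * P.z - P.c
    ^ 4 * P.z + P.c ^ 3 * P.z - 2 * P.c ^ 3 * P.y + 2 * P.c ^ 2 * P.y) * P.hz2 + (3 * P.p ^ 3 *
    P.z - 3 * P.p ^ 3 * P.y - P.p ^ 2 * P.c ^ 2 * P.z + 2 * P.p ^ 2 * P.c * P.z + P.p ^ 2 * P.c *
    P.y + 6 * P.p ^ 2 * P.z - 5 * P.p ^ 2 * P.y - P.p * P.c ^ 3 * P.z - P.p * P.c ^ 2 * P.z - 2 *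
    P.p * P.c ^ 2 * P.y + 3 * P.p * P.c * P.z + P.p * P.c * P.y + 3 * P.p * P.z - P.c ^ 3 * P.z -
    2 * P.c ^ 2 * P.y + P.c * P.z + 2 * P.y) * P.hc + (9 * P.p ^ 2 * P.c ^ 2 * P.z - 9 * P.p ^ 2 *
    P.c ^ 2 * P.y - 9 * P.p ^ 2 * P.c * P.z + 9 * P.p ^ 2 * P.c * P.y - 9 * P.p ^ 2 * P.z + 9 *
    P.p ^ 2 * P.y + 9 * P.p * P.c ^ 2 * P.z - 9 * P.p * P.c ^ 2 * P.y - 12 * P.p * P.c * P.z + 12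
    * P.p * P.c * P.y - 9 * P.p * P.z + 3 * P.p * P.y + 6 * P.c ^ 2 * P.z - 6 * P.c * P.z + 3 *
    P.c * P.y - 6 * P.y) * P.hp
  · linear_combination (-P.p * P.U + P.U ^ 3 + P.U * P.y ^ 2 + P.U * P.y' ^ 2 + P.U) * P.hyv +
    (P.p * P.U + P.U) * P.U_sq + (3 * P.p * P.z ^ 2 * P.Z + 3 * P.p * P.Z ^ 3 + 3 * P.p * P.Z) *
    P.hZ2 + (-P.p * P.c * P.z * P.U + P.p * P.U * P.y' - P.c * P.z * P.U + P.U * P.y') * P.hv +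
    (-3 * P.p ^ 2 + P.p * P.c ^ 2 * P.z ^ 2 + P.p * P.c * P.z * P.y + P.p * P.c + P.p * P.y ^ 2 -
    2 * P.p + P.c ^ 2 * P.z ^ 2 + P.c * P.z * P.y + P.c + P.y ^ 2 + 1) * P.hU + (-3 * P.p ^ 2 *
    P.c ^ 2 * P.Z + 6 * P.p ^ 2 * P.c * P.Z - 6 * P.p * P.c ^ 2 * P.Z + 13 * P.p * P.c * P.Z - 3 *
    P.p * P.Z - 3 * P.c ^ 2 * P.Z + 7 * P.c * P.Z - 3 * P.Z) * P.y_sq + (-3 * P.p ^ 2 * P.c ^ 4 *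
    P.Z + 6 * P.p ^ 2 * P.c ^ 3 * P.Z + 3 * P.p ^ 2 * P.c ^ 2 * P.Z - 3 * P.p ^ 2 * P.c * P.Z - 3
    * P.p ^ 2 * P.Z - 6 * P.p * P.c ^ 4 * P.Z + 13 * P.p * P.c ^ 3 * P.Z - 3 * P.p * P.c * P.Z + 3
    * P.p * P.z ^ 2 * P.Z + 3 * P.p * P.Z - 3 * P.c ^ 4 * P.Z + 7 * P.c ^ 3 * P.Z - 3 * P.c ^ 2 *
    P.Z) * P.hz2 + (-81 * P.p ^ 6 * P.Z - 27 * P.p ^ 5 * P.c * P.Z - 270 * P.p ^ 5 * P.Z - 9 * P.p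
    ^ 4 * P.c ^ 2 * P.Z - 81 * P.p ^ 4 * P.c * P.Z - 279 * P.p ^ 4 * P.Z - 3 * P.p ^ 3 * P.c ^ 3 *
    P.Z - 24 * P.p ^ 3 * P.c ^ 2 * P.Z - 69 * P.p ^ 3 * P.c * P.Z - 48 * P.p ^ 3 * P.Z - 9 * P.p ^
    2 * P.c ^ 3 * P.Z - 17 * P.p ^ 2 * P.c ^ 2 * P.Z + P.p ^ 2 * P.c * P.Z + 60 * P.p ^ 2 * P.Z -
    9 * P.p * P.c ^ 3 * P.Z + 2 * P.p * P.c ^ 2 * P.Z + 20 * P.p * P.c * P.Z + 12 * P.p * P.Z - 3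
    * P.c ^ 3 * P.Z + 4 * P.c ^ 2 * P.Z + 4 * P.c * P.Z - 6 * P.Z) * P.hc + (-243 * P.p ^ 5 * P.c
    ^ 2 * P.Z + 243 * P.p ^ 5 * P.c * P.Z + 243 * P.p ^ 5 * P.Z - 648 * P.p ^ 4 * P.c ^ 2 * P.Z +
    729 * P.p ^ 4 * P.c * P.Z + 486 * P.p ^ 4 * P.Z - 513 * P.p ^ 3 * P.c ^ 2 * P.Z + 675 * P.p ^
    3 * P.c * P.Z + 162 * P.p ^ 3 * P.Z - 54 * P.p ^ 2 * P.c ^ 2 * P.Z + 117 * P.p ^ 2 * P.c * P.Z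
    - 135 * P.p ^ 2 * P.Z + 69 * P.p * P.c ^ 2 * P.Z - 114 * P.p * P.c * P.Z - 36 * P.p * P.Z + 15
    * P.c ^ 2 * P.Z - 42 * P.c * P.Z + 27 * P.Z) * P.hp

end LevelThree

/-! ### Symmetries of the cell equations -/

namespace LevelThree

variable (P : Values)

theorem kind_cyclic : ∀ a b c, kind a b c = kind b c a := by decide

theorem kind_comm : ∀ a b c, kind a b c = kind a c b := by decide

theorem cell_cyclic (a b c : Fin 4) : P.cell a b c = P.cell b c a :=
  congrArg P.val (kind_cyclic a b c)

theorem cell_comm (a b c : Fin 4) : P.cell a b c = P.cell a c b :=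
  congrArg P.val (kind_comm a b c)

theorem cell_reverse (a b c : Fin 4) : P.cell a b c = P.cell c b a := by
  rw [cell_comm, cell_cyclic]

theorem cell_swap (a b c : Fin 4) : P.cell a b c = P.cell b a c := by
  rw [cell_cyclic, cell_comm]

theorem ite_invWeight_comm {a b : Fin 4} {s t : ℝ} (h : a = b → s = t) :
    (if a = b then P.invWeight a * s else 0) = if b = a then P.invWeight b * t else 0 := by
  by_cases hab : a = b
  · rw [if_pos hab, if_pos hab.symm, h hab, hab]
  · rw [if_neg hab, if_neg (Ne.symm hab)]

theorem ite_invWeight_comm' (a b : Fin 4) :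
    (if a = b then P.invWeight a else 0) = if b = a then P.invWeight b else 0 := by
  simpa using ite_invWeight_comm P (a := a) (b := b) (s := 1) fun _ => rfl

variable {P}

/-- The equations are invariant under rotation of the walk. -/
theorem Equation.rotate {a : Fin 4} {l : List (Fin 4)} (h : Equation P (a :: l)) :
    Equation P (l ++ [a]) := by
  have cy := cell_cyclic P
  match l, h with
  | [], h => exact h
  | [b], h =>
    refine Eq.trans (Finset.sum_congr rfl fun x _ => ?_) h
    rw [cy b a x, ← cy a b x, mul_comm (P.cell a x b)]
  | [b, c], h =>
    refine (Finset.sum_congr rfl fun x _ => ?_).trans (h.trans ?_)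
    · ring
    · rw [cy a b c]
  | [b, c, d], h =>
    refine (Finset.sum_congr rfl fun x _ => ?_).trans (h.trans ?_)
    · ring
    · rw [← cy a b c, ← cy d b c, ← cy a b d, ite_invWeight_comm' P a c]
      ring
  | [b, c, d, e], h =>
    refine (Finset.sum_congr rfl fun x _ => ?_).trans (h.trans ?_)
    · ring
    · ring
  | b :: c :: d :: e :: f :: l, h =>
    match l with
    | [] => trivial
    | _ :: _ => trivial

/-- The cells being totally symmetric, the equations are invariant under reversal of the walk. -/
theorem Equation.reverse {l : List (Fin 4)} (h : Equation P l) : Equation P l.reverse := by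
  have sw := cell_swap P
  have re := cell_reverse P
  have cy := cell_cyclic P
  have co := cell_comm P
  match l, h with
  | [], _ => trivial
  | [a], h => exact h
  | [a, b], h => exact h.rotate
  | [a, b, c], h =>
    refine (Finset.sum_congr rfl fun x _ => ?_).trans (h.trans ?_)
    · rw [sw c b, sw b a, sw a c]
      ring
    · rw [re a b c]
  | [a, b, c, d], h =>
    refine (Finset.sum_congr rfl fun x _ => ?_).trans (h.trans ?_)
    · rw [sw d c, sw c b, sw b a, sw a d]
      ring
    · rw [re d c b, re d b a, re d c a, co a c b, cy d b c, ite_invWeight_comm' P c a,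
        ite_invWeight_comm' P d b]
      ring
  | [a, b, c, d, e], h =>
    refine (Finset.sum_congr rfl fun x _ => ?_).trans (h.trans ?_)
    · rw [sw e d, sw d c, sw c b, sw b a, sw a e]
      ring
    · rw [re e d c, re e c b, re e b a, re d c b, re d b a, cy d a e, re c b a, cy c a e, co c e d,
        sw b a e, co b e d, co b d c, co a e d, co a d c, co a c b, co a e c, cy b e a, cy e a b,
        cy c e a, cy e a c, cy c a b, cy d e a, cy e a d, cy d a b, cy d b c, cy e b c, cy e c d,
        ite_invWeight_comm P (a := d) (b := a) (t := P.cell a b c),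
        ite_invWeight_comm P (a := c) (b := e) (t := P.cell a b e),
        ite_invWeight_comm P (a := b) (b := d) (t := P.cell a d e),
        ite_invWeight_comm P (a := a) (b := c) (t := P.cell c d e),
        ite_invWeight_comm P (a := e) (b := b) (t := P.cell b c d)]
      · ring
      all_goals
        rintro rfl
        first | exact (cy _ _ _).symm | rfl
  | a :: b :: c :: d :: e :: f :: l, _ =>
    generalize hl : (a :: b :: c :: d :: e :: f :: l).reverse = l'
    have hlen := congrArg List.length hl
    simp only [List.length_reverse, List.length_cons] at hlen
    match l' with
    | [] => trivial
    | [_] => simp at hlen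
    | [_, _] => simp at hlen
    | [_, _, _] => simp at hlen
    | [_, _, _, _] => simp at hlen
    | [_, _, _, _, _] => simp at hlen
    | _ :: _ :: _ :: _ :: _ :: _ :: _ => trivial

/-- The equations are invariant under permutations of the vertices preserving weights and cells. -/
theorem Equation.of_map {Q : Values} {f : Fin 4 → Fin 4} (hf : f.Bijective)
    (hcell : ∀ a b c, Q.cell (f a) (f b) (f c) = P.cell a b c) (hc : Q.c = P.c)
    (hw : ∀ a, Q.weight (f a) = P.weight a) (hw' : ∀ a, Q.invWeight (f a) = P.invWeight a)
    {l : List (Fin 4)} (h : Equation Q (l.map f)) : Equation P l := by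
  match l, h with
  | [], h => trivial
  | [a], h =>
    simp only [List.map, Equation] at h ⊢
    rw [← hf.sum_comp] at h
    simpa only [hcell, hc, hw, hw', hf.injective.eq_iff] using h
  | [a, b], h =>
    simp only [List.map, Equation] at h ⊢
    rw [← hf.sum_comp] at h
    simpa only [hcell, hc, hw, hw', hf.injective.eq_iff] using h
  | [a, b, c], h =>
    simp only [List.map, Equation] at h ⊢
    rw [← hf.sum_comp] at h
    simpa only [hcell, hc, hw, hw', hf.injective.eq_iff] using h
  | [a, b, c, d], h =>
    simp only [List.map, Equation] at h ⊢
    rw [← hf.sum_comp] at h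
    simpa only [hcell, hc, hw, hw', hf.injective.eq_iff] using h
  | [a, b, c, d, e], h =>
    simp only [List.map, Equation] at h ⊢
    rw [← hf.sum_comp] at h
    simpa only [hcell, hc, hw, hw', hf.injective.eq_iff] using h
  | a :: b :: c :: d :: e :: f :: l, h => trivial

end LevelThree

/-! ### The equations for all closed walks -/

namespace LevelThree

/-- The permutations of the vertices which fix `0`. -/
def perms : List (Fin 4 → Fin 4) :=
  [![0, 1, 2, 3], ![0, 2, 3, 1], ![0, 3, 1, 2], ![0, 1, 3, 2], ![0, 3, 2, 1], ![0, 2, 1, 3]]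

/-- The effect on types of an odd permutation of the vertices `1, 2, 3`. -/
def swapKind : Fin 7 → Fin 7 := ![0, 1, 2, 3, 5, 4, 6]

theorem Values.swap_val (P : Values) (k : Fin 7) : P.swap.val (swapKind k) = P.val k := by
  fin_cases k <;> simp [Values.val, Values.swap, swapKind]

theorem perms_spec : ∀ f ∈ perms, f.Bijective ∧ (∀ a, f a = 0 ↔ a = 0) ∧
    ((∀ a b c, kind (f a) (f b) (f c) = kind a b c) ∨
      ∀ a b c, kind (f a) (f b) (f c) = swapKind (kind a b c)) := by
  decide +kernel

/-- The even permutations of the vertices `1, 2, 3` preserve the cells, and the odd ones exchange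
`y` and `y'`, so that it suffices to prove an equation, for all values, up to permutations. -/
theorem equation_of_map {f : Fin 4 → Fin 4} (hf : f ∈ perms) {l : List (Fin 4)}
    (h : ∀ P, Equation P (l.map f)) (P : Values) : Equation P l := by
  obtain ⟨hbij, h0, hk⟩ := perms_spec f hf
  have hw (Q : Values) (a : Fin 4) : Q.weight (f a) = Q.weight a := by
    by_cases ha : a = 0
    · rw [ha, (h0 0).2 rfl]
    · have key : ∀ b : Fin 4, b ≠ 0 → Q.weight b = 1 := by
        intro b hb
        fin_cases b <;> first | rfl | exact absurd rfl hb
      rw [key a ha, key _ fun h => ha ((h0 a).1 h)]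
  have hw' (Q : Values) (a : Fin 4) : Q.invWeight (f a) = Q.invWeight a := by
    by_cases ha : a = 0
    · rw [ha, (h0 0).2 rfl]
    · have key : ∀ b : Fin 4, b ≠ 0 → Q.invWeight b = 1 := by
        intro b hb
        fin_cases b <;> first | rfl | exact absurd rfl hb
      rw [key a ha, key _ fun h => ha ((h0 a).1 h)]
  rcases hk with hk | hk
  · exact .of_map hbij (fun a b c => congrArg P.val (hk a b c)) rfl (hw P) (hw' P) (h P)
  · exact .of_map (Q := P.swap) hbij
      (fun a b c => (congrArg P.swap.val (hk a b c)).trans (P.swap_val _)) rfl (hw P) (hw' P)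
      (h P.swap)

theorem Equation.rotate_n {P : Values} (n : ℕ) {l : List (Fin 4)} (h : Equation P l) :
    Equation P (l.rotate n) := by
  induction n generalizing l with
  | zero => rwa [List.rotate_zero]
  | succ n ih =>
    cases l with
    | nil => exact h
    | cons a l =>
      rw [List.rotate_cons_succ]
      exact ih h.rotate

/-- Whether a walk is equivalent, under the permutations of the vertices, rotations and the
reflection, to one of a given list of closed walks. -/
def covers (reps : List (List (Fin 4))) (l : List (Fin 4)) : Bool :=
  perms.any fun f => reps.any fun r => (List.range r.length).any fun n =>
    decide (r.rotate n = l.map f) || decide (r.reverse.rotate n = l.map f)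

theorem equation_of_covers {reps : List (List (Fin 4))} (h : ∀ P, ∀ r ∈ reps, Equation P r)
    {l : List (Fin 4)} (hl : covers reps l = true) (P : Values) : Equation P l := by
  simp only [covers, List.any_eq_true, Bool.or_eq_true, decide_eq_true_eq] at hl
  obtain ⟨f, hf, r, hr, n, -, hn⟩ := hl
  refine equation_of_map hf (fun Q => ?_) P
  rcases hn with hn | hn <;> rw [← hn]
  · exact (h Q r hr).rotate_n n
  · exact (h Q r hr).reverse.rotate_n n

theorem covers_one : ∀ a : Fin 4, a ≠ 0 → covers (shortWalks.filter (·.length = 1)) [a] = true := by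
  decide +kernel

theorem covers_two : ∀ a b : Fin 4, a ≠ 0 ∨ b ≠ 0 →
    covers (shortWalks.filter (·.length = 2)) [a, b] = true := by
  decide +kernel

theorem covers_three : ∀ a b c : Fin 4, a ≠ 0 ∨ b ≠ 0 → b ≠ 0 ∨ c ≠ 0 → c ≠ 0 ∨ a ≠ 0 →
    covers (shortWalks.filter (·.length = 3)) [a, b, c] = true := by
  decide +kernel

set_option synthInstance.maxHeartbeats 400000 in
theorem covers_four : ∀ a b c d : Fin 4, a ≠ 0 ∨ b ≠ 0 → b ≠ 0 ∨ c ≠ 0 → c ≠ 0 ∨ d ≠ 0 →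
    d ≠ 0 ∨ a ≠ 0 → covers (shortWalks.filter (·.length = 4)) [a, b, c, d] = true := by
  decide +kernel

/-- A permutation of the vertices `1, 2, 3` makes the first vertex of a walk avoiding `0` equal to
`1`; this reduces the number of walks to be compared with the representatives. -/
theorem covers_five_one : ∀ b c d e : Fin 4, b ≠ 0 → c ≠ 0 → d ≠ 0 → e ≠ 0 →
    covers (pentagonWalks.filter (0 ∉ ·)) [1, b, c, d, e] = true := by
  decide +kernel

/-- A rotation and a permutation of the vertices `1, 2, 3` make a walk through `0` begin with
`0, 1`. -/
theorem covers_five_zero : ∀ c d e : Fin 4, c ≠ 0 ∨ d ≠ 0 → d ≠ 0 ∨ e ≠ 0 → e ≠ 0 →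
    covers (pentagonWalks.filter (0 ∈ ·)) [0, 1, c, d, e] = true := by
  decide +kernel

theorem exists_perm_eq_one : ∀ a : Fin 4, a ≠ 0 → ∃ f ∈ perms, f a = 1 := by
  decide +kernel

theorem equation_one (P : Values) {a : Fin 4} (h : a ≠ 0) : Equation P [a] :=
  equation_of_covers (fun P r hr => equation_short P r (List.mem_filter.1 hr).1)
    (covers_one a h) P

theorem equation_two (P : Values) {a b : Fin 4} (h : a ≠ 0 ∨ b ≠ 0) : Equation P [a, b] :=
  equation_of_covers (fun P r hr => equation_short P r (List.mem_filter.1 hr).1)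
    (covers_two a b h) P

theorem equation_three (P : Values) {a b c : Fin 4} (h₁ : a ≠ 0 ∨ b ≠ 0) (h₂ : b ≠ 0 ∨ c ≠ 0)
    (h₃ : c ≠ 0 ∨ a ≠ 0) : Equation P [a, b, c] :=
  equation_of_covers (fun P r hr => equation_short P r (List.mem_filter.1 hr).1)
    (covers_three a b c h₁ h₂ h₃) P

theorem equation_four (P : Values) {a b c d : Fin 4} (h₁ : a ≠ 0 ∨ b ≠ 0) (h₂ : b ≠ 0 ∨ c ≠ 0)
    (h₃ : c ≠ 0 ∨ d ≠ 0) (h₄ : d ≠ 0 ∨ a ≠ 0) : Equation P [a, b, c, d] :=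
  equation_of_covers (fun P r hr => equation_short P r (List.mem_filter.1 hr).1)
    (covers_four a b c d h₁ h₂ h₃ h₄) P

theorem equation_five_of_ne (P : Values) {a b c d e : Fin 4} (ha : a ≠ 0) (hb : b ≠ 0)
    (hc : c ≠ 0) (hd : d ≠ 0) (he : e ≠ 0) : Equation P [a, b, c, d, e] := by
  obtain ⟨f, hf, h1⟩ := exists_perm_eq_one a ha
  have h0 (x : Fin 4) (hx : x ≠ 0) : f x ≠ 0 := fun h => hx (((perms_spec f hf).2.1 x).1 h)
  refine equation_of_map hf (fun Q => ?_) P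
  rw [List.map_cons, h1]
  exact equation_of_covers (fun P r hr => equation_pentagon P r (List.mem_filter.1 hr).1)
    (covers_five_one _ _ _ _ (h0 b hb) (h0 c hc) (h0 d hd) (h0 e he)) Q

theorem equation_five_of_zero (P : Values) {b c d e : Fin 4} (hb : b ≠ 0) (h₁ : c ≠ 0 ∨ d ≠ 0)
    (h₂ : d ≠ 0 ∨ e ≠ 0) (he : e ≠ 0) : Equation P [0, b, c, d, e] := by
  obtain ⟨f, hf, h1⟩ := exists_perm_eq_one b hb
  have h0 (x : Fin 4) (hx : x ≠ 0) : f x ≠ 0 := fun h => hx (((perms_spec f hf).2.1 x).1 h)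
  refine equation_of_map hf (fun Q => ?_) P
  rw [List.map_cons, List.map_cons, h1, ((perms_spec f hf).2.1 0).2 rfl]
  exact equation_of_covers (fun P r hr => equation_pentagon P r (List.mem_filter.1 hr).1)
    (covers_five_zero _ _ _ (h₁.imp (h0 c) (h0 d)) (h₂.imp (h0 d) (h0 e)) (h0 e he)) Q

/-- The equations hold for all closed walks of length five, that is, as soon as no two cyclically
consecutive vertices are `0`. -/
theorem equation_five (P : Values) {a b c d e : Fin 4} (h₁ : a ≠ 0 ∨ b ≠ 0) (h₂ : b ≠ 0 ∨ c ≠ 0)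
    (h₃ : c ≠ 0 ∨ d ≠ 0) (h₄ : d ≠ 0 ∨ e ≠ 0) (h₅ : e ≠ 0 ∨ a ≠ 0) :
    Equation P [a, b, c, d, e] := by
  by_cases ha : a = 0
  · subst ha
    exact equation_five_of_zero P (by simpa using h₁) h₃ h₄ (by simpa using h₅)
  by_cases hb : b = 0
  · subst hb
    exact (equation_five_of_zero P (by simpa using h₂) h₄ h₅ ha).rotate_n 4
  by_cases hc : c = 0
  · subst hc
    exact (equation_five_of_zero P (by simpa using h₃) h₅ h₁ hb).rotate_n 3
  by_cases hd : d = 0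
  · subst hd
    exact (equation_five_of_zero P (by simpa using h₄) h₁ h₂ hc).rotate_n 2
  by_cases he : e = 0
  · subst he
    exact (equation_five_of_zero P ha h₂ h₃ hd).rotate_n 1
  exact equation_five_of_ne P ha hb hc hd he

end LevelThree

namespace LevelThree

/-! ### The numbers at level three -/

/-- The real number `2 cos (2 π / 21)`. -/
noncomputable def cosVal : ℝ := 2 * Real.cos (2 * Real.pi / 21)

theorem q₃_ne_zero : q₃ ≠ 0 := Complex.exp_ne_zero _

theorem q₃_sq : q₃ ^ 2 = Complex.exp (2 * Real.pi * Complex.I / (21 : ℕ)) := by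
  rw [q₃, ← Complex.exp_nat_mul]
  congr 1
  push_cast
  ring

theorem isPrimitiveRoot_q₃_sq : IsPrimitiveRoot (q₃ ^ 2) 21 := by
  rw [q₃_sq]
  exact Complex.isPrimitiveRoot_exp 21 (by norm_num)

theorem q₃_sq_add_inv : q₃ ^ 2 + (q₃ ^ 2)⁻¹ = (cosVal : ℂ) := by
  have h : (cosVal : ℂ) = 2 * Complex.cos (2 * Real.pi / 21) := by
    rw [cosVal]
    push_cast
    ring
  rw [h, Complex.two_cos, q₃_sq, ← Complex.exp_neg]
  congr 2 <;> push_cast <;> ring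

/-- The minimal equation of `cosVal`, obtained from the cyclotomic polynomial of index `21`. -/
theorem cosVal_eq : cosVal ^ 6 - cosVal ^ 5 - 6 * cosVal ^ 4 + 6 * cosVal ^ 3 + 8 * cosVal ^ 2
    - 8 * cosVal + 1 = 0 := by
  have hx := isPrimitiveRoot_q₃_sq
  have hc := q₃_sq_add_inv
  generalize q₃ ^ 2 = x at hx hc
  have hx0 : x ≠ 0 := hx.ne_zero (by norm_num)
  have h7 : x ^ 7 - 1 ≠ 0 := sub_ne_zero.2 (hx.pow_ne_one_of_pos_of_lt (by norm_num) (by norm_num))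
  have h3 : x ^ 2 + x + 1 ≠ 0 := by
    intro h
    refine hx.pow_ne_one_of_pos_of_lt (l := 3) (by norm_num) (by norm_num) ?_
    linear_combination (x - 1) * h
  -- the cyclotomic polynomial of index `21` is `(x ^ 21 - 1) / ((x ^ 7 - 1) * (x ^ 2 + x + 1))`
  have h : x ^ 12 - x ^ 11 + x ^ 9 - x ^ 8 + x ^ 6 - x ^ 4 + x ^ 3 - x + 1 = 0 := by
    refine (mul_eq_zero.1 ((mul_eq_zero.1 ?_).resolve_left h7)).resolve_left h3
    linear_combination hx.pow_eq_one
  have key : ((cosVal ^ 6 - cosVal ^ 5 - 6 * cosVal ^ 4 + 6 * cosVal ^ 3 + 8 * cosVal ^ 2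
    - 8 * cosVal + 1 : ℝ) : ℂ) = 0 := by
    push_cast
    rw [← hc]
    field_simp
    linear_combination h
  exact_mod_cast key

theorem cosVal_gt : 191 / 100 < cosVal := by
  have h := Real.one_sub_sq_div_two_le_cos (x := 2 * Real.pi / 21)
  have hp := Real.pi_lt_d2
  have hp0 := Real.pi_pos
  have h2 : Real.pi ^ 2 < 3.15 ^ 2 := by gcongr
  rw [cosVal]
  nlinarith

/-- One third of the Frobenius-Perron weight of the vertex `0`. -/
noncomputable def pVal : ℝ :=
  (6 * cosVal - 4 * cosVal ^ 2 - 5 * cosVal ^ 3 + cosVal ^ 4 + cosVal ^ 5) / 3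

theorem pVal_sq : pVal ^ 2 = (1 - 3 * pVal) / 3 := by
  have h := cosVal_eq
  rw [pVal]
  linear_combination (-1 / 3 - 2 / 3 * cosVal + 1 / 3 * cosVal ^ 3 + 1 / 9 * cosVal ^ 4) * h

theorem cosVal_cube : cosVal ^ 3
    = 1 - cosVal + 2 * cosVal ^ 2 + 3 * pVal * (cosVal ^ 2 - cosVal - 1) := by
  have h := cosVal_eq
  rw [pVal]
  linear_combination (-1 - cosVal) * h

theorem pVal_pos : 0 < pVal := by
  have h := cosVal_gt
  rw [pVal]
  obtain ⟨t, ht, h⟩ : ∃ t, 0 < t ∧ cosVal = 191 / 100 + t :=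
    ⟨cosVal - 191 / 100, by linarith, by ring⟩
  rw [h]
  ring_nf
  positivity

theorem pVal_lt_one : pVal < 1 := by
  nlinarith [pVal_sq, pVal_pos]

theorem quad_pos : 0 < cosVal ^ 2 - cosVal - 1 := by
  nlinarith [cosVal_gt]

/-- The cell at `(0, 1, 1)`. -/
noncomputable def zVal : ℝ := √((1 + pVal) * (cosVal ^ 2 - cosVal - 1))

theorem zVal_sq : zVal ^ 2 = (1 + pVal) * (cosVal ^ 2 - cosVal - 1) :=
  Real.sq_sqrt (mul_pos (by linarith [pVal_pos]) quad_pos).le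

theorem disc_pos : 0 < cosVal ^ 2 * zVal ^ 2 - 4 * pVal := by
  have h1 := cosVal_gt
  have h2 : 7 / 10 < cosVal ^ 2 - cosVal - 1 := by nlinarith
  have h3 : 7 / 2 < cosVal ^ 2 := by nlinarith
  have h4 : 7 / 2 * (7 / 10) < cosVal ^ 2 * (cosVal ^ 2 - cosVal - 1) := by
    apply mul_lt_mul'' h3 h2 <;> norm_num
  rw [zVal_sq]
  nlinarith [pVal_pos, pVal_lt_one, mul_pos pVal_pos (sub_pos.2 h4)]

/-- The values of the cells at level three; `y` and `y'` are the roots of `t ^ 2 + c z t + p`. -/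
noncomputable def values : Values where
  p := pVal
  c := cosVal
  z := zVal
  Z := √(zVal ^ 2 + 1)
  X := (cosVal - 3 * pVal) * zVal
  U := (-3 + 7 * cosVal - 3 * cosVal ^ 2 + 3 * pVal * (2 * cosVal - cosVal ^ 2))
    * √(zVal ^ 2 + 1)
  y := (-cosVal * zVal - √(cosVal ^ 2 * zVal ^ 2 - 4 * pVal)) / 2
  y' := (-cosVal * zVal + √(cosVal ^ 2 * zVal ^ 2 - 4 * pVal)) / 2
  hp := pVal_sq
  hc := cosVal_cube
  hz2 := zVal_sq
  hZ2 := Real.sq_sqrt (by positivity)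
  hX := rfl
  hU := rfl
  hv := by ring
  hyv := by
    have h := Real.sq_sqrt disc_pos.le
    linear_combination (-1 / 4) * h

theorem weight_pos (a : Fin 4) : 0 < values.weight a := by
  have h : 0 < 3 * pVal := by linarith [pVal_pos]
  fin_cases a <;> first | exact h | exact one_pos

theorem invWeight_eq (a : Fin 4) : values.invWeight a = (values.weight a)⁻¹ := by
  have h : (1 + pVal) = (3 * pVal)⁻¹ := by
    have := pVal_pos
    field_simp
    linear_combination 3 * pVal_sq
  fin_cases a <;> first | exact h | exact inv_one.symm

theorem kind_of_not_adj : ∀ a b c : Fin 4, ¬ (a ≠ 0 ∨ b ≠ 0) → kind a b c = 0 := by decide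

/-- The cell system on the graph `Γ₃`. -/
noncomputable def cells : LoopGraph.CellSystem Γ₃ where
  w a := values.weight a
  u a b c := values.cell a b c
  w_ne_zero a := Complex.ofReal_ne_zero.2 (weight_pos a).ne'
  cyclic a b c := congrArg Complex.ofReal (cell_cyclic values a b c)
  supp a b c h := by
    by_contra hab
    refine h (Complex.ofReal_eq_zero.2 ?_)
    rw [Values.cell, kind_of_not_adj a b c hab]
    rfl

theorem cells_w (a : Fin 4) : cells.w a = (values.weight a : ℂ) := rfl

theorem cells_u (a b c : Fin 4) : cells.u a b c = (values.cell a b c : ℂ) := rfl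

theorem isSolution_cells : cells.IsSolution (3 + 3 * pVal : ℝ)
    (cosVal ^ 3 - 3 * cosVal + (cosVal ^ 2 - 2) + cosVal : ℝ) (cosVal ^ 2 - 1 : ℝ) (cosVal : ℝ)
    (cosVal + 1 : ℝ) where
  loop a := by
    have hp : (pVal : ℂ) ^ 2 = (1 - 3 * pVal) / 3 := by
      exact_mod_cast congrArg Complex.ofReal pVal_sq
    have h0 : cells.w 0 = 3 * pVal := by
      rw [cells_w, ← Complex.ofReal_ofNat, ← Complex.ofReal_mul]
      rfl
    have h1 (b : Fin 4) (hb : b ≠ 0) : cells.w b = 1 := by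
      rw [cells_w]
      fin_cases b <;> first | exact absurd rfl hb | exact Complex.ofReal_one
    have hadj (b c : Fin 4) : Γ₃.adjC b c = if b ≠ 0 ∨ c ≠ 0 then 1 else 0 := by
      classical
      by_cases h : b ≠ 0 ∨ c ≠ 0
      · rw [if_pos h, LoopGraph.adjC_of (Γ := Γ₃) h]
      · rw [if_neg h]
        exact if_neg h
    rw [Fin.sum_univ_four, hadj, hadj, hadj, hadj, h0, h1 1 (by decide), h1 2 (by decide),
      h1 3 (by decide)]
    by_cases ha : a = 0
    · subst ha
      rw [h0]
      push_cast
      simp only [or_self, if_false, or_true, if_true]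
      linear_combination (-9) * hp
    · rw [h1 a ha]
      push_cast
      simp only [ne_eq, ha, not_false_eq_true, true_or, if_true]
      ring
  lollipop a h := by
    have h := congrArg Complex.ofReal (equation_one values (a := a) (by simpa [Γ₃] using h))
    push_cast at h
    exact h
  bigon a b h := by
    have h := congrArg Complex.ofReal (equation_two values h)
    push_cast at h ⊢
    exact h
  trigon a b c h₁ h₂ h₃ := by
    have h := congrArg Complex.ofReal (equation_three values h₁ h₂ h₃)
    push_cast at h ⊢
    exact h
  tetragon a b c d h₁ h₂ h₃ h₄ := by
    have h := congrArg Complex.ofReal (equation_four values h₁ h₂ h₃ h₄)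
    simp only [invWeight_eq] at h
    push_cast [apply_ite Complex.ofReal] at h ⊢
    exact h
  pentagon a b c d e h₁ h₂ h₃ h₄ h₅ := by
    have h := congrArg Complex.ofReal (equation_five values h₁ h₂ h₃ h₄ h₅)
    simp only [invWeight_eq] at h
    push_cast [apply_ite Complex.ofReal] at h
    exact h

theorem exists_faithful : ∃ F : StrictMonoidalFunctor (G2ss q₃) Γ₃.GPA,
    F.toFunctor.Faithful ∧
    F.map (G2.dualityss q₃).cap = Γ₃.GPAev values.weight ∧
    F.map (G2.dualityss q₃).cup = Γ₃.GPAcoev values.weight ∧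
    ∀ (p : Γ₃.Path 2) (e : Γ₃.Path 1), p.Parallel e →
      Γ₃.GPAcoord (F.map (G2.vertexss q₃)) p e
        = ((√(values.weight (p.vert 1))
          * values.cell (p.vert 0) (p.vert 1) (p.vert 2) : ℝ) : ℂ) := by
  have hx := q₃_sq_add_inv
  have hx0 := q₃_ne_zero
  refine isSolution_cells.exists_faithful ?_ ?_ ?_ ?_ ?_ weight_pos cells_w cells_u
    (cell_comm values)
  · push_cast [pVal]
    rw [← hx]
    field_simp
    ring
  · rw [G2.qInt]
    simp only [Finset.sum_range_succ, Finset.sum_range_zero]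
    push_cast
    norm_num
    rw [← hx]
    field_simp
    ring
  all_goals
    push_cast
    rw [← hx]
    field_simp
    try ring

end LevelThree

namespace LevelThree

open Polynomial IntermediateField

/-! ### The field generated by `2 cos (2 π / 21)` -/

/-- The minimal polynomial of `cosVal + 1`. -/
noncomputable def cosPoly : ℤ[X] :=
  X ^ 6 - 7 * X ^ 5 + 14 * X ^ 4 - 21 * X ^ 2 + 7 * X + 7

theorem cosPoly_eq : cosPoly = C 1 * X ^ 6 + C (-7) * X ^ 5 + C 14 * X ^ 4 + C 0 * X ^ 3
    + C (-21) * X ^ 2 + C 7 * X + C 7 := by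
  simp only [cosPoly, map_neg, map_one, map_zero, map_ofNat]
  ring

theorem natDegree_cosPoly : cosPoly.natDegree = 6 := by
  rw [cosPoly]
  compute_degree!

theorem monic_cosPoly : cosPoly.Monic := by
  rw [cosPoly]
  monicity!

theorem irreducible_cosPoly : Irreducible cosPoly := by
  have hprime : (Ideal.span {(7 : ℤ)}).IsPrime :=
    (Ideal.span_singleton_prime (by norm_num)).2 (by norm_num)
  refine IsEisensteinAt.irreducible (𝓟 := Ideal.span {(7 : ℤ)}) ⟨?_, ?_, ?_⟩ hprime
    monic_cosPoly.isPrimitive (by rw [natDegree_cosPoly]; norm_num)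
  · rw [monic_cosPoly.leadingCoeff, Ideal.mem_span_singleton]
    norm_num
  · intro n hn
    rw [natDegree_cosPoly] at hn
    rw [Ideal.mem_span_singleton, cosPoly_eq]
    interval_cases n <;> simp [coeff_X]
  · rw [Ideal.span_singleton_pow, Ideal.mem_span_singleton, cosPoly_eq]
    simp

theorem aeval_cosPoly (x : ℝ) : aeval x (cosPoly.map (Int.castRingHom ℚ))
    = x ^ 6 - 7 * x ^ 5 + 14 * x ^ 4 - 21 * x ^ 2 + 7 * x + 7 := by
  simp only [cosPoly_eq, Polynomial.map_add, Polynomial.map_mul, Polynomial.map_pow, map_X, map_C,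
    map_add, map_mul, map_pow, aeval_X, aeval_C]
  norm_num
  ring

theorem minpoly_cosVal : minpoly ℚ (cosVal + 1) = cosPoly.map (Int.castRingHom ℚ) := by
  refine (minpoly.eq_of_irreducible_of_monic
    ((Polynomial.IsPrimitive.Int.irreducible_iff_irreducible_map_cast
      monic_cosPoly.isPrimitive).1 irreducible_cosPoly) ?_ (monic_cosPoly.map _)).symm
  rw [aeval_cosPoly]
  linear_combination cosVal_eq

theorem isIntegral_cosVal : IsIntegral ℚ (cosVal + 1) :=
  ⟨cosPoly.map (Int.castRingHom ℚ), monic_cosPoly.map _, by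
    rw [← minpoly_cosVal]
    exact minpoly.aeval ℚ _⟩

/-- The real subfield of the cyclotomic field of index `21`. -/
noncomputable def cosField : IntermediateField ℚ ℝ := ℚ⟮cosVal + 1⟯

theorem finrank_cosField : Module.finrank ℚ cosField = 6 := by
  rw [cosField, adjoin.finrank isIntegral_cosVal, minpoly_cosVal,
    monic_cosPoly.natDegree_map, natDegree_cosPoly]

theorem cosVal_mem : cosVal ∈ cosField := by
  have h : cosVal + 1 ∈ cosField := mem_adjoin_simple_self ℚ _
  simpa using sub_mem h (one_mem _)

theorem cosField_le {L : IntermediateField ℚ ℝ} (h : cosVal ∈ L) : cosField ≤ L :=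
  adjoin_simple_le_iff.2 (add_mem h (one_mem _))

/-- `cosVal` as an element of the field which it generates. -/
noncomputable def cosElt : cosField := ⟨cosVal, cosVal_mem⟩

/-- `pVal` as an element of the field generated by `cosVal`. -/
noncomputable def pElt : cosField :=
  (6 * cosElt - 4 * cosElt ^ 2 - 5 * cosElt ^ 3 + cosElt ^ 4 + cosElt ^ 5) / 3

/-- There is a real embedding which moves `cosVal` to a number close to `3 / 20` and fixes `pVal`;
only the estimates needed below are recorded. -/
theorem exists_conj : ∃ σ : cosField →ₐ[ℚ] ℝ, 1 / 10 < σ cosElt ∧ σ cosElt < 1 / 5 ∧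
    1 / 4 < σ pElt ∧ σ pElt < 7 / 25 := by
  obtain ⟨x, ⟨hx1, hx2⟩, hx⟩ : ∃ x ∈ Set.Ioo (11 / 10 : ℝ) (6 / 5),
      x ^ 6 - 7 * x ^ 5 + 14 * x ^ 4 - 21 * x ^ 2 + 7 * x + 7 = 0 := by
    refine intermediate_value_Ioo' (by norm_num) (by fun_prop) ?_
    constructor <;> norm_num
  have hroot : x ∈ (minpoly ℚ (cosVal + 1)).aroots ℝ := by
    rw [mem_aroots, minpoly_cosVal, aeval_cosPoly]
    exact ⟨(monic_cosPoly.map _).ne_zero, hx⟩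
  let σ : cosField →ₐ[ℚ] ℝ := (algHomAdjoinIntegralEquiv ℚ isIntegral_cosVal).symm ⟨x, hroot⟩
  let g : cosField := AdjoinSimple.gen ℚ (cosVal + 1)
  have hσ : σ g = x :=
    algHomAdjoinIntegralEquiv_symm_apply_gen ℚ isIntegral_cosVal ⟨x, hroot⟩
  have hc : σ cosElt = x - 1 := by
    have h : cosElt = g - 1 :=
      Subtype.ext (add_sub_cancel_right cosVal 1).symm
    rw [h, map_sub, hσ, map_one]
  have hp : σ pElt = (6 * (x - 1) - 4 * (x - 1) ^ 2 - 5 * (x - 1) ^ 3 + (x - 1) ^ 4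
      + (x - 1) ^ 5) / 3 := by
    rw [pElt, ← hc]
    simp only [map_div₀, map_add, map_sub, map_mul, map_pow, map_ofNat]
  have hp2 : σ pElt ^ 2 = (1 - 3 * σ pElt) / 3 := by
    have h : pElt ^ 2 = (1 - 3 * pElt) / 3 := Subtype.ext pVal_sq
    rw [← map_pow, h]
    simp only [map_div₀, map_sub, map_mul, map_ofNat, map_one]
  have hp0 : 0 < σ pElt := by
    obtain ⟨t, ht, hx⟩ : ∃ t, 0 < t ∧ x - 1 = t := ⟨x - 1, by linarith, rfl⟩
    have ht1 : t < 1 := by linarith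
    rw [hp, hx]
    have h1 : t ^ 2 < t := by nlinarith
    nlinarith [pow_pos ht 4, pow_pos ht 5, pow_pos ht 3]
  refine ⟨σ, by rw [hc]; linarith, by rw [hc]; linarith, ?_, ?_⟩ <;> nlinarith

/-- A square root of an element of `cosField` that has a negative conjugate is not in the field. -/
theorem not_mem_of_conj {v : ℝ} {a : cosField} (hv : v ^ 2 = a) (σ : cosField →ₐ[ℚ] ℝ)
    (ha : σ a < 0) : v ∉ cosField := by
  intro hmem
  have h : (⟨v, hmem⟩ : cosField) ^ 2 = a := Subtype.ext hv
  rw [← h, map_pow] at ha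
  exact absurd ha (sq_nonneg _).not_gt

/-- The tower law for the fields generated by `cosVal` and a number that generates `cosVal`. -/
theorem natDegree_minpoly {v : ℝ} (hv : IsIntegral cosField v) (hc : cosVal ∈ ℚ⟮v⟯) :
    IsIntegral ℚ v ∧ (minpoly ℚ v).natDegree = 6 * (minpoly cosField v).natDegree := by
  have : FiniteDimensional ℚ cosField := .of_finrank_pos (by rw [finrank_cosField]; norm_num)
  have hv' : IsIntegral ℚ v := isIntegral_trans v hv
  refine ⟨hv', ?_⟩
  have h : restrictScalars ℚ cosField⟮v⟯ = ℚ⟮v⟯ := by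
    exact (restrictScalars_adjoin_eq_sup ℚ cosField {v}).trans (sup_eq_right.2 (cosField_le hc))
  rw [← adjoin.finrank hv', ← adjoin.finrank hv, ← finrank_cosField,
    Module.finrank_mul_finrank ℚ cosField cosField⟮v⟯, ← h]
  rfl

end LevelThree

namespace LevelThree

open Polynomial IntermediateField

/-! ### The degrees of the coordinates -/

theorem mem_of_eq_quintic {L : IntermediateField ℚ ℝ} {T x : ℝ} (q₀ q₁ q₂ q₃ q₄ q₅ : ℚ)
    (hT : T ∈ L) (h : x = q₀ + q₁ * T + q₂ * T ^ 2 + q₃ * T ^ 3 + q₄ * T ^ 4 + q₅ * T ^ 5) :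
    x ∈ L := by
  have hq (q : ℚ) : (q : ℝ) ∈ L := SubfieldClass.ratCast_mem L q
  rw [h]
  exact add_mem (add_mem (add_mem (add_mem (add_mem (hq _) (mul_mem (hq _) hT))
    (mul_mem (hq _) (pow_mem hT _))) (mul_mem (hq _) (pow_mem hT _)))
    (mul_mem (hq _) (pow_mem hT _))) (mul_mem (hq _) (pow_mem hT _))

/-- The square of the cell `z` generates `cosField`: `cosVal` is a quintic polynomial in this
square.  The certificate for this identity is arranged in powers of `T` as in Horner's scheme; the
statements for the other coordinates are proved in the same way. -/
theorem cosVal_mem_of_z {L : IntermediateField ℚ ℝ} {T : ℝ} (h : T ∈ L)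
    (hT : T = (1 + pVal) * (cosVal ^ 2 - cosVal - 1)) : cosVal ∈ L := by
  have hp := pVal_sq
  have hc := cosVal_cube
  refine mem_of_eq_quintic 1 (-33) (-66) 18 72 27 h ?_
  push_cast
  generalize pVal = p at hp hc hT
  generalize cosVal = c at hc hT
  linear_combination -((3 * p * c ^ 2 + 6 * p * c + 3 * p - 3 * c) * hT + (3 * c ^ 4 + 3 * c ^ 3
    - 6 * c ^ 2 - 9 * c - 3) * hp + c * hc + T * ((9 * p * c ^ 2 - 9 * p * c + 45 * p + 24 * c ^
    2 - 18 * c - 33) * hT + (9 * c ^ 4 + 54 * c ^ 3 + 18 * c ^ 2 - 153 * c - 90) * hp + (24 * p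
    * c + 15 * p + 27 * c + 30) * hc) + T ^ 2 * ((45 * p * c ^ 2 - 45 * p * c - 18 * p + 54 * c
    ^ 2 - 45 * c - 18) * hT + (45 * c ^ 4 + 72 * c ^ 3 - 18 * c ^ 2 - 261 * c - 144) * hp + (54
    * p * c + 54 * p + 69 * c + 63) * hc) + T ^ 3 * ((27 * p * c ^ 2 - 27 * p * c - 27 * p + 27
    * c ^ 2 - 27 * c + 45) * hT + (27 * c ^ 4 + 27 * c ^ 3 - 27 * c ^ 2 - 108 * c - 54) * hp +
    (27 * p * c + 27 * p + 36 * c + 27) * hc) + T ^ 4 * (27 * hT))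

theorem cosVal_mem_of_weight_z {L : IntermediateField ℚ ℝ} {T : ℝ} (h : T ∈ L)
    (hT : T = cosVal ^ 2 - cosVal - 1) : cosVal ∈ L := by
  have hp := pVal_sq
  have hc := cosVal_cube
  refine mem_of_eq_quintic (62 / 43) (124 / 43) (-99 / 43) (-78 / 43) (53 / 43) (-7 / 43) h ?_
  push_cast
  generalize pVal = p at hp hc hT
  generalize cosVal = c at hc hT
  linear_combination -((-72 / 43 * p * c + 57 / 43 * p + 24 / 43 * c ^ 2 - c + 1) * hT + (24 /
    43 * c - 19 / 43) * hc + T * ((-87 / 43 * p * c ^ 2 + 96 / 43 * p * c + 111 / 43 * p - 95 /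
    43 * c ^ 2 + 106 / 43 * c + 20 / 43) * hT + (-87 / 43 * p * c - 15 / 43 * p - 95 / 43 * c -
    76 / 43) * hc + (-261 / 43 * c ^ 3 + 216 / 43 * c ^ 2 + 306 / 43 * c + 45 / 43) * hp) + T ^
    2 * ((42 / 43 * p * c ^ 2 - 21 / 43 * p * c - 84 / 43 * p + 46 / 43 * c ^ 2 - 53 / 43 * c -
    117 / 43) * hT + (42 / 43 * p * c + 33 / 43 * p + 46 / 43 * c + 35 / 43) * hc + (126 / 43 *
    c ^ 3 - 27 / 43 * c ^ 2 - 225 / 43 * c - 99 / 43) * hp) + T ^ 3 * ((-7 / 43 * c ^ 2 + 7 / 43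
    * c + 60 / 43) * hT + (-21 / 43 * p - 7 / 43 * c) * hc + (-63 / 43 * c ^ 2 + 63 / 43 * c +
    63 / 43) * hp) + T ^ 4 * ((-7 / 43) * hT))

theorem cosVal_mem_of_Z {L : IntermediateField ℚ ℝ} {T : ℝ} (h : T ∈ L)
    (hT : T = (1 + pVal) * (cosVal ^ 2 - cosVal - 1) + 1) : cosVal ∈ L := by
  have hp := pVal_sq
  have hc := cosVal_cube
  refine mem_of_eq_quintic (-5) 0 42 0 (-63) 27 h ?_
  push_cast
  generalize pVal = p at hp hc hT
  generalize cosVal = c at hc hT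
  linear_combination -((12 * p * c ^ 2 - 3 * p * c - 33 * p + 3 * c ^ 2 - 3 * c - 3) * hT + (12
    * c ^ 4 - 6 * c ^ 3 - 15 * c ^ 2 - 9 * c - 3) * hp + (3 * p * c + 12 * p + 7 * c + 6) * hc +
    T * ((-3 * c ^ 2 - 9 * c + 30) * hT + (-3 * p * c - 12 * p - 3 * c - 15) * hc + (-9 * c ^ 3
    - 27 * c ^ 2 + 45 * c + 36) * hp) + T ^ 2 * ((-36 * p * c ^ 2 + 36 * p * c + 63 * p - 27 * c
    ^ 2 + 36 * c + 9) * hT + (-36 * c ^ 4 - 9 * c ^ 3 + 63 * c ^ 2 + 63 * c + 18) * hp + (-27 *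
    p * c - 27 * p - 39 * c - 18) * hc) + T ^ 3 * ((27 * p * c ^ 2 - 27 * p * c - 27 * p + 27 *
    c ^ 2 - 27 * c - 63) * hT + (27 * c ^ 4 + 27 * c ^ 3 - 27 * c ^ 2 - 108 * c - 54) * hp + (27
    * p * c + 27 * p + 36 * c + 27) * hc) + T ^ 4 * (27 * hT))

theorem cosVal_mem_of_weight_Z {L : IntermediateField ℚ ℝ} {T : ℝ} (h : T ∈ L)
    (hT : T = cosVal ^ 2 - cosVal - 1 + 3 * pVal) : cosVal ∈ L := by
  have hp := pVal_sq
  have hc := cosVal_cube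
  refine mem_of_eq_quintic (-3) (-9) 4 8 (-2) (-1) h ?_
  push_cast
  generalize pVal = p at hp hc hT
  generalize cosVal = c at hc hT
  linear_combination -((3 * p * c ^ 2 - 3 * p * c - 3 * p + 5 * c ^ 2 - 4 * c - 8) * hT + (9 * c
    ^ 3 + 18 * c ^ 2 - 36 * c - 27) * hp + (3 * p * c + 6 * p + 5 * c + 4) * hc + T * ((-3 * p *
    c ^ 2 - 3 * p * c + 18 * p + 5 * c ^ 2 - 4 * c - 3) * hT + (-9 * c ^ 3 + 54 * c ^ 2 - 54 *
    c) * hp + (-3 * p * c + 18 * p + 5 * c - 2) * hc) + T ^ 2 * ((3 * p * c - 3 * p - 3 * c ^ 2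
    + 2 * c + 9) * hT + (-18 * c ^ 2 + 27 * c + 9) * hp + (-6 * p - 3 * c - 1) * hc) + T ^ 3 *
    ((-3 * p - c ^ 2 + c - 1) * hT + (-9 * c ^ 2 + 9 * c) * hp + (-3 * p - c) * hc) + T ^ 4 *
    ((-1) * hT))

theorem cosVal_mem_of_X {L : IntermediateField ℚ ℝ} {T : ℝ} (h : T ∈ L)
    (hT : T = cosVal - 1 + pVal) : cosVal ∈ L := by
  have hp := pVal_sq
  have hc := cosVal_cube
  refine mem_of_eq_quintic (1010 / 967) (55024 / 967) (72501 / 967) (-51591 / 967)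
    (-36324 / 967) (-4914 / 967) h ?_
  push_cast
  generalize pVal = p at hp hc hT
  generalize cosVal = c at hc hT
  linear_combination -((-50868 / 967 * p * c ^ 2 + 105024 / 967 * p * c - 13668 / 967 * p -
    64407 / 967 * c ^ 2 + 132231 / 967 * c - 17085 / 967) * hT + (-203472 / 967 * c ^ 2 + 257628
    / 967 * c + 138936 / 967) * hp + (-50868 / 967 * p - 64407 / 967) * hc + T * ((-29484 / 967
    * p * c ^ 2 - 13680 / 967 * p * c + 36087 / 967 * p - 31410 / 967 * c ^ 2 + 6315 / 967 * c +
    82212 / 967) * hT + (-117936 / 967 * c ^ 2 + 74772 / 967 * c + 124539 / 967) * hp + (-29484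
    / 967 * p - 31410 / 967) * hc) + T ^ 2 * ((-9828 / 967 * p * c - 21582 / 967 * p - 4914 /
    967 * c ^ 2 - 26496 / 967 * c - 21819 / 967) * hT + (-9828 / 967 * c - 21582 / 967) * hp +
    (-4914 / 967) * hc) + T ^ 3 * ((-4914 / 967 * p - 4914 / 967 * c - 31410 / 967) * hT +
    (-4914 / 967) * hp) + T ^ 4 * ((-4914 / 967) * hT))

theorem cosVal_mem_of_U {L : IntermediateField ℚ ℝ} {T : ℝ} (h : T ∈ L)
    (hT : T = cosVal - 1 - 2 * pVal) : cosVal ∈ L := by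
  have hp := pVal_sq
  have hc := cosVal_cube
  refine mem_of_eq_quintic (-77 / 41) (245 / 41) (498 / 41) (-150 / 41) (-180 / 41) (54 / 41) h ?_
  push_cast
  generalize pVal = p at hp hc hT
  generalize cosVal = c at hc hT
  linear_combination -((324 / 41 * p * c ^ 2 - 6 * p * c - 372 / 41 * p + 6 * c ^ 2 - 354 / 41 *
    c + 93 / 41) * hT + (324 / 41 * c ^ 2 - 480 / 41 * c - 228 / 41) * hp + (324 / 41 * p + 6) *
    hc + T * ((-162 / 41 * p * c ^ 2 + 558 / 41 * p * c - 114 / 41 * p - 234 / 41 * c ^ 2 + 534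
    / 41 * c + 156 / 41) * hT + (-162 / 41 * c ^ 2 - 630 / 41 * c + 714 / 41) * hp + (-162 / 41
    * p - 234 / 41) * hc) + T ^ 2 * ((-216 / 41 * p * c + 360 / 41 * p + 54 / 41 * c ^ 2 - 288 /
    41 * c + 156 / 41) * hT + (432 / 41 * c - 720 / 41) * hp + (54 / 41) * hc) + T ^ 3 * ((-108
    / 41 * p + 54 / 41 * c - 234 / 41) * hT + (216 / 41) * hp) + T ^ 4 * ((54 / 41) * hT))

theorem natDegree_minpoly_of_sq {v : ℝ} {a : cosField} (hv : v ^ 2 = a)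
    (hmem : v ∉ cosField) : IsIntegral cosField v ∧ (minpoly cosField v).natDegree = 2 := by
  have hroot : aeval v (X ^ 2 - C a) = 0 := by
    rw [map_sub, map_pow, aeval_X, aeval_C, hv]
    exact sub_self _
  have hint : IsIntegral cosField v := ⟨X ^ 2 - C a, monic_X_pow_sub_C a two_ne_zero, hroot⟩
  refine ⟨hint, le_antisymm ?_ ?_⟩
  · rw [← natDegree_X_pow_sub_C (n := 2) (r := a)]
    exact natDegree_le_of_dvd (minpoly.dvd _ _ hroot) (monic_X_pow_sub_C a two_ne_zero).ne_zero
  · refine (minpoly.two_le_natDegree_iff hint).2 ?_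
    rintro ⟨x, rfl⟩
    exact hmem x.2

/-- A square root of an element of `cosField` has degree `12` if it does not lie in `cosField` but
its square generates this field. -/
theorem natDegree_eq_twelve {v : ℝ} (a : cosField) (hv : v ^ 2 = a) (hmem : v ∉ cosField)
    (hc : ∀ L : IntermediateField ℚ ℝ, v ^ 2 ∈ L → cosVal ∈ L) :
    IsIntegral ℚ v ∧ (minpoly ℚ v).natDegree = 12 := by
  obtain ⟨hint, hdeg⟩ := natDegree_minpoly_of_sq hv hmem
  obtain ⟨h1, h2⟩ := natDegree_minpoly hint (hc _ (pow_mem (mem_adjoin_simple_self ℚ v) 2))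
  exact ⟨h1, by rw [h2, hdeg]⟩

theorem zVal_pow : zVal ^ 2 = (((1 + pElt) * (cosElt ^ 2 - cosElt - 1) : cosField) : ℝ) := by
  rw [zVal_sq]
  rfl

theorem zVal_not_mem : zVal ∉ cosField := by
  obtain ⟨σ, h1, h2, h3, h4⟩ := exists_conj
  refine not_mem_of_conj zVal_pow σ ?_
  simp only [map_mul, map_add, map_sub, map_pow, map_one]
  nlinarith

theorem degree_z : IsIntegral ℚ values.z ∧ (minpoly ℚ values.z).natDegree = 12 :=
  natDegree_eq_twelve _ zVal_pow zVal_not_mem fun _ h => cosVal_mem_of_z h zVal_sq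

theorem degree_Z : IsIntegral ℚ values.Z ∧ (minpoly ℚ values.Z).natDegree = 12 := by
  have hv : values.Z ^ 2 = (((1 + pElt) * (cosElt ^ 2 - cosElt - 1) + 1 : cosField) : ℝ) := by
    rw [values.hZ2, values.hz2]
    rfl
  refine natDegree_eq_twelve _ hv ?_ fun _ h => cosVal_mem_of_Z h hv
  obtain ⟨σ, h1, h2, h3, h4⟩ := exists_conj
  refine not_mem_of_conj hv σ ?_
  simp only [map_mul, map_add, map_sub, map_pow, map_one]
  nlinarith

theorem degree_X : IsIntegral ℚ values.X ∧ (minpoly ℚ values.X).natDegree = 12 := by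
  have hv : values.X ^ 2 = ((cosElt - 1 + pElt : cosField) : ℝ) := by
    rw [values.X_sq]
    rfl
  refine natDegree_eq_twelve _ hv ?_ fun _ h => cosVal_mem_of_X h hv
  obtain ⟨σ, h1, h2, h3, h4⟩ := exists_conj
  refine not_mem_of_conj hv σ ?_
  simp only [map_add, map_sub, map_one]
  linarith

theorem degree_U : IsIntegral ℚ values.U ∧ (minpoly ℚ values.U).natDegree = 12 := by
  have hv : values.U ^ 2 = ((cosElt - 1 - 2 * pElt : cosField) : ℝ) := by
    rw [values.U_sq]
    rfl
  refine natDegree_eq_twelve _ hv ?_ fun _ h => cosVal_mem_of_U h hv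
  obtain ⟨σ, h1, h2, h3, h4⟩ := exists_conj
  refine not_mem_of_conj hv σ ?_
  simp only [map_mul, map_sub, map_one, map_ofNat]
  linarith

theorem degree_weight_z : IsIntegral ℚ (√(3 * pVal) * values.z) ∧
    (minpoly ℚ (√(3 * pVal) * values.z)).natDegree = 12 := by
  have hv : (√(3 * pVal) * values.z) ^ 2 = ((cosElt ^ 2 - cosElt - 1 : cosField) : ℝ) := by
    rw [mul_pow, Real.sq_sqrt (by linarith [pVal_pos]), values.hz2]
    change 3 * pVal * ((1 + pVal) * (cosVal ^ 2 - cosVal - 1)) = cosVal ^ 2 - cosVal - 1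
    linear_combination 3 * (cosVal ^ 2 - cosVal - 1) * pVal_sq
  refine natDegree_eq_twelve _ hv ?_ fun _ h => cosVal_mem_of_weight_z h hv
  obtain ⟨σ, h1, h2, h3, h4⟩ := exists_conj
  refine not_mem_of_conj hv σ ?_
  simp only [map_sub, map_pow, map_one]
  nlinarith

theorem degree_weight_Z : IsIntegral ℚ (√(3 * pVal) * values.Z) ∧
    (minpoly ℚ (√(3 * pVal) * values.Z)).natDegree = 12 := by
  have hv : (√(3 * pVal) * values.Z) ^ 2
      = ((cosElt ^ 2 - cosElt - 1 + 3 * pElt : cosField) : ℝ) := by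
    rw [mul_pow, Real.sq_sqrt (by linarith [pVal_pos]), values.hZ2, values.hz2]
    change 3 * pVal * ((1 + pVal) * (cosVal ^ 2 - cosVal - 1) + 1)
      = cosVal ^ 2 - cosVal - 1 + 3 * pVal
    linear_combination 3 * (cosVal ^ 2 - cosVal - 1) * pVal_sq
  refine natDegree_eq_twelve _ hv ?_ fun _ h => cosVal_mem_of_weight_Z h hv
  obtain ⟨σ, h1, h2, h3, h4⟩ := exists_conj
  refine not_mem_of_conj hv σ ?_
  simp only [map_mul, map_add, map_sub, map_pow, map_one, map_ofNat]
  nlinarith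

/-- The number `T = y ^ 2` generates `cosField`: the sum `S = T + p ^ 2 / T` of the squares of the
two roots lies in `cosField` and is a root of a cubic polynomial with coefficients in `ℚ(p)`.
Inserting `S` in the cubic and using the quadratic equation for `p` expresses `p` as a rational
function of `T`, and `cosVal` is a polynomial in `S` and `p`. -/
theorem cosVal_mem_of_y {L : IntermediateField ℚ ℝ} {y : ℝ} (h : y ∈ L)
    (hy : y ^ 2 = -cosVal * zVal * y - pVal) : cosVal ∈ L := by
  have hp := pVal_sq
  have hc := cosVal_cube
  have hz := zVal_sq
  have hp0 := pVal_pos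
  have hy0 : y ≠ 0 := by
    rintro rfl
    norm_num at hy
    exact hp0.ne' hy
  obtain ⟨T, hT⟩ : ∃ T, T = y ^ 2 := ⟨_, rfl⟩
  have hTpos : 0 < T := hT ▸ by positivity
  have hTL : T ∈ L := hT ▸ pow_mem h 2
  obtain ⟨S, hS⟩ : ∃ S, S = 3 * pVal * cosVal ^ 2 - 3 * pVal * cosVal - 4 * pVal + 2 * cosVal ^ 2
    - 3 * cosVal + 1 := ⟨_, rfl⟩
  have hSz : S = cosVal ^ 2 * zVal ^ 2 - 2 * pVal := by
    linear_combination hS - cosVal ^ 2 * hz - (pVal * cosVal + pVal + cosVal + 2) * hc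
      - (3 * cosVal ^ 3 - 6 * cosVal - 3) * hp
  have hTS : T ^ 2 + 1 / 3 - pVal = S * T := by
    rw [hT]
    linear_combination (y ^ 2 + pVal - cosVal * zVal * y) * hy - hp - y ^ 2 * hSz
  have hS2 : S ^ 2 = -pVal * cosVal ^ 2 + 3 * pVal + 2 * cosVal ^ 2 + cosVal - 2 / 3 := by
    linear_combination (S + (3 * pVal * cosVal ^ 2 - 3 * pVal * cosVal - 4 * pVal + 2 * cosVal ^ 2
      - 3 * cosVal + 1)) * hS + (9 * cosVal ^ 4 - 9 * cosVal ^ 3 - 6 * cosVal ^ 2 - 3 * cosVal - 2)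
      * hp + (3 * pVal * cosVal + 6 * pVal + 7 * cosVal - 1) * hc
  have hS3 : S ^ 3 = S ^ 2 + 5 * S + 2 / 3 - pVal * (S - 17 / 3) := by
    linear_combination (S - 1) * hS2 + (-pVal * cosVal ^ 2 + 3 * pVal + 2 * cosVal ^ 2 + cosVal
      - 2 / 3 - 5 + pVal) * hS + (-3 * cosVal ^ 4 + 24 * cosVal ^ 3 - 8 * cosVal ^ 2 - 30 * cosVal
      - 13) * hp + (7 * pVal * cosVal - pVal + 3 * cosVal + 10) * hc
  have hA : T ^ 6 - T ^ 5 - 4 * T ^ 4 - 4 / 3 * T ^ 3 - 2 / 3 * T ^ 2 - 4 / 9 * T + 19 / 27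
      = (2 * T ^ 4 + 11 / 3 * T ^ 3 - 4 / 3 * T ^ 2 - 5 / 3 * T + 8 / 3) * pVal := by
    linear_combination ((T ^ 2 + 1 / 3 - pVal) ^ 2 + (T ^ 2 + 1 / 3 - pVal) * (S * T)
      + S ^ 2 * T ^ 2 - T * (T ^ 2 + 1 / 3 - pVal + S * T) - 5 * T ^ 2 + pVal * T ^ 2) * hTS
      + T ^ 3 * hS3 - (-pVal + 3 * (T ^ 2 + 1 / 3) - T - T ^ 2 + 1) * hp
  have hB : 0 < 2 * T ^ 4 + 11 / 3 * T ^ 3 - 4 / 3 * T ^ 2 - 5 / 3 * T + 8 / 3 := by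
    nlinarith [sq_nonneg (T - 1), sq_nonneg (T ^ 2 - T), pow_pos hTpos 3, sq_nonneg (T ^ 2 - 1)]
  have hpL : pVal ∈ L := by
    lift T to L using hTL
    rw [(eq_div_iff hB.ne').2 ((mul_comm _ _).trans hA.symm)]
    exact ((T ^ 6 - T ^ 5 - 4 * T ^ 4 - 4 / 3 * T ^ 3 - 2 / 3 * T ^ 2 - 4 / 9 * T + 19 / 27)
      / (2 * T ^ 4 + 11 / 3 * T ^ 3 - 4 / 3 * T ^ 2 - 5 / 3 * T + 8 / 3) : L).2
  have hSL : S ∈ L := by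
    rw [(eq_div_iff hTpos.ne').2 hTS.symm]
    lift T to L using hTL
    generalize pVal = p at hpL
    lift p to L using hpL
    exact ((T ^ 2 + 1 / 3 - p) / T : L).2
  have hcS : cosVal = 71 / 41 * pVal - 62 / 123 - (1 / 41 + 25 / 41 * pVal) * S
      + (13 / 41 - 3 / 41 * pVal) * S ^ 2 := by
    linear_combination (1 / 41 + 25 / 41 * pVal) * hS + (-13 / 41 + 3 / 41 * pVal) * hS2
      + (72 / 41 * cosVal ^ 2 - 75 / 41 * cosVal - 91 / 41) * hp
  rw [hcS]
  clear * - hpL hSL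
  generalize pVal = p at hpL
  lift p to L using hpL
  lift S to L using hSL
  exact (71 / 41 * p - 62 / 123 - (1 / 41 + 25 / 41 * p) * S
    + (13 / 41 - 3 / 41 * p) * S ^ 2 : L).2

/-- A root `y` of `y ^ 2 + c z y + p` has degree `2` or `4` over `cosField`: the square root `z`
lies in the field which it generates. -/
theorem degree_of_y {y : ℝ} (hy : y ^ 2 = -cosVal * zVal * y - pVal) : IsIntegral ℚ y ∧
    ((minpoly ℚ y).natDegree = 12 ∨ (minpoly ℚ y).natDegree = 24) := by
  have hy0 : y ≠ 0 := by
    rintro rfl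
    norm_num at hy
    exact pVal_pos.ne' hy
  have hc0 : cosVal ≠ 0 := by linarith [cosVal_gt]
  let b : cosField := 2 * pElt - cosElt ^ 2 * ((1 + pElt) * (cosElt ^ 2 - cosElt - 1))
  let f : cosField[X] := X ^ 4 + C b * X ^ 2 + C (pElt ^ 2)
  have hmonic : f.Monic := by
    simp only [f]
    monicity!
  have hdeg : f.natDegree = 4 := by
    simp only [f]
    compute_degree!
  have hroot : aeval y f = 0 := by
    have hb : (algebraMap cosField ℝ) b
        = 2 * pVal - cosVal ^ 2 * ((1 + pVal) * (cosVal ^ 2 - cosVal - 1)) := rfl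
    have hp : (algebraMap cosField ℝ) (pElt ^ 2) = pVal ^ 2 := rfl
    simp only [f, map_add, map_mul, map_pow, aeval_X, aeval_C]
    rw [← map_pow, hb, hp, ← zVal_sq]
    linear_combination (y ^ 2 + pVal - cosVal * zVal * y) * hy
  have hint : IsIntegral cosField y := ⟨f, hmonic, hroot⟩
  obtain ⟨h1, h2⟩ := natDegree_minpoly hint (cosVal_mem_of_y (mem_adjoin_simple_self ℚ y) hy)
  refine ⟨h1, ?_⟩
  have hle : (minpoly cosField y).natDegree ≤ 4 :=
    (natDegree_le_of_dvd (minpoly.dvd _ _ hroot) hmonic.ne_zero).trans hdeg.le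
  have hpos := minpoly.natDegree_pos hint
  have hdvd : 2 ∣ (minpoly cosField y).natDegree := by
    have hz : zVal ∈ cosField⟮y⟯ := by
      have hc (x : cosField) : (x : ℝ) ∈ cosField⟮y⟯ :=
        cosField⟮y⟯.algebraMap_mem x
      have hy' := mem_adjoin_simple_self cosField y
      have h : zVal = -(y + pVal / y) / cosVal := by
        field_simp
        linear_combination hy
      rw [h]
      exact div_mem (neg_mem (add_mem hy' (div_mem (hc pElt) hy'))) (hc cosElt)
    obtain ⟨hzint, hz2⟩ := natDegree_minpoly_of_sq zVal_pow zVal_not_mem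
    rw [← hz2, ← adjoin.finrank hint, ← adjoin.finrank hzint]
    exact finrank_dvd_of_le_right (adjoin_simple_le_iff.2 hz)
  rw [h2]
  omega

theorem degree_y : IsIntegral ℚ values.y ∧
    ((minpoly ℚ values.y).natDegree = 12 ∨ (minpoly ℚ values.y).natDegree = 24) :=
  degree_of_y values.y_sq

theorem degree_y' : IsIntegral ℚ values.y' ∧
    ((minpoly ℚ values.y').natDegree = 12 ∨ (minpoly ℚ values.y').natDegree = 24) :=
  degree_of_y values.swap.y_sq

/-- The coordinates of the trivalent vertex have degree `12` or `24`. -/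
theorem degree_coord (a b c : Fin 4) (hab : a ≠ 0 ∨ b ≠ 0) (hbc : b ≠ 0 ∨ c ≠ 0)
    (hac : a ≠ 0 ∨ c ≠ 0) : IsIntegral ℚ (√(values.weight b) * values.cell a b c) ∧
    ((minpoly ℚ (√(values.weight b) * values.cell a b c)).natDegree = 12 ∨
      (minpoly ℚ (√(values.weight b) * values.cell a b c)).natDegree = 24) := by
  by_cases hb : b = 0
  · subst hb
    have h : ∀ a c, a ≠ 0 ∨ (0 : Fin 4) ≠ 0 → (0 : Fin 4) ≠ 0 ∨ c ≠ 0 →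
      kind a 0 c = 1 ∨ kind a 0 c = 2 := by decide
    have hw : values.weight 0 = 3 * pVal := rfl
    rw [hw, Values.cell]
    replace h := h a c hab hbc
    rcases h with h | h <;> rw [h]
    · exact ⟨degree_weight_z.1, .inl degree_weight_z.2⟩
    · exact ⟨degree_weight_Z.1, .inl degree_weight_Z.2⟩
  · have hw : values.weight b = 1 := by
      fin_cases b <;> first | exact absurd rfl hb | rfl
    have h : ∀ a b c : Fin 4, a ≠ 0 ∨ b ≠ 0 → b ≠ 0 ∨ c ≠ 0 → a ≠ 0 ∨ c ≠ 0 →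
      kind a b c ≠ 0 := by decide
    replace h := h a b c hab hbc hac
    rw [hw, Real.sqrt_one, one_mul, Values.cell]
    generalize kind a b c = k at h
    fin_cases k
    · exact absurd rfl h
    · exact ⟨degree_z.1, .inl degree_z.2⟩
    · exact ⟨degree_Z.1, .inl degree_Z.2⟩
    · exact ⟨degree_X.1, .inl degree_X.2⟩
    · exact degree_y
    · exact degree_y'
    · exact ⟨degree_U.1, .inl degree_U.2⟩

end LevelThree

/-! ### Frobenius-Perron eigenvectors and conclusion -/

namespace LevelThree

/-- The Frobenius-Perron eigenvectors of `Γ₃` are multiples of `values.weight`. -/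
theorem exists_eq_mul_weight {wt : Fin 4 → ℝ} (h : Γ₃.IsFrobeniusPerron wt) :
    ∃ k : ℝ, k ≠ 0 ∧ ∀ a, wt a = k * values.weight a := by
  classical
  obtain ⟨hpos, d, hd⟩ := h
  have hadj (a b : Fin 4) : Γ₃.adjMatrix a b = if a ≠ 0 ∨ b ≠ 0 then 1 else 0 := by
    by_cases h : a ≠ 0 ∨ b ≠ 0
    · rw [if_pos h]
      exact if_pos h
    · rw [if_neg h]
      exact if_neg h
  have hrow (a : Fin 4) : ∑ b, Γ₃.adjMatrix a b * wt b = d * wt a := congrFun hd a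
  simp only [hadj, Fin.sum_univ_four] at hrow
  have h0 := hrow 0
  have h1 := hrow 1
  have h2 := hrow 2
  have h3 := hrow 3
  simp at h0 h1 h2 h3
  have p0 := hpos 0
  have p1 := hpos 1
  have hp0 := pVal_pos
  have hd0 : d ≠ 0 := by
    rintro rfl
    linarith [hpos 2, hpos 3]
  have e2 : wt 2 = wt 1 := mul_left_cancel₀ hd0 (by rw [← h1, ← h2])
  have e3 : wt 3 = wt 1 := mul_left_cancel₀ hd0 (by rw [← h1, ← h3])
  rw [e2, e3] at h0 h1
  have e0 : wt 0 = wt 1 * (3 * pVal) := by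
    have h : (wt 0 - wt 1 * (3 * pVal)) * (wt 0 + wt 1 * (3 * pVal) + 3 * wt 1) = 0 := by
      linear_combination wt 0 * h1 - wt 1 * h0 - 9 * wt 1 ^ 2 * pVal_sq
    refine sub_eq_zero.1 ((mul_eq_zero.1 h).resolve_right ?_)
    positivity
  refine ⟨wt 1, p1.ne', fun a => ?_⟩
  fin_cases a
  · exact e0
  · exact (mul_one _).symm
  · exact e2.trans (mul_one _).symm
  · exact e3.trans (mul_one _).symm

end LevelThree

theorem mainTheorem8 (wt : Fin 4 → ℝ) (hwt : Γ₃.IsFrobeniusPerron wt) :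
    ∃ F : StrictMonoidalFunctor (G2ss q₃) Γ₃.GPA,
      F.toFunctor.Faithful ∧
      F.map (G2.dualityss q₃).cap = Γ₃.GPAev wt ∧
      F.map (G2.dualityss q₃).cup = Γ₃.GPAcoev wt ∧
      ∀ (p : Γ₃.Path 2) (e : Γ₃.Path 1), p.Parallel e →
        IsAlgebraic ℚ (Γ₃.GPAcoord (F.map (G2.vertexss q₃)) p e) ∧
        ((minpoly ℚ (Γ₃.GPAcoord (F.map (G2.vertexss q₃)) p e)).natDegree = 12 ∨
          (minpoly ℚ (Γ₃.GPAcoord (F.map (G2.vertexss q₃)) p e)).natDegree = 24) := by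
  obtain ⟨F, hF, hcap, hcup, hcoord⟩ := LevelThree.exists_faithful
  obtain ⟨k, hk, hkw⟩ := LevelThree.exists_eq_mul_weight hwt
  refine ⟨F, hF, hcap.trans (LoopGraph.GPAev_eq hk hkw).symm,
    hcup.trans (LoopGraph.GPAcoev_eq hk hkw).symm, fun p e h => ?_⟩
  have h01 : Γ₃.Adj (p.vert 0) (p.vert 1) := p.2 0
  have h12 : Γ₃.Adj (p.vert 1) (p.vert 2) := p.2 1
  have h02 : Γ₃.Adj (p.vert 0) (p.vert 2) := by
    have he : Γ₃.Adj (e.vert 0) (e.vert 1) := e.2 0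
    rwa [show p.vert 0 = e.vert 0 from h.1, show p.vert 2 = e.vert 1 from h.2]
  obtain ⟨h1, h2⟩ := LevelThree.degree_coord _ _ _ h01 h12 h02
  rw [hcoord p e h]
  generalize √(LevelThree.values.weight (p.vert 1))
    * LevelThree.values.cell (p.vert 0) (p.vert 1) (p.vert 2) = r at h1 h2
  have hr : minpoly ℚ (r : ℂ) = minpoly ℚ r :=
    minpoly.algebraMap_eq (algebraMap ℝ ℂ).injective r
  rw [hr]
  exact ⟨h1.isAlgebraic.algebraMap, h2⟩
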